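/- **Setting.** Write $\langle x\rangle=(1+x^2)^{1/2}$. Let $\mathrm{Ai},\mathrm{Bi}$ be the Airy functions and let $M_{\kappa,\mu}(z)=e^{-z/2}z^{\frac12+\mu}\,{}_1F_1(\tfrac12+\mu-\kappa;1+2\mu;z)$ be the Whittaker function. For $\sigma,r>0$ put $$e(\sigma,r)=-i\,\sigma^{-\frac12}\big[e^{\pi/\sigma}-1\big]^{-\frac12}M_{\frac{i}{2\sigma},\frac12}(2i\sigma r).$$ For $x>0$ let $$Q(x)=x^{-1}-1,\qquad \zeta(x)=\operatorname{sign}(x-1)\Big|\tfrac32\int_1^x\sqrt{|Q(u)|}\,du\Big|^{\frac23},\qquad q=-\frac{Q}{\zeta}\ \ (q(1)=1\text{ by continuity}).$$ The map $x\mapsto\zeta(x)$ is a smooth change of variables on $(0,\infty)$; regarding $q$ as a function of $\zeta$, put $V=-q^{-\frac14}\frac{d^2q^{1/4}}{d\zeta^2}$. A dot denotes $\partial_\zeta$. Put $\tau=-\sigma^{-2/3}\zeta$ and $\zeta_r(\sigma)=\frac{2}{3\sigma}\,\zeta(\sigma^2r)^{3/2}$. **Statement.** There are absolute constants $c>0$,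 $K>0$ and $C>1$ for which the following holds. (1) *Oscillatory basis.* There are complex-valued functions $b_\pm(\sigma,\zeta)$, smooth on $(0,c)\times[0,\infty)$, such that for every $\sigma\in(0,c)$ the functions $$\psi_\pm(\sigma,\zeta)=\big(\mathrm{Ai}(\tau)\pm i\,\mathrm{Bi}(\tau)\big)\big[1+\sigma b_\pm(\sigma,\zeta)\big]$$ form a basis of the space of complex-valued solutions on $[0,\infty)$ of $-\sigma^2\ddot w=(\zeta+\sigma^2V(\zeta))w$, and for all $\sigma\in(0,c)$, $\zeta\ge0$, $$|b_\pm|\le K\langle\zeta\rangle^{-\frac32},\qquad |\dot b_\pm|\le K\sigma^{-\frac13}\langle\sigma^{-\frac23}\zeta\rangle^{-\frac12}\langle\zeta\rangle^{-2},\qquad |\ddot b_\pm|\le K\sigma^{-1}\langle\zeta\rangle^{-2},$$ $$|\partial_\sigma b_\pm|\le K\sigma^{-1}\langle\zeta\rangle^{-\frac32},\qquad |\partial_\sigma^2b_\pm|\le K\sigma^{-3},\qquad |\partial_\sigma\dot b_\pm|\le K\sigma^{-2}\langle\zeta\rangle^{-1},\qquad |\partial_\sigma^2\dot b_\pm|\le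 K\sigma^{-3}.$$ At $\zeta=0$ the $\zeta$-derivatives are one-sided. (2) *Connection.* With these $\psi_\pm$, there are complex-valued $e_3,e_4\in C^2((0,c))$ such that for all $\sigma\in(0,c)$ and all $x\ge1$ $$e(\sigma,x/\sigma^2)=\sigma^{-\frac16}(1+e_3(\sigma))\,q(x)^{-\frac14}\psi_+(\sigma,\zeta(x))+\sigma^{-\frac16}(1+e_4(\sigma))\,q(x)^{-\frac14}\psi_-(\sigma,\zeta(x)),$$ and $|e_j(\sigma)|\le K\sigma$, $|e_j'(\sigma)|\le K\sigma^{-\frac13}$, $|e_j''(\sigma)|\le K\sigma^{-\frac73}$ for $j=3,4$ and $\sigma\in(0,c)$. (3) *Oscillatory representation.* There are complex-valued functions $a_\pm(\sigma,r)$, independent of $s$, such that for all $0<s\le r$ and all $\sigma\in[Cs^{-\frac12},c]$ the functions $a_\pm$ are smooth at $(\sigma,r)$ and $$e(\sigma,r)=e^{i\zeta_r(\sigma)}a_+(\sigma,r)+e^{-i\zeta_r(\sigma)}a_-(\sigma,r),$$ $$|a_\pm(\sigma,r)|\le K,\qquad |\partial_\sigma a_\pm(\sigma,r)|\le K\sigma^{-1},\quad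 \sigma^{-1}\le Ks^{\frac12},\qquad |\partial_\sigma^2a_\pm(\sigma,r)|\le K\sigma^{-\frac73}.$$ -/

import Mathlib

open Set
open scoped ContDiff

namespace CoulombLG

noncomputable section

/-- The Japanese bracket `⟨x⟩ = (1 + x²)^{1/2}`. -/
def bracket (x : ℝ) : ℝ := Real.sqrt (1 + x ^ 2)

/-! ### Special functions -/

/-- The Maclaurin series of the solution of `y'' = z y` with `y(0) = 1`, `y'(0) = 0`. -/
def airyF (z : ℝ) : ℝ :=
  ∑' k : ℕ, 3 ^ k * (ascPochhammer ℝ k).eval (1 / 3) / ((3 * k).factorial : ℝ) * z ^ (3 * k)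

/-- The Maclaurin series of the solution of `y'' = z y` with `y(0) = 0`, `y'(0) = 1`. -/
def airyG (z : ℝ) : ℝ :=
  ∑' k : ℕ,
    3 ^ k * (ascPochhammer ℝ k).eval (2 / 3) / ((3 * k + 1).factorial : ℝ) * z ^ (3 * k + 1)

/-- The Airy function of the first kind, with
`Ai(0) = 3^{-2/3} / Γ(2/3)` and `Ai'(0) = -3^{-1/3} / Γ(1/3)`. -/
def airyAi (z : ℝ) : ℝ :=
  (3 : ℝ) ^ (-2 / 3 : ℝ) / Real.Gamma (2 / 3) * airyF z
    - (3 : ℝ) ^ (-1 / 3 : ℝ) / Real.Gamma (1 / 3) * airyG z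

/-- The Airy function of the second kind, with
`Bi(0) = 3^{-1/6} / Γ(2/3)` and `Bi'(0) = 3^{1/6} / Γ(1/3)`. -/
def airyBi (z : ℝ) : ℝ :=
  (3 : ℝ) ^ (-1 / 6 : ℝ) / Real.Gamma (2 / 3) * airyF z
    + (3 : ℝ) ^ (1 / 6 : ℝ) / Real.Gamma (1 / 3) * airyG z

/-- Kummer's confluent hypergeometric function `₁F₁(a; b; z)`. -/
def kummerM (a b z : ℂ) : ℂ :=
  ∑' n : ℕ, (ascPochhammer ℂ n).eval a / (ascPochhammer ℂ n).eval b * z ^ n / (n.factorial : ℂ)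

/-- The Whittaker function `M_{κ,μ}(z) = e^{-z/2} z^{1/2+μ} ₁F₁(1/2 + μ - κ; 1 + 2μ; z)`,
with the principal branch of the power. -/
def whittakerM (κ μ z : ℂ) : ℂ :=
  Complex.exp (-z / 2) * z ^ (1 / 2 + μ) * kummerM (1 / 2 + μ - κ) (1 + 2 * μ) z

/-- The distorted Fourier basis
`e(σ, r) = -i σ^{-1/2} [e^{π/σ} - 1]^{-1/2} M_{i/(2σ), 1/2}(2iσr)`. -/
def eFun (σ r : ℝ) : ℂ :=
  -Complex.I * ((σ ^ (-1 / 2 : ℝ) * (Real.exp (Real.pi / σ) - 1) ^ (-1 / 2 : ℝ) : ℝ) : ℂ)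
    * whittakerM (Complex.I / (2 * (σ : ℂ))) (1 / 2) (2 * Complex.I * (σ : ℂ) * (r : ℂ))

/-! ### The Liouville-Green transform -/

/-- `Q(u) = u⁻¹ - 1`. -/
def Q (u : ℝ) : ℝ := u⁻¹ - 1

/-- `ζ(x) = sign(x - 1) |(3/2) ∫_1^x √|Q(u)| du|^{2/3}`. -/
def zeta (x : ℝ) : ℝ :=
  Real.sign (x - 1) * |3 / 2 * ∫ u in (1 : ℝ)..x, Real.sqrt (|Q u|)| ^ (2 / 3 : ℝ)

/-- `q = -Q / ζ`. The quotient has a removable singularity at the turning point `x = 1`, where its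
limit is `1`. -/
def q (x : ℝ) : ℝ := if x = 1 then 1 else -Q x / zeta x

/-- The inverse `x(ζ)` of the change of variables `x ↦ ζ(x)` on `(0, ∞)`. -/
def xOf (z : ℝ) : ℝ := Function.invFunOn zeta (Ioi 0) z

/-- `V = -q^{-1/4} d²(q^{1/4}) / dζ²`, as a function of `ζ`. -/
def V (z : ℝ) : ℝ :=
  -(q (xOf z)) ^ (-1 / 4 : ℝ) * iteratedDeriv 2 (fun y => q (xOf y) ^ (1 / 4 : ℝ)) z

/-- The phase `ζ_r(σ) = σ⁻¹ (2/3) ζ(σ² r)^{3/2}`. -/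
def phase (r σ : ℝ) : ℝ := σ⁻¹ * (2 / 3) * zeta (σ ^ 2 * r) ^ (3 / 2 : ℝ)

/-! ### Solutions of the perturbed Airy equation -/

/-- `w` is a solution on `[0, ∞)` of `-σ² w'' = (ζ + σ² V) w`
(derivatives at the end point are one-sided). -/
def IsSolution (σ : ℝ) (w : ℝ → ℂ) : Prop :=
  ContDiffOn ℝ 2 w (Ici 0) ∧
    ∀ z ∈ Ici (0 : ℝ),
      -(σ : ℂ) ^ 2 * iteratedDerivWithin 2 w (Ici 0) z = ((z + σ ^ 2 * V z : ℝ) : ℂ) * w z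

/-- `w₁, w₂` form a basis of the space of solutions on `[0, ∞)`. -/
def IsSolutionBasis (σ : ℝ) (w₁ w₂ : ℝ → ℂ) : Prop :=
  IsSolution σ w₁ ∧ IsSolution σ w₂ ∧
    ∀ w, IsSolution σ w →
      ∃! p : ℂ × ℂ, ∀ z ∈ Ici (0 : ℝ), w z = p.1 * w₁ z + p.2 * w₂ z

/-- `τ = -σ^{-2/3} ζ`. -/
def tau (σ z : ℝ) : ℝ := -σ ^ (-2 / 3 : ℝ) * z

/-- `(Ai(τ) + i Bi(τ)) (1 + σ b(σ, ζ))`. -/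
def psiPlus (b : ℝ → ℝ → ℂ) (σ z : ℝ) : ℂ :=
  ((airyAi (tau σ z) : ℂ) + Complex.I * (airyBi (tau σ z) : ℂ)) * (1 + (σ : ℂ) * b σ z)

/-- `(Ai(τ) - i Bi(τ)) (1 + σ b(σ, ζ))`. -/
def psiMinus (b : ℝ → ℝ → ℂ) (σ z : ℝ) : ℂ :=
  ((airyAi (tau σ z) : ℂ) - Complex.I * (airyBi (tau σ z) : ℂ)) * (1 + (σ : ℂ) * b σ z)

/-- `b` is smooth on `(0, c) × [0, ∞)` and obeys there, with the constant `K`, the bounds required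
of the relative errors of the oscillatory basis. Derivatives in the second variable are taken
within `[0, ∞)`. -/
structure OscBounds (c K : ℝ) (b : ℝ → ℝ → ℂ) : Prop where
  smooth : ContDiffOn ℝ ∞ (Function.uncurry b) (Ioo 0 c ×ˢ Ici 0)
  zero : ∀ σ ∈ Ioo 0 c, ∀ z ∈ Ici (0 : ℝ),
    ‖b σ z‖ ≤ K * bracket z ^ (-3 / 2 : ℝ)
  dz : ∀ σ ∈ Ioo 0 c, ∀ z ∈ Ici (0 : ℝ),
    ‖derivWithin (b σ) (Ici 0) z‖ ≤
      K * (σ ^ (-1 / 3 : ℝ) * bracket (σ ^ (-2 / 3 : ℝ) * z) ^ (-1 / 2 : ℝ)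
        * bracket z ^ (-2 : ℝ))
  dzz : ∀ σ ∈ Ioo 0 c, ∀ z ∈ Ici (0 : ℝ),
    ‖iteratedDerivWithin 2 (b σ) (Ici 0) z‖ ≤ K * (σ ^ (-1 : ℝ) * bracket z ^ (-2 : ℝ))
  ds : ∀ σ ∈ Ioo 0 c, ∀ z ∈ Ici (0 : ℝ),
    ‖deriv (fun s => b s z) σ‖ ≤ K * (σ ^ (-1 : ℝ) * bracket z ^ (-3 / 2 : ℝ))
  dss : ∀ σ ∈ Ioo 0 c, ∀ z ∈ Ici (0 : ℝ),
    ‖iteratedDeriv 2 (fun s => b s z) σ‖ ≤ K * σ ^ (-3 : ℝ)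
  dsdz : ∀ σ ∈ Ioo 0 c, ∀ z ∈ Ici (0 : ℝ),
    ‖deriv (fun s => derivWithin (b s) (Ici 0) z) σ‖ ≤
      K * (σ ^ (-2 : ℝ) * bracket z ^ (-1 : ℝ))
  dssdz : ∀ σ ∈ Ioo 0 c, ∀ z ∈ Ici (0 : ℝ),
    ‖iteratedDeriv 2 (fun s => derivWithin (b s) (Ici 0) z) σ‖ ≤ K * σ ^ (-3 : ℝ)

/-- `ε` is twice continuously differentiable on `(0, c)` and obeys, with the constant `K`, the
bounds required of the relative errors of the connection coefficients. -/
structure CoeffBounds (c K : ℝ) (ε : ℝ → ℂ) : Prop where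
  smooth : ContDiffOn ℝ 2 ε (Ioo 0 c)
  zero : ∀ σ ∈ Ioo 0 c, ‖ε σ‖ ≤ K * σ
  ds : ∀ σ ∈ Ioo 0 c, ‖deriv ε σ‖ ≤ K * σ ^ (-1 / 3 : ℝ)
  dss : ∀ σ ∈ Ioo 0 c, ‖iteratedDeriv 2 ε σ‖ ≤ K * σ ^ (-7 / 3 : ℝ)

/-- `a` is smooth at all points `(σ, r)` with `0 < s ≤ r` and `C s^{-1/2} ≤ σ ≤ c` for some `s`,
and obeys there, with the constant `K`, the bounds required of the amplitudes. -/
structure AmplitudeBounds (c C K : ℝ) (a : ℝ → ℝ → ℂ) : Prop where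
  smooth : ∀ s r σ : ℝ, 0 < s → s ≤ r → σ ∈ Icc (C * s ^ (-1 / 2 : ℝ)) c →
    ContDiffAt ℝ ∞ (Function.uncurry a) (σ, r)
  zero : ∀ s r σ : ℝ, 0 < s → s ≤ r → σ ∈ Icc (C * s ^ (-1 / 2 : ℝ)) c →
    ‖a σ r‖ ≤ K
  ds : ∀ s r σ : ℝ, 0 < s → s ≤ r → σ ∈ Icc (C * s ^ (-1 / 2 : ℝ)) c →
    ‖deriv (fun t => a t r) σ‖ ≤ K * σ ^ (-1 : ℝ) ∧ σ ^ (-1 : ℝ) ≤ K * s ^ (1 / 2 : ℝ)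
  dss : ∀ s r σ : ℝ, 0 < s → s ≤ r → σ ∈ Icc (C * s ^ (-1 / 2 : ℝ)) c →
    ‖iteratedDeriv 2 (fun t => a t r) σ‖ ≤ K * σ ^ (-7 / 3 : ℝ)

end

end CoulombLG

open Filter Topology MeasureTheory

namespace CoulombLG

noncomputable section

open Complex (I Gamma ofRealCLM norm_real I_sq ofReal_mul real_smul ofReal_pow conj_ofReal
  continuous_ofReal norm_cpow_eq_rpow_re_of_pos)
open Real (exp sqrt log rpow_mul rpow_natCast rpow_add rpow_neg_one rpow_pos_of_pos rpow_add_one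
  norm_eq_abs sq_sqrt sinh sqrt_eq_rpow exp_pos pi_pos hasDerivAt_rpow_const)
open scoped ComplexConjugate Real

local notation "cexp" => Complex.exp

section PowerSeries

variable {𝕜 : Type*} [RCLike 𝕜]

/-- Coefficients decaying like those of an exponential. -/
def EntireCoeff (d : ℕ → 𝕜) : Prop := ∃ K C : ℝ, ∀ n, ‖d n‖ ≤ K * (C ^ n / n.factorial)

/-- The sum of a power series. -/
def powSum (d : ℕ → 𝕜) (z : 𝕜) : 𝕜 := ∑' n, d n * z ^ n

/-- The coefficients of the derivative of a power series. -/
def derivCoeff (d : ℕ → 𝕜) (n : ℕ) : 𝕜 := (n + 1 : 𝕜) * d (n + 1)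

theorem EntireCoeff.of_ratio {d : ℕ → 𝕜} {C : ℝ} (hC : 0 ≤ C)
    (h : ∀ n, ‖d (n + 1)‖ * (n + 1) ≤ C * ‖d n‖) : EntireCoeff d := by
  refine ⟨‖d 0‖, C, fun n => ?_⟩
  induction n with
  | zero => simp
  | succ n ih =>
    have h1 := h n
    have hn : (0 : ℝ) < n + 1 := by positivity
    have : ‖d (n + 1)‖ ≤ C * ‖d n‖ / (n + 1) := by rwa [le_div_iff₀ hn]
    refine this.trans ?_
    rw [Nat.factorial_succ, div_le_iff₀ hn]; push_cast
    calc C * ‖d n‖ ≤ C * (‖d 0‖ * (C ^ n / n.factorial)) := by gcongr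
      _ = _ := by field_simp; ring

theorem EntireCoeff.deriv_coeff {d : ℕ → 𝕜} (h : EntireCoeff d) :
    EntireCoeff (derivCoeff d) := by
  obtain ⟨K, C, h⟩ := h
  refine ⟨K * C, C, fun n => ?_⟩
  have hn : (0 : ℝ) < n + 1 := by positivity
  have e : ‖(n + 1 : 𝕜)‖ = n + 1 := by
    have := RCLike.norm_natCast (K := 𝕜) (n + 1)
    push_cast at this
    exact this
  rw [derivCoeff, norm_mul, e]
  calc (n + 1 : ℝ) * ‖d (n + 1)‖ ≤ (n + 1) * (K * (C ^ (n + 1) / (n + 1).factorial)) := by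
        gcongr; exact h _
    _ = _ := by rw [Nat.factorial_succ]; push_cast; field_simp; ring

theorem EntireCoeff.summable_norm {d : ℕ → 𝕜} (h : EntireCoeff d) (z : 𝕜) :
    Summable fun n => ‖d n * z ^ n‖ := by
  obtain ⟨K, C, h⟩ := h
  refine Summable.of_nonneg_of_le (fun _ => norm_nonneg _) (fun n => ?_)
    ((Real.summable_pow_div_factorial (C * ‖z‖)).mul_left K)
  rw [norm_mul, norm_pow, mul_pow]
  calc ‖d n‖ * ‖z‖ ^ n ≤ K * (C ^ n / n.factorial) * ‖z‖ ^ n := by gcongr; exact h n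
    _ = _ := by ring

theorem EntireCoeff.summable {d : ℕ → 𝕜} (h : EntireCoeff d) (z : 𝕜) :
    Summable fun n => d n * z ^ n := (h.summable_norm z).of_norm

theorem EntireCoeff.hasDerivAt {d : ℕ → 𝕜} (h : EntireCoeff d) (z : 𝕜) :
    HasDerivAt (powSum d) (powSum (derivCoeff d) z) z := by
  set R : ℝ := ‖z‖ + 1
  have hR : 0 < R := by positivity
  have hR' : ‖((R : ℝ) : 𝕜)‖ = R := by simp [abs_of_pos hR]
  have hs := h.deriv_coeff.summable_norm ((R : ℝ) : 𝕜)
  have key := hasDerivAt_tsum_of_isPreconnected (𝕜 := 𝕜) (F := 𝕜)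
    (u := fun n => ‖d n * (n * (R : 𝕜) ^ (n - 1))‖)
    (g := fun n y => d n * y ^ n) (g' := fun n y => d n * (n * y ^ (n - 1)))
    (t := Metric.ball 0 R) (y₀ := 0) (y := z) ?_ Metric.isOpen_ball
    (convex_ball (0 : 𝕜) R).isPreconnected (fun n y _ => (hasDerivAt_pow n y).const_mul _) ?_
    (by simp [hR]) ?_ (by simp [R])
  · convert! key using 1
    have hs2 : Summable fun n => d n * (n * z ^ (n - 1)) := by
      rw [← summable_nat_add_iff 1]
      refine (h.deriv_coeff.summable z).congr fun n => ?_
      simp only [derivCoeff, Nat.add_sub_cancel]; push_cast; ring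
    rw [hs2.tsum_eq_zero_add]; simp only [powSum, derivCoeff]
    simp
    congr 1; ext n; ring
  · rw [← summable_nat_add_iff 1]
    refine hs.congr fun n => ?_
    congr 1; simp only [derivCoeff, Nat.add_sub_cancel]; push_cast; ring
  · intro n y hy; simp only [Metric.mem_ball, dist_zero_right] at hy
    simp only [norm_mul, norm_pow]
    rw [hR']; gcongr
  · exact h.summable 0

theorem EntireCoeff.mul_powSum_derivCoeff {d : ℕ → 𝕜} (h : EntireCoeff d) (z : 𝕜) :
    HasSum (fun n : ℕ => (n : 𝕜) * d n * z ^ n) (z * powSum (derivCoeff d) z) := by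
  have h1 := (h.deriv_coeff.summable z).hasSum.mul_left z
  rw [← hasSum_nat_add_iff' 1]; simp only [Finset.sum_range_one, Nat.cast_zero, zero_mul, sub_zero]
  convert! h1 using 2 with n
  simp only [derivCoeff]
  push_cast; ring

end PowerSeries

/-- A second order equation of hypergeometric type for the sum of a power series. -/
theorem EntireCoeff.hyp_ode {𝕜 : Type*} [RCLike 𝕜] {d : ℕ → 𝕜} (h : EntireCoeff d) {A B c a : 𝕜}
    (hd : ∀ n : ℕ, (n + 1) * (A * n + B) * d (n + 1) = (c * n + a) * d n) (z : 𝕜) :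
    A * (z * powSum (derivCoeff (derivCoeff d)) z)
      + B * powSum (derivCoeff d) z =
    c * (z * powSum (derivCoeff d) z) + a * powSum d z := by
  have h1 := ((h.deriv_coeff.mul_powSum_derivCoeff z).mul_left A).add
    ((h.deriv_coeff.summable z).hasSum.mul_left B)
  have h2 := ((h.mul_powSum_derivCoeff z).mul_left c).add ((h.summable z).hasSum.mul_left a)
  refine h1.unique ?_
  convert! h2 using 2 with n
  have := hd n
  simp only [derivCoeff]
  linear_combination z ^ n * this

/-! ### The Airy functions -/

/-- Coefficients of `airyF` as a series in `z ^ 3`. -/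
def airyFCoeff (k : ℕ) : ℝ := 3 ^ k * (ascPochhammer ℝ k).eval (1 / 3) / ((3 * k).factorial : ℝ)

/-- Coefficients of `airyG / z` as a series in `z ^ 3`. -/
def airyGCoeff (k : ℕ) : ℝ := 3 ^ k * (ascPochhammer ℝ k).eval (2 / 3) / ((3 * k + 1).factorial : ℝ)

theorem airyFCoeff_succ (n : ℕ) :
    ((n : ℝ) + 1) * (9 * n + 6) * airyFCoeff (n + 1) = (0 * n + 1) * airyFCoeff n := by
  simp only [airyFCoeff, ascPochhammer_succ_eval]
  rw [show 3 * (n + 1) = 3 * n + 1 + 1 + 1 by ring]; simp only [Nat.factorial_succ]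
  push_cast; field_simp
  ring

theorem airyGCoeff_succ (n : ℕ) :
    ((n : ℝ) + 1) * (9 * n + 12) * airyGCoeff (n + 1) = (0 * n + 1) * airyGCoeff n := by
  simp only [airyGCoeff, ascPochhammer_succ_eval]
  rw [show 3 * (n + 1) + 1 = 3 * n + 1 + 1 + 1 + 1 by ring]; simp only [Nat.factorial_succ]
  push_cast; field_simp
  ring

theorem EntireCoeff.of_recurrence {d : ℕ → ℝ} {B : ℝ} (hB : 1 ≤ B)
    (h : ∀ n : ℕ, ((n : ℝ) + 1) * (9 * n + B) * d (n + 1) = (0 * n + 1) * d n) :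
    EntireCoeff d := by
  refine EntireCoeff.of_ratio (C := 1) zero_le_one fun n => ?_
  have h1 := congrArg abs (h n)
  rw [abs_mul, abs_of_pos (by positivity : (0 : ℝ) < (n + 1) * (9 * n + B))] at h1
  simp only [zero_mul, zero_add, one_mul] at h1
  simp only [norm_eq_abs, one_mul]
  rw [← h1]
  have : (0 : ℝ) ≤ n := by positivity
  nlinarith [mul_nonneg (abs_nonneg (d (n + 1))) (by positivity : (0 : ℝ) ≤ n + 1)]

theorem entireCoeff_airyF : EntireCoeff airyFCoeff :=
  EntireCoeff.of_recurrence (by norm_num) airyFCoeff_succ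

theorem entireCoeff_airyG : EntireCoeff airyGCoeff :=
  EntireCoeff.of_recurrence (by norm_num) airyGCoeff_succ

theorem airyF_eq (z : ℝ) : airyF z = powSum airyFCoeff (z ^ 3) := by
  simp only [airyF, powSum, airyFCoeff, pow_mul]

theorem airyG_eq (z : ℝ) : airyG z = z * powSum airyGCoeff (z ^ 3) := by
  simp only [airyG, powSum, airyGCoeff]
  rw [← tsum_mul_left]
  congr 1; ext n; rw [pow_succ, pow_mul]; ring

/-- The derivative of `airyF`. -/
def airyF' (z : ℝ) : ℝ := powSum (derivCoeff airyFCoeff) (z ^ 3) * (3 * z ^ 2)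

/-- The derivative of `airyG`. -/
def airyG' (z : ℝ) : ℝ :=
  powSum airyGCoeff (z ^ 3) + z * (powSum (derivCoeff airyGCoeff) (z ^ 3) * (3 * z ^ 2))

theorem hasDerivAt_powSum_cube {d : ℕ → ℝ} (h : EntireCoeff d) (z : ℝ) :
    HasDerivAt (fun z : ℝ => powSum d (z ^ 3)) (powSum (derivCoeff d) (z ^ 3) * (3 * z ^ 2)) z := by
  have h1 := (h.hasDerivAt (z ^ 3)).comp z (hasDerivAt_pow 3 z)
  exact h1.congr_deriv (by norm_num)

theorem hasDerivAt_airyF (z : ℝ) : HasDerivAt airyF (airyF' z) z := by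
  rw [show airyF = fun z => powSum airyFCoeff (z ^ 3) from funext airyF_eq]
  exact hasDerivAt_powSum_cube entireCoeff_airyF z

theorem hasDerivAt_airyG (z : ℝ) : HasDerivAt airyG (airyG' z) z := by
  rw [show airyG = fun z => z * powSum airyGCoeff (z ^ 3) from funext airyG_eq]
  exact ((hasDerivAt_id z).mul (hasDerivAt_powSum_cube entireCoeff_airyG z)).congr_deriv
    (by simp [airyG'])

theorem hasDerivAt_airyF' (z : ℝ) : HasDerivAt airyF' (z * airyF z) z := by
  have h := (hasDerivAt_powSum_cube entireCoeff_airyF.deriv_coeff z).mul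
    ((hasDerivAt_pow 2 z).const_mul 3)
  refine h.congr_deriv ?_
  have := entireCoeff_airyF.hyp_ode airyFCoeff_succ (z ^ 3)
  rw [airyF_eq]; push_cast
  linear_combination z * this

theorem hasDerivAt_airyG' (z : ℝ) : HasDerivAt airyG' (z * airyG z) z := by
  have h := (hasDerivAt_powSum_cube entireCoeff_airyG z).add ((hasDerivAt_id z).mul
    ((hasDerivAt_powSum_cube entireCoeff_airyG.deriv_coeff z).mul
      ((hasDerivAt_pow 2 z).const_mul 3)))
  refine h.congr_deriv ?_
  have := entireCoeff_airyG.hyp_ode airyGCoeff_succ (z ^ 3)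
  rw [airyG_eq]; simp only [id, Pi.mul_apply]
  push_cast
  linear_combination z ^ 2 * this

theorem powSum_zero {𝕜 : Type*} [RCLike 𝕜] (d : ℕ → 𝕜) : powSum d 0 = d 0 := by
  rw [powSum, tsum_eq_single 0 (fun n hn => by simp [hn])]; simp

theorem airyF_zero : airyF 0 = 1 := by simp [airyF_eq, powSum_zero, airyFCoeff]

theorem airyG_zero : airyG 0 = 0 := by simp [airyG_eq]

theorem airyF'_zero : airyF' 0 = 0 := by simp [airyF']

theorem airyG'_zero : airyG' 0 = 1 := by simp [airyG', powSum_zero, airyGCoeff]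

/-- The outgoing Airy solution `Ai(-t) - i Bi(-t)`. -/
def outAiry (t : ℝ) : ℂ := (airyAi (-t) : ℂ) - I * (airyBi (-t) : ℂ)

/-- The value of `outAiry` at `0`. -/
def outAiryA : ℂ := ((3 : ℝ) ^ (-2 / 3 : ℝ) / Real.Gamma (2 / 3) : ℝ) * (1 - I * (sqrt 3 : ℝ))

/-- The derivative of `outAiry` at `0`. -/
def outAiryB : ℂ := ((3 : ℝ) ^ (-1 / 3 : ℝ) / Real.Gamma (1 / 3) : ℝ) * (1 + I * (sqrt 3 : ℝ))

theorem outAiry_eq (t : ℝ) :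
    outAiry t = outAiryA * (airyF (-t) : ℂ) - outAiryB * (airyG (-t) : ℂ) := by
  have e1 : (3 : ℝ) ^ (-1 / 6 : ℝ) = (3 : ℝ) ^ (-2 / 3 : ℝ) * sqrt 3 := by
    rw [sqrt_eq_rpow, ← rpow_add (by norm_num)]; norm_num
  have e2 : (3 : ℝ) ^ (1 / 6 : ℝ) = (3 : ℝ) ^ (-1 / 3 : ℝ) * sqrt 3 := by
    rw [sqrt_eq_rpow, ← rpow_add (by norm_num)]; norm_num
  simp only [outAiry, airyAi, airyBi, outAiryA, outAiryB]
  rw [e1, e2]; push_cast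
  ring

/-- The derivative of `outAiry`. -/
def outAiry' (t : ℝ) : ℂ := -outAiryA * (airyF' (-t) : ℂ) + outAiryB * (airyG' (-t) : ℂ)

theorem hasDerivAt_ofReal_comp_neg {f : ℝ → ℝ} {f' t : ℝ} (h : HasDerivAt f f' (-t)) :
    HasDerivAt (fun t => (f (-t) : ℂ)) (-(f' : ℂ)) t := by
  have := (h.comp t (hasDerivAt_neg t)).ofReal_comp
  simpa using this

theorem hasDerivAt_outAiry (t : ℝ) : HasDerivAt outAiry (outAiry' t) t := by
  rw [show outAiry = _ from funext outAiry_eq]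
  refine (((hasDerivAt_ofReal_comp_neg (hasDerivAt_airyF (-t))).const_mul outAiryA).sub
    ((hasDerivAt_ofReal_comp_neg (hasDerivAt_airyG (-t))).const_mul outAiryB)).congr_deriv ?_
  simp only [outAiry']; ring

theorem hasDerivAt_outAiry' (t : ℝ) : HasDerivAt outAiry' (-(t * outAiry t)) t := by
  refine (((hasDerivAt_ofReal_comp_neg (hasDerivAt_airyF' (-t))).const_mul (-outAiryA)).add
    ((hasDerivAt_ofReal_comp_neg (hasDerivAt_airyG' (-t))).const_mul outAiryB)).congr_deriv ?_
  simp only [outAiry_eq]; push_cast; ring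

theorem outAiry_zero : outAiry 0 = outAiryA := by simp [outAiry_eq, airyF_zero, airyG_zero]

theorem outAiry'_zero : outAiry' 0 = outAiryB := by simp [outAiry', airyF'_zero, airyG'_zero]

theorem norm_ofReal_cpow_mul_exp {a r : ℂ} {x : ℝ} (hx : 0 < x) :
    ‖(x : ℂ) ^ (a - 1) * cexp (-r * x)‖ = x ^ (a.re - 1) * exp (-r.re * x) := by
  rw [norm_mul, norm_cpow_eq_rpow_re_of_pos hx, Complex.norm_exp]; simp

theorem aestronglyMeasurable_cpow_mul_exp (a r : ℂ) :
    AEStronglyMeasurable (fun x : ℝ => (x : ℂ) ^ (a - 1) * cexp (-r * x))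
      (volume.restrict (Ioi 0)) := by
  refine ContinuousOn.aestronglyMeasurable (fun x hx => ?_) measurableSet_Ioi
  refine ContinuousAt.continuousWithinAt (ContinuousAt.mul ?_ (by fun_prop))
  exact (continuousAt_cpow_const (Or.inl (by simpa using hx))).comp
    continuous_ofReal.continuousAt

theorem integrableOn_rpow_mul_exp {s b : ℝ} (hs : 0 < s) (hb : 0 < b) :
    IntegrableOn (fun x : ℝ => x ^ (s - 1) * exp (-b * x)) (Ioi 0) := by
  have := integrableOn_rpow_mul_exp_neg_mul_rpow (p := 1) (s := s - 1) (b := b) (by linarith)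
    one_pos hb
  simpa using this

theorem integrableOn_cpow_mul_exp {a r : ℂ} (ha : 0 < a.re) (hr : 0 < r.re) :
    IntegrableOn (fun x : ℝ => (x : ℂ) ^ (a - 1) * cexp (-r * x)) (Ioi 0) := by
  refine Integrable.mono' (integrableOn_rpow_mul_exp ha hr)
    (aestronglyMeasurable_cpow_mul_exp a r) ?_
  filter_upwards [ae_restrict_mem measurableSet_Ioi] with x hx
  exact (norm_ofReal_cpow_mul_exp hx).le

/-- Identity theorem in the right half plane, for functions agreeing on a real half line. -/
theorem eq_of_differentiableOn_re_pos {f g : ℂ → ℂ} (hf : DifferentiableOn ℂ f {z | 0 < z.re})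
    (hg : DifferentiableOn ℂ g {z | 0 < z.re}) {L : ℝ} (hL : 0 < L) (h : ∀ x : ℝ, L < x → f x = g x)
    {z : ℂ} (hz : 0 < z.re) : f z = g z := by
  have hU : IsOpen {z : ℂ | 0 < z.re} := isOpen_lt continuous_const Complex.continuous_re
  refine (hf.analyticOnNhd hU).eqOn_of_preconnected_of_frequently_eq (hg.analyticOnNhd hU)
    (convex_halfSpace_re_gt 0).isPreconnected (z₀ := (L : ℂ)) (by simpa using hL) ?_ hz
  have h1 : Tendsto (fun n : ℕ => ((L + 1 / ((n : ℝ) + 1) : ℝ) : ℂ)) atTop (𝓝[≠] (L : ℂ)) := by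
    refine tendsto_nhdsWithin_iff.mpr ⟨?_, Eventually.of_forall fun n => ?_⟩
    · have := (tendsto_one_div_add_atTop_nhds_zero_nat (𝕜 := ℝ)).const_add L
      rw [add_zero] at this
      exact (continuous_ofReal.tendsto L).comp this
    · simp only [mem_compl_iff, mem_singleton_iff, Complex.ofReal_inj]
      have : (0 : ℝ) < 1 / ((n : ℝ) + 1) := by positivity
      linarith
  refine h1.frequently (Frequently.of_forall fun n => h _ ?_)
  have : (0 : ℝ) < 1 / ((n : ℝ) + 1) := by positivity
  linarith

/-- The Laplace transform of a power, in the right half plane. -/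
theorem integral_cpow_mul_exp_neg {a r : ℂ} (ha : 0 < a.re) (hr : 0 < r.re) :
    ∫ x : ℝ in Ioi 0, (x : ℂ) ^ (a - 1) * cexp (-r * x) =
      (1 / r) ^ a * Gamma a := by
  have hf : DifferentiableOn ℂ
      (fun r : ℂ => ∫ x : ℝ in Ioi 0, (x : ℂ) ^ (a - 1) * cexp (-r * x)) {z | 0 < z.re} := by
    intro r hr
    have hr : 0 < r.re := hr
    have hs : {z : ℂ | r.re / 2 < z.re} ∈ 𝓝 r :=
      (isOpen_lt continuous_const Complex.continuous_re).mem_nhds (by simp; linarith)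
    have := hasDerivAt_integral_of_dominated_loc_of_deriv_le (μ := volume.restrict (Ioi (0 : ℝ)))
      (F := fun r x => ((x : ℝ) : ℂ) ^ (a - 1) * cexp (-r * x)) (x₀ := r)
      (F' := fun r x => ((x : ℝ) : ℂ) ^ (a - 1) * (cexp (-r * x) * (-x)))
      (bound := fun x => x ^ ((a.re + 1) - 1) * exp (-(r.re / 2) * x)) hs
      (Eventually.of_forall fun _ => aestronglyMeasurable_cpow_mul_exp _ _)
      (integrableOn_cpow_mul_exp ha hr) ?_ ?_ (integrableOn_rpow_mul_exp (by linarith)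
        (by linarith)) ?_
    · exact this.2.differentiableAt.differentiableWithinAt
    · have h1 := (aestronglyMeasurable_cpow_mul_exp a r).mul
        (f := fun x : ℝ => (x : ℂ) ^ (a - 1) * cexp (-r * x))
        (g := fun x : ℝ => (-x : ℂ)) (by fun_prop)
      refine h1.congr (Eventually.of_forall fun x => ?_)
      simp only [Pi.mul_apply]; ring
    · filter_upwards [ae_restrict_mem measurableSet_Ioi] with x hx z hz
      have hx : 0 < x := hx
      rw [← mul_assoc, norm_mul, norm_ofReal_cpow_mul_exp hx]
      have e : x ^ (a.re + 1 - 1) = x ^ (a.re - 1) * x := by rw [← rpow_add_one hx.ne']; ring_nf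
      rw [e]; simp only [norm_neg, norm_real, norm_eq_abs, abs_of_pos hx]
      have : exp (-z.re * x) ≤ exp (-(r.re / 2) * x) := by
        apply Real.exp_le_exp.mpr
        have : r.re / 2 < z.re := hz
        nlinarith
      nlinarith [mul_le_mul_of_nonneg_left this (by positivity : 0 ≤ x ^ (a.re - 1) * x)]
    · refine Eventually.of_forall fun x z _ => ?_
      have h1 : HasDerivAt (fun z : ℂ => -z * (x : ℂ)) (-x) z := by
        simpa using ((hasDerivAt_id z).neg.mul_const (x : ℂ))
      exact h1.cexp.const_mul _
  have hg : DifferentiableOn ℂ (fun r : ℂ => (1 / r) ^ a * Gamma a) {z | 0 < z.re} := by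
    intro r hr
    have hr : 0 < r.re := hr
    have hr0 : r ≠ 0 := by rintro rfl; simp at hr
    refine DifferentiableAt.differentiableWithinAt (DifferentiableAt.mul_const ?_ _)
    refine DifferentiableAt.cpow_const ?_ (Or.inl ?_)
    · exact (differentiableAt_const _).div differentiableAt_id hr0
    · rw [one_div, Complex.inv_re]; exact div_pos hr (Complex.normSq_pos.mpr hr0)
  refine eq_of_differentiableOn_re_pos hf hg one_pos (fun x hx => ?_) hr
  simpa only [neg_mul] using Complex.integral_cpow_mul_exp_neg_mul_Ioi ha (by linarith : 0 < x)

/-! ### Rays of the Airy contour -/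

/-- The exponent of the Airy integrand. -/
def airyExp (t : ℝ) (s : ℂ) : ℂ := s ^ 3 / 3 + t * s

/-- The majorant of the integrands along a ray. -/
def rayBound (d : ℂ) (M : ℝ) (k : ℕ) (v : ℝ) : ℝ :=
  exp ((d ^ 3).re / 3 * v ^ 3 + M * ‖d‖ ^ 2 * v ^ 2 + (M ^ 2 + M + k) * ‖d‖ * v
    + (M ^ 3 / 3 + M ^ 2 + k * M))

theorem tendsto_cubic {α β γ : ℝ} (hγ : γ < 0) :
    Tendsto (fun v : ℝ => γ * v ^ 3 + β * v ^ 2 + α * v) atTop atBot := by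
  have h1 : Tendsto (fun v : ℝ => β * v⁻¹ + α * (v⁻¹) ^ 2 + γ) atTop (𝓝 (β * 0 + α * 0 ^ 2 + γ)) :=
    ((tendsto_inv_atTop_zero.const_mul β).add ((tendsto_inv_atTop_zero.pow 2).const_mul α)).add_const
      γ
  have h2 := Tendsto.neg_mul_atTop (by linarith : β * 0 + α * 0 ^ 2 + γ < 0) h1
    (tendsto_pow_atTop (α := ℝ) (n := 3) (by norm_num))
  refine h2.congr' ?_
  filter_upwards [eventually_gt_atTop 0] with v hv
  field_simp; ring

theorem integrableOn_exp_cubic {α β γ κ : ℝ} (hγ : γ < 0) :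
    IntegrableOn (fun v : ℝ => exp (γ * v ^ 3 + β * v ^ 2 + α * v + κ)) (Ioi 0) := by
  refine integrable_of_isBigO_exp_neg (b := 1) one_pos (by fun_prop) ?_
  refine Asymptotics.IsBigO.of_bound (exp κ) ?_
  have := (tendsto_cubic (α := α + 1) (β := β) hγ).eventually_le_atBot 0
  filter_upwards [this] with v hv
  rw [norm_eq_abs, norm_eq_abs, Real.abs_exp, Real.abs_exp, ← Real.exp_add]
  apply Real.exp_le_exp.mpr
  linarith

theorem integrableOn_rayBound {d : ℂ} (hd : (d ^ 3).re < 0) (M : ℝ) (k : ℕ) :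
    IntegrableOn (rayBound d M k) (Ioi 0) := integrableOn_exp_cubic (by linarith)

theorem norm_ray_integrand_le {d c : ℂ} {t M v : ℝ} (k : ℕ) (hc : ‖c‖ ≤ M) (ht : |t| ≤ M)
    (hv : 0 ≤ v) :
    ‖(c + d * v) ^ k * cexp (airyExp t (c + d * v))‖ ≤ rayBound d M k v := by
  have hM : 0 ≤ M := (norm_nonneg _).trans hc
  have hd := norm_nonneg d
  have h1 : ‖c + d * v‖ ≤ M + ‖d‖ * v := by
    refine (norm_add_le _ _).trans (add_le_add hc ?_)
    rw [norm_mul, norm_real, norm_eq_abs, abs_of_nonneg hv]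
  have h2 : ‖(c + d * v) ^ k‖ ≤ exp (k * (M + ‖d‖ * v)) := by
    rw [norm_pow, mul_comm (k : ℝ), Real.exp_mul, rpow_natCast]
    refine pow_le_pow_left₀ (norm_nonneg _) (h1.trans ?_) k
    linarith [Real.add_one_le_exp (M + ‖d‖ * v)]
  rw [norm_mul, Complex.norm_exp, rayBound]
  refine (mul_le_mul_of_nonneg_right h2 (Real.exp_nonneg _)).trans ?_
  rw [← Real.exp_add]
  apply Real.exp_le_exp.mpr
  have e : airyExp t (c + d * v) = ((v ^ 3 / 3 : ℝ) : ℂ) * d ^ 3 + (v ^ 2 : ℝ) * (c * d ^ 2)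
      + (v : ℝ) * (c ^ 2 * d + t * d) + (c ^ 3 / 3 + t * c) := by
    simp only [airyExp]; push_cast; ring
  rw [e]; simp only [Complex.add_re, Complex.re_ofReal_mul]
  have b1 : (c * d ^ 2).re ≤ M * ‖d‖ ^ 2 := by
    refine (Complex.re_le_norm _).trans ?_
    rw [norm_mul, norm_pow]; gcongr
  have b2 : (c ^ 2 * d).re ≤ M ^ 2 * ‖d‖ := by
    refine (Complex.re_le_norm _).trans ?_
    rw [norm_mul, norm_pow]; gcongr
  have b3 : (t * d : ℂ).re ≤ M * ‖d‖ := by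
    refine (Complex.re_le_norm _).trans ?_
    rw [norm_mul, norm_real]; gcongr; exact ht
  have b4 : (c ^ 3 / 3).re ≤ M ^ 3 / 3 := by
    refine (Complex.re_le_norm _).trans ?_
    rw [norm_div, norm_pow]; norm_num
    gcongr
  have b5 : (t * c : ℂ).re ≤ M ^ 2 := by
    refine (Complex.re_le_norm _).trans ?_
    rw [norm_mul, norm_real, sq]; gcongr; exact ht
  have v2 : v ^ 2 * (c * d ^ 2).re ≤ v ^ 2 * (M * ‖d‖ ^ 2) := by gcongr
  simp only [Complex.mul_re, Complex.ofReal_re, Complex.ofReal_im, zero_mul, sub_zero] at b3 b5 ⊢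
  have v1 : v * ((c ^ 2 * d).re + t * d.re) ≤ v * (M ^ 2 * ‖d‖ + M * ‖d‖) := by gcongr
  simp only [Complex.mul_re] at v1 v2
  nlinarith

/-- The moments of the Airy integrand along the ray from `c` in the direction `d`. -/
def rayInt (d : ℂ) (k : ℕ) (c : ℂ) (t : ℝ) : ℂ :=
  ∫ v : ℝ in Ioi 0, d * ((c + d * v) ^ k * cexp (airyExp t (c + d * v)))

theorem continuous_ray_integrand (d c : ℂ) (k : ℕ) (t : ℝ) :
    Continuous fun v : ℝ => d * ((c + d * v) ^ k * cexp (airyExp t (c + d * v))) := by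
  unfold airyExp; fun_prop

theorem integrableOn_ray {d : ℂ} (hd : (d ^ 3).re < 0) (k : ℕ) (c : ℂ) (t : ℝ) :
    IntegrableOn (fun v : ℝ => d * ((c + d * v) ^ k * cexp (airyExp t (c + d * v))))
      (Ioi 0) := by
  refine Integrable.mono' ((integrableOn_rayBound hd (max ‖c‖ |t|) k).const_mul ‖d‖)
    (continuous_ray_integrand d c k t).aestronglyMeasurable ?_
  filter_upwards [ae_restrict_mem measurableSet_Ioi] with v hv
  rw [norm_mul]; gcongr
  exact norm_ray_integrand_le k (le_max_left _ _) (le_max_right _ _) (le_of_lt hv)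

theorem hasDerivAt_rayInt {d : ℂ} (hd : (d ^ 3).re < 0) (k : ℕ) (c : ℂ) (t : ℝ) :
    HasDerivAt (rayInt d k c) (rayInt d (k + 1) c t) t := by
  set M := max ‖c‖ (|t| + 1)
  refine (hasDerivAt_integral_of_dominated_loc_of_deriv_le (μ := volume.restrict (Ioi (0 : ℝ)))
    (F' := fun (t : ℝ) (v : ℝ) => d * ((c + d * v) ^ (k + 1) * cexp (airyExp t (c + d * v))))
    (s := Metric.ball t 1) (Metric.ball_mem_nhds t one_pos)
    (bound := fun v => ‖d‖ * rayBound d M (k + 1) v)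
    (Eventually.of_forall fun t => (continuous_ray_integrand d c k t).aestronglyMeasurable)
    (integrableOn_ray hd k c t)
    (continuous_ray_integrand d c (k + 1) t).aestronglyMeasurable ?_
    ((integrableOn_rayBound hd M (k + 1)).const_mul _) ?_).2
  · filter_upwards [ae_restrict_mem measurableSet_Ioi] with v hv s hs
    rw [norm_mul]; gcongr
    refine norm_ray_integrand_le _ (le_max_left _ _) ?_ (le_of_lt hv)
    refine le_trans ?_ (le_max_right _ _)
    have := abs_sub_abs_le_abs_sub s t
    rw [Metric.mem_ball, Real.dist_eq] at hs
    linarith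
  · refine Eventually.of_forall fun v s _ => ?_
    have h1 : HasDerivAt (fun s : ℝ => airyExp s (c + d * v)) (c + d * v) s := by
      have := ((ofRealCLM.hasDerivAt (x := s)).mul_const (c + d * v)).const_add
        ((c + d * v) ^ 3 / 3)
      simpa [airyExp] using this
    refine ((h1.cexp.const_mul ((c + d * v) ^ k)).const_mul d).congr_deriv ?_
    ring

theorem tendsto_ray_exp {d : ℂ} (hd : (d ^ 3).re < 0) (c : ℂ) (t : ℝ) :
    Tendsto (fun v : ℝ => cexp (airyExp t (c + d * v))) atTop (𝓝 0) := by
  rw [tendsto_zero_iff_norm_tendsto_zero]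
  set M := max ‖c‖ |t|
  refine squeeze_zero' (Eventually.of_forall fun _ => norm_nonneg _)
    (g := rayBound d M 0) ?_ ?_
  · filter_upwards [eventually_ge_atTop 0] with v hv
    simpa using norm_ray_integrand_le (d := d) 0 (le_max_left ‖c‖ |t|) (le_max_right _ _) hv
  · refine Real.tendsto_exp_atBot.comp (tendsto_atBot_add_const_right _ _ ?_)
    exact tendsto_cubic (by linarith)

theorem hasDerivAt_ray_exp (d c : ℂ) (t v : ℝ) :
    HasDerivAt (fun v : ℝ => cexp (airyExp t (c + d * v)))
      (d * (((c + d * v) ^ 2 + t) * cexp (airyExp t (c + d * v)))) v := by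
  have h0 : HasDerivAt (fun v : ℝ => c + d * (v : ℂ)) d v := by
    simpa using ((ofRealCLM.hasDerivAt (x := v)).const_mul d).const_add c
  have h1 : HasDerivAt (fun v : ℝ => airyExp t (c + d * v)) (((c + d * v) ^ 2 + t) * d) v := by
    unfold airyExp
    refine (((h0.pow 3).div_const 3).add (h0.const_mul (t : ℂ))).congr_deriv ?_
    push_cast; ring
  refine h1.cexp.congr_deriv ?_
  ring

theorem rayInt_two_add {d : ℂ} (hd : (d ^ 3).re < 0) (c : ℂ) (t : ℝ) :
    rayInt d 2 c t + t * rayInt d 0 c t = -cexp (airyExp t c) := by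
  have h := integral_Ioi_of_hasDerivAt_of_tendsto' (a := 0)
    (fun v _ => hasDerivAt_ray_exp d c t v) ?_ (tendsto_ray_exp hd c t)
  · simp only [Complex.ofReal_zero, mul_zero, add_zero, zero_sub] at h
    rw [← h, rayInt, rayInt, ← integral_const_mul, ← integral_add (integrableOn_ray hd 2 c t)
      ((integrableOn_ray hd 0 c t).const_mul _)]
    congr 1; ext v; ring
  · refine ((integrableOn_ray hd 2 c t).add ((integrableOn_ray hd 0 c t).const_mul (t : ℂ))).congr
      (Eventually.of_forall fun v => ?_)
    simp only [Pi.add_apply]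
    ring

theorem hasDerivAt_rayInt_base {d : ℂ} (hd : (d ^ 3).re < 0) (t l : ℝ) :
    HasDerivAt (fun l : ℝ => rayInt d 0 (I * l) t)
      (-I * cexp (airyExp t (I * l))) l := by
  set M := max (|l| + 1) |t|
  have key := (hasDerivAt_integral_of_dominated_loc_of_deriv_le
    (μ := volume.restrict (Ioi (0 : ℝ))) (x₀ := l)
    (F := fun (l : ℝ) (v : ℝ) => d * ((I * l + d * v) ^ 0 * cexp (airyExp t (I * l + d * v))))
    (F' := fun (l : ℝ) (v : ℝ) => I * (d * ((I * l + d * v) ^ 2 *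
      cexp (airyExp t (I * l + d * v))) + t * (d * ((I * l + d * v) ^ 0 *
      cexp (airyExp t (I * l + d * v))))))
    (s := Metric.ball l 1) (Metric.ball_mem_nhds l one_pos)
    (bound := fun v => ‖d‖ * rayBound d M 2 v + |t| * (‖d‖ * rayBound d M 0 v))
    (Eventually.of_forall fun l => (continuous_ray_integrand d _ 0 t).aestronglyMeasurable)
    (integrableOn_ray hd 0 _ t)
    (((continuous_ray_integrand d _ 2 t).add
      ((continuous_ray_integrand d _ 0 t).const_mul _)).const_mul _).aestronglyMeasurable ?_
    (((integrableOn_rayBound hd M 2).const_mul _).add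
      (((integrableOn_rayBound hd M 0).const_mul _).const_mul _)) ?_).2
  · refine key.congr_deriv ?_
    rw [integral_const_mul, integral_add (integrableOn_ray hd 2 _ t)
      ((integrableOn_ray hd 0 _ t).const_mul _)]
    have := rayInt_two_add hd (I * l) t
    rw [rayInt, rayInt, ← integral_const_mul (t : ℂ)] at this
    rw [this]; ring
  · filter_upwards [ae_restrict_mem measurableSet_Ioi] with v hv s hs
    have hs' : ‖I * (s : ℂ)‖ ≤ M := by
      have := abs_sub_abs_le_abs_sub s l
      rw [Metric.mem_ball, Real.dist_eq] at hs
      refine le_trans ?_ (le_max_left _ _)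
      simp only [norm_mul, Complex.norm_I, one_mul, norm_real, norm_eq_abs]
      linarith
    have e : ‖(t : ℂ)‖ = |t| := by simp
    rw [norm_mul, Complex.norm_I, one_mul]
    refine (norm_add_le _ _).trans (add_le_add ?_ ?_)
    · rw [norm_mul]; gcongr
      exact norm_ray_integrand_le _ hs' (le_max_right _ _) (le_of_lt hv)
    · rw [norm_mul, norm_mul, e]; gcongr
      exact norm_ray_integrand_le _ hs' (le_max_right _ _) (le_of_lt hv)
  · refine Eventually.of_forall fun v s _ => ?_
    have h0 : HasDerivAt (fun s : ℝ => I * (s : ℂ) + d * v) I s := by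
      simpa using ((ofRealCLM.hasDerivAt (x := s)).const_mul I).add_const (d * v)
    have h1 : HasDerivAt (fun s : ℝ => airyExp t (I * (s : ℂ) + d * v))
        (((I * (s : ℂ) + d * v) ^ 2 + t) * I) s := by
      unfold airyExp
      refine (((h0.pow 3).div_const 3).add (h0.const_mul (t : ℂ))).congr_deriv ?_
      push_cast; ring
    simp only [pow_zero, one_mul]
    refine (h1.cexp.const_mul d).congr_deriv ?_
    ring

/-! ### The outgoing Airy solution as a contour integral -/

/-- The direction of the right ray. -/
def rayR : ℂ := 1 + I

/-- The direction of the left ray. -/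
def rayL : ℂ := -(2 + I)

theorem rayR_sq : rayR ^ 2 = 2 * I := by rw [rayR]; linear_combination I_sq

theorem rayL_sq : rayL ^ 2 = 3 + 4 * I := by rw [rayL]; linear_combination I_sq

theorem rayR_cube : rayR ^ 3 = -2 + 2 * I := by
  rw [pow_succ, rayR_sq, rayR]; linear_combination 2 * I_sq

theorem rayL_cube : rayL ^ 3 = -2 - 11 * I := by
  rw [pow_succ, rayL_sq, rayL]; linear_combination -4 * I_sq

theorem rayR_cube_re : (rayR ^ 3).re < 0 := by rw [rayR_cube]; simp

theorem rayL_cube_re : (rayL ^ 3).re < 0 := by rw [rayL_cube]; simp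

theorem abs_arg_le_pi_div_three {s : ℂ} (hs : 0 < s.re) (h : |s.im| ≤ s.re) :
    -(π / (3 : ℕ)) < s.arg ∧ s.arg ≤ π / (3 : ℕ) := by
  have hpi := pi_pos
  rw [Complex.arg_of_re_nonneg hs.le]
  have hn : 0 < ‖s‖ := norm_pos_iff.mpr (by rintro rfl; simp at hs)
  have h1 : ‖s‖ ^ 2 = s.re ^ 2 + s.im ^ 2 := by rw [Complex.sq_norm, Complex.normSq_apply]; ring
  have h2 : |s.im / ‖s‖| < sqrt 3 / 2 := by
    rw [abs_div, abs_of_pos hn, div_lt_iff₀ hn]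
    apply lt_of_pow_lt_pow_left₀ 2 (by positivity)
    rw [mul_pow, div_pow, sq_sqrt (by norm_num), h1, sq_abs]
    have := sq_le_sq' (by linarith [abs_nonneg s.im]) h
    rw [sq_abs] at this
    nlinarith
  rw [abs_lt] at h2
  constructor
  · rw [← Real.arcsin_sin (x := -(π / (3 : ℕ))) (by push_cast; linarith)
      (by push_cast; linarith)]
    refine Real.strictMonoOn_arcsin ⟨?_, ?_⟩ ⟨?_, ?_⟩ ?_
    · exact Real.neg_one_le_sin _
    · exact Real.sin_le_one _
    · have := Complex.abs_im_div_norm_le_one s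
      exact (abs_le.mp this).1
    · have := Complex.abs_im_div_norm_le_one s
      exact (abs_le.mp this).2
    · push_cast; rw [Real.sin_neg, Real.sin_pi_div_three]; exact h2.1
  · rw [← Real.arcsin_sin (x := (π / (3 : ℕ))) (by push_cast; linarith)
      (by push_cast; linarith)]
    apply Real.monotone_arcsin
    push_cast; rw [Real.sin_pi_div_three]; exact h2.2.le

theorem rayInt_zero_zero {d s : ℂ} (hd : (d ^ 3).re < 0) (hs : 0 < s.re) (hsi : |s.im| ≤ s.re)
    (h : s ^ 3 * d ^ 3 = -3) (k : ℕ) :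
    rayInt d k 0 0 = (d * s) ^ (k + 1) / 3 * Gamma ((k + 1 : ℝ) / 3 : ℝ) := by
  set r : ℂ := -(d ^ 3) / 3
  have hr : 0 < r.re := by
    have : r.re = -(d ^ 3).re / 3 := by simp only [r]; simp
    rw [this]; linarith
  have hr0 : r ≠ 0 := by rintro h; rw [h] at hr; simp at hr
  have h1r : 1 / r = s ^ 3 := by
    rw [div_eq_iff hr0]; simp only [r]; linear_combination (1 / 3 : ℂ) * h
  set a : ℂ := (((k + 1 : ℝ) / 3 : ℝ) : ℂ)
  have ha : 0 < a.re := by simp only [a, Complex.ofReal_re]; positivity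
  have key := integral_cpow_mul_exp_neg ha hr
  rw [h1r] at key
  have e1 : (s ^ 3) ^ a = s ^ (k + 1) := by
    have e : a = (((3 : ℕ) : ℂ)⁻¹) * ((k + 1 : ℕ) : ℂ) := by simp only [a]; push_cast; ring
    rw [e, Complex.cpow_mul_nat]
    have := abs_arg_le_pi_div_three hs hsi
    rw [Complex.pow_cpow_nat_inv (by norm_num) this.1 this.2]
  rw [e1] at key
  have e2 := integral_comp_rpow_Ioi_of_pos (p := 1 / 3)
    (g := fun v : ℝ => d * (((0 : ℂ) + d * v) ^ k * cexp (airyExp 0 (0 + d * v))))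
    (by norm_num)
  rw [rayInt, ← e2]
  have e3 : ∀ x ∈ Ioi (0 : ℝ), ((1 / 3 : ℝ) * x ^ ((1 / 3 : ℝ) - 1)) •
      (d * (((0 : ℂ) + d * ((x ^ (1 / 3 : ℝ) : ℝ) : ℂ)) ^ k *
        cexp (airyExp 0 (0 + d * ((x ^ (1 / 3 : ℝ) : ℝ) : ℂ))))) =
      d ^ (k + 1) / 3 * ((x : ℂ) ^ (a - 1) * cexp (-r * x)) := by
    intro x hx
    have hx : 0 < x := hx
    have c3 : (x ^ (1 / 3 : ℝ)) ^ 3 = x := by rw [← rpow_natCast, ← rpow_mul hx.le]; norm_num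
    have ex : airyExp 0 (0 + d * ((x ^ (1 / 3 : ℝ) : ℝ) : ℂ)) = -r * x := by
      simp only [airyExp, r, zero_add, mul_pow, ← ofReal_pow, c3]
      simp; ring
    have ep : (x : ℂ) ^ (a - 1) =
        ((x ^ ((1 / 3 : ℝ) - 1) : ℝ) : ℂ) * (((x ^ (1 / 3 : ℝ) : ℝ) : ℂ)) ^ k := by
      rw [← ofReal_pow, ← ofReal_mul, ← rpow_natCast, ← rpow_mul hx.le,
        ← rpow_add hx, Complex.ofReal_cpow hx.le]
      congr 1; simp only [a]; push_cast; ring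
    rw [ex, ep, real_smul, zero_add, mul_pow]; push_cast; ring
  rw [setIntegral_congr_fun measurableSet_Ioi e3, integral_const_mul, key]; simp only [a]
  ring

/-- The primitive sixth root of unity `e^{iπ/3}`. -/
def root6 : ℂ := (1 + I * (sqrt 3 : ℝ)) / 2

theorem sqrt3_sq : ((sqrt 3 : ℝ) : ℂ) ^ 2 = 3 := by
  rw [← ofReal_pow, sq_sqrt (by norm_num)]; norm_num

theorem root6_sq : root6 ^ 2 = root6 - 1 := by
  rw [root6]
  linear_combination (1 / 4 : ℂ) * (I ^ 2 * sqrt3_sq + 3 * I_sq)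

theorem root6_cube : root6 ^ 3 = -1 := by rw [pow_succ, root6_sq]; linear_combination root6_sq

/-- The real cube root of `3`. -/
def cbrt3 : ℝ := 3 ^ (1 / 3 : ℝ)

theorem cbrt3_pos : 0 < cbrt3 := by unfold cbrt3; positivity

theorem cbrt3_cube : (cbrt3 : ℂ) ^ 3 = 3 := by
  have : cbrt3 ^ 3 = 3 := by rw [cbrt3, ← rpow_natCast, ← rpow_mul (by norm_num)]; norm_num
  rw [← ofReal_pow, this]; norm_num

theorem rayR_moment (k : ℕ) : rayInt rayR k 0 0 =
    (cbrt3 * root6) ^ (k + 1) / 3 * Gamma ((k + 1 : ℝ) / 3 : ℝ) := by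
  have h3 : (1 : ℝ) < sqrt 3 := by rw [Real.lt_sqrt (by norm_num)]; norm_num
  have hc := cbrt3_pos
  set s : ℂ := ((cbrt3 / 4 : ℝ) : ℂ) * (((1 + sqrt 3 : ℝ) : ℂ) + ((sqrt 3 - 1 : ℝ) : ℂ) * I)
  have hs : rayR * s = cbrt3 * root6 := by
    simp only [s, rayR, root6]; push_cast
    linear_combination (cbrt3 / 4 : ℂ) * (((sqrt 3 : ℝ) : ℂ) - 1) * I_sq
  have hre : s.re = cbrt3 / 4 * (1 + sqrt 3) := by
    simp only [s, Complex.re_ofReal_mul, Complex.add_re, Complex.re_ofReal_mul, Complex.ofReal_re,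
      Complex.I_re, mul_zero, add_zero]
  have him : s.im = cbrt3 / 4 * (sqrt 3 - 1) := by
    simp only [s, Complex.im_ofReal_mul, Complex.add_im, Complex.im_ofReal_mul, Complex.ofReal_im,
      Complex.I_im, mul_one, zero_add]
  rw [← hs]
  refine rayInt_zero_zero rayR_cube_re ?_ ?_ ?_ k
  · rw [hre]; positivity
  · rw [hre, him, abs_of_nonneg (by nlinarith)]; nlinarith
  · rw [← mul_pow, mul_comm, hs, mul_pow, cbrt3_cube, root6_cube]; norm_num

theorem rayL_moment (k : ℕ) : rayInt rayL k 0 0 =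
    (-cbrt3 : ℂ) ^ (k + 1) / 3 * Gamma ((k + 1 : ℝ) / 3 : ℝ) := by
  have hc := cbrt3_pos
  set s : ℂ := ((cbrt3 / 5 : ℝ) : ℂ) * (2 - I)
  have hs : rayL * s = -cbrt3 := by
    simp only [s, rayL]; push_cast
    linear_combination (cbrt3 / 5 : ℂ) * I_sq
  have hre : s.re = cbrt3 / 5 * 2 := by simp [s]
  have him : s.im = -(cbrt3 / 5) := by simp [s]
  rw [← hs]
  refine rayInt_zero_zero rayL_cube_re ?_ ?_ ?_ k
  · rw [hre]; positivity
  · rw [hre, him, abs_neg, abs_of_nonneg (by linarith)]; linarith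
  · rw [← mul_pow, mul_comm, hs, neg_pow, cbrt3_cube]; norm_num

theorem Gamma_third_mul : Real.Gamma (1 / 3) * Real.Gamma (2 / 3) = 2 * π / sqrt 3 := by
  have := Real.Gamma_mul_Gamma_one_sub (1 / 3)
  rw [show π * (1 / 3) = π / 3 by ring, Real.sin_pi_div_three] at this
  rw [show (2 / 3 : ℝ) = 1 - 1 / 3 by norm_num, this]; field_simp

/-- The Airy contour integral. -/
def contourAiry (k : ℕ) (c : ℂ) (t : ℝ) : ℂ := rayInt rayR k c t - rayInt rayL k c t

theorem contourAiry_zero : contourAiry 0 0 0 = I * π * outAiryA := by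
  rw [contourAiry, rayR_moment, rayL_moment, outAiryA]
  have hG := Gamma_third_mul
  have hne : Real.Gamma (2 / 3) ≠ 0 := (Real.Gamma_pos_of_pos (by norm_num)).ne'
  have h3 : sqrt 3 ≠ 0 := by positivity
  have e : (3 : ℝ) ^ (-2 / 3 : ℝ) = cbrt3 / 3 := by
    rw [cbrt3, eq_div_iff (by norm_num), ← rpow_add_one (by norm_num)]; norm_num
  have hG' : π = Real.Gamma (1 / 3) * Real.Gamma (2 / 3) * sqrt 3 / 2 := by rw [hG]; field_simp
  rw [e]
  have e2 : (3 : ℝ) ^ (-2 / 3 : ℝ) = cbrt3 / 3 := e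
  have e3 : π * (cbrt3 / 3 / Real.Gamma (2 / 3)) =
      Real.Gamma (1 / 3) * sqrt 3 / 2 * (cbrt3 / 3) := by rw [hG']; field_simp
  have e4 : (π : ℂ) * ((cbrt3 / 3 / Real.Gamma (2 / 3) : ℝ) : ℂ) =
      (Real.Gamma (1 / 3) : ℂ) * (sqrt 3 : ℝ) / 2 * (cbrt3 / 3) := by
    rw [← ofReal_mul, e3]; push_cast; ring
  have eG : Gamma (((0 : ℕ) + 1 : ℝ) / 3 : ℝ) = (Real.Gamma (1 / 3) : ℂ) := by
    rw [Complex.Gamma_ofReal]; norm_num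
  rw [eG, root6]
  linear_combination (-I * (1 - I * (sqrt 3 : ℝ))) * e4 +
    (Real.Gamma (1 / 3) : ℂ) * cbrt3 / 6 * (I ^ 2 * sqrt3_sq + 3 * I_sq)

theorem contourAiry_one_zero : contourAiry 1 0 0 = I * π * outAiryB := by
  rw [contourAiry, rayR_moment, rayL_moment, outAiryB]
  have hG := Gamma_third_mul
  have hne : Real.Gamma (1 / 3) ≠ 0 := (Real.Gamma_pos_of_pos (by norm_num)).ne'
  have h3 : sqrt 3 ≠ 0 := by positivity
  have e : (3 : ℝ) ^ (-1 / 3 : ℝ) = cbrt3 ^ 2 / 3 := by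
    rw [cbrt3, eq_div_iff (by norm_num), ← rpow_add_one (by norm_num), ← rpow_natCast,
      ← rpow_mul (by norm_num)]; norm_num
  have hG' : π = Real.Gamma (1 / 3) * Real.Gamma (2 / 3) * sqrt 3 / 2 := by rw [hG]; field_simp
  rw [e]
  have e3 : π * (cbrt3 ^ 2 / 3 / Real.Gamma (1 / 3)) =
      Real.Gamma (2 / 3) * sqrt 3 / 2 * (cbrt3 ^ 2 / 3) := by rw [hG']; field_simp
  have e4 : (π : ℂ) * ((cbrt3 ^ 2 / 3 / Real.Gamma (1 / 3) : ℝ) : ℂ) =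
      (Real.Gamma (2 / 3) : ℂ) * (sqrt 3 : ℝ) / 2 * (cbrt3 ^ 2 / 3) := by
    rw [← ofReal_mul, e3]; push_cast; ring
  have eG : Gamma (((1 : ℕ) + 1 : ℝ) / 3 : ℝ) = (Real.Gamma (2 / 3) : ℂ) := by
    rw [Complex.Gamma_ofReal]; norm_num
  rw [eG, mul_pow, root6_sq, root6]
  linear_combination (-I * (1 + I * (sqrt 3 : ℝ))) * e4 -
    (Real.Gamma (2 / 3) : ℂ) * cbrt3 ^ 2 / 6 * (I ^ 2 * sqrt3_sq + 3 * I_sq)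

/-! ### Wronskians -/

theorem hasDerivAt_conj {f : ℝ → ℂ} {f' : ℂ} {t : ℝ} (h : HasDerivAt f f' t) :
    HasDerivAt (fun t => conj (f t)) (conj f') t := h.star

/-- The Wronskian of `outAiry` and its conjugate. -/
def airyW : ℂ := outAiryA * conj outAiryB - outAiryB * conj outAiryA

theorem airyW_ne_zero : airyW ≠ 0 := by
  have h1 : (3 : ℝ) ^ (-2 / 3 : ℝ) / Real.Gamma (2 / 3) ≠ 0 :=
    (div_pos (by positivity) (Real.Gamma_pos_of_pos (by norm_num))).ne'
  have h2 : (3 : ℝ) ^ (-1 / 3 : ℝ) / Real.Gamma (1 / 3) ≠ 0 :=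
    (div_pos (by positivity) (Real.Gamma_pos_of_pos (by norm_num))).ne'
  have h3 : sqrt 3 ≠ 0 := by positivity
  have : airyW = -4 * I * (sqrt 3 : ℝ) *
      (((3 : ℝ) ^ (-2 / 3 : ℝ) / Real.Gamma (2 / 3) : ℝ) *
        ((3 : ℝ) ^ (-1 / 3 : ℝ) / Real.Gamma (1 / 3) : ℝ)) := by
    simp only [airyW, outAiryA, outAiryB, map_mul, map_add, map_sub, map_one, Complex.conj_I,
      conj_ofReal]
    ring
  rw [this]
  refine mul_ne_zero (mul_ne_zero (by simp) (by exact_mod_cast h3)) (mul_ne_zero ?_ ?_)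
  · exact_mod_cast h1
  · exact_mod_cast h2

theorem const_of_hasDerivAt_zero {f : ℝ → ℂ} (h : ∀ t, HasDerivAt f 0 t) (s t : ℝ) : f s = f t :=
  is_const_of_deriv_eq_zero (fun t => (h t).differentiableAt) (fun t => (h t).deriv) s t

theorem outAiry_wronskian (t : ℝ) : outAiry t * conj (outAiry' t)
    - outAiry' t * conj (outAiry t) = airyW := by
  have h : ∀ t, HasDerivAt (fun t => outAiry t * conj (outAiry' t)
    - outAiry' t * conj (outAiry t)) 0 t := fun t => by
    refine (((hasDerivAt_outAiry t).mul (hasDerivAt_conj (hasDerivAt_outAiry' t))).sub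
      ((hasDerivAt_outAiry' t).mul (hasDerivAt_conj (hasDerivAt_outAiry t)))).congr_deriv ?_
    simp only [map_neg, map_mul, conj_ofReal]; ring
  have := const_of_hasDerivAt_zero h t 0
  rw [this, outAiry_zero, outAiry'_zero, airyW]

theorem outAiry_ne_zero (t : ℝ) : outAiry t ≠ 0 := by
  intro h
  have := outAiry_wronskian t
  rw [h] at this
  simp only [zero_mul, map_zero, mul_zero, sub_zero] at this
  exact airyW_ne_zero this.symm

/-- Solutions of the Airy equation are determined by their Cauchy data at `0`. -/
theorem airy_unique {u u' : ℝ → ℂ} (h : ∀ t, HasDerivAt u (u' t) t)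
    (h' : ∀ t, HasDerivAt u' (-(t * u t)) t) (c : ℂ) (h0 : u 0 = c * outAiryA)
    (h0' : u' 0 = c * outAiryB) (t : ℝ) : u t = c * outAiry t := by
  have w1 : ∀ t, HasDerivAt (fun t => u t * outAiry' t - u' t * outAiry t) 0 t := fun t => by
    refine (((h t).mul (hasDerivAt_outAiry' t)).sub
      ((h' t).mul (hasDerivAt_outAiry t))).congr_deriv ?_
    ring
  have w2 : ∀ t, HasDerivAt (fun t => u t * conj (outAiry' t)
      - u' t * conj (outAiry t)) 0 t := fun t => by
    refine (((h t).mul (hasDerivAt_conj (hasDerivAt_outAiry' t))).sub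
      ((h' t).mul (hasDerivAt_conj (hasDerivAt_outAiry t)))).congr_deriv ?_
    simp only [map_neg, map_mul, conj_ofReal]; ring
  have c1 := const_of_hasDerivAt_zero w1 t 0
  have c2 := const_of_hasDerivAt_zero w2 t 0
  simp only [outAiry_zero, outAiry'_zero, h0, h0'] at c1 c2
  have c3 : c * outAiryA * conj outAiryB - c * outAiryB * conj outAiryA
    = c * airyW := by rw [airyW]; ring
  rw [c3] at c2
  have w := outAiry_wronskian t
  apply mul_right_cancel₀ airyW_ne_zero
  linear_combination (-u t) * w + outAiry t * c2 - conj (outAiry t) * c1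

theorem outAiry_eq_contour (t : ℝ) : contourAiry 0 0 t = I * π * outAiry t := by
  refine airy_unique (u' := contourAiry 1 0) (fun t => ?_) (fun t => ?_) _ contourAiry_zero
    contourAiry_one_zero t
  · exact (hasDerivAt_rayInt rayR_cube_re 0 0 t).sub (hasDerivAt_rayInt rayL_cube_re 0 0 t)
  · refine ((hasDerivAt_rayInt rayR_cube_re 1 0 t).sub
      (hasDerivAt_rayInt rayL_cube_re 1 0 t)).congr_deriv ?_
    rw [contourAiry]
    linear_combination rayInt_two_add rayR_cube_re 0 t - rayInt_two_add rayL_cube_re 0 t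

theorem contourAiry_base (t l : ℝ) : contourAiry 0 (I * l) t = contourAiry 0 0 t := by
  have := const_of_hasDerivAt_zero (f := fun l : ℝ => contourAiry 0 (I * l) t)
    (fun l => by
      have := (hasDerivAt_rayInt_base rayR_cube_re t l).sub
        (hasDerivAt_rayInt_base rayL_cube_re t l)
      rw [sub_self] at this
      exact this) l 0
  simpa using this

/-! ### The amplitude of the outgoing Airy solution -/

/-- The integrand of the amplitude along the direction `d`. -/
def ampIntegrand (d : ℂ) (k : ℕ) (y x : ℝ) : ℂ := d * (d ^ 3 / 3) ^ k * ((x : ℂ) ^ (3 * k) *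
    cexp (I * d ^ 2 * x ^ 2 + y * (d ^ 3 / 3 * x ^ 3)))

/-- The contribution of the direction `d` to the amplitude. -/
def ampRay (d : ℂ) (k : ℕ) (y : ℝ) : ℂ := ∫ x : ℝ in Ioi 0, ampIntegrand d k y x

/-- The majorant of the integrand of the amplitude. -/
def ampBound (d : ℂ) (k : ℕ) (x : ℝ) : ℝ :=
  ‖d * (d ^ 3 / 3) ^ k‖ * (x ^ ((3 * k : ℕ) : ℝ) * exp (-(-(I * d ^ 2).re) * x ^ 2))

theorem continuous_ampIntegrand (d : ℂ) (k : ℕ) (y : ℝ) : Continuous (ampIntegrand d k y) := by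
  unfold ampIntegrand; fun_prop

theorem norm_ampIntegrand_le {d : ℂ} (hd : (d ^ 3).re < 0) (k : ℕ) {y x : ℝ} (hy : 0 ≤ y)
    (hx : 0 < x) : ‖ampIntegrand d k y x‖ ≤ ampBound d k x := by
  rw [ampIntegrand, ampBound, norm_mul, norm_mul _ (cexp _), Complex.norm_exp, norm_pow,
    norm_real, norm_eq_abs, abs_of_pos hx, rpow_natCast]
  gcongr
  have e1 : (I * d ^ 2 * (x : ℂ) ^ 2).re = (I * d ^ 2).re * x ^ 2 := by
    rw [← ofReal_pow, Complex.re_mul_ofReal]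
  have e2 : ((y : ℂ) * (d ^ 3 / 3 * (x : ℂ) ^ 3)).re = y * ((d ^ 3).re / 3 * x ^ 3) := by
    rw [Complex.re_ofReal_mul, ← ofReal_pow, Complex.re_mul_ofReal]
    congr 2
    rw [show (3 : ℂ) = ((3 : ℝ) : ℂ) by norm_num, Complex.div_ofReal_re]
  rw [Complex.add_re, e1, e2]
  have : y * ((d ^ 3).re / 3 * x ^ 3) ≤ 0 :=
    mul_nonpos_of_nonneg_of_nonpos hy (mul_nonpos_of_nonpos_of_nonneg (by linarith) (by positivity))
  linarith

theorem integrableOn_ampBound {d : ℂ} (hd : (I * d ^ 2).re < 0) (k : ℕ) :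
    IntegrableOn (ampBound d k) (Ioi 0) :=
  ((integrable_rpow_mul_exp_neg_mul_sq (by linarith)
    (by have : (0 : ℝ) ≤ (3 * k : ℕ) := by positivity
        linarith)).const_mul _).integrableOn

theorem integrableOn_ampIntegrand {d : ℂ} (hd2 : (I * d ^ 2).re < 0)
    (hd : (d ^ 3).re < 0) (k : ℕ) {y : ℝ} (hy : 0 ≤ y) :
    IntegrableOn (ampIntegrand d k y) (Ioi 0) := by
  refine Integrable.mono' (integrableOn_ampBound hd2 k)
    (continuous_ampIntegrand d k y).aestronglyMeasurable ?_
  filter_upwards [ae_restrict_mem measurableSet_Ioi] with x hx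
  exact norm_ampIntegrand_le hd k hy hx

theorem norm_ampRay_le {d : ℂ} (hd2 : (I * d ^ 2).re < 0) (hd : (d ^ 3).re < 0) (k : ℕ)
    {y : ℝ} (hy : 0 ≤ y) : ‖ampRay d k y‖ ≤ ∫ x in Ioi 0, ampBound d k x := by
  refine norm_integral_le_of_norm_le (integrableOn_ampBound hd2 k) ?_
  filter_upwards [ae_restrict_mem measurableSet_Ioi] with x hx
  exact norm_ampIntegrand_le hd k hy hx

theorem hasDerivAt_ampRay {d : ℂ} (hd2 : (I * d ^ 2).re < 0) (hd : (d ^ 3).re < 0) (k : ℕ)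
    {y : ℝ} (hy : 0 < y) : HasDerivAt (ampRay d k) (ampRay d (k + 1) y) y := by
  refine (hasDerivAt_integral_of_dominated_loc_of_deriv_le (μ := volume.restrict (Ioi (0 : ℝ)))
    (F := ampIntegrand d k) (F' := ampIntegrand d (k + 1))
    (s := Ioi 0) (Ioi_mem_nhds hy) (bound := ampBound d (k + 1))
    (Eventually.of_forall fun y => (continuous_ampIntegrand d k y).aestronglyMeasurable)
    (integrableOn_ampIntegrand hd2 hd k hy.le)
    (continuous_ampIntegrand d (k + 1) y).aestronglyMeasurable ?_
    (integrableOn_ampBound hd2 (k + 1)) ?_).2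
  · filter_upwards [ae_restrict_mem measurableSet_Ioi] with x hx z hz
    exact norm_ampIntegrand_le hd _ (le_of_lt hz) hx
  · refine Eventually.of_forall fun x z _ => ?_
    have h1 : HasDerivAt (fun z : ℝ => I * d ^ 2 * (x : ℂ) ^ 2 +
        (z : ℂ) * (d ^ 3 / 3 * (x : ℂ) ^ 3)) (d ^ 3 / 3 * (x : ℂ) ^ 3) z := by
      simpa using ((ofRealCLM.hasDerivAt (x := z)).mul_const
        (d ^ 3 / 3 * (x : ℂ) ^ 3)).const_add (I * d ^ 2 * (x : ℂ) ^ 2)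
    unfold ampIntegrand
    refine ((h1.cexp.const_mul _).const_mul _).congr_deriv ?_
    ring

theorem tendsto_ampRay {d : ℂ} (hd2 : (I * d ^ 2).re < 0) (hd : (d ^ 3).re < 0) :
    Tendsto (ampRay d 0) (𝓝[>] 0) (𝓝 (ampRay d 0 0)) := by
  refine tendsto_integral_filter_of_dominated_convergence (ampBound d 0)
    (Eventually.of_forall fun y => (continuous_ampIntegrand d 0 y).aestronglyMeasurable) ?_
    (integrableOn_ampBound hd2 0) ?_
  · filter_upwards [self_mem_nhdsWithin] with y hy
    filter_upwards [ae_restrict_mem measurableSet_Ioi] with x hx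
    exact norm_ampIntegrand_le hd _ (le_of_lt hy) hx
  · refine Eventually.of_forall fun x => ?_
    have : Continuous fun y => ampIntegrand d 0 y x := by unfold ampIntegrand; fun_prop
    exact this.continuousAt.tendsto.mono_left nhdsWithin_le_nhds

theorem rayInt_saddle {d : ℂ} {t : ℝ} (ht : 0 < t) : rayInt d 0 (I * (t ^ (1 / 2 : ℝ) : ℝ)) t =
      cexp (I * (2 / 3 * t ^ (3 / 2 : ℝ) : ℝ)) * (t ^ (-1 / 4 : ℝ) : ℝ) *
        ampRay d 0 (t ^ (-3 / 4 : ℝ)) := by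
  set a : ℝ := t ^ (1 / 2 : ℝ)
  set b : ℝ := t ^ (-1 / 4 : ℝ)
  have hb : 0 < b := by positivity
  have ha2 : (a : ℂ) ^ 2 = t := by rw [← ofReal_pow, ← rpow_natCast, ← rpow_mul ht.le]; norm_num
  have ha3 : ((t ^ (3 / 2 : ℝ) : ℝ) : ℂ) = a * t := by
    rw [← ofReal_mul, ← rpow_add_one ht.ne']; norm_num
  have hab : (a : ℂ) * b ^ 2 = 1 := by
    rw [← ofReal_pow, ← ofReal_mul, ← rpow_natCast, ← rpow_mul ht.le, ← rpow_add ht]; norm_num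
  have hb3 : ((t ^ (-3 / 4 : ℝ) : ℝ) : ℂ) = b ^ 3 := by
    rw [← ofReal_pow, ← rpow_natCast, ← rpow_mul ht.le]; norm_num
  have h1 := integral_comp_mul_left_Ioi (fun v : ℝ => d * ((I * a + d * v) ^ 0 *
    cexp (airyExp t (I * a + d * v)))) 0 hb
  rw [mul_zero] at h1
  rw [rayInt]
  have h2 : ∫ v : ℝ in Ioi 0, d * ((I * a + d * v) ^ 0 *
    cexp (airyExp t (I * a + d * v))) = (b : ℂ) * ∫ x : ℝ in Ioi 0,
      d * ((I * a + d * (b * x : ℝ)) ^ 0 *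
        cexp (airyExp t (I * a + d * (b * x : ℝ)))) := by
    rw [h1, real_smul, ← mul_assoc, ← ofReal_mul, mul_inv_cancel₀ hb.ne']; simp
  rw [h2, ampRay, mul_comm (cexp _), mul_assoc, ← integral_const_mul (cexp _)]
  congr 1
  refine integral_congr_ae (Eventually.of_forall fun x => ?_)
  have e : airyExp t (I * a + d * (b * x : ℝ)) =
      I * (2 / 3 * t ^ (3 / 2 : ℝ) : ℝ) + (I * d ^ 2 * x ^ 2 +
        (t ^ (-3 / 4 : ℝ) : ℝ) * (d ^ 3 / 3 * x ^ 3)) := by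
    simp only [airyExp]
    rw [hb3]; push_cast; rw [ha3]
    linear_combination (I * d ^ 2 * x ^ 2) * hab - (I * a / 3 + d * b * x) * ha2 +
      ((a : ℂ) ^ 3 * I / 3 + a ^ 2 * d * b * x) * I_sq
  simp only [ampIntegrand]
  rw [e, Complex.exp_add]; ring

theorem rayR_sq_re : (I * rayR ^ 2).re < 0 := by rw [rayR_sq]; simp

theorem rayL_sq_re : (I * rayL ^ 2).re < 0 := by rw [rayL_sq]; simp

/-- The amplitude of the outgoing Airy solution and its derivatives, in the variable
`t ^ (-3 / 4)`. -/
def airyAmp (k : ℕ) (y : ℝ) : ℂ := ampRay rayR k y - ampRay rayL k y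

theorem hasDerivAt_airyAmp (k : ℕ) {y : ℝ} (hy : 0 < y) :
    HasDerivAt (airyAmp k) (airyAmp (k + 1) y) y :=
  (hasDerivAt_ampRay rayR_sq_re rayR_cube_re k hy).sub
    (hasDerivAt_ampRay rayL_sq_re rayL_cube_re k hy)

theorem exists_norm_airyAmp_le (k : ℕ) : ∃ C, 0 < C ∧ ∀ y, 0 ≤ y → ‖airyAmp k y‖ ≤ C := by
  refine ⟨max 1 (_ + _), by positivity, fun y hy => le_max_of_le_right ((norm_sub_le _ _).trans
    (add_le_add (norm_ampRay_le rayR_sq_re rayR_cube_re k hy)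
      (norm_ampRay_le rayL_sq_re rayL_cube_re k hy)))⟩

theorem ampRay_zero {d w : ℂ} (hd2 : (I * d ^ 2).re < 0)
    (hw : 0 < w.re) (hwd : w ^ 2 * (-(I * d ^ 2)) = 1) :
    ampRay d 0 0 = d * w * (sqrt π : ℝ) / 2 := by
  set b : ℂ := -(I * d ^ 2)
  have hb : 0 < b.re := by simp only [b, Complex.neg_re]; linarith
  have hb0 : b ≠ 0 := by rintro h; rw [h] at hb; simp at hb
  have h1 := integral_gaussian_complex_Ioi hb
  have h2 : (π / b : ℂ) = (((sqrt π : ℝ) : ℂ) * w) ^ 2 := by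
    rw [div_eq_iff hb0, mul_pow, mul_assoc, hwd, mul_one, ← ofReal_pow, sq_sqrt pi_pos.le]
  rw [h2, one_div, Complex.sq_cpow_two_inv] at h1
  · rw [ampRay]
    have : ∀ x : ℝ, ampIntegrand d 0 0 x = d * cexp (-b * x ^ 2) := by
      intro x; simp [ampIntegrand, b]
    simp only [this]
    rw [integral_const_mul, h1]; ring
  · rw [Complex.re_ofReal_mul]
    have := pi_pos
    positivity

theorem airyAmp_zero_zero :
    airyAmp 0 0 = (sqrt π : ℝ) * (1 + I) * (sqrt 2 / 2 : ℝ) := by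
  have h2 : ((sqrt 2 : ℝ) : ℂ) ^ 2 = 2 := by rw [← ofReal_pow, sq_sqrt (by norm_num)]; norm_num
  have hp : (0 : ℝ) < sqrt 2 := by positivity
  rw [airyAmp, ampRay_zero (w := (sqrt 2 / 2 : ℝ)) rayR_sq_re,
    ampRay_zero (w := (sqrt 2 / 10 : ℝ) * (3 + I)) rayL_sq_re]
  · rw [rayR, rayL]; push_cast
    linear_combination ((sqrt π : ℝ) : ℂ) * (sqrt 2 : ℝ) / 20 * I_sq
  · rw [Complex.re_ofReal_mul]; simp
  · rw [rayL_sq, mul_pow]; push_cast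
    linear_combination ((3 + I) ^ 2 * (-(I * (3 + 4 * I))) / 100) * h2 +
      (1 / 50) * (-4 * I ^ 2 - 27 * I - 50) * I_sq
  · rw [Complex.ofReal_re]; positivity
  · rw [rayR_sq]; push_cast
    linear_combination (-I ^ 2 / 2) * h2 - I_sq

theorem outAiry_eq_amp {t : ℝ} (ht : 0 < t) : outAiry t =
    -I / π * (cexp (I * (2 / 3 * t ^ (3 / 2 : ℝ) : ℝ)) *
      ((t ^ (-1 / 4 : ℝ) : ℝ) * airyAmp 0 (t ^ (-3 / 4 : ℝ)))) := by
  have h := outAiry_eq_contour t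
  rw [← contourAiry_base t (t ^ (1 / 2 : ℝ)), contourAiry, rayInt_saddle ht, rayInt_saddle ht] at h
  have hpi : (π : ℂ) ≠ 0 := by exact_mod_cast pi_pos.ne'
  rw [airyAmp, div_mul_eq_mul_div, eq_div_iff hpi]
  linear_combination (I) * h + π * outAiry t * I_sq

theorem airyAmp_ne_zero {y : ℝ} (hy : 0 < y) : airyAmp 0 y ≠ 0 := by
  intro h
  have ht : (0 : ℝ) < y ^ (-4 / 3 : ℝ) := by positivity
  have := outAiry_eq_amp ht
  rw [← rpow_mul hy.le (-4 / 3) (-3 / 4), show (-4 / 3 : ℝ) * (-3 / 4) = 1 by norm_num, Real.rpow_one, h] at this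
  exact outAiry_ne_zero _ (by rw [this]; simp)

theorem tendsto_airyAmp : Tendsto (airyAmp 0) (𝓝[>] 0) (𝓝 (airyAmp 0 0)) :=
  (tendsto_ampRay rayR_sq_re rayR_cube_re).sub (tendsto_ampRay rayL_sq_re rayL_cube_re)

theorem airyAmp_zero_ne_zero : airyAmp 0 0 ≠ 0 := by
  rw [airyAmp_zero_zero]
  have := pi_pos
  refine mul_ne_zero (mul_ne_zero ?_ ?_) ?_
  · exact_mod_cast (by positivity : sqrt π ≠ 0)
  · intro h; have := congrArg Complex.re h; simp at this
  · exact_mod_cast (by positivity : sqrt 2 / 2 ≠ 0)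

theorem exists_airyAmp_ge : ∃ c > 0, ∀ y, 0 < y → y ≤ 1 → c ≤ ‖airyAmp 0 y‖ := by
  have h0 : 0 < ‖airyAmp 0 0‖ := norm_pos_iff.mpr airyAmp_zero_ne_zero
  have h1 := tendsto_airyAmp.norm.eventually_const_lt (half_lt_self h0)
  obtain ⟨u, hu, hu'⟩ := mem_nhdsGT_iff_exists_Ioo_subset.mp h1
  have hu : 0 < u := hu
  have hc : ContinuousOn (fun y => ‖airyAmp 0 y‖) (Icc (u / 2) 1) := fun y hy =>
    (hasDerivAt_airyAmp 0 (by linarith [hy.1])).continuousAt.norm.continuousWithinAt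
  rcases le_or_gt (u / 2) 1 with h | h
  · obtain ⟨z, hz, hz'⟩ := isCompact_Icc.exists_isMinOn ⟨1, h, le_rfl⟩ hc
    refine ⟨min (‖airyAmp 0 0‖ / 2) ‖airyAmp 0 z‖, lt_min (by positivity)
      (norm_pos_iff.mpr (airyAmp_ne_zero (by linarith [hz.1]))), fun y hy hy1 => ?_⟩
    rcases lt_or_ge y (u / 2) with hyu | hyu
    · exact (min_le_left _ _).trans (hu' ⟨hy, by linarith⟩ : _ < _).le
    · exact (min_le_right _ _).trans (hz' ⟨hyu, hy1⟩)
  · exact ⟨‖airyAmp 0 0‖ / 2, by positivity, fun y hy hy1 => (hu' ⟨hy, by linarith⟩ : _ < _).le⟩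

theorem contDiffOn_airyAmp (k : ℕ) : ContDiffOn ℝ ∞ (airyAmp k) (Ioi 0) := by
  rw [contDiffOn_infty]
  intro n
  induction n generalizing k with
  | zero =>
    exact contDiffOn_zero.mpr fun y hy => (hasDerivAt_airyAmp k hy).continuousAt.continuousWithinAt
  | succ n ih =>
    rw [Nat.cast_succ, contDiffOn_succ_iff_deriv_of_isOpen isOpen_Ioi]
    refine ⟨fun y hy => (hasDerivAt_airyAmp k hy).differentiableAt.differentiableWithinAt,
      by simp, (ih (k + 1)).congr fun y hy => (hasDerivAt_airyAmp k hy).deriv⟩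

/-! ### Modulus and logarithmic derivative of the outgoing Airy solution -/

theorem hasDerivAt_rpow_mul_comp {G : ℝ → ℂ} {G' : ℂ} {t e : ℝ} (ht : 0 < t)
    (hG : HasDerivAt G G' (t ^ (-3 / 4 : ℝ))) :
    HasDerivAt (fun t : ℝ => ((t ^ e : ℝ) : ℂ) * G (t ^ (-3 / 4 : ℝ)))
      ((t ^ (e - 1) : ℝ) * (e * G (t ^ (-3 / 4 : ℝ)) - 3 / 4 * ((t ^ (-3 / 4 : ℝ) : ℝ) * G'))) t := by
  have h1 : HasDerivAt (fun t : ℝ => ((t ^ e : ℝ) : ℂ)) ((e * t ^ (e - 1) : ℝ) : ℂ) t :=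
    (hasDerivAt_rpow_const (Or.inl ht.ne')).ofReal_comp
  have h2 : HasDerivAt (fun t : ℝ => t ^ (-3 / 4 : ℝ)) (-3 / 4 * t ^ (-3 / 4 - 1 : ℝ)) t :=
    hasDerivAt_rpow_const (Or.inl ht.ne')
  have h3 := HasDerivAt.scomp t hG h2
  refine (h1.mul h3).congr_deriv ?_
  have e1 : t ^ e * t ^ (-3 / 4 - 1 : ℝ) = t ^ (e - 1) * t ^ (-3 / 4 : ℝ) := by
    rw [← rpow_add ht, ← rpow_add ht]; ring_nf
  have e2 : ((t ^ e : ℝ) : ℂ) * ((t ^ (-3 / 4 - 1 : ℝ) : ℝ) : ℂ) =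
      ((t ^ (e - 1) : ℝ) : ℂ) * ((t ^ (-3 / 4 : ℝ) : ℝ) : ℂ) := by rw [← ofReal_mul, e1, ofReal_mul]
  simp only [Function.comp, real_smul]
  push_cast
  linear_combination (-3 / 4 * G') * e2

/-- Twice the logarithmic derivative of `outAiry`. -/
def airyP (t : ℝ) : ℂ := 2 * outAiry' t / outAiry t

/-- The derivative of `airyP`. -/
def airyP1 (t : ℝ) : ℂ := -2 * t - airyP t ^ 2 / 2

/-- The second derivative of `airyP`. -/
def airyP2 (t : ℝ) : ℂ := -2 - airyP t * airyP1 t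

theorem hasDerivAt_airyP (t : ℝ) : HasDerivAt airyP (airyP1 t) t := by
  have h0 := outAiry_ne_zero t
  refine (((hasDerivAt_outAiry' t).const_mul 2).div (hasDerivAt_outAiry t) h0).congr_deriv ?_
  simp only [airyP1, airyP]
  field_simp

theorem hasDerivAt_airyP1 (t : ℝ) : HasDerivAt airyP1 (airyP2 t) t := by
  have h1 := (ofRealCLM.hasDerivAt (x := t)).const_mul (-2)
  refine (h1.sub (((hasDerivAt_airyP t).pow 2).div_const 2)).congr_deriv ?_
  simp only [airyP2]
  push_cast; simp
  ring

theorem outAiry_mul_airyP (t : ℝ) : outAiry t * airyP t = 2 * outAiry' t := by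
  rw [airyP]; field_simp [outAiry_ne_zero t]

theorem continuous_outAiry : Continuous outAiry :=
  continuous_iff_continuousAt.mpr fun t => (hasDerivAt_outAiry t).continuousAt

theorem continuous_airyP : Continuous airyP :=
  continuous_iff_continuousAt.mpr fun t => (hasDerivAt_airyP t).continuousAt

theorem continuous_airyP1 : Continuous airyP1 :=
  continuous_iff_continuousAt.mpr fun t => (hasDerivAt_airyP1 t).continuousAt

theorem continuous_airyP2 : Continuous airyP2 := by
  unfold airyP2; exact continuous_const.sub (continuous_airyP.mul continuous_airyP1)

/-- The logarithmic derivative of the amplitude. -/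
def ampL (y : ℝ) : ℂ := airyAmp 1 y / airyAmp 0 y

def ampL1 (y : ℝ) : ℂ := airyAmp 2 y / airyAmp 0 y - ampL y ^ 2

def ampL2 (y : ℝ) : ℂ :=
  airyAmp 3 y / airyAmp 0 y - ampL y * (airyAmp 2 y / airyAmp 0 y) - 2 * ampL y * ampL1 y

theorem hasDerivAt_ampL {y : ℝ} (hy : 0 < y) : HasDerivAt ampL (ampL1 y) y := by
  have h0 := airyAmp_ne_zero hy
  refine ((hasDerivAt_airyAmp 1 hy).div (hasDerivAt_airyAmp 0 hy) h0).congr_deriv ?_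
  simp only [ampL1, ampL]
  field_simp

theorem hasDerivAt_ampL1 {y : ℝ} (hy : 0 < y) : HasDerivAt ampL1 (ampL2 y) y := by
  have h0 := airyAmp_ne_zero hy
  refine (((hasDerivAt_airyAmp 2 hy).div (hasDerivAt_airyAmp 0 hy) h0).sub
    ((hasDerivAt_ampL hy).pow 2)).congr_deriv ?_
  simp only [ampL2, ampL1, ampL]
  norm_num
  generalize airyAmp 0 y = A at *
  field_simp

theorem exists_norm_amp_div_le (k : ℕ) :
    ∃ C, ∀ y, 0 < y → y ≤ 1 → ‖airyAmp k y / airyAmp 0 y‖ ≤ C := by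
  obtain ⟨C, _, hC⟩ := exists_norm_airyAmp_le k
  obtain ⟨c, hc, hc'⟩ := exists_airyAmp_ge
  refine ⟨C / c, fun y hy hy1 => ?_⟩
  rw [norm_div]; gcongr
  · exact hC y hy.le
  · exact hc' y hy hy1

/-- Functions bounded on `(0, 1]`. -/
def BddUnit (f : ℝ → ℂ) : Prop := ∃ C, ∀ y, 0 < y → y ≤ 1 → ‖f y‖ ≤ C

theorem BddUnit.add {f g : ℝ → ℂ} (hf : BddUnit f) (hg : BddUnit g) :
    BddUnit fun y => f y + g y := by
  obtain ⟨A, hA⟩ := hf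
  obtain ⟨B, hB⟩ := hg
  exact ⟨A + B, fun y h h' => (norm_add_le _ _).trans (add_le_add (hA y h h') (hB y h h'))⟩

theorem BddUnit.mul {f g : ℝ → ℂ} (hf : BddUnit f) (hg : BddUnit g) :
    BddUnit fun y => f y * g y := by
  obtain ⟨A, hA⟩ := hf
  obtain ⟨B, hB⟩ := hg
  refine ⟨A * B, fun y h h' => ?_⟩
  rw [norm_mul]
  exact mul_le_mul (hA y h h') (hB y h h') (norm_nonneg _) ((norm_nonneg _).trans (hA y h h'))

theorem BddUnit.const (c : ℂ) : BddUnit fun _ => c := ⟨‖c‖, fun _ _ _ => le_rfl⟩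

theorem BddUnit.id : BddUnit fun y => (y : ℂ) :=
  ⟨1, fun y h h' => by rwa [norm_real, norm_eq_abs, abs_of_pos h]⟩

theorem BddUnit.sub {f g : ℝ → ℂ} (hf : BddUnit f) (hg : BddUnit g) :
    BddUnit fun y => f y - g y := by
  have := hf.add ((BddUnit.const (-1)).mul hg)
  simpa [sub_eq_add_neg] using this

theorem bddUnit_ampL : BddUnit ampL := exists_norm_amp_div_le 1

theorem bddUnit_ampL1 : BddUnit ampL1 := by
  have := BddUnit.sub (exists_norm_amp_div_le 2) (bddUnit_ampL.mul bddUnit_ampL)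
  show BddUnit fun y => airyAmp 2 y / airyAmp 0 y - ampL y ^ 2
  simpa only [sq] using this

theorem bddUnit_ampL2 : BddUnit ampL2 :=
  (BddUnit.sub (exists_norm_amp_div_le 3) (bddUnit_ampL.mul (exists_norm_amp_div_le 2))).sub
    (((BddUnit.const 2).mul bddUnit_ampL).mul bddUnit_ampL1)

/-- The subleading part of `airyP` and of its derivatives. -/
def subP (y : ℝ) : ℂ := -1 / 4 - 3 / 4 * (y * ampL y)

def subP' (y : ℝ) : ℂ := -3 / 4 * (ampL y + y * ampL1 y)

def subP'' (y : ℝ) : ℂ := -3 / 4 * (2 * ampL1 y + y * ampL2 y)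

theorem hasDerivAt_subP {y : ℝ} (hy : 0 < y) : HasDerivAt subP (subP' y) y := by
  refine ((((ofRealCLM.hasDerivAt (x := y)).mul (hasDerivAt_ampL hy)).const_mul
    (3 / 4)).const_sub (-1 / 4)).congr_deriv ?_
  simp [subP']; ring

theorem hasDerivAt_subP' {y : ℝ} (hy : 0 < y) : HasDerivAt subP' (subP'' y) y := by
  refine (((hasDerivAt_ampL hy).add ((ofRealCLM.hasDerivAt (x := y)).mul
    (hasDerivAt_ampL1 hy))).const_mul (-3 / 4)).congr_deriv ?_
  simp [subP'']; ring

def subP1 (y : ℝ) : ℂ := -subP y - 3 / 4 * (y * subP' y)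

def subP2 (y : ℝ) : ℂ := -2 * subP1 y - 3 / 4 * (y * (-subP' y - 3 / 4 * (subP' y + y * subP'' y)))

theorem hasDerivAt_subP1 {y : ℝ} (hy : 0 < y) :
    HasDerivAt subP1 (-subP' y - 3 / 4 * (subP' y + y * subP'' y)) y := by
  refine ((hasDerivAt_subP hy).neg.sub (((ofRealCLM.hasDerivAt (x := y)).mul
    (hasDerivAt_subP' hy)).const_mul (3 / 4))).congr_deriv ?_
  simp

theorem bddUnit_subP : BddUnit subP :=
  (BddUnit.const _).sub ((BddUnit.const _).mul (BddUnit.id.mul bddUnit_ampL))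

theorem bddUnit_subP' : BddUnit subP' :=
  (BddUnit.const _).mul (bddUnit_ampL.add (BddUnit.id.mul bddUnit_ampL1))

theorem bddUnit_subP'' : BddUnit subP'' :=
  (BddUnit.const _).mul (((BddUnit.const _).mul bddUnit_ampL1).add (BddUnit.id.mul bddUnit_ampL2))

theorem bddUnit_subP1 : BddUnit subP1 := by
  have := ((BddUnit.const (-1)).mul bddUnit_subP).sub
    ((BddUnit.const (3 / 4)).mul (BddUnit.id.mul bddUnit_subP'))
  show BddUnit fun y => -subP y - 3 / 4 * (y * subP' y)
  simpa only [neg_one_mul] using this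

theorem bddUnit_subP2 : BddUnit subP2 := by
  have := ((BddUnit.const (-2)).mul bddUnit_subP1).sub ((BddUnit.const (3 / 4)).mul
    (BddUnit.id.mul ((((BddUnit.const (-1)).mul bddUnit_subP')).sub ((BddUnit.const (3 / 4)).mul
      (bddUnit_subP'.add (BddUnit.id.mul bddUnit_subP''))))))
  show BddUnit fun y =>
    -2 * subP1 y - 3 / 4 * (y * (-subP' y - 3 / 4 * (subP' y + y * subP'' y)))
  simpa only [neg_one_mul] using this

theorem airyP_eq {t : ℝ} (ht : 0 < t) : airyP t = 2 * I * (t ^ (1 / 2 : ℝ) : ℝ) +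
    2 * (((t ^ (-1 : ℝ) : ℝ) : ℂ) * subP (t ^ (-3 / 4 : ℝ))) := by
  have hy : 0 < t ^ (-3 / 4 : ℝ) := by positivity
  have h1 : HasDerivAt (fun t : ℝ => I * ((2 / 3 * t ^ (3 / 2 : ℝ) : ℝ) : ℂ))
      (I * (t ^ (1 / 2 : ℝ) : ℝ)) t := by
    refine (((hasDerivAt_rpow_const (Or.inl ht.ne')).const_mul
      (2 / 3)).ofReal_comp.const_mul I).congr_deriv ?_
    congr 2; ring_nf
  have h2 := hasDerivAt_rpow_mul_comp (e := -1 / 4) ht (hasDerivAt_airyAmp 0 hy)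
  have h3 := (h1.cexp.mul h2).const_mul (-I / π)
  have h4 := (hasDerivAt_outAiry t).congr_of_eventuallyEq (f₁ := fun t : ℝ =>
    -I / π * (cexp (I * (2 / 3 * t ^ (3 / 2 : ℝ) : ℝ)) *
      ((t ^ (-1 / 4 : ℝ) : ℝ) * airyAmp 0 (t ^ (-3 / 4 : ℝ)))))
    (by filter_upwards [eventually_gt_nhds ht] with s hs; exact (outAiry_eq_amp hs).symm)
  have h5 := h4.unique h3
  have hA := airyAmp_ne_zero hy
  have hb : ((t ^ (-1 / 4 : ℝ) : ℝ) : ℂ) ≠ 0 := by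
    exact_mod_cast (by positivity : t ^ (-1 / 4 : ℝ) ≠ 0)
  have hpi : (π : ℂ) ≠ 0 := by exact_mod_cast pi_pos.ne'
  have e1 : ((t ^ (-1 / 4 - 1 : ℝ) : ℝ) : ℂ) = (t ^ (-1 / 4 : ℝ) : ℝ) * (t ^ (-1 : ℝ) : ℝ) := by
    rw [← ofReal_mul, ← rpow_add ht]; norm_num
  have hE := Complex.exp_ne_zero (I * (2 / 3 * t ^ (3 / 2 : ℝ) : ℝ))
  have hI := Complex.I_ne_zero
  rw [airyP, h5, outAiry_eq_amp ht, e1, subP, ampL]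
  generalize cexp (I * (2 / 3 * t ^ (3 / 2 : ℝ) : ℝ)) = E at *
  generalize ((t ^ (-1 / 4 : ℝ) : ℝ) : ℂ) = B at *
  generalize ((t ^ (-1 : ℝ) : ℝ) : ℂ) = T at *
  generalize airyAmp 0 (t ^ (-3 / 4 : ℝ)) = A at *
  rw [show ((-1 / 4 : ℝ) : ℂ) = -1 / 4 by push_cast; ring]; field_simp

theorem airyP1_eq {t : ℝ} (ht : 0 < t) : airyP1 t = I * (t ^ (-1 / 2 : ℝ) : ℝ) +
    2 * (((t ^ (-2 : ℝ) : ℝ) : ℂ) * subP1 (t ^ (-3 / 4 : ℝ))) := by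
  have hy : 0 < t ^ (-3 / 4 : ℝ) := by positivity
  have h1 : HasDerivAt (fun t : ℝ => 2 * I * ((t ^ (1 / 2 : ℝ) : ℝ) : ℂ))
      (I * (t ^ (-1 / 2 : ℝ) : ℝ)) t := by
    refine ((hasDerivAt_rpow_const (Or.inl ht.ne')).ofReal_comp.const_mul (2 * I)).congr_deriv ?_
    rw [show (1 / 2 - 1 : ℝ) = -1 / 2 by norm_num]; push_cast; ring
  have h2 := (hasDerivAt_rpow_mul_comp (e := -1) ht (hasDerivAt_subP hy)).const_mul 2
  have h4 := (hasDerivAt_airyP t).congr_of_eventuallyEq (f₁ := fun t : ℝ =>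
    2 * I * (t ^ (1 / 2 : ℝ) : ℝ) +
      2 * (((t ^ (-1 : ℝ) : ℝ) : ℂ) * subP (t ^ (-3 / 4 : ℝ))))
    (by filter_upwards [eventually_gt_nhds ht] with s hs; exact (airyP_eq hs).symm)
  rw [h4.unique (h1.add h2), subP1, show (-1 - 1 : ℝ) = -2 by norm_num]; push_cast
  ring

theorem airyP2_eq {t : ℝ} (ht : 0 < t) : airyP2 t = -I / 2 * (t ^ (-3 / 2 : ℝ) : ℝ) +
    2 * (((t ^ (-3 : ℝ) : ℝ) : ℂ) * subP2 (t ^ (-3 / 4 : ℝ))) := by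
  have hy : 0 < t ^ (-3 / 4 : ℝ) := by positivity
  have h1 : HasDerivAt (fun t : ℝ => I * ((t ^ (-1 / 2 : ℝ) : ℝ) : ℂ))
      (-I / 2 * (t ^ (-3 / 2 : ℝ) : ℝ)) t := by
    refine ((hasDerivAt_rpow_const (Or.inl ht.ne')).ofReal_comp.const_mul I).congr_deriv ?_
    rw [show (-1 / 2 - 1 : ℝ) = -3 / 2 by norm_num]; push_cast; ring
  have h2 := (hasDerivAt_rpow_mul_comp (e := -2) ht (hasDerivAt_subP1 hy)).const_mul 2
  have h4 := (hasDerivAt_airyP1 t).congr_of_eventuallyEq (f₁ := fun t : ℝ =>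
    I * (t ^ (-1 / 2 : ℝ) : ℝ) +
      2 * (((t ^ (-2 : ℝ) : ℝ) : ℂ) * subP1 (t ^ (-3 / 4 : ℝ))))
    (by filter_upwards [eventually_gt_nhds ht] with s hs; exact (airyP1_eq hs).symm)
  rw [h4.unique (h1.add h2), subP2, show (-2 - 1 : ℝ) = -3 by norm_num]; push_cast
  ring

/-- A continuous function bounded near infinity is bounded on `[-1, ∞)`. -/
theorem exists_bound_of_tail {f : ℝ → ℝ} (hf : ContinuousOn f (Ici (-1)))
    (h : ∃ C, ∀ t, 1 ≤ t → f t ≤ C) : ∃ C, 0 < C ∧ ∀ t, -1 ≤ t → f t ≤ C := by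
  obtain ⟨C, hC⟩ := h
  obtain ⟨D, hD⟩ := (isCompact_Icc (a := (-1 : ℝ)) (b := 1)).bddAbove_image
    (hf.mono Icc_subset_Ici_self)
  refine ⟨max 1 (max C D), by positivity, fun t ht => ?_⟩
  rcases le_total 1 t with h1 | h1
  · exact (hC t h1).trans ((le_max_left _ _).trans (le_max_right _ _))
  · exact (hD ⟨t, ⟨ht, h1⟩, rfl⟩).trans ((le_max_right _ _).trans (le_max_right _ _))

/-- The weight `(t + 2)^{1/2}`. -/
def wt (t : ℝ) : ℝ := sqrt (t + 2)

theorem one_le_wt {t : ℝ} (ht : -1 ≤ t) : 1 ≤ wt t := by rw [wt, Real.one_le_sqrt]; linarith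

theorem wt_pos {t : ℝ} (ht : -1 ≤ t) : 0 < wt t := one_pos.trans_le (one_le_wt ht)

theorem wt_sq {t : ℝ} (ht : -1 ≤ t) : wt t ^ 2 = t + 2 := sq_sqrt (by linarith)

theorem continuous_wt : Continuous wt := by unfold wt; fun_prop

theorem wt_le {t : ℝ} (ht : 1 ≤ t) : wt t ≤ 2 * t ^ (1 / 2 : ℝ) := by
  rw [wt, ← sqrt_eq_rpow]
  apply Real.sqrt_le_iff.mpr
  refine ⟨by positivity, ?_⟩
  rw [mul_pow, sq_sqrt (by linarith)]; linarith

theorem le_wt (t : ℝ) : t ^ (1 / 2 : ℝ) ≤ wt t := by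
  rw [wt, ← sqrt_eq_rpow]; exact Real.sqrt_le_sqrt (by linarith)

theorem rpow_neg_three_fourths_le_one {t : ℝ} (ht : 1 ≤ t) : t ^ (-3 / 4 : ℝ) ≤ 1 :=
  Real.rpow_le_one_of_one_le_of_nonpos ht (by norm_num)

theorem norm_outAiry_sq {t : ℝ} (ht : 0 < t) : ‖outAiry t‖ ^ 2 * t ^ (1 / 2 : ℝ) =
    (1 / π) ^ 2 * ‖airyAmp 0 (t ^ (-3 / 4 : ℝ))‖ ^ 2 := by
  have h1 : ‖cexp (I * (2 / 3 * t ^ (3 / 2 : ℝ) : ℝ))‖ = 1 := by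
    rw [mul_comm]; exact Complex.norm_exp_ofReal_mul_I _
  have h2 : (t ^ (-1 / 4 : ℝ)) ^ 2 * t ^ (1 / 2 : ℝ) = 1 := by
    rw [← rpow_natCast, ← rpow_mul ht.le, ← rpow_add ht]; norm_num
  rw [outAiry_eq_amp ht, norm_mul, norm_mul, norm_mul, h1, norm_div, norm_neg, Complex.norm_I,
    norm_real, norm_real, norm_eq_abs, norm_eq_abs,
    abs_of_pos pi_pos, abs_of_pos (by positivity : 0 < t ^ (-1 / 4 : ℝ))]
  linear_combination ((1 / π) ^ 2 * ‖airyAmp 0 (t ^ (-3 / 4 : ℝ))‖ ^ 2) * h2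

theorem exists_outAiry_le : ∃ C, 0 < C ∧ ∀ t, -1 ≤ t → ‖outAiry t‖ ^ 2 * wt t ≤ C := by
  refine exists_bound_of_tail (by
    have := continuous_outAiry; have := continuous_wt; fun_prop) ?_
  obtain ⟨C, hC0, hC⟩ := exists_norm_airyAmp_le 0
  refine ⟨2 * ((1 / π) ^ 2 * C ^ 2), fun t ht => ?_⟩
  have ht0 : 0 < t := by linarith
  calc ‖outAiry t‖ ^ 2 * wt t ≤ ‖outAiry t‖ ^ 2 * (2 * t ^ (1 / 2 : ℝ)) := by
        gcongr; exact wt_le ht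
    _ = 2 * (‖outAiry t‖ ^ 2 * t ^ (1 / 2 : ℝ)) := by ring
    _ ≤ _ := by
      rw [norm_outAiry_sq ht0]; gcongr
      exact hC _ (by positivity)

theorem exists_outAiry_ge : ∃ C, 0 < C ∧ ∀ t, -1 ≤ t → 1 ≤ C * (‖outAiry t‖ ^ 2 * wt t) := by
  have hpos : ∀ t, -1 ≤ t → 0 < ‖outAiry t‖ ^ 2 * wt t := fun t ht =>
    mul_pos (pow_pos (norm_pos_iff.mpr (outAiry_ne_zero t)) 2) (wt_pos ht)
  have := exists_bound_of_tail (f := fun t => (‖outAiry t‖ ^ 2 * wt t)⁻¹) (by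
    refine ContinuousOn.inv₀ ?_ (fun t ht => (hpos t ht).ne')
    have := continuous_outAiry; have := continuous_wt; fun_prop) ?_
  · obtain ⟨C, hC, h⟩ := this
    refine ⟨C, hC, fun t ht => ?_⟩
    have := h t ht
    rwa [inv_le_iff_one_le_mul₀ (hpos t ht)] at this
  · obtain ⟨c, hc, hc'⟩ := exists_airyAmp_ge
    refine ⟨((1 / π) ^ 2 * c ^ 2)⁻¹, fun t ht => ?_⟩
    have ht0 : 0 < t := by linarith
    have hpi := pi_pos
    refine inv_anti₀ (by positivity) ?_
    calc (1 / π) ^ 2 * c ^ 2 ≤ (1 / π) ^ 2 * ‖airyAmp 0 (t ^ (-3 / 4 : ℝ))‖ ^ 2 := by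
          gcongr; exact hc' _ (by positivity) (rpow_neg_three_fourths_le_one ht)
      _ = ‖outAiry t‖ ^ 2 * t ^ (1 / 2 : ℝ) := (norm_outAiry_sq ht0).symm
      _ ≤ _ := mul_le_mul_of_nonneg_left (le_wt t) (by positivity)

theorem norm_airyP_ge (t : ℝ) : ‖airyW‖ ≤ ‖airyP t‖ * ‖outAiry t‖ ^ 2 := by
  have h := outAiry_wronskian t
  have h1 := outAiry_mul_airyP t
  have h2 : ‖outAiry' t‖ = ‖outAiry t‖ * ‖airyP t‖ / 2 := by rw [← norm_mul, h1, norm_mul]; simp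
  rw [← h]
  refine (norm_sub_le _ _).trans ?_
  rw [norm_mul, norm_mul, RCLike.norm_conj, RCLike.norm_conj, h2]
  apply le_of_eq; ring

theorem exists_airyP_ge : ∃ C, 0 < C ∧ ∀ t, -1 ≤ t → wt t ≤ C * ‖airyP t‖ := by
  obtain ⟨C, hC, h⟩ := exists_outAiry_le
  have hW : 0 < ‖airyW‖ := norm_pos_iff.mpr airyW_ne_zero
  refine ⟨C / ‖airyW‖, by positivity, fun t ht => ?_⟩
  rw [div_mul_eq_mul_div, le_div_iff₀ hW]
  calc wt t * ‖airyW‖ ≤ wt t * (‖airyP t‖ * ‖outAiry t‖ ^ 2) := by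
        gcongr
        · exact (wt_pos ht).le
        · exact norm_airyP_ge t
    _ = ‖airyP t‖ * (‖outAiry t‖ ^ 2 * wt t) := by ring
    _ ≤ ‖airyP t‖ * C := by gcongr; exact h t ht
    _ = _ := mul_comm _ _

theorem exists_norm_tail_le {f G : ℝ → ℂ} {c : ℂ} {e e' : ℝ} (hG : BddUnit G) (he : e' ≤ e)
    (hf : ∀ t, 0 < t → f t = c * (t ^ e : ℝ) + 2 * (((t ^ e' : ℝ) : ℂ) * G (t ^ (-3 / 4 : ℝ)))) :
    ∃ C, 0 ≤ C ∧ ∀ t, 1 ≤ t → ‖f t‖ ≤ C * t ^ e := by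
  obtain ⟨C, hC⟩ := hG
  have hC0 : 0 ≤ C := (norm_nonneg _).trans (hC 1 one_pos le_rfl)
  refine ⟨‖c‖ + 2 * C, by positivity, fun t ht => ?_⟩
  have ht0 : 0 < t := by linarith
  have h1 := hC (t ^ (-3 / 4 : ℝ)) (by positivity) (rpow_neg_three_fourths_le_one ht)
  have h2 : t ^ e' ≤ t ^ e := Real.rpow_le_rpow_of_exponent_le ht he
  rw [hf t ht0]
  refine (norm_add_le _ _).trans ?_
  simp only [norm_mul, norm_real, norm_eq_abs, abs_of_pos (rpow_pos_of_pos ht0 _)]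
  have h3 : ‖(2 : ℂ)‖ = 2 := by simp
  rw [h3, add_mul, mul_assoc 2 C, mul_comm C]; gcongr

theorem exists_airyP_le : ∃ C, 0 < C ∧ ∀ t, -1 ≤ t → ‖airyP t‖ ≤ C * wt t := by
  have := exists_bound_of_tail (f := fun t => ‖airyP t‖ / wt t) ?_ ?_
  · obtain ⟨C, hC, h⟩ := this
    exact ⟨C, hC, fun t ht => (div_le_iff₀ (wt_pos ht)).mp (h t ht)⟩
  · refine ContinuousOn.div continuous_airyP.norm.continuousOn continuous_wt.continuousOn
      (fun t ht => (wt_pos ht).ne')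
  · obtain ⟨C, hC, h⟩ := exists_norm_tail_le bddUnit_subP (by norm_num) (fun t ht => airyP_eq ht)
    refine ⟨C, fun t ht => ?_⟩
    rw [div_le_iff₀ (wt_pos (by linarith))]; exact (h t ht).trans (by gcongr; exact le_wt t)

theorem exists_airyP1_le : ∃ C, 0 < C ∧ ∀ t, -1 ≤ t → ‖airyP1 t‖ * wt t ≤ C := by
  refine exists_bound_of_tail (by
    have := continuous_airyP1; have := continuous_wt; fun_prop) ?_
  obtain ⟨C, hC, h⟩ := exists_norm_tail_le bddUnit_subP1 (by norm_num) (fun t ht => airyP1_eq ht)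
  refine ⟨C * 2, fun t ht => ?_⟩
  have ht0 : 0 < t := by linarith
  have h1 : t ^ (-1 / 2 : ℝ) * t ^ (1 / 2 : ℝ) = 1 := by rw [← rpow_add ht0]; norm_num
  have := (wt_pos (t := t) (by linarith)).le
  calc ‖airyP1 t‖ * wt t ≤ (C * t ^ (-1 / 2 : ℝ)) * (2 * t ^ (1 / 2 : ℝ)) := by
        gcongr
        · exact h t ht
        · exact wt_le ht
    _ = C * 2 := by linear_combination (C * 2) * h1

theorem exists_airyP2_le : ∃ C, 0 < C ∧ ∀ t, -1 ≤ t → ‖airyP2 t‖ * wt t ^ 3 ≤ C := by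
  refine exists_bound_of_tail (by
    have := continuous_airyP2; have := continuous_wt; fun_prop) ?_
  obtain ⟨C, hC, h⟩ := exists_norm_tail_le bddUnit_subP2 (by norm_num) (fun t ht => airyP2_eq ht)
  refine ⟨C * 8, fun t ht => ?_⟩
  have ht0 : 0 < t := by linarith
  have h1 : t ^ (-3 / 2 : ℝ) * (t ^ (1 / 2 : ℝ)) ^ 3 = 1 := by
    rw [← rpow_natCast, ← rpow_mul ht0.le, ← rpow_add ht0]; norm_num
  have := wt_pos (t := t) (by linarith)
  calc ‖airyP2 t‖ * wt t ^ 3 ≤ (C * t ^ (-3 / 2 : ℝ)) * (2 * t ^ (1 / 2 : ℝ)) ^ 3 := by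
        gcongr
        · exact h t ht
        · exact wt_le ht
    _ = C * 8 := by linear_combination (C * 8) * h1

theorem contDiff_outAiry_pair : ContDiff ℝ ∞ outAiry ∧ ContDiff ℝ ∞ outAiry' := by
  suffices h : ∀ n : ℕ, ContDiff ℝ n outAiry ∧ ContDiff ℝ n outAiry' from
    ⟨contDiff_infty.mpr fun n => (h n).1, contDiff_infty.mpr fun n => (h n).2⟩
  have d1 : deriv outAiry = outAiry' := funext fun t => (hasDerivAt_outAiry t).deriv
  have d2 : deriv outAiry' = fun t : ℝ => -((t : ℂ) * outAiry t) :=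
    funext fun t => (hasDerivAt_outAiry' t).deriv
  intro n
  induction n with
  | zero =>
    exact ⟨contDiff_zero.mpr continuous_outAiry, contDiff_zero.mpr
      (continuous_iff_continuousAt.mpr fun t => (hasDerivAt_outAiry' t).continuousAt)⟩
  | succ n ih =>
    rw [Nat.cast_succ, contDiff_succ_iff_deriv, contDiff_succ_iff_deriv, d1, d2]
    exact ⟨⟨fun t => (hasDerivAt_outAiry t).differentiableAt, by simp, ih.2⟩,
      ⟨fun t => (hasDerivAt_outAiry' t).differentiableAt, by simp,
        (ofRealCLM.contDiff.mul ih.1).neg⟩⟩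

theorem contDiff_airyP : ContDiff ℝ ∞ airyP :=
  (contDiff_const.mul contDiff_outAiry_pair.2).mul (contDiff_outAiry_pair.1.inv outAiry_ne_zero)

/-! ### The Liouville-Green variable -/

/-- The integrand of `lgMoment`. -/
def lgIntegrand (j n : ℕ) (x w : ℝ) : ℝ := w ^ (2 * j) * (1 + w ^ 2 * (x - 1)) ^ (-1 / 2 - n : ℝ)

/-- Smooth integrals in terms of which the Liouville-Green variable is expressed. -/
def lgMoment (j n : ℕ) (x : ℝ) : ℝ := ∫ w in (0 : ℝ)..1, lgIntegrand j n x w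

theorem lg_base_ge {x w m : ℝ} (hm : m ≤ x) (hm1 : m ≤ 1) (hw : w ∈ Icc (0 : ℝ) 1) :
    m ≤ 1 + w ^ 2 * (x - 1) := by
  have h1 : w ^ 2 ≤ 1 := by nlinarith [hw.1, hw.2]
  nlinarith [sq_nonneg w]

theorem lg_base_pos {x w : ℝ} (hx : 0 < x) (hw : w ∈ Icc (0 : ℝ) 1) : 0 < 1 + w ^ 2 * (x - 1) :=
  (lt_min hx one_pos).trans_le (lg_base_ge (min_le_left _ _) (min_le_right _ _) hw)

theorem continuousOn_lgIntegrand (j n : ℕ) {x : ℝ} (hx : 0 < x) :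
    ContinuousOn (lgIntegrand j n x) (Icc 0 1) := by
  unfold lgIntegrand
  refine ContinuousOn.mul (by fun_prop) (ContinuousOn.rpow_const (by fun_prop)
    fun w hw => Or.inl (lg_base_pos hx hw).ne')

theorem intervalIntegrable_lgIntegrand (j n : ℕ) {x : ℝ} (hx : 0 < x) :
    IntervalIntegrable (lgIntegrand j n x) volume 0 1 :=
  ContinuousOn.intervalIntegrable (by
    rw [uIcc_of_le zero_le_one]; exact continuousOn_lgIntegrand j n hx)

theorem hasDerivAt_lgMoment (j n : ℕ) {x : ℝ} (hx : 0 < x) :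
    HasDerivAt (lgMoment j n) ((-1 / 2 - n) * lgMoment (j + 1) (n + 1) x) x := by
  set m := min (x / 2) 1
  have hm : 0 < m := lt_min (by linarith) one_pos
  have hIoc : Set.uIoc (0 : ℝ) 1 = Ioc 0 1 := uIoc_of_le zero_le_one
  have key := (intervalIntegral.hasDerivAt_integral_of_dominated_loc_of_deriv_le
    (F := lgIntegrand j n) (F' := fun x w => (-1 / 2 - n) * lgIntegrand (j + 1) (n + 1) x w)
    (μ := volume) (a := 0) (b := 1) (x₀ := x) (s := Ioi (x / 2)) (Ioi_mem_nhds (by linarith))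
    (bound := fun _ => |(-1 / 2 - n : ℝ)| * m ^ (-1 / 2 - (n + 1 : ℕ) : ℝ)) ?_
    (intervalIntegrable_lgIntegrand j n hx) ?_ ?_ (by simp) ?_).2
  · rwa [intervalIntegral.integral_const_mul] at key
  · filter_upwards [Ioi_mem_nhds hx] with z hz
    exact (intervalIntegrable_lgIntegrand j n hz).def'.aestronglyMeasurable
  · exact ((intervalIntegrable_lgIntegrand (j + 1) (n + 1) hx).const_mul
      _).def'.aestronglyMeasurable
  · refine Eventually.of_forall fun w hw z hz => ?_
    rw [hIoc] at hw
    have hz : x / 2 < z := hz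
    have hw' : w ∈ Icc (0 : ℝ) 1 := ⟨hw.1.le, hw.2⟩
    have hb := lg_base_ge ((min_le_left (x / 2) 1).trans hz.le) (min_le_right _ _) hw'
    rw [norm_mul, norm_eq_abs, norm_eq_abs, lgIntegrand, abs_mul]; gcongr
    rw [abs_of_nonneg (pow_nonneg hw'.1 _), abs_of_nonneg (Real.rpow_nonneg (hm.le.trans hb) _)]
    calc _ ≤ 1 * (1 + w ^ 2 * (z - 1)) ^ (-1 / 2 - (n + 1 : ℕ) : ℝ) := by
          gcongr
          · exact Real.rpow_nonneg (hm.le.trans hb) _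
          · exact pow_le_one₀ hw'.1 hw'.2
      _ ≤ _ := by
        rw [one_mul]
        refine Real.rpow_le_rpow_of_nonpos hm hb ?_
        push_cast
        have : (0 : ℝ) ≤ n := by positivity
        linarith
  · refine Eventually.of_forall fun w hw z hz => ?_
    rw [hIoc] at hw
    have hz : x / 2 < z := hz
    have hb := lg_base_pos (by linarith : 0 < z) ⟨hw.1.le, hw.2⟩
    have h1 : HasDerivAt (fun z : ℝ => 1 + w ^ 2 * (z - 1)) (w ^ 2) z := by
      simpa using (((hasDerivAt_id z).sub_const 1).const_mul (w ^ 2)).const_add 1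
    refine ((h1.rpow_const (p := -1 / 2 - n) (Or.inl hb.ne')).const_mul
      (w ^ (2 * j))).congr_deriv ?_
    simp only [lgIntegrand]
    rw [show (-1 / 2 - n - 1 : ℝ) = -1 / 2 - (n + 1 : ℕ) by push_cast; ring]; ring

theorem contDiffOn_lgMoment (j n : ℕ) : ContDiffOn ℝ ∞ (lgMoment j n) (Ioi 0) := by
  rw [contDiffOn_infty]
  intro N
  induction N generalizing j n with
  | zero =>
    exact contDiffOn_zero.mpr fun x hx =>
      (hasDerivAt_lgMoment j n hx).continuousAt.continuousWithinAt
  | succ N ih =>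
    rw [Nat.cast_succ, contDiffOn_succ_iff_deriv_of_isOpen isOpen_Ioi]
    refine ⟨fun x hx => (hasDerivAt_lgMoment j n hx).differentiableAt.differentiableWithinAt,
      by simp, (contDiffOn_const.mul (ih (j + 1) (n + 1))).congr
        fun x hx => (hasDerivAt_lgMoment j n hx).deriv⟩

/-- The smooth positive function `k` with `ζ = (x - 1) k^{2/3}`. -/
def lgK (x : ℝ) : ℝ := 3 * lgMoment 1 0 x

/-- The derivative of `lgK`. -/
def lgK' (x : ℝ) : ℝ := -3 / 2 * lgMoment 2 1 x

theorem hasDerivAt_lgK {x : ℝ} (hx : 0 < x) : HasDerivAt lgK (lgK' x) x := by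
  refine ((hasDerivAt_lgMoment 1 0 hx).const_mul 3).congr_deriv ?_
  simp only [lgK']; push_cast; ring

theorem contDiffOn_lgK : ContDiffOn ℝ ∞ lgK (Ioi 0) := contDiffOn_const.mul (contDiffOn_lgMoment 1 0)

theorem lgK_pos {x : ℝ} (hx : 0 < x) : 0 < lgK x := by
  refine mul_pos (by norm_num) ?_
  refine intervalIntegral.intervalIntegral_pos_of_pos_on (intervalIntegrable_lgIntegrand 1 0 hx)
    (fun w hw => ?_) one_pos
  have := lg_base_pos hx (Ioo_subset_Icc_self hw)
  have h0 := hw.1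
  unfold lgIntegrand
  positivity

theorem lgK_ode {x : ℝ} (hx : 0 < x) : 2 / 3 * (x - 1) * lgK' x + lgK x = x ^ (-1 / 2 : ℝ) := by
  have h := intervalIntegral.integral_eq_sub_of_hasDerivAt_of_le (a := 0) (b := 1)
    (f := fun w : ℝ => w ^ 3 * (1 + w ^ 2 * (x - 1)) ^ (-1 / 2 : ℝ))
    (f' := fun w => 3 * lgIntegrand 1 0 x w - (x - 1) * lgIntegrand 2 1 x w) zero_le_one ?_ ?_ ?_
  · rw [intervalIntegral.integral_sub ((intervalIntegrable_lgIntegrand 1 0 hx).const_mul _)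
      ((intervalIntegrable_lgIntegrand 2 1 hx).const_mul _), intervalIntegral.integral_const_mul,
      intervalIntegral.integral_const_mul] at h
    simp only [one_pow, one_mul, add_sub_cancel, ne_eq, OfNat.ofNat_ne_zero, not_false_eq_true,
      zero_pow, zero_mul, sub_zero] at h
    rw [← h, lgK', lgK, lgMoment, lgMoment]; ring
  · refine ContinuousOn.mul (by fun_prop) (ContinuousOn.rpow_const (by fun_prop)
      fun w hw => Or.inl (lg_base_pos hx hw).ne')
  · intro w hw
    have hb := lg_base_pos hx (Ioo_subset_Icc_self hw)
    have h1 : HasDerivAt (fun w : ℝ => 1 + w ^ 2 * (x - 1)) (2 * w * (x - 1)) w := by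
      simpa using ((hasDerivAt_pow 2 w).mul_const (x - 1)).const_add 1
    refine ((hasDerivAt_pow 3 w).mul (h1.rpow_const (p := -1 / 2) (Or.inl hb.ne'))).congr_deriv ?_
    simp only [lgIntegrand]
    rw [show (-1 / 2 - 1 : ℝ) = -1 / 2 - (1 : ℕ) by norm_num,
      show (-1 / 2 - (0 : ℕ) : ℝ) = -1 / 2 by norm_num]
    push_cast; ring
  · exact ((intervalIntegrable_lgIntegrand 1 0 hx).const_mul _).sub
      ((intervalIntegrable_lgIntegrand 2 1 hx).const_mul _)

theorem lgK_one : lgK 1 = 1 := by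
  have := lgK_ode one_pos
  simpa using this

theorem hasDerivAt_action_right {x : ℝ} (hx : 1 < x) :
    HasDerivAt (fun x : ℝ => 2 / 3 * ((x - 1) ^ (3 / 2 : ℝ) * lgK x)) (sqrt |Q x|) x := by
  have hx0 : 0 < x := by linarith
  have h1 : HasDerivAt (fun x : ℝ => (x - 1) ^ (3 / 2 : ℝ)) (3 / 2 * (x - 1) ^ (1 / 2 : ℝ)) x := by
    refine (((hasDerivAt_id x).sub_const 1).rpow_const (p := 3 / 2) (Or.inr (by norm_num))).congr_deriv
      ?_
    norm_num
  refine ((h1.mul (hasDerivAt_lgK hx0)).const_mul (2 / 3)).congr_deriv ?_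
  have e1 : (x - 1) ^ (3 / 2 : ℝ) = (x - 1) ^ (1 / 2 : ℝ) * (x - 1) := by
    rw [← rpow_add_one (by linarith)]; norm_num
  have e2 : |Q x| = (x - 1) * x⁻¹ := by
    rw [Q, abs_of_neg (by have := inv_lt_one_of_one_lt₀ hx; linarith)]; field_simp; ring
  have e3 : sqrt |Q x| = (x - 1) ^ (1 / 2 : ℝ) * x ^ (-1 / 2 : ℝ) := by
    rw [e2, sqrt_eq_rpow, Real.mul_rpow (by linarith) (by positivity), ← rpow_neg_one,
      ← rpow_mul hx0.le]
    norm_num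
  rw [e3, e1, ← lgK_ode hx0]; ring

theorem hasDerivAt_action_left {x : ℝ} (hx0 : 0 < x) (hx : x < 1) :
    HasDerivAt (fun x : ℝ => -(2 / 3 * ((1 - x) ^ (3 / 2 : ℝ) * lgK x))) (sqrt |Q x|) x := by
  have h1 : HasDerivAt (fun x : ℝ => (1 - x) ^ (3 / 2 : ℝ)) (-(3 / 2 * (1 - x) ^ (1 / 2 : ℝ))) x := by
    refine (((hasDerivAt_id x).const_sub 1).rpow_const (p := 3 / 2) (Or.inr (by norm_num))).congr_deriv
      ?_
    norm_num
  refine ((h1.mul (hasDerivAt_lgK hx0)).const_mul (2 / 3)).neg.congr_deriv ?_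
  have e1 : (1 - x) ^ (3 / 2 : ℝ) = (1 - x) ^ (1 / 2 : ℝ) * (1 - x) := by
    rw [← rpow_add_one (by linarith)]; norm_num
  have e2 : |Q x| = (1 - x) * x⁻¹ := by
    rw [Q, abs_of_pos (by have := one_lt_inv_iff₀.mpr ⟨hx0, hx⟩; linarith)]; field_simp
  have e3 : sqrt |Q x| = (1 - x) ^ (1 / 2 : ℝ) * x ^ (-1 / 2 : ℝ) := by
    rw [e2, sqrt_eq_rpow, Real.mul_rpow (by linarith) (by positivity), ← rpow_neg_one,
      ← rpow_mul hx0.le]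
    norm_num
  rw [e3, e1, ← lgK_ode hx0]; ring

theorem continuousOn_sqrt_Q {a b : ℝ} (ha : 0 < a) :
    ContinuousOn (fun u => sqrt |Q u|) (Icc a b) := by
  unfold Q
  refine (ContinuousOn.abs ?_).sqrt
  exact (ContinuousOn.inv₀ continuousOn_id fun u hu => by
    have : a ≤ u := hu.1
    exact (ha.trans_le this).ne').sub continuousOn_const

theorem continuousOn_lgK : ContinuousOn lgK (Ioi 0) := contDiffOn_lgK.continuousOn

theorem integral_sqrt_Q_right {x : ℝ} (hx : 1 ≤ x) :
    ∫ u in (1 : ℝ)..x, sqrt |Q u| = 2 / 3 * ((x - 1) ^ (3 / 2 : ℝ) * lgK x) := by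
  rw [intervalIntegral.integral_eq_sub_of_hasDerivAt_of_le hx
    (f := fun x : ℝ => 2 / 3 * ((x - 1) ^ (3 / 2 : ℝ) * lgK x)) ?_
    (fun u hu => hasDerivAt_action_right hu.1) ?_]
  · norm_num
  · refine ContinuousOn.mul continuousOn_const (ContinuousOn.mul (ContinuousOn.rpow_const
      (by fun_prop) fun _ _ => Or.inr (by norm_num)) (continuousOn_lgK.mono fun u hu => ?_))
    exact (by linarith [hu.1] : (0 : ℝ) < u)
  · apply ContinuousOn.intervalIntegrable
    rw [uIcc_of_le hx]; exact continuousOn_sqrt_Q one_pos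

theorem integral_sqrt_Q_left {x : ℝ} (hx0 : 0 < x) (hx : x ≤ 1) :
    ∫ u in (1 : ℝ)..x, sqrt |Q u| = -(2 / 3 * ((1 - x) ^ (3 / 2 : ℝ) * lgK x)) := by
  rw [intervalIntegral.integral_symm, intervalIntegral.integral_eq_sub_of_hasDerivAt_of_le hx
    (f := fun x : ℝ => -(2 / 3 * ((1 - x) ^ (3 / 2 : ℝ) * lgK x))) ?_
    (fun u hu => hasDerivAt_action_left (hx0.trans hu.1) hu.2) ?_]
  · norm_num
  · refine (ContinuousOn.mul continuousOn_const (ContinuousOn.mul (ContinuousOn.rpow_const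
      (by fun_prop) fun _ _ => Or.inr (by norm_num)) (continuousOn_lgK.mono fun u hu => ?_))).neg
    exact (hx0.trans_le hu.1 : (0 : ℝ) < u)
  · apply ContinuousOn.intervalIntegrable
    rw [uIcc_of_le hx]; exact continuousOn_sqrt_Q hx0

theorem rpow_three_halves_two_thirds {a k : ℝ} (ha : 0 ≤ a) (hk : 0 ≤ k) :
    |3 / 2 * (2 / 3 * (a ^ (3 / 2 : ℝ) * k))| ^ (2 / 3 : ℝ) = a * k ^ (2 / 3 : ℝ) := by
  rw [← mul_assoc, show (3 / 2 : ℝ) * (2 / 3) = 1 by norm_num, one_mul, abs_of_nonneg (by positivity),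
    Real.mul_rpow (by positivity) hk, ← rpow_mul ha]
  norm_num

theorem zeta_eq {x : ℝ} (hx : 0 < x) : zeta x = (x - 1) * lgK x ^ (2 / 3 : ℝ) := by
  rcases lt_trichotomy x 1 with h | rfl | h
  · rw [zeta, integral_sqrt_Q_left hx h.le, Real.sign_of_neg (by linarith), mul_neg, abs_neg,
      rpow_three_halves_two_thirds (by linarith) (lgK_pos hx).le]
    ring
  · simp [zeta]
  · rw [zeta, integral_sqrt_Q_right h.le, Real.sign_of_pos (by linarith),
      rpow_three_halves_two_thirds (by linarith) (lgK_pos hx).le, one_mul]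

theorem q_eq {x : ℝ} (hx : 0 < x) : q x = x⁻¹ * lgK x ^ (-2 / 3 : ℝ) := by
  rw [q]
  split_ifs with h
  · rw [h, lgK_one]; norm_num
  · have hk := lgK_pos hx
    have h1 : x - 1 ≠ 0 := sub_ne_zero.mpr h
    have h2 : lgK x ^ (2 / 3 : ℝ) ≠ 0 := by positivity
    rw [zeta_eq hx, Q, show (-2 / 3 : ℝ) = -(2 / 3) by norm_num, Real.rpow_neg hk.le]; field_simp
    ring

theorem q_pos {x : ℝ} (hx : 0 < x) : 0 < q x := by
  have := lgK_pos hx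
  rw [q_eq hx]; positivity

theorem zeta_one : zeta 1 = 0 := by simp [zeta]

theorem zeta_pos {x : ℝ} (hx : 1 < x) : 0 < zeta x := by
  have := lgK_pos (by linarith : 0 < x)
  rw [zeta_eq (by linarith)]; exact mul_pos (by linarith) (by positivity)

theorem q_mul_zeta {x : ℝ} (hx : 0 < x) : q x * zeta x = 1 - x⁻¹ := by
  have hk := lgK_pos hx
  rw [q_eq hx, zeta_eq hx, show (-2 / 3 : ℝ) = -(2 / 3) by norm_num, Real.rpow_neg hk.le]
  field_simp

theorem hasDerivAt_zeta {x : ℝ} (hx : 0 < x) : HasDerivAt zeta (sqrt (q x)) x := by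
  have hk := lgK_pos hx
  have h1 := ((hasDerivAt_id x).sub_const 1).mul
    ((hasDerivAt_lgK hx).rpow_const (p := 2 / 3) (Or.inl hk.ne'))
  have h2 : zeta =ᶠ[𝓝 x] fun x => (x - 1) * lgK x ^ (2 / 3 : ℝ) := by
    filter_upwards [Ioi_mem_nhds hx] with y hy using zeta_eq hy
  refine (h1.congr_of_eventuallyEq h2).congr_deriv ?_
  have e1 : sqrt (q x) = x ^ (-1 / 2 : ℝ) * lgK x ^ (-1 / 3 : ℝ) := by
    rw [q_eq hx, sqrt_eq_rpow, Real.mul_rpow (by positivity) (by positivity),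
      ← rpow_neg_one, ← rpow_mul hx.le, ← rpow_mul hk.le]
    norm_num
  have e2 : lgK x ^ (2 / 3 : ℝ) = lgK x * lgK x ^ (-1 / 3 : ℝ) := by
    rw [mul_comm, ← rpow_add_one hk.ne']; norm_num
  rw [e1, ← lgK_ode hx, show (2 / 3 - 1 : ℝ) = -1 / 3 by norm_num, e2]; simp only [id]
  ring

theorem contDiffOn_zeta : ContDiffOn ℝ ∞ zeta (Ioi 0) := by
  refine ContDiffOn.congr (f := fun x => (x - 1) * lgK x ^ (2 / 3 : ℝ)) ?_ fun x hx => zeta_eq hx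
  exact (contDiffOn_id.sub contDiffOn_const).mul
    (contDiffOn_lgK.rpow_const_of_ne fun x hx => (lgK_pos hx).ne')

theorem contDiffOn_q : ContDiffOn ℝ ∞ q (Ioi 0) := by
  refine ContDiffOn.congr (f := fun x => x⁻¹ * lgK x ^ (-2 / 3 : ℝ)) ?_ fun x hx => q_eq hx
  exact (contDiffOn_id.inv fun x hx => ne_of_gt hx).mul
    (contDiffOn_lgK.rpow_const_of_ne fun x hx => (lgK_pos hx).ne')

theorem strictMonoOn_zeta : StrictMonoOn zeta (Ioi 0) :=
  strictMonoOn_of_deriv_pos (convex_Ioi 0) contDiffOn_zeta.continuousOn fun x hx => by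
    rw [interior_Ioi] at hx
    rw [(hasDerivAt_zeta hx).deriv]; exact Real.sqrt_pos.mpr (q_pos hx)

theorem xOf_zeta {x : ℝ} (hx : 0 < x) : xOf (zeta x) = x :=
  strictMonoOn_zeta.injOn.leftInvOn_invFunOn hx

theorem lgK_ge {x : ℝ} (hx : 1 ≤ x) : x ^ (-1 / 2 : ℝ) ≤ lgK x := by
  have hx0 : 0 < x := by linarith
  have h : ∫ w in (0 : ℝ)..1, w ^ 2 * x ^ (-1 / 2 : ℝ) ≤ lgMoment 1 0 x := by
    refine intervalIntegral.integral_mono_on zero_le_one (by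
      apply Continuous.intervalIntegrable; fun_prop) (intervalIntegrable_lgIntegrand 1 0 hx0)
      fun w hw => ?_
    rw [lgIntegrand]; simp only [Nat.cast_zero, sub_zero, mul_one]
    gcongr ?_ * ?_
    refine Real.rpow_le_rpow_of_nonpos (lg_base_pos hx0 hw) ?_ (by norm_num)
    have : w ^ 2 ≤ 1 := by nlinarith [hw.1, hw.2]
    nlinarith
  rw [intervalIntegral.integral_mul_const, integral_pow] at h
  rw [lgK]; norm_num at h ⊢
  linarith

theorem lgK_le {x : ℝ} (hx : 1 ≤ x) : lgK x ≤ 3 / 2 * x ^ (-1 / 2 : ℝ) := by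
  have hx0 : 0 < x := by linarith
  have h : lgMoment 1 0 x ≤ ∫ w in (0 : ℝ)..1, w * x ^ (-1 / 2 : ℝ) := by
    refine intervalIntegral.integral_mono_on zero_le_one (intervalIntegrable_lgIntegrand 1 0 hx0)
      (by apply Continuous.intervalIntegrable; fun_prop) fun w hw => ?_
    rw [lgIntegrand]; simp only [Nat.cast_zero, sub_zero, mul_one]
    rcases hw.1.eq_or_lt with h0 | h0
    · rw [← h0]; simp
    · have h1 : (1 + w ^ 2 * (x - 1)) ^ (-1 / 2 : ℝ) ≤ (w ^ 2 * x) ^ (-1 / 2 : ℝ) := by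
        refine Real.rpow_le_rpow_of_nonpos (by positivity) ?_ (by norm_num)
        have : w ^ 2 ≤ 1 := by nlinarith [hw.1, hw.2]
        nlinarith
      have h2 : (w ^ 2 * x) ^ (-1 / 2 : ℝ) = w⁻¹ * x ^ (-1 / 2 : ℝ) := by
        rw [Real.mul_rpow (by positivity) hx0.le, ← rpow_natCast, ← rpow_mul h0.le,
          ← rpow_neg_one]
        norm_num
      calc _ ≤ w ^ 2 * (w⁻¹ * x ^ (-1 / 2 : ℝ)) := by rw [← h2]; gcongr
        _ = _ := by field_simp
  rw [intervalIntegral.integral_mul_const, integral_id] at h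
  rw [lgK]; norm_num at h ⊢
  linarith

theorem zeta_rpow {x : ℝ} (hx : 1 ≤ x) : zeta x ^ (3 / 2 : ℝ) = (x - 1) ^ (3 / 2 : ℝ) * lgK x := by
  have hk := lgK_pos (by linarith : 0 < x)
  rw [zeta_eq (by linarith), Real.mul_rpow (by linarith) (by positivity), ← rpow_mul hk.le]
  norm_num

theorem zeta_rpow_le {x : ℝ} (hx : 1 ≤ x) : zeta x ^ (3 / 2 : ℝ) ≤ 3 / 2 * x := by
  have hx0 : 0 < x := by linarith
  rw [zeta_rpow hx]
  calc (x - 1) ^ (3 / 2 : ℝ) * lgK x ≤ x ^ (3 / 2 : ℝ) * (3 / 2 * x ^ (-1 / 2 : ℝ)) := by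
        refine mul_le_mul (Real.rpow_le_rpow (by linarith) (by linarith) (by norm_num)) (lgK_le hx)
          (lgK_pos hx0).le (by positivity)
    _ = 3 / 2 * (x ^ (3 / 2 : ℝ) * x ^ (-1 / 2 : ℝ)) := by ring
    _ = 3 / 2 * x := by rw [← rpow_add hx0]; norm_num

theorem zeta_rpow_ge {x : ℝ} (hx : 2 ≤ x) : x / 4 ≤ zeta x ^ (3 / 2 : ℝ) := by
  have hx0 : 0 < x := by linarith
  rw [zeta_rpow (by linarith)]
  calc x / 4 ≤ (x / 2) ^ (3 / 2 : ℝ) * x ^ (-1 / 2 : ℝ) := by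
        rw [Real.div_rpow hx0.le (by norm_num), div_mul_eq_mul_div, ← rpow_add hx0]; norm_num
        gcongr
        calc (2 : ℝ) ^ (3 / 2 : ℝ) ≤ 2 ^ (2 : ℝ) :=
              Real.rpow_le_rpow_of_exponent_le (by norm_num) (by norm_num)
          _ = 4 := by norm_num
    _ ≤ _ := mul_le_mul (Real.rpow_le_rpow (by positivity) (by linarith) (by norm_num))
      (lgK_ge (by linarith)) (by positivity) (by have : 0 ≤ x - 1 := by linarith
                                                 positivity)

theorem tendsto_zeta : Tendsto zeta atTop atTop := by
  have h1 : Tendsto (fun x : ℝ => (x / 4) ^ (2 / 3 : ℝ)) atTop atTop :=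
    (tendsto_rpow_atTop (by norm_num)).comp (tendsto_id.atTop_div_const (by norm_num))
  refine tendsto_atTop_mono' _ ?_ h1
  filter_upwards [eventually_ge_atTop 2] with x hx
  have h0 := (zeta_pos (by linarith : 1 < x)).le
  calc (x / 4) ^ (2 / 3 : ℝ) ≤ (zeta x ^ (3 / 2 : ℝ)) ^ (2 / 3 : ℝ) :=
        Real.rpow_le_rpow (by linarith) (zeta_rpow_ge hx) (by norm_num)
    _ = zeta x := by rw [← rpow_mul h0]; norm_num

/-- The left end of the interval of `ζ` that is used. -/
def zetaMin : ℝ := zeta (1 / 2)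

theorem zetaMin_neg : zetaMin < 0 := by
  rw [← zeta_one]
  exact strictMonoOn_zeta (by norm_num : (1 / 2 : ℝ) ∈ Ioi 0) (by norm_num : (1 : ℝ) ∈ Ioi 0)
    (by norm_num)

theorem exists_zeta_eq {z : ℝ} (hz : zetaMin < z) : ∃ x, 0 < x ∧ zeta x = z := by
  obtain ⟨b, hb, hb2⟩ := ((tendsto_zeta.eventually_ge_atTop z).and (eventually_ge_atTop 2)).exists
  have hc : ContinuousOn zeta (Icc (1 / 2) b) := contDiffOn_zeta.continuousOn.mono fun x hx => by
    exact (by linarith [hx.1] : (0 : ℝ) < x)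
  obtain ⟨x, hx, hx'⟩ := intermediate_value_Icc (by linarith) hc ⟨hz.le, hb⟩
  exact ⟨x, by linarith [hx.1], hx'⟩

theorem zeta_xOf {z : ℝ} (hz : zetaMin < z) : zeta (xOf z) = z := by
  obtain ⟨x, hx, rfl⟩ := exists_zeta_eq hz
  rw [xOf_zeta hx]

theorem xOf_pos {z : ℝ} (hz : zetaMin < z) : 0 < xOf z := by
  obtain ⟨x, hx, rfl⟩ := exists_zeta_eq hz
  rwa [xOf_zeta hx]

theorem contDiffOn_xOf : ContDiffOn ℝ ∞ xOf (Ioi zetaMin) := by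
  intro z hz
  obtain ⟨x, hx, rfl⟩ := exists_zeta_eq hz
  refine ContDiffAt.contDiffWithinAt ?_
  have hf : ContDiffAt ℝ ∞ zeta x := contDiffOn_zeta.contDiffAt (Ioi_mem_nhds hx)
  have hf' := (hasDerivAt_zeta hx).hasFDerivAt_equiv (Real.sqrt_pos.mpr (q_pos hx)).ne'
  have hn : (∞ : WithTop ℕ∞) ≠ 0 := by simp
  have h1 := hf.to_localInverse hf' hn
  refine h1.congr_of_eventuallyEq ?_
  have h2 := (hf.hasStrictFDerivAt' hf' hn).eventually_right_inverse
  have h3 := (hf.hasStrictFDerivAt' hf' hn).localInverse_continuousAt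
  have h4 : hf.localInverse hf' hn (zeta x) = x := hf.localInverse_apply_image hf' hn
  have h5 : ∀ᶠ y in 𝓝 (zeta x), 0 < hf.localInverse hf' hn y :=
    h3.eventually (by
      have : (hf.hasStrictFDerivAt' hf' hn).localInverse zeta _ x (zeta x) = x := h4
      rw [this]; exact lt_mem_nhds hx)
  filter_upwards [h2, h5] with y hy hy'
  have h6 : zeta (hf.localInverse hf' hn y) = y := hy
  conv_lhs => rw [← h6]
  exact xOf_zeta hy'

theorem hasDerivAt_xOf {z : ℝ} (hz : zetaMin < z) :
    HasDerivAt xOf (sqrt (q (xOf z)))⁻¹ z := by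
  have h1 : HasDerivAt xOf (deriv xOf z) z :=
    ((contDiffOn_xOf.contDiffAt (Ioi_mem_nhds hz)).differentiableAt (by simp)).hasDerivAt
  have h2 := (hasDerivAt_zeta (xOf_pos hz)).comp z h1
  have h3 : HasDerivAt (zeta ∘ xOf) 1 z := (hasDerivAt_id z).congr_of_eventuallyEq (by
    filter_upwards [Ioi_mem_nhds hz] with y hy using zeta_xOf hy)
  have h4 := h2.unique h3
  rwa [eq_inv_of_mul_eq_one_right h4] at h1

/-! ### The potential of the perturbed Airy equation -/

/-- The weight `q^{1/4}` as a function of `ζ`. -/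
def lgWeight (z : ℝ) : ℝ := q (xOf z) ^ (1 / 4 : ℝ)

theorem lgWeight_pos {z : ℝ} (hz : zetaMin < z) : 0 < lgWeight z :=
  rpow_pos_of_pos (q_pos (xOf_pos hz)) _

theorem contDiffOn_lgWeight : ContDiffOn ℝ ∞ lgWeight (Ioi zetaMin) :=
  (contDiffOn_q.comp contDiffOn_xOf fun _ hz => xOf_pos hz).rpow_const_of_ne
    fun _ hz => (q_pos (xOf_pos hz)).ne'

theorem V_eq {z : ℝ} (hz : zetaMin < z) : V z = -(deriv (deriv lgWeight) z / lgWeight z) := by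
  have h := q_pos (xOf_pos hz)
  rw [V, iteratedDeriv_succ, iteratedDeriv_one, show (-1 / 4 : ℝ) = -(1 / 4) by norm_num,
    Real.rpow_neg h.le]
  have e : (fun y => q (xOf y) ^ (1 / 4 : ℝ)) = lgWeight := rfl
  rw [e, neg_mul, lgWeight, div_eq_mul_inv _ (q (xOf z) ^ (1 / 4 : ℝ)), mul_comm]

theorem contDiffOn_deriv {f : ℝ → ℝ} {s : Set ℝ} (hs : IsOpen s) (hf : ContDiffOn ℝ ∞ f s) :
    ContDiffOn ℝ ∞ (deriv f) s :=
  ((contDiffOn_infty_iff_deriv_of_isOpen hs).mp hf).2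

theorem hasDerivAt_of_contDiffOn {f : ℝ → ℝ} {s : Set ℝ} (hs : IsOpen s) (hf : ContDiffOn ℝ ∞ f s)
    {x : ℝ} (hx : x ∈ s) : HasDerivAt f (deriv f x) x :=
  ((hf.contDiffAt (hs.mem_nhds hx)).differentiableAt (by simp)).hasDerivAt

theorem contDiffOn_V : ContDiffOn ℝ ∞ V (Ioi zetaMin) := by
  have h2 := contDiffOn_deriv isOpen_Ioi (contDiffOn_deriv isOpen_Ioi contDiffOn_lgWeight)
  exact (h2.div contDiffOn_lgWeight fun z hz => (lgWeight_pos hz).ne').neg.congr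
    fun z hz => V_eq hz

/-- Generators of the algebra of functions that describes the potential for large `ζ`. -/
def genY (z : ℝ) : ℝ := (xOf z)⁻¹

def genM (z : ℝ) : ℝ := (sqrt (1 - (xOf z)⁻¹))⁻¹

def genG (z : ℝ) : ℝ := z ^ (3 / 2 : ℝ) * (xOf z)⁻¹

/-- The algebra of functions that describes the potential for large `ζ`. -/
def lgAlgebra : Subalgebra ℝ (ℝ → ℝ) := Algebra.adjoin ℝ {genY, genM, genG}

theorem genY_mem : genY ∈ lgAlgebra := Algebra.subset_adjoin (by simp)

theorem genM_mem : genM ∈ lgAlgebra := Algebra.subset_adjoin (by simp)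

theorem genG_mem : genG ∈ lgAlgebra := Algebra.subset_adjoin (by simp)

theorem zetaMin_lt_zeta_two : zetaMin < zeta 2 := zetaMin_neg.trans (zeta_pos (by norm_num))

theorem two_lt_xOf {z : ℝ} (hz : zeta 2 < z) : 2 < xOf z := by
  have h := zetaMin_lt_zeta_two.trans hz
  rw [← zeta_xOf h] at hz
  exact (strictMonoOn_zeta.lt_iff_lt (by norm_num : (2 : ℝ) ∈ Ioi 0) (xOf_pos h)).mp hz

theorem genY_mem_Ioo {z : ℝ} (hz : zeta 2 < z) : genY z ∈ Ioo (0 : ℝ) (1 / 2) := by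
  have h := two_lt_xOf hz
  refine ⟨by unfold genY; positivity, ?_⟩
  rw [genY, one_div]; exact inv_strictAnti₀ (by norm_num) h

theorem genM_sq {z : ℝ} (hz : zeta 2 < z) : genM z ^ 2 * (1 - genY z) = 1 := by
  have h := genY_mem_Ioo hz
  have h1 : 0 < 1 - (xOf z)⁻¹ := by have := h.2; rw [genY] at this; linarith
  rw [genM, genY, inv_pow, sq_sqrt h1.le, inv_mul_cancel₀ h1.ne']

theorem genM_pos {z : ℝ} (hz : zeta 2 < z) : 0 < genM z := by
  have h := genY_mem_Ioo hz
  have h1 : 0 < 1 - (xOf z)⁻¹ := by have := h.2; rw [genY] at this; linarith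
  unfold genM; positivity

theorem hasDerivAt_xOf_gen {z : ℝ} (hz : zeta 2 < z) :
    HasDerivAt xOf (z ^ (1 / 2 : ℝ) * genM z) z := by
  have hz0 : 0 < z := (zeta_pos (by norm_num)).trans hz
  have h := zetaMin_lt_zeta_two.trans hz
  have h1 := genY_mem_Ioo hz
  refine (hasDerivAt_xOf h).congr_deriv ?_
  have h2 := q_mul_zeta (xOf_pos h)
  rw [zeta_xOf h] at h2
  have h3 : q (xOf z) = (1 - (xOf z)⁻¹) * z⁻¹ := by rw [← h2]; field_simp
  have h4 : 0 ≤ 1 - (xOf z)⁻¹ := by have := h1.2; rw [genY] at this; linarith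
  rw [h3, Real.sqrt_mul h4, mul_inv, Real.sqrt_inv, inv_inv, sqrt_eq_rpow z, genM]; ring

theorem hasDerivAt_genY {z : ℝ} (hz : zeta 2 < z) :
    HasDerivAt genY (-(genY z * genG z * genM z) / z) z := by
  have hz0 : 0 < z := (zeta_pos (by norm_num)).trans hz
  have hx := xOf_pos (zetaMin_lt_zeta_two.trans hz)
  refine ((hasDerivAt_xOf_gen hz).inv hx.ne').congr_deriv ?_
  have e : z ^ (3 / 2 : ℝ) = z ^ (1 / 2 : ℝ) * z := by rw [← rpow_add_one hz0.ne']; norm_num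
  rw [genY, genG, e]; field_simp

theorem hasDerivAt_genM {z : ℝ} (hz : zeta 2 < z) :
    HasDerivAt genM (-(1 / 2 * (genY z * genG z * genM z ^ 4)) / z) z := by
  have hz0 : 0 < z := (zeta_pos (by norm_num)).trans hz
  have h := genY_mem_Ioo hz
  have h1 : 0 < 1 - genY z := by linarith [h.2]
  have h2 := ((((hasDerivAt_genY hz).const_sub 1).sqrt h1.ne').inv (Real.sqrt_pos.mpr h1).ne')
  refine h2.congr_deriv ?_
  have e : sqrt (1 - genY z) = (genM z)⁻¹ := by rw [genM, inv_inv]; rfl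
  have hm := genM_pos hz
  rw [e]; field_simp

theorem hasDerivAt_genG {z : ℝ} (hz : zeta 2 < z) :
    HasDerivAt genG ((3 / 2 * genG z - genG z ^ 2 * genM z) / z) z := by
  have hz0 : 0 < z := (zeta_pos (by norm_num)).trans hz
  have h1 : HasDerivAt (fun z : ℝ => z ^ (3 / 2 : ℝ)) (3 / 2 * z ^ (1 / 2 : ℝ)) z := by
    refine (hasDerivAt_rpow_const (Or.inl hz0.ne')).congr_deriv ?_
    norm_num
  refine (h1.mul (hasDerivAt_genY hz)).congr_deriv ?_
  have e : z ^ (3 / 2 : ℝ) = z ^ (1 / 2 : ℝ) * z := by rw [← rpow_add_one hz0.ne']; norm_num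
  have eg : genG z = z ^ (1 / 2 : ℝ) * z * genY z := by rw [genG, e, genY]
  rw [eg, e]; field_simp
  ring

theorem lgAlgebra_bounded {F : ℝ → ℝ} (hF : F ∈ lgAlgebra) :
    ∃ C, ∀ z, zeta 2 < z → |F z| ≤ C := by
  induction hF using Algebra.adjoin_induction with
  | mem F hF =>
    rcases hF with rfl | rfl | rfl
    · refine ⟨1, fun z hz => ?_⟩
      have := genY_mem_Ioo hz
      rw [abs_of_pos this.1]; linarith [this.2]
    · refine ⟨2, fun z hz => ?_⟩
      have h1 := genY_mem_Ioo hz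
      have h2 := genM_sq hz
      have h3 := genM_pos hz
      rw [abs_of_pos h3]; nlinarith [h1.2]
    · refine ⟨3 / 2, fun z hz => ?_⟩
      have h := zetaMin_lt_zeta_two.trans hz
      have h2 := two_lt_xOf hz
      have hz0 : 0 < z := (zeta_pos (by norm_num)).trans hz
      have h3 := zeta_rpow_le (by linarith : 1 ≤ xOf z)
      rw [zeta_xOf h] at h3
      rw [genG, abs_of_pos (by positivity), mul_inv_le_iff₀ (by linarith)]; exact h3
  | algebraMap r => exact ⟨|r|, fun z _ => le_rfl⟩
  | add F G _ _ hF hG =>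
    obtain ⟨A, hA⟩ := hF
    obtain ⟨B, hB⟩ := hG
    exact ⟨A + B, fun z hz => (abs_add_le _ _).trans (add_le_add (hA z hz) (hB z hz))⟩
  | mul F G _ _ hF hG =>
    obtain ⟨A, hA⟩ := hF
    obtain ⟨B, hB⟩ := hG
    refine ⟨A * B, fun z hz => ?_⟩
    rw [Pi.mul_apply, abs_mul]
    exact mul_le_mul (hA z hz) (hB z hz) (abs_nonneg _) ((abs_nonneg _).trans (hA z hz))

theorem lgAlgebra_deriv {F : ℝ → ℝ} (hF : F ∈ lgAlgebra) :
    ∃ F' ∈ lgAlgebra, ∀ z, zeta 2 < z → HasDerivAt F (F' z / z) z := by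
  have mY := genY_mem
  have mM := genM_mem
  have mG := genG_mem
  induction hF using Algebra.adjoin_induction with
  | mem F hF =>
    rcases hF with rfl | rfl | rfl
    · exact ⟨-(genY * genG * genM), neg_mem (mul_mem (mul_mem mY mG) mM),
        fun z hz => hasDerivAt_genY hz⟩
    · refine ⟨-((1 / 2 : ℝ) • (genY * genG * genM ^ 4)), neg_mem (Subalgebra.smul_mem _
        (mul_mem (mul_mem mY mG) (pow_mem mM 4)) _), fun z hz => hasDerivAt_genM hz⟩
    · refine ⟨(3 / 2 : ℝ) • genG - genG ^ 2 * genM, sub_mem (Subalgebra.smul_mem _ mG _)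
        (mul_mem (pow_mem mG 2) mM), fun z hz => hasDerivAt_genG hz⟩
  | algebraMap r =>
    refine ⟨0, zero_mem _, fun z _ => ?_⟩
    exact (hasDerivAt_const z r).congr_deriv (by simp)
  | add F G _ _ hF hG =>
    obtain ⟨F', hF', h1⟩ := hF
    obtain ⟨G', hG', h2⟩ := hG
    refine ⟨F' + G', add_mem hF' hG', fun z hz => ((h1 z hz).add (h2 z hz)).congr_deriv ?_⟩
    rw [Pi.add_apply, add_div]
  | mul F G hF0 hG0 hF hG =>
    obtain ⟨F', hF', h1⟩ := hF
    obtain ⟨G', hG', h2⟩ := hG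
    refine ⟨F' * G + F * G', add_mem (mul_mem hF' hG0) (mul_mem hF0 hG'),
      fun z hz => ((h1 z hz).mul (h2 z hz)).congr_deriv ?_⟩
    simp only [Pi.add_apply, Pi.mul_apply]
    ring

theorem hasDerivAt_lgWeight_gen {z : ℝ} (hz : zeta 2 < z) : HasDerivAt lgWeight
    (lgWeight z * (1 / 4 * (genY z * genG z * genM z ^ 3 - 1)) / z) z := by
  have hz0 : 0 < z := (zeta_pos (by norm_num)).trans hz
  have h := zetaMin_lt_zeta_two.trans hz
  have heq : ∀ z, zeta 2 < z → lgWeight z = ((1 - genY z) * z⁻¹) ^ (1 / 4 : ℝ) := fun z hz => by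
    have hz0 : 0 < z := (zeta_pos (by norm_num)).trans hz
    have h := zetaMin_lt_zeta_two.trans hz
    have h2 := q_mul_zeta (xOf_pos h)
    rw [zeta_xOf h] at h2
    rw [lgWeight, genY, ← h2]; congr 1; field_simp
  have h1 : 0 < 1 - genY z := by linarith [(genY_mem_Ioo hz).2]
  have hpos : 0 < (1 - genY z) * z⁻¹ := by positivity
  have hd := (((hasDerivAt_genY hz).const_sub 1).mul (hasDerivAt_inv hz0.ne')).rpow_const
    (p := 1 / 4) (Or.inl hpos.ne')
  refine (hd.congr_of_eventuallyEq (by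
    filter_upwards [Ioi_mem_nhds hz] with y hy using heq y hy)).congr_deriv ?_
  simp only [Pi.mul_apply]
  rw [heq z hz, Real.rpow_sub_one hpos.ne']
  have hm := genM_sq hz
  have hmp := genM_pos hz
  have e : (1 - genY z) = (genM z ^ 2)⁻¹ := eq_inv_of_mul_eq_one_right hm
  rw [e]; field_simp
  ring

theorem V_gen : ∃ F ∈ lgAlgebra, ∀ z, zeta 2 < z → z ^ 2 * V z = F z := by
  have mY := genY_mem
  have mM := genM_mem
  have mG := genG_mem
  set E : ℝ → ℝ := (1 / 4 : ℝ) • (genY * genG * genM ^ 3 - 1)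
  have hE : E ∈ lgAlgebra := Subalgebra.smul_mem _
    (sub_mem (mul_mem (mul_mem mY mG) (pow_mem mM 3)) (one_mem _)) _
  obtain ⟨E', hE', hd⟩ := lgAlgebra_deriv hE
  refine ⟨-(E ^ 2 + E' - E), neg_mem (sub_mem (add_mem (pow_mem hE 2) hE') hE), fun z hz => ?_⟩
  have h1 : ∀ z, zeta 2 < z → HasDerivAt lgWeight (lgWeight z * E z / z) z :=
    fun z hz => hasDerivAt_lgWeight_gen hz
  have h2 : deriv lgWeight =ᶠ[𝓝 z] fun z => lgWeight z * E z / z := by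
    filter_upwards [Ioi_mem_nhds hz] with y hy using (h1 y hy).deriv
  have hz0 : 0 < z := (zeta_pos (by norm_num)).trans hz
  have h3 := ((h1 z hz).mul (hd z hz)).div (hasDerivAt_id z) hz0.ne'
  have h4 := (h3.congr_of_eventuallyEq h2).deriv
  have hw := lgWeight_pos (zetaMin_lt_zeta_two.trans hz)
  rw [V_eq (zetaMin_lt_zeta_two.trans hz), h4]
  simp only [Pi.neg_apply, Pi.sub_apply, Pi.add_apply, Pi.pow_apply, Pi.mul_apply, id]
  field_simp

theorem V_iteratedDeriv_gen (k : ℕ) :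
    ∃ F ∈ lgAlgebra, ∀ z, zeta 2 < z → z ^ (2 + k) * iteratedDeriv k V z = F z := by
  induction k with
  | zero => simpa using V_gen
  | succ k ih =>
    obtain ⟨F, hF, h⟩ := ih
    obtain ⟨F', hF', hd⟩ := lgAlgebra_deriv hF
    refine ⟨F' - (2 + k : ℝ) • F, sub_mem hF' (Subalgebra.smul_mem _ hF _), fun z hz => ?_⟩
    have hz0 : 0 < z := (zeta_pos (by norm_num)).trans hz
    have h1 : iteratedDeriv k V =ᶠ[𝓝 z] fun z => F z / z ^ (2 + k) := by
      filter_upwards [Ioi_mem_nhds hz] with y hy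
      have hy0 : 0 < y := (zeta_pos (by norm_num)).trans hy
      rw [← h y hy]; field_simp
    have h2 := (((hd z hz).div (hasDerivAt_pow (2 + k) z)
      (by positivity)).congr_of_eventuallyEq h1).deriv
    rw [iteratedDeriv_succ, h2]; simp only [Pi.sub_apply, Pi.smul_apply, smul_eq_mul]
    have e : 2 + k - 1 = k + 1 := by omega
    rw [e]; push_cast
    field_simp; ring

/-- Smooth functions near `[0, ∞)` all of whose derivatives decay like those of `|z|^{-m}`. -/
def IsSymbol (a : ℝ) (m : ℕ) (W : ℝ → ℝ) : Prop := ContDiffOn ℝ ∞ W (Ioi a) ∧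
    ∀ k, ∃ C, ∀ z, a < z → |iteratedDeriv k W z| * (1 + |z|) ^ (m + k) ≤ C

theorem isSymbol_V : IsSymbol (zetaMin / 2) 2 V := by
  have hneg := zetaMin_neg
  refine ⟨contDiffOn_V.mono (Ioi_subset_Ioi (by linarith)), fun k => ?_⟩
  obtain ⟨F, hF, h⟩ := V_iteratedDeriv_gen k
  obtain ⟨C, hC⟩ := lgAlgebra_bounded hF
  set b := max (zeta 2 + 1) 1
  have hc : ContinuousOn (fun z => |iteratedDeriv k V z| * (1 + |z|) ^ (2 + k))
      (Icc (zetaMin / 2) b) := by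
    refine ContinuousOn.mul (ContinuousOn.abs ?_) (by fun_prop)
    refine ContinuousOn.mono (s := Ioi zetaMin) ?_ fun z hz => ?_
    · have := contDiffOn_V.continuousOn_iteratedDerivWithin (m := k) (by exact_mod_cast le_top)
        isOpen_Ioi.uniqueDiffOn
      refine this.congr fun z hz => ?_
      exact (iteratedDerivWithin_of_isOpen isOpen_Ioi hz).symm
    · exact (by linarith [hz.1] : zetaMin < z)
  obtain ⟨D, hD⟩ := isCompact_Icc.bddAbove_image hc
  refine ⟨max D (C * 2 ^ (2 + k)), fun z hz => ?_⟩
  rcases le_total z b with hzb | hzb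
  · exact (hD ⟨z, ⟨hz.le, hzb⟩, rfl⟩).trans (le_max_left _ _)
  · refine le_trans ?_ (le_max_right _ _)
    have h1 : zeta 2 < z := by
      have := le_max_left (zeta 2 + 1) 1
      linarith
    have h2 : 1 ≤ z := (le_max_right _ _).trans hzb
    have h3 := hC z h1
    rw [← h z h1, abs_mul, abs_of_pos (by positivity : 0 < z ^ (2 + k))] at h3
    calc |iteratedDeriv k V z| * (1 + |z|) ^ (2 + k)
        ≤ |iteratedDeriv k V z| * (2 * z) ^ (2 + k) := by
          gcongr; rw [abs_of_pos (by linarith)]; linarith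
      _ = z ^ (2 + k) * |iteratedDeriv k V z| * 2 ^ (2 + k) := by rw [mul_pow]; ring
      _ ≤ C * 2 ^ (2 + k) := by gcongr

theorem IsSymbol.deriv {a : ℝ} {m : ℕ} {W : ℝ → ℝ} (h : IsSymbol a m W) :
    IsSymbol a (m + 1) (deriv W) := by
  refine ⟨contDiffOn_deriv isOpen_Ioi h.1, fun k => ?_⟩
  obtain ⟨C, hC⟩ := h.2 (k + 1)
  refine ⟨C, fun z hz => ?_⟩
  have := hC z hz
  rwa [iteratedDeriv_succ', show m + (k + 1) = m + 1 + k by ring] at this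

theorem contDiffOn_iteratedDeriv {f : ℝ → ℝ} {s : Set ℝ} (hs : IsOpen s)
    (hf : ContDiffOn ℝ ∞ f s) (k : ℕ) : ContDiffOn ℝ ∞ (iteratedDeriv k f) s := by
  induction k with
  | zero => simpa using hf
  | succ k ih => rw [iteratedDeriv_succ]; exact contDiffOn_deriv hs ih

theorem iteratedDeriv_id_mul {a : ℝ} {W : ℝ → ℝ} (h : ContDiffOn ℝ ∞ W (Ioi a)) (k : ℕ) :
    ∀ z, a < z → iteratedDeriv k (fun z => z * W z) z =
      z * iteratedDeriv k W z + k * iteratedDeriv (k - 1) W z := by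
  induction k with
  | zero => intro z _; simp
  | succ k ih =>
    intro z hz
    have hd : ∀ j : ℕ, HasDerivAt (iteratedDeriv j W) (iteratedDeriv (j + 1) W z) z := fun j => by
      rw [iteratedDeriv_succ]
      exact hasDerivAt_of_contDiffOn isOpen_Ioi (contDiffOn_iteratedDeriv isOpen_Ioi h j) hz
    have h1 : iteratedDeriv k (fun z => z * W z) =ᶠ[𝓝 z]
        fun z => z * iteratedDeriv k W z + k * iteratedDeriv (k - 1) W z := by
      filter_upwards [Ioi_mem_nhds hz] with y hy using ih y hy
    have h2 := ((((hasDerivAt_id z).mul (hd k)).add ((hd (k - 1)).const_mul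
      (k : ℝ))).congr_of_eventuallyEq h1).deriv
    rw [iteratedDeriv_succ, h2]
    rcases k with _ | k
    · simp [add_comm]
    · simp only [id, Nat.add_sub_cancel]; push_cast; ring

theorem IsSymbol.id_mul {a : ℝ} {m : ℕ} {W : ℝ → ℝ} (h : IsSymbol a (m + 1) W) :
    IsSymbol a m (fun z => z * W z) := by
  refine ⟨contDiffOn_id.mul h.1, fun k => ?_⟩
  obtain ⟨C, hC⟩ := h.2 k
  obtain ⟨D, hD⟩ := h.2 (k - 1)
  refine ⟨C + k * D, fun z hz => ?_⟩
  rw [iteratedDeriv_id_mul h.1 k z hz]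
  have h1 := hC z hz
  have h2 := hD z hz
  have h3 := abs_nonneg z
  have e1 : |z| * |iteratedDeriv k W z| * (1 + |z|) ^ (m + k) ≤ C := by
    refine le_trans ?_ h1
    rw [show m + 1 + k = m + k + 1 by ring, pow_succ]
    have : 0 ≤ |iteratedDeriv k W z| * (1 + |z|) ^ (m + k) := by positivity
    nlinarith
  have e2 : (k : ℝ) * |iteratedDeriv (k - 1) W z| * (1 + |z|) ^ (m + k) ≤ k * D := by
    rcases k with _ | k
    · simp
    · rw [mul_assoc]; gcongr
      rwa [show m + 1 + (k + 1 - 1) = m + (k + 1) by omega] at h2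
  calc _ ≤ (|z| * |iteratedDeriv k W z| + k * |iteratedDeriv (k - 1) W z|)
        * (1 + |z|) ^ (m + k) := by
        gcongr
        refine (abs_add_le _ _).trans (le_of_eq ?_)
        rw [abs_mul, abs_mul, Nat.abs_cast]
    _ ≤ _ := by rw [add_mul]; exact add_le_add e1 e2

theorem IsSymbol.const_mul {a : ℝ} {m : ℕ} {W : ℝ → ℝ} (h : IsSymbol a m W) (c : ℝ) :
    IsSymbol a m (fun z => c * W z) := by
  refine ⟨contDiffOn_const.mul h.1, fun k => ?_⟩
  obtain ⟨C, hC⟩ := h.2 k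
  refine ⟨|c| * C, fun z hz => ?_⟩
  rw [iteratedDeriv_const_mul_field, abs_mul, mul_assoc]; gcongr
  exact hC z hz

theorem IsSymbol.add {a : ℝ} {m : ℕ} {W X : ℝ → ℝ} (h : IsSymbol a m W) (h' : IsSymbol a m X) :
    IsSymbol a m (fun z => W z + X z) := by
  refine ⟨h.1.add h'.1, fun k => ?_⟩
  obtain ⟨C, hC⟩ := h.2 k
  obtain ⟨D, hD⟩ := h'.2 k
  refine ⟨C + D, fun z hz => ?_⟩
  have e : iteratedDeriv k (fun z => W z + X z) z = iteratedDeriv k W z + iteratedDeriv k X z :=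
    iteratedDeriv_fun_add ((h.1.contDiffAt (Ioi_mem_nhds hz)).of_le (by exact_mod_cast le_top))
      ((h'.1.contDiffAt (Ioi_mem_nhds hz)).of_le (by exact_mod_cast le_top))
  rw [e]
  calc _ ≤ (|iteratedDeriv k W z| + |iteratedDeriv k X z|) * (1 + |z|) ^ (m + k) := by
        gcongr; exact abs_add_le _ _
    _ ≤ _ := by rw [add_mul]; exact add_le_add (hC z hz) (hD z hz)

/-- The symbol `m W + z W'`, whose dilates are the derivatives of the dilates of `W`. -/
def eulerOp (m : ℝ) (W : ℝ → ℝ) (z : ℝ) : ℝ := m * W z + z * deriv W z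

theorem IsSymbol.eulerOp {a : ℝ} {m : ℕ} {W : ℝ → ℝ} (h : IsSymbol a m W) (c : ℝ) :
    IsSymbol a m (eulerOp c W) := (h.const_mul c).add h.deriv.id_mul

/-! ### Volterra operators attached to the Airy equation -/

theorem exists_airyC : ∃ C : ℝ, 1 ≤ C ∧ ∀ t, -1 ≤ t → ‖outAiry t‖ ^ 2 * wt t ≤ C ∧
    1 ≤ C * (‖outAiry t‖ ^ 2 * wt t) ∧ wt t ≤ C * ‖airyP t‖ ∧ ‖airyP t‖ ≤ C * wt t ∧
    ‖airyP1 t‖ * wt t ≤ C ∧ ‖airyP2 t‖ * wt t ^ 3 ≤ C := by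
  obtain ⟨C1, h1, H1⟩ := exists_outAiry_le
  obtain ⟨C2, h2, H2⟩ := exists_outAiry_ge
  obtain ⟨C3, h3, H3⟩ := exists_airyP_ge
  obtain ⟨C4, h4, H4⟩ := exists_airyP_le
  obtain ⟨C5, h5, H5⟩ := exists_airyP1_le
  obtain ⟨C6, h6, H6⟩ := exists_airyP2_le
  refine ⟨1 + C1 + C2 + C3 + C4 + C5 + C6, by linarith, fun t ht => ?_⟩
  have hw := wt_pos ht
  refine ⟨(H1 t ht).trans (by linarith), (H2 t ht).trans ?_, (H3 t ht).trans ?_,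
    (H4 t ht).trans ?_, (H5 t ht).trans (by linarith), (H6 t ht).trans (by linarith)⟩ <;>
  · gcongr; linarith

/-- A constant in all bounds of Airy quantities. -/
def airyC : ℝ := exists_airyC.choose

theorem one_le_airyC : 1 ≤ airyC := exists_airyC.choose_spec.1

theorem airyC_pos : 0 < airyC := one_pos.trans_le one_le_airyC

theorem norm_outAiry_sq_le {t : ℝ} (ht : -1 ≤ t) : ‖outAiry t‖ ^ 2 ≤ airyC / wt t :=
  (le_div_iff₀ (wt_pos ht)).mpr (exists_airyC.choose_spec.2 t ht).1

theorem inv_norm_outAiry_sq_le {t : ℝ} (ht : -1 ≤ t) : (‖outAiry t‖ ^ 2)⁻¹ ≤ airyC * wt t := by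
  have h := (exists_airyC.choose_spec.2 t ht).2.1
  have h0 : 0 < ‖outAiry t‖ ^ 2 := by have := norm_pos_iff.mpr (outAiry_ne_zero t); positivity
  rw [inv_le_iff_one_le_mul₀ h0]; exact h.trans (le_of_eq (by rw [airyC]; ring))

theorem norm_airyP_pos {t : ℝ} (ht : -1 ≤ t) : 0 < ‖airyP t‖ := by
  have h := (exists_airyC.choose_spec.2 t ht).2.2.1
  by_contra h'
  have h0 : ‖airyP t‖ = 0 := le_antisymm (not_lt.mp h') (norm_nonneg _)
  rw [h0, mul_zero] at h
  exact absurd (wt_pos ht) (not_lt.mpr h)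

theorem inv_norm_airyP_le {t : ℝ} (ht : -1 ≤ t) : ‖airyP t‖⁻¹ ≤ airyC / wt t := by
  have h := (exists_airyC.choose_spec.2 t ht).2.2.1
  rw [inv_le_comm₀ (norm_airyP_pos ht) (div_pos airyC_pos (wt_pos ht)), inv_div,
    div_le_iff₀ airyC_pos, mul_comm]
  exact h

theorem norm_airyP_le {t : ℝ} (ht : -1 ≤ t) : ‖airyP t‖ ≤ airyC * wt t :=
  (exists_airyC.choose_spec.2 t ht).2.2.2.1

theorem norm_airyP1_le {t : ℝ} (ht : -1 ≤ t) : ‖airyP1 t‖ ≤ airyC / wt t :=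
  (le_div_iff₀ (wt_pos ht)).mpr (exists_airyC.choose_spec.2 t ht).2.2.2.2.1

theorem norm_airyP2_le {t : ℝ} (ht : -1 ≤ t) : ‖airyP2 t‖ ≤ airyC / wt t ^ 3 :=
  (le_div_iff₀ (pow_pos (wt_pos ht) 3)).mpr (exists_airyC.choose_spec.2 t ht).2.2.2.2.2

theorem airyP_ne_zero {t : ℝ} (ht : -1 ≤ t) : airyP t ≠ 0 := norm_pos_iff.mp (norm_airyP_pos ht)

/-- A function that vanishes at infinity is controlled by its derivative. -/
theorem norm_le_of_decay {Y Y' : ℝ → ℂ} {Φ φ : ℝ → ℝ} {t : ℝ}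
    (hY : ∀ s, t ≤ s → HasDerivAt Y (Y' s) s) (hΦ : ∀ s, t ≤ s → HasDerivAt Φ (-φ s) s)
    (hle : ∀ s, t ≤ s → ‖Y' s‖ ≤ φ s) (hY0 : Tendsto Y atTop (𝓝 0))
    (hΦ0 : ∀ s, t ≤ s → 0 ≤ Φ s) : ‖Y t‖ ≤ Φ t := by
  have key : ∀ T, t ≤ T → ‖Y T - Y t‖ ≤ Φ t := fun T hT => by
    have h := image_norm_le_of_norm_deriv_right_le_deriv_boundary' (f := fun s => Y s - Y t)
      (f' := Y') (a := t) (b := T) (B := fun s => Φ t - Φ s) (B' := φ)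
      (fun s hs => ((hY s hs.1).continuousAt.sub continuousAt_const).continuousWithinAt)
      (fun s hs => ((hY s hs.1).sub_const _).hasDerivWithinAt) (by simp)
      (fun s hs => (continuousAt_const.sub (hΦ s hs.1).continuousAt).continuousWithinAt)
      (fun s hs => (((hΦ s hs.1).const_sub _).congr_deriv (by simp)).hasDerivWithinAt)
      (fun s hs => hle s hs.1)
    refine (h ⟨hT, le_rfl⟩).trans ?_
    linarith [hΦ0 T hT]
  have h1 : Tendsto (fun T => ‖Y T - Y t‖) atTop (𝓝 ‖(0 : ℂ) - Y t‖) := (hY0.sub_const _).norm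
  rw [zero_sub, norm_neg] at h1
  exact le_of_tendsto h1 (by filter_upwards [eventually_ge_atTop t] with T hT using key T hT)

/-- The integral over `(t, ∞)`, for `t ≥ -1`. -/
def tailInt (F : ℝ → ℂ) (t : ℝ) : ℂ := (∫ s in Ioi (-1 : ℝ), F s) - ∫ s in (-1 : ℝ)..t, F s

theorem hasDerivAt_tailInt {F : ℝ → ℂ} (hF : Continuous F) (t : ℝ) :
    HasDerivAt (tailInt F) (-F t) t :=
  (intervalIntegral.integral_hasDerivAt_right (hF.intervalIntegrable _ _)
    (hF.stronglyMeasurableAtFilter _ _) hF.continuousAt).const_sub _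

theorem tendsto_tailInt {F : ℝ → ℂ} (hF : IntegrableOn F (Ioi (-1))) :
    Tendsto (tailInt F) atTop (𝓝 0) := by
  have h := (intervalIntegral_tendsto_integral_Ioi (-1) hF tendsto_id).const_sub
    (∫ s in Ioi (-1 : ℝ), F s)
  rwa [sub_self] at h

theorem hasDerivAt_wt {t : ℝ} (ht : -2 < t) : HasDerivAt wt (1 / (2 * wt t)) t :=
  ((hasDerivAt_id t).add_const 2).sqrt (by simp only [id]; linarith)

theorem tendsto_wt : Tendsto wt atTop atTop :=
  Real.tendsto_sqrt_atTop.comp (tendsto_atTop_add_const_right _ _ tendsto_id)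

/-- The decay rate of the perturbation at scale `a²`. -/
def volRho (c a t : ℝ) : ℝ := a / (c + a * wt t)

section volRho

variable {c a t : ℝ}

theorem volRho_pos (hc : 0 ≤ c) (ha : 0 < a) (ht : -1 ≤ t) : 0 < volRho c a t := by
  have := wt_pos ht; unfold volRho; positivity

theorem volRho_mul_wt_le (hc : 0 ≤ c) (ha : 0 < a) (ht : -1 ≤ t) : volRho c a t * wt t ≤ 1 := by
  have := wt_pos ht
  rw [volRho, div_mul_eq_mul_div, div_le_one (by positivity)]; linarith

theorem volRho_le_inv (hc : 0 ≤ c) (ha : 0 < a) (ht : -1 ≤ t) : volRho c a t ≤ 1 / wt t :=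
  (le_div_iff₀ (wt_pos ht)).mpr (volRho_mul_wt_le hc ha ht)

theorem volRho_le_one (hc : 0 ≤ c) (ha : 0 < a) (ht : -1 ≤ t) : volRho c a t ≤ 1 :=
  (volRho_le_inv hc ha ht).trans (by
    rw [div_le_one (wt_pos ht)]; exact one_le_wt ht)

theorem hasDerivAt_volRho (hc : 0 ≤ c) (ha : 0 < a) (ht : -1 ≤ t) :
    HasDerivAt (volRho c a) (-(volRho c a t ^ 2 / (2 * wt t))) t := by
  have hw := wt_pos ht
  have h := (hasDerivAt_const t a).div
    (((hasDerivAt_wt (by linarith : -2 < t)).const_mul a).const_add c)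
    (by positivity : c + a * wt t ≠ 0)
  refine h.congr_deriv ?_
  rw [volRho]; field_simp; ring

theorem tendsto_volRho (hc : 0 ≤ c) (ha : 0 < a) : Tendsto (volRho c a) atTop (𝓝 0) := by
  have h := tendsto_wt.inv_tendsto_atTop
  refine squeeze_zero' ?_ ?_ h
  · filter_upwards [eventually_ge_atTop (-1)] with s hs using (volRho_pos hc ha hs).le
  · filter_upwards [eventually_ge_atTop (-1)] with s hs
    simpa using volRho_le_inv hc ha hs

theorem hasDerivAt_volRho_cube (hc : 0 ≤ c) (ha : 0 < a) (ht : -1 ≤ t) (D : ℝ) :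
    HasDerivAt (fun s => D * volRho c a s ^ 3) (-(D * (3 / 2) * volRho c a t ^ 4 / wt t)) t := by
  have hw := wt_pos ht
  refine (((hasDerivAt_volRho hc ha ht).pow 3).const_mul D).congr_deriv ?_
  field_simp; ring

end volRho

theorem integrableOn_of_le_volRho {F : ℝ → ℂ} (hF : Continuous F) {c a D : ℝ} (hc : 0 ≤ c)
    (ha : 0 < a) (hle : ∀ s, -1 ≤ s → ‖F s‖ ≤ D * volRho c a s ^ 4 / wt s) :
    IntegrableOn F (Ioi (-1)) := by
  have hD : 0 ≤ D := by
    have h := (norm_nonneg _).trans (hle 0 (by norm_num))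
    have h1 := volRho_pos hc ha (by norm_num : (-1 : ℝ) ≤ 0)
    have h2 := wt_pos (by norm_num : (-1 : ℝ) ≤ 0)
    by_contra hD
    rw [not_le] at hD
    have : D * volRho c a 0 ^ 4 / wt 0 < 0 := div_neg_of_neg_of_pos
      (mul_neg_of_neg_of_pos hD (by positivity)) h2
    linarith
  have h0 : Tendsto (fun s => D * (2 / 3) * volRho c a s ^ 3) atTop (𝓝 0) := by
    simpa using ((tendsto_volRho hc ha).pow 3).const_mul (D * (2 / 3))
  have h1 := integrableOn_Ioi_deriv_of_nonpos' (a := -1)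
    (fun s hs => hasDerivAt_volRho_cube hc ha hs (D * (2 / 3))) (fun s hs => by
      have h1 := volRho_pos hc ha (le_of_lt hs)
      have h2 := wt_pos (le_of_lt hs)
      rw [neg_nonpos]; positivity) h0
  refine h1.neg.mono' hF.aestronglyMeasurable ?_
  filter_upwards [ae_restrict_mem measurableSet_Ioi] with s hs
  refine (hle s (le_of_lt hs)).trans (le_of_eq ?_)
  simp only [Pi.neg_apply]; ring

theorem norm_tailInt_le {F : ℝ → ℂ} (hF : Continuous F) {c a D : ℝ} (hc : 0 ≤ c)
    (ha : 0 < a) (hle : ∀ s, -1 ≤ s → ‖F s‖ ≤ D * volRho c a s ^ 4 / wt s) {t : ℝ} (ht : -1 ≤ t) :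
    ‖tailInt F t‖ ≤ D * volRho c a t ^ 3 := by
  have hD : ∀ s, -1 ≤ s → 0 ≤ D * volRho c a s ^ 4 / wt s := fun s hs =>
    (norm_nonneg _).trans (hle s hs)
  have hD' : 0 ≤ D := by
    by_contra hD'
    rw [not_le] at hD'
    have := hD t ht
    have h1 := volRho_pos hc ha ht
    have h2 := wt_pos ht
    have : D * volRho c a t ^ 4 / wt t < 0 := div_neg_of_neg_of_pos
      (mul_neg_of_neg_of_pos hD' (by positivity)) h2
    linarith
  refine norm_le_of_decay (Y' := fun s => -F s) (Φ := fun s => D * volRho c a s ^ 3)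
    (fun s _ => hasDerivAt_tailInt hF s)
    (fun s hs => hasDerivAt_volRho_cube hc ha (ht.trans hs) D) (fun s hs => ?_)
    (tendsto_tailInt (integrableOn_of_le_volRho hF hc ha hle)) (fun s hs => ?_)
  · rw [norm_neg]
    refine (hle s (ht.trans hs)).trans ?_
    have := hD s (ht.trans hs)
    have e : D * (3 / 2) * volRho c a s ^ 4 / wt s = 3 / 2 * (D * volRho c a s ^ 4 / wt s) := by
      ring
    linarith
  · have := volRho_pos hc ha (ht.trans hs); positivity

/-- The solution of `f' = -p f - G` that vanishes at infinity. -/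
def volT (G : ℝ → ℂ) (t : ℝ) : ℂ := tailInt (fun s => outAiry s ^ 2 * G s) t / outAiry t ^ 2

/-- The primitive of `volT G` that vanishes at infinity. -/
def volB (G : ℝ → ℂ) (t : ℝ) : ℂ :=
  -airyW⁻¹ * (tailInt (fun s => outAiry s * conj (outAiry s) * G s) t -
    conj (outAiry t) / outAiry t * tailInt (fun s => outAiry s ^ 2 * G s) t)

theorem hasDerivAt_volT {G : ℝ → ℂ} (hG : Continuous G) (t : ℝ) :
    HasDerivAt (volT G) (-(airyP t * volT G t) - G t) t := by
  have h0 := outAiry_ne_zero t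
  have hc := continuous_outAiry
  have h := (hasDerivAt_tailInt (F := fun s => outAiry s ^ 2 * G s) (by fun_prop) t).div
    ((hasDerivAt_outAiry t).pow 2) (pow_ne_zero 2 h0)
  refine h.congr_deriv ?_
  simp only [volT, airyP, Pi.pow_apply]
  field_simp; push_cast
  ring

theorem hasDerivAt_volB {G : ℝ → ℂ} (hG : Continuous G) (t : ℝ) :
    HasDerivAt (volB G) (volT G t) t := by
  have h0 := outAiry_ne_zero t
  have hw := airyW_ne_zero
  have hW := outAiry_wronskian t
  have hc := continuous_outAiry
  have h1 := hasDerivAt_tailInt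
    (F := fun s => outAiry s * conj (outAiry s) * G s) (by fun_prop) t
  have h2 := hasDerivAt_tailInt (F := fun s => outAiry s ^ 2 * G s) (by fun_prop) t
  have h3 := (hasDerivAt_conj (hasDerivAt_outAiry t)).div (hasDerivAt_outAiry t) h0
  have h := (h1.sub (h3.mul h2)).const_mul (-airyW⁻¹)
  refine h.congr_deriv ?_
  simp only [volT, Pi.div_apply]
  generalize tailInt (fun s => outAiry s ^ 2 * G s) t = J at *
  rw [← hW] at hw ⊢
  field_simp; ring

theorem norm_kernel_le {k G : ℝ → ℂ} {c a A : ℝ} (hk : ∀ s, ‖k s‖ = ‖outAiry s‖ ^ 2)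
    (hle : ∀ s, -1 ≤ s → ‖G s‖ ≤ A * volRho c a s ^ 4) (s : ℝ) (hs : -1 ≤ s) :
    ‖k s * G s‖ ≤ airyC * A * volRho c a s ^ 4 / wt s := by
  have h1 := norm_outAiry_sq_le hs
  have h2 := hle s hs
  have h3 := wt_pos hs
  have h4 := airyC_pos
  rw [norm_mul, hk]
  calc _ ≤ airyC / wt s * (A * volRho c a s ^ 4) := by gcongr
    _ = _ := by ring

theorem norm_volT_le {G : ℝ → ℂ} (hG : Continuous G) {c a A : ℝ} (hc : 0 ≤ c) (ha : 0 < a)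
    (hle : ∀ s, -1 ≤ s → ‖G s‖ ≤ A * volRho c a s ^ 4) {t : ℝ} (ht : -1 ≤ t) :
    ‖volT G t‖ ≤ airyC ^ 2 * A * volRho c a t ^ 2 := by
  have hψ := continuous_outAiry
  have h := norm_tailInt_le (F := fun s => outAiry s ^ 2 * G s) (by fun_prop) hc ha
    (norm_kernel_le (fun s => norm_pow _ _) hle) ht
  have hw := wt_pos ht
  have hr := volRho_pos hc ha ht
  have hr1 := volRho_mul_wt_le hc ha ht
  have hC := airyC_pos
  have hA : 0 ≤ A := by
    have := (norm_nonneg _).trans (hle t ht)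
    exact nonneg_of_mul_nonneg_left this (by positivity)
  rw [volT, norm_div, norm_pow, div_eq_mul_inv]
  calc _ ≤ airyC * A * volRho c a t ^ 3 * (airyC * wt t) := by
        gcongr; exact inv_norm_outAiry_sq_le ht
    _ = airyC ^ 2 * A * volRho c a t ^ 2 * (volRho c a t * wt t) := by ring
    _ ≤ airyC ^ 2 * A * volRho c a t ^ 2 * 1 := by gcongr
    _ = _ := mul_one _

theorem norm_volB_le {G : ℝ → ℂ} (hG : Continuous G) {c a A : ℝ} (hc : 0 ≤ c) (ha : 0 < a)
    (hle : ∀ s, -1 ≤ s → ‖G s‖ ≤ A * volRho c a s ^ 4) {t : ℝ} (ht : -1 ≤ t) :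
    ‖volB G t‖ ≤ ‖airyW‖⁻¹ * 2 * airyC * A * volRho c a t ^ 3 := by
  have hψ := continuous_outAiry
  have h := norm_tailInt_le (F := fun s => outAiry s ^ 2 * G s) (by fun_prop) hc ha
    (norm_kernel_le (fun s => norm_pow _ _) hle) ht
  have h' := norm_tailInt_le (F := fun s => outAiry s * conj (outAiry s) * G s)
    (by fun_prop) hc ha (norm_kernel_le (fun s => by rw [norm_mul, RCLike.norm_conj, sq]) hle) ht
  have h0 := norm_pos_iff.mpr (outAiry_ne_zero t)
  rw [volB, norm_mul, norm_neg, norm_inv]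
  have h1 : ‖conj (outAiry t) / outAiry t * tailInt (fun s => outAiry s ^ 2 * G s) t‖ ≤
      airyC * A * volRho c a t ^ 3 := by
    rw [norm_mul, norm_div, RCLike.norm_conj, div_self h0.ne', one_mul]; exact h
  calc _ ≤ ‖airyW‖⁻¹ * (airyC * A * volRho c a t ^ 3 + airyC * A * volRho c a t ^ 3) := by
        gcongr; exact (norm_sub_le _ _).trans (add_le_add h' h1)
    _ = _ := by ring

/-! ### Improved bounds by integration by parts -/

theorem norm_le_of_forcing {f E : ℝ → ℂ} {a A t : ℝ} {m : ℕ} (hm : 1 ≤ m) (ha : 0 < a)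
    (ht : -1 ≤ t) (hA : 0 ≤ A)
    (hf : ∀ s, t ≤ s → HasDerivAt f (-(airyP s * f s) + E s) s)
    (hE : ∀ s, t ≤ s → ‖E s‖ ≤ A * volRho 1 a s ^ 4 / wt s ^ (m + 1))
    (hf0 : Tendsto f atTop (𝓝 0)) :
    ‖f t‖ ≤ 2 * airyC ^ 2 * A * volRho 1 a t ^ 4 * wt t / wt t ^ m := by
  have hC := airyC_pos
  have hm0 : (1 : ℝ) ≤ m := by exact_mod_cast hm
  have hY : ∀ s, t ≤ s → HasDerivAt (fun s => outAiry s ^ 2 * f s) (outAiry s ^ 2 * E s) s :=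
    fun s hs => by
      refine (((hasDerivAt_outAiry s).pow 2).mul (hf s hs)).congr_deriv ?_
      simp only [Pi.pow_apply]
      push_cast
      linear_combination (-(outAiry s * f s)) * outAiry_mul_airyP s
  have hΦ : ∀ s, t ≤ s → HasDerivAt
      (fun s => 2 * airyC * A * (volRho 1 a s ^ 4 * (wt s ^ m)⁻¹))
      (-(2 * airyC * A * (2 * volRho 1 a s ^ 5 / wt s * (wt s ^ m)⁻¹ +
        volRho 1 a s ^ 4 * (m / 2) * (wt s ^ (m + 2))⁻¹))) s := fun s hs => by
    have hs1 : -1 ≤ s := ht.trans hs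
    have hw := wt_pos hs1
    obtain ⟨n, rfl⟩ : ∃ n, m = n + 1 := ⟨m - 1, by omega⟩
    have h1 := (hasDerivAt_volRho zero_le_one ha hs1).pow 4
    have h2 := ((hasDerivAt_wt (by linarith : -2 < s)).pow (n + 1)).inv (pow_pos hw _).ne'
    refine ((h1.mul h2).const_mul (2 * airyC * A)).congr_deriv ?_
    simp only [Pi.pow_apply, Pi.inv_apply, Nat.add_sub_cancel]
    push_cast; field_simp
    ring
  have hY0 : Tendsto (fun s => outAiry s ^ 2 * f s) atTop (𝓝 0) := by
    rw [tendsto_zero_iff_norm_tendsto_zero] at hf0 ⊢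
    have h := hf0.const_mul airyC
    rw [mul_zero] at h
    refine squeeze_zero' (Eventually.of_forall fun s => norm_nonneg _) ?_ h
    filter_upwards [eventually_ge_atTop (-1)] with s hs
    rw [norm_mul, norm_pow]; gcongr
    refine (norm_outAiry_sq_le hs).trans (div_le_self hC.le (one_le_wt hs))
  have key := norm_le_of_decay hY hΦ (fun s hs => ?_) hY0 (fun s hs => ?_)
  · have h0 := norm_pos_iff.mpr (outAiry_ne_zero t)
    have hw := wt_pos ht
    have hr := volRho_pos zero_le_one ha ht
    have e : ‖f t‖ = ‖outAiry t ^ 2 * f t‖ * (‖outAiry t‖ ^ 2)⁻¹ := by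
      rw [norm_mul, norm_pow]; field_simp
    rw [e]
    calc _ ≤ 2 * airyC * A * (volRho 1 a t ^ 4 * (wt t ^ m)⁻¹) * (airyC * wt t) := by
          gcongr; exact inv_norm_outAiry_sq_le ht
      _ = _ := by rw [div_eq_mul_inv]; ring
  · have hs1 : -1 ≤ s := ht.trans hs
    have hw := wt_pos hs1
    have hr := volRho_pos zero_le_one ha hs1
    rw [norm_mul, norm_pow]
    calc _ ≤ airyC / wt s * (A * volRho 1 a s ^ 4 / wt s ^ (m + 1)) := by
          gcongr
          · exact norm_outAiry_sq_le hs1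
          · exact hE s hs
      _ = 2 * airyC * A * (volRho 1 a s ^ 4 * (1 / 2) * (wt s ^ (m + 2))⁻¹) := by
          field_simp; ring
      _ ≤ 2 * airyC * A * (volRho 1 a s ^ 4 * (m / 2) * (wt s ^ (m + 2))⁻¹) := by gcongr
      _ ≤ _ := by
          gcongr; exact le_add_of_nonneg_left (by positivity)
  · have hs1 : -1 ≤ s := ht.trans hs
    have hw := wt_pos hs1
    have hr := volRho_pos zero_le_one ha hs1
    positivity

theorem norm_div_airyP_le {X : ℂ} {B s : ℝ} (hs : -1 ≤ s) (hB : 0 ≤ B) (h : ‖X‖ ≤ B) :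
    ‖X / airyP s‖ ≤ airyC * B / wt s := by
  have h1 := inv_norm_airyP_le hs
  have h2 := wt_pos hs
  have h3 := airyC_pos
  rw [norm_div, div_eq_mul_inv]
  calc _ ≤ B * (airyC / wt s) := by gcongr
    _ = _ := by ring

theorem tendsto_of_le_volRho {f : ℝ → ℂ} {a B t : ℝ} (ha : 0 < a)
    (h : ∀ s, t ≤ s → ‖f s‖ ≤ B * volRho 1 a s) : Tendsto f atTop (𝓝 0) := by
  rw [tendsto_zero_iff_norm_tendsto_zero]
  have h0 := (tendsto_volRho zero_le_one ha).const_mul B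
  rw [mul_zero] at h0
  refine squeeze_zero' (Eventually.of_forall fun s => norm_nonneg _) ?_ h0
  filter_upwards [eventually_ge_atTop t] with s hs using h s hs

section ByParts

variable {h G G' : ℝ → ℂ} {a A t : ℝ}

/-- The forcing term of `h + G / p`. -/
def byPartsE (G G' : ℝ → ℂ) (s : ℝ) : ℂ := G' s / airyP s - G s / airyP s * airyP1 s / airyP s

theorem norm_byPartsE_le {s : ℝ} (hs : -1 ≤ s) (ha : 0 < a) (hA : 0 ≤ A)
    (bG : ‖G s‖ ≤ A * volRho 1 a s ^ 4) (bG' : ‖G' s‖ ≤ A * volRho 1 a s ^ 4 / wt s ^ 2) :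
    ‖byPartsE G G' s‖ ≤ 2 * airyC ^ 3 * A * volRho 1 a s ^ 4 / wt s ^ 3 := by
  have hw := wt_pos hs
  have hr := volRho_pos zero_le_one ha hs
  have hC := airyC_pos
  have hC1 := one_le_airyC
  have h1 := norm_div_airyP_le hs (by positivity) bG'
  have h2 := norm_div_airyP_le hs (by positivity) bG
  have h3 : ‖G s / airyP s * airyP1 s‖ ≤
      airyC * (A * volRho 1 a s ^ 4) / wt s * (airyC / wt s) := by
    rw [norm_mul]; gcongr
    exact norm_airyP1_le hs
  have h4 := norm_div_airyP_le hs (by positivity) h3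
  refine (norm_sub_le _ _).trans ((add_le_add h1 h4).trans ?_)
  have e : airyC * (A * volRho 1 a s ^ 4 / wt s ^ 2) / wt s +
      airyC * (airyC * (A * volRho 1 a s ^ 4) / wt s * (airyC / wt s)) / wt s =
      (airyC + airyC ^ 3) * (A * volRho 1 a s ^ 4 / wt s ^ 3) := by field_simp
  rw [e, show 2 * airyC ^ 3 * A * volRho 1 a s ^ 4 / wt s ^ 3 =
    (2 * airyC ^ 3) * (A * volRho 1 a s ^ 4 / wt s ^ 3) by ring]
  gcongr
  have : airyC ≤ airyC ^ 3 := le_self_pow₀ hC1 (by norm_num)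
  linarith

theorem hasDerivAt_byParts {s : ℝ} (hs : -1 ≤ s) (hh : HasDerivAt h (-(airyP s * h s) - G s) s)
    (hG : HasDerivAt G (G' s) s) :
    HasDerivAt (fun s => h s + G s / airyP s)
      (-(airyP s * (h s + G s / airyP s)) + byPartsE G G' s) s := by
  have hp := airyP_ne_zero hs
  refine (hh.add (hG.div (hasDerivAt_airyP s) hp)).congr_deriv ?_
  rw [byPartsE]; field_simp
  ring

theorem tendsto_byParts (ha : 0 < a) (ht : -1 ≤ t) (hA : 0 ≤ A)
    (bG : ∀ s, t ≤ s → ‖G s‖ ≤ A * volRho 1 a s ^ 4) (h0 : Tendsto h atTop (𝓝 0)) :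
    Tendsto (fun s => h s + G s / airyP s) atTop (𝓝 0) := by
  rw [← add_zero (0 : ℂ)]
  refine h0.add (tendsto_of_le_volRho ha (B := airyC * A) (t := t) fun s hs => ?_)
  have hs1 := ht.trans hs
  have hw := one_le_wt hs1
  have hr := volRho_pos zero_le_one ha hs1
  have hr1 := volRho_le_one zero_le_one ha hs1
  have hC := airyC_pos
  refine (norm_div_airyP_le hs1 (by positivity) (bG s hs)).trans ?_
  refine (div_le_self (by positivity) hw).trans ?_
  rw [mul_assoc]; gcongr
  exact pow_le_of_le_one hr.le hr1 (by norm_num)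

theorem norm_le_of_byParts (ha : 0 < a) (ht : -1 ≤ t) (hA : 0 ≤ A)
    (hh : ∀ s, t ≤ s → HasDerivAt h (-(airyP s * h s) - G s) s)
    (hG : ∀ s, t ≤ s → HasDerivAt G (G' s) s)
    (bG : ∀ s, t ≤ s → ‖G s‖ ≤ A * volRho 1 a s ^ 4)
    (bG' : ∀ s, t ≤ s → ‖G' s‖ ≤ A * volRho 1 a s ^ 4 / wt s ^ 2)
    (h0 : Tendsto h atTop (𝓝 0)) :
    ‖h t‖ ≤ 5 * airyC ^ 5 * A * volRho 1 a t ^ 4 / wt t := by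
  have hC := airyC_pos
  have key := norm_le_of_forcing (m := 2) (A := 2 * airyC ^ 3 * A) (by norm_num) ha ht
    (by positivity)
    (fun s hs => hasDerivAt_byParts (ht.trans hs) (hh s hs) (hG s hs))
    (fun s hs => norm_byPartsE_le (ht.trans hs) ha hA (bG s hs) (bG' s hs))
    (tendsto_byParts ha ht hA bG h0)
  have hw := wt_pos ht
  have hr := volRho_pos zero_le_one ha ht
  have h2 := norm_div_airyP_le ht (by positivity) (bG t le_rfl)
  have e : h t = (h t + G t / airyP t) - G t / airyP t := by ring
  rw [e]
  refine (norm_sub_le _ _).trans ((add_le_add key h2).trans ?_)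
  have e : 2 * airyC ^ 2 * (2 * airyC ^ 3 * A) * volRho 1 a t ^ 4 * wt t / wt t ^ 2 +
      airyC * (A * volRho 1 a t ^ 4) / wt t =
      (4 * airyC ^ 5 + airyC) * (A * volRho 1 a t ^ 4 / wt t) := by field_simp; ring
  rw [e, show 5 * airyC ^ 5 * A * volRho 1 a t ^ 4 / wt t =
    (5 * airyC ^ 5) * (A * volRho 1 a t ^ 4 / wt t) by ring]
  gcongr
  have : airyC ≤ airyC ^ 5 := le_self_pow₀ one_le_airyC (by norm_num)
  linarith

/-- The derivative of `byPartsE G G'`. -/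
def byPartsE' (G G' G'' : ℝ → ℂ) (s : ℝ) : ℂ :=
  G'' s / airyP s - 2 * (G' s / airyP s * airyP1 s / airyP s) -
    G s / airyP s * airyP2 s / airyP s +
    2 * (G s / airyP s * airyP1 s / airyP s * airyP1 s / airyP s)

theorem hasDerivAt_byPartsE {G'' : ℝ → ℂ} {s : ℝ} (hs : -1 ≤ s) (hG : HasDerivAt G (G' s) s)
    (hG' : HasDerivAt G' (G'' s) s) :
    HasDerivAt (byPartsE G G') (byPartsE' G G' G'' s) s := by
  have hp := airyP_ne_zero hs
  have h1 := hG'.div (hasDerivAt_airyP s) hp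
  have h2 := (((hG.div (hasDerivAt_airyP s) hp).mul (hasDerivAt_airyP1 s))).div
    (hasDerivAt_airyP s) hp
  refine (h1.sub h2).congr_deriv ?_
  simp only [byPartsE', Pi.div_apply, Pi.mul_apply]
  field_simp; ring

theorem norm_byPartsE'_le {G'' : ℝ → ℂ} {s : ℝ} (hs : -1 ≤ s) (ha : 0 < a) (hA : 0 ≤ A)
    (bG : ‖G s‖ ≤ A * volRho 1 a s ^ 4) (bG' : ‖G' s‖ ≤ A * volRho 1 a s ^ 4 / wt s ^ 2)
    (bG'' : ‖G'' s‖ ≤ A * volRho 1 a s ^ 4 / wt s ^ 4) :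
    ‖byPartsE' G G' G'' s‖ ≤ 6 * airyC ^ 5 * A * volRho 1 a s ^ 4 / wt s ^ 5 := by
  have hw := wt_pos hs
  have hr := volRho_pos zero_le_one ha hs
  have hC := airyC_pos
  have hC1 := one_le_airyC
  have step : ∀ {X : ℂ} {B : ℝ}, 0 ≤ B → ‖X‖ ≤ B →
      ‖X / airyP s * airyP1 s / airyP s‖ ≤ airyC ^ 3 * B / wt s ^ 3 := fun {X B} hB hX => by
    have h2 := norm_div_airyP_le hs hB hX
    have h3 : ‖X / airyP s * airyP1 s‖ ≤ airyC * B / wt s * (airyC / wt s) := by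
      rw [norm_mul]; gcongr
      exact norm_airyP1_le hs
    refine (norm_div_airyP_le hs (by positivity) h3).trans (le_of_eq ?_)
    field_simp
  have h1 := norm_div_airyP_le hs (by positivity) bG''
  have h2 := step (by positivity) bG'
  have h3 : ‖G s / airyP s * airyP2 s / airyP s‖ ≤
      airyC * (airyC * (A * volRho 1 a s ^ 4) / wt s * (airyC / wt s ^ 3)) / wt s := by
    refine norm_div_airyP_le hs (by positivity) ?_
    rw [norm_mul]; gcongr
    · exact norm_div_airyP_le hs (by positivity) bG
    · exact norm_airyP2_le hs
  have h4 := step (by positivity) bG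
  have h5 : ‖G s / airyP s * airyP1 s / airyP s * airyP1 s / airyP s‖ ≤
      airyC * (airyC ^ 3 * (A * volRho 1 a s ^ 4) / wt s ^ 3 * (airyC / wt s)) / wt s := by
    refine norm_div_airyP_le hs (by positivity) ?_
    rw [norm_mul]; gcongr
    exact norm_airyP1_le hs
  have n2 : ‖(2 : ℂ)‖ = 2 := by norm_num
  have tri : ‖byPartsE' G G' G'' s‖ ≤ ‖G'' s / airyP s‖ +
      2 * ‖G' s / airyP s * airyP1 s / airyP s‖ + ‖G s / airyP s * airyP2 s / airyP s‖ +
      2 * ‖G s / airyP s * airyP1 s / airyP s * airyP1 s / airyP s‖ := by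
    rw [byPartsE']
    refine (norm_add_le _ _).trans ?_
    rw [norm_mul, n2]; gcongr
    refine (norm_sub_le _ _).trans ?_
    gcongr
    refine (norm_sub_le _ _).trans ?_
    rw [norm_mul, n2]
  have p1 : airyC ≤ airyC ^ 5 := le_self_pow₀ hC1 (by norm_num)
  have p3 : airyC ^ 3 ≤ airyC ^ 5 := pow_le_pow_right₀ hC1 (by norm_num)
  set M := A * volRho 1 a s ^ 4 / wt s ^ 5 with hM
  have hM0 : 0 ≤ M := by positivity
  have e1 : airyC * (A * volRho 1 a s ^ 4 / wt s ^ 4) / wt s = airyC * M := by rw [hM]; field_simp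
  have e2 : airyC ^ 3 * (A * volRho 1 a s ^ 4 / wt s ^ 2) / wt s ^ 3 = airyC ^ 3 * M := by
    rw [hM]; field_simp
  have e3 : airyC * (airyC * (A * volRho 1 a s ^ 4) / wt s * (airyC / wt s ^ 3)) / wt s =
      airyC ^ 3 * M := by rw [hM]; field_simp
  have e5 : airyC * (airyC ^ 3 * (A * volRho 1 a s ^ 4) / wt s ^ 3 * (airyC / wt s)) / wt s =
      airyC ^ 5 * M := by rw [hM]; field_simp
  rw [e1] at h1
  rw [e2] at h2
  rw [e3] at h3
  rw [e5] at h5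
  have q1 : airyC * M ≤ airyC ^ 5 * M := by gcongr
  have q3 : airyC ^ 3 * M ≤ airyC ^ 5 * M := by gcongr
  rw [show 6 * airyC ^ 5 * A * volRho 1 a s ^ 4 / wt s ^ 5 = 6 * (airyC ^ 5 * M) by rw [hM]; ring]
  linarith

theorem norm_deriv_le_of_byParts {G'' : ℝ → ℂ} (ha : 0 < a) (ht : -1 ≤ t) (hA : 0 ≤ A)
    (hh : ∀ s, t ≤ s → HasDerivAt h (-(airyP s * h s) - G s) s)
    (hG : ∀ s, t ≤ s → HasDerivAt G (G' s) s)
    (hG' : ∀ s, t ≤ s → HasDerivAt G' (G'' s) s)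
    (bG : ∀ s, t ≤ s → ‖G s‖ ≤ A * volRho 1 a s ^ 4)
    (bG' : ∀ s, t ≤ s → ‖G' s‖ ≤ A * volRho 1 a s ^ 4 / wt s ^ 2)
    (bG'' : ∀ s, t ≤ s → ‖G'' s‖ ≤ A * volRho 1 a s ^ 4 / wt s ^ 4)
    (h0 : Tendsto h atTop (𝓝 0)) :
    ‖-(airyP t * h t) - G t‖ ≤ 20 * airyC ^ 9 * A * volRho 1 a t ^ 4 / wt t ^ 3 := by
  have hC := airyC_pos
  have hC1 := one_le_airyC
  have bE : ∀ s, t ≤ s → ‖byPartsE G G' s‖ ≤ 2 * airyC ^ 3 * A * volRho 1 a s ^ 4 / wt s ^ 3 :=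
    fun s hs => norm_byPartsE_le (ht.trans hs) ha hA (bG s hs) (bG' s hs)
  have bE' : ∀ s, t ≤ s → ‖byPartsE' G G' G'' s‖ ≤
      6 * airyC ^ 5 * A * volRho 1 a s ^ 4 / wt s ^ 5 :=
    fun s hs => norm_byPartsE'_le (ht.trans hs) ha hA (bG s hs) (bG' s hs) (bG'' s hs)
  have dE := fun s (hs : t ≤ s) => hasDerivAt_byPartsE (ht.trans hs) (hG s hs) (hG' s hs)
  have df : ∀ s, t ≤ s → HasDerivAt (fun s => h s + G s / airyP s)
      (-(airyP s * (h s + G s / airyP s)) - (-byPartsE G G' s)) s := fun s hs =>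
    (hasDerivAt_byParts (ht.trans hs) (hh s hs) (hG s hs)).congr_deriv (by ring)
  have d2 : ∀ s, t ≤ s → HasDerivAt
      (fun s => (h s + G s / airyP s) + (-byPartsE G G' s) / airyP s)
      (-(airyP s * ((h s + G s / airyP s) + (-byPartsE G G' s) / airyP s)) +
        byPartsE (fun s => -byPartsE G G' s) (fun s => -byPartsE' G G' G'' s) s) s :=
    fun s hs => hasDerivAt_byParts (h := fun s => h s + G s / airyP s)
      (G := fun s => -byPartsE G G' s) (G' := fun s => -byPartsE' G G' G'' s)
      (ht.trans hs) (df s hs) (dE s hs).neg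
  have bF : ∀ s, t ≤ s →
      ‖byPartsE (fun s => -byPartsE G G' s) (fun s => -byPartsE' G G' G'' s) s‖ ≤
        8 * airyC ^ 6 * A * volRho 1 a s ^ 4 / wt s ^ (5 + 1) := fun s hs => by
    have hs1 := ht.trans hs
    have hw := wt_pos hs1
    have hr := volRho_pos zero_le_one ha hs1
    have h1 := norm_div_airyP_le hs1 (by positivity) ((norm_neg _).trans_le (bE' s hs))
    have h2 := norm_div_airyP_le hs1 (by positivity) ((norm_neg _).trans_le (bE s hs))
    have h3 : ‖-byPartsE G G' s / airyP s * airyP1 s‖ ≤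
        airyC * (2 * airyC ^ 3 * A * volRho 1 a s ^ 4 / wt s ^ 3) / wt s * (airyC / wt s) := by
      rw [norm_mul]; gcongr
      exact norm_airyP1_le hs1
    have h4 := norm_div_airyP_le hs1 (by positivity) h3
    rw [byPartsE]
    refine (norm_sub_le _ _).trans ((add_le_add h1 h4).trans (le_of_eq ?_))
    field_simp; ring
  have t0 : Tendsto (fun s => (h s + G s / airyP s) + (-byPartsE G G' s) / airyP s) atTop
      (𝓝 0) := by
    refine tendsto_byParts ha ht (A := 2 * airyC ^ 3 * A) (by positivity) (fun s hs => ?_)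
      (tendsto_byParts ha ht hA bG h0)
    have hs1 := ht.trans hs
    have hr := volRho_pos zero_le_one ha hs1
    rw [norm_neg]; exact (bE s hs).trans (div_le_self (by positivity) (one_le_pow₀ (one_le_wt hs1)))
  have key := norm_le_of_forcing (m := 5) (A := 8 * airyC ^ 6 * A) (by norm_num) ha ht
    (by positivity) d2 bF t0
  have hw := wt_pos ht
  have hr := volRho_pos zero_le_one ha ht
  have hp := airyP_ne_zero ht
  have h2 := norm_div_airyP_le ht (by positivity) ((norm_neg _).trans_le (bE t le_rfl))
  have e : -(airyP t * h t) - G t = -(airyP t * (((h t + G t / airyP t) +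
      (-byPartsE G G' t) / airyP t) - (-byPartsE G G' t) / airyP t)) := by field_simp; ring
  rw [e, norm_neg, norm_mul]
  calc _ ≤ airyC * wt t * (2 * airyC ^ 2 * (8 * airyC ^ 6 * A) * volRho 1 a t ^ 4 * wt t /
        wt t ^ 5 + airyC * (2 * airyC ^ 3 * A * volRho 1 a t ^ 4 / wt t ^ 3) / wt t) := by
        gcongr
        · exact norm_airyP_le ht
        · exact (norm_sub_le _ _).trans (add_le_add key h2)
    _ = (16 * airyC ^ 9 + 2 * airyC ^ 5) * (A * volRho 1 a t ^ 4 / wt t ^ 3) := by field_simp; ring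
    _ ≤ (20 * airyC ^ 9) * (A * volRho 1 a t ^ 4 / wt t ^ 3) := by
        gcongr
        have : airyC ^ 5 ≤ airyC ^ 9 := pow_le_pow_right₀ hC1 (by norm_num)
        have : 0 < airyC ^ 9 := by positivity
        linarith
    _ = _ := by ring

end ByParts

/-! ### Volterra operators on bounded continuous functions -/

/-- Bounded continuous functions. -/
abbrev BC := BoundedContinuousFunction ℝ ℂ

open Classical in
/-- A function as a bounded continuous function, if it is one. -/
def toBC (f : ℝ → ℂ) : BC := if h : Continuous f ∧ ∃ C, ∀ s, ‖f s‖ ≤ C then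
    BoundedContinuousFunction.ofNormedAddCommGroup f h.1 h.2.choose h.2.choose_spec else 0

theorem toBC_apply {f : ℝ → ℂ} (hf : Continuous f) {C : ℝ} (hC : ∀ s, ‖f s‖ ≤ C) (s : ℝ) :
    toBC f s = f s := by
  have h : Continuous f ∧ ∃ C, ∀ s, ‖f s‖ ≤ C := ⟨hf, C, hC⟩
  rw [toBC, dif_pos h]; rfl

/-- The retraction onto `[-1, ∞)`. -/
def clampL (s : ℝ) : ℝ := max s (-1)

theorem neg_one_le_clampL (s : ℝ) : -1 ≤ clampL s := le_max_right _ _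

theorem clampL_of_le {s : ℝ} (hs : -1 ≤ s) : clampL s = s := max_eq_left hs

theorem continuous_clampL : Continuous clampL := by unfold clampL; fun_prop

theorem tailInt_add {F G : ℝ → ℂ} (hF : Continuous F) (hG : Continuous G)
    (hF' : IntegrableOn F (Ioi (-1))) (hG' : IntegrableOn G (Ioi (-1))) (t : ℝ) :
    tailInt (fun s => F s + G s) t = tailInt F t + tailInt G t := by
  rw [tailInt, tailInt, tailInt, integral_add hF' hG',
    intervalIntegral.integral_add (hF.intervalIntegrable _ _) (hG.intervalIntegrable _ _)]
  ring

theorem tailInt_const_mul (c : ℂ) (F : ℝ → ℂ) (t : ℝ) :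
    tailInt (fun s => c * F s) t = c * tailInt F t := by
  rw [tailInt, tailInt, integral_const_mul, intervalIntegral.integral_const_mul]; ring

/-- The function `g(s) (s + 2)⁻²`, continued as `g` to the left of `-1`. -/
def wgt (g : BC) (s : ℝ) : ℂ := (((wt (clampL s) ^ 4)⁻¹ : ℝ) : ℂ) * g s

theorem wt_clampL_pos (s : ℝ) : 0 < wt (clampL s) := wt_pos (neg_one_le_clampL s)

theorem continuous_wgt (g : BC) : Continuous (wgt g) := by
  have h1 : Continuous fun s => (wt (clampL s) ^ 4)⁻¹ :=
    ((continuous_wt.comp continuous_clampL).pow 4).inv₀ fun s => (pow_pos (wt_clampL_pos s) 4).ne'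
  exact (continuous_ofReal.comp h1).mul g.continuous

theorem norm_wgt_le (g : BC) {s : ℝ} (hs : -1 ≤ s) : ‖wgt g s‖ ≤ ‖g‖ * volRho 0 1 s ^ 4 := by
  have h := wt_pos hs
  have e : volRho 0 1 s ^ 4 = (wt s ^ 4)⁻¹ := by rw [volRho]; field_simp; ring
  rw [wgt, norm_mul, norm_real, Real.norm_of_nonneg (by have := wt_clampL_pos s; positivity),
    clampL_of_le hs, mul_comm, e]
  gcongr; exact g.norm_coe_le_norm s

theorem wgt_add (f g : BC) (s : ℝ) : wgt (f + g) s = wgt f s + wgt g s := by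
  simp only [wgt, BoundedContinuousFunction.add_apply]; ring

theorem wgt_smul (c : ℂ) (g : BC) (s : ℝ) : wgt (c • g) s = c * wgt g s := by
  simp only [wgt, BoundedContinuousFunction.smul_apply, smul_eq_mul]; ring

theorem tailInt_kernel_add {k : ℝ → ℂ} (hk : Continuous k) (hk' : ∀ s, ‖k s‖ = ‖outAiry s‖ ^ 2)
    (f g : BC) (t : ℝ) : tailInt (fun s => k s * wgt (f + g) s) t =
      tailInt (fun s => k s * wgt f s) t + tailInt (fun s => k s * wgt g s) t := by
  have hf := continuous_wgt f
  have hg := continuous_wgt g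
  have i : ∀ f : BC, IntegrableOn (fun s => k s * wgt f s) (Ioi (-1)) := fun f =>
    integrableOn_of_le_volRho (by have := continuous_wgt f; fun_prop) le_rfl one_pos
      (norm_kernel_le hk' fun s hs => norm_wgt_le f hs)
  rw [← tailInt_add (by fun_prop) (by fun_prop) (i f) (i g)]; simp only [wgt_add, mul_add]

theorem tailInt_kernel_smul (k : ℝ → ℂ) (c : ℂ) (g : BC) (t : ℝ) :
    tailInt (fun s => k s * wgt (c • g) s) t = c * tailInt (fun s => k s * wgt g s) t := by
  rw [← tailInt_const_mul]; simp only [wgt_smul, mul_left_comm]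

theorem volT_wgt_add (f g : BC) (t : ℝ) :
    volT (wgt (f + g)) t = volT (wgt f) t + volT (wgt g) t := by
  have hψ := continuous_outAiry
  rw [volT, tailInt_kernel_add (by fun_prop) (fun s => norm_pow _ _), add_div]; rfl

theorem volT_wgt_smul (c : ℂ) (g : BC) (t : ℝ) :
    volT (wgt (c • g)) t = c * volT (wgt g) t := by
  rw [volT, tailInt_kernel_smul, mul_div_assoc]; rfl

theorem volB_wgt_add (f g : BC) (t : ℝ) :
    volB (wgt (f + g)) t = volB (wgt f) t + volB (wgt g) t := by
  have hψ := continuous_outAiry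
  simp only [volB]
  rw [tailInt_kernel_add (by fun_prop) (fun s => norm_pow _ _),
    tailInt_kernel_add (by fun_prop) (fun s => by rw [norm_mul, RCLike.norm_conj, sq])]
  ring

theorem volB_wgt_smul (c : ℂ) (g : BC) (t : ℝ) :
    volB (wgt (c • g)) t = c * volB (wgt g) t := by
  simp only [volB]
  rw [tailInt_kernel_smul, tailInt_kernel_smul]; ring

theorem continuous_volT_wgt (g : BC) : Continuous (volT (wgt g)) :=
  continuous_iff_continuousAt.mpr fun t => (hasDerivAt_volT (continuous_wgt g) t).continuousAt

theorem continuous_volB_wgt (g : BC) : Continuous (volB (wgt g)) :=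
  continuous_iff_continuousAt.mpr fun t => (hasDerivAt_volB (continuous_wgt g) t).continuousAt

theorem norm_volT_wgt_le (g : BC) (t : ℝ) : ‖volT (wgt g) (clampL t)‖ ≤ airyC ^ 2 * ‖g‖ := by
  have h := norm_volT_le (continuous_wgt g) le_rfl one_pos (fun s hs => norm_wgt_le g hs)
    (neg_one_le_clampL t)
  have hC := airyC_pos
  have h1 := volRho_pos le_rfl one_pos (neg_one_le_clampL t)
  refine h.trans (mul_le_of_le_one_right (by positivity) ?_)
  exact pow_le_one₀ h1.le (volRho_le_one le_rfl one_pos (neg_one_le_clampL t))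

theorem norm_volB_wgt_le (g : BC) (t : ℝ) :
    ‖volB (wgt g) (clampL t)‖ ≤ ‖airyW‖⁻¹ * 2 * airyC * ‖g‖ := by
  have h := norm_volB_le (continuous_wgt g) le_rfl one_pos (fun s hs => norm_wgt_le g hs)
    (neg_one_le_clampL t)
  have hC := airyC_pos
  have h1 := volRho_pos le_rfl one_pos (neg_one_le_clampL t)
  refine h.trans (mul_le_of_le_one_right (by positivity) ?_)
  exact pow_le_one₀ h1.le (volRho_le_one le_rfl one_pos (neg_one_le_clampL t))

theorem toBC_volT_apply (g : BC) (t : ℝ) :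
    toBC (fun t => volT (wgt g) (clampL t)) t = volT (wgt g) (clampL t) :=
  toBC_apply ((continuous_volT_wgt g).comp continuous_clampL) (norm_volT_wgt_le g) t

theorem toBC_volB_apply (g : BC) (t : ℝ) :
    toBC (fun t => volB (wgt g) (clampL t)) t = volB (wgt g) (clampL t) :=
  toBC_apply ((continuous_volB_wgt g).comp continuous_clampL) (norm_volB_wgt_le g) t

/-- `volT` as an operator on bounded continuous functions. -/
def opT : BC →L[ℝ] BC := LinearMap.mkContinuous
    { toFun := fun g => toBC fun t => volT (wgt g) (clampL t)
      map_add' := fun f g => by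
        ext t; rw [BoundedContinuousFunction.add_apply]; simp only [toBC_volT_apply]; exact volT_wgt_add f g _
      map_smul' := fun c g => by
        ext t
        have : c • g = (c : ℂ) • g := by ext; simp
        rw [this, toBC_volT_apply, volT_wgt_smul]; simp [toBC_volT_apply] }
    (airyC ^ 2) fun g => by
      have hC := airyC_pos
      refine (BoundedContinuousFunction.norm_le (by positivity)).mpr fun t => ?_
      exact (congrArg norm (toBC_volT_apply g t)).trans_le (norm_volT_wgt_le g t)

/-- `volB` as an operator on bounded continuous functions. -/
def opB : BC →L[ℝ] BC := LinearMap.mkContinuous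
    { toFun := fun g => toBC fun t => volB (wgt g) (clampL t)
      map_add' := fun f g => by
        ext t; rw [BoundedContinuousFunction.add_apply]; simp only [toBC_volB_apply]; exact volB_wgt_add f g _
      map_smul' := fun c g => by
        ext t
        have : c • g = (c : ℂ) • g := by ext; simp
        rw [this, toBC_volB_apply, volB_wgt_smul]; simp [toBC_volB_apply] }
    (‖airyW‖⁻¹ * 2 * airyC) fun g => by
      have hC := airyC_pos
      refine (BoundedContinuousFunction.norm_le (by positivity)).mpr fun t => ?_
      exact (congrArg norm (toBC_volB_apply g t)).trans_le (norm_volB_wgt_le g t)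

theorem opT_apply (g : BC) (t : ℝ) : opT g t = volT (wgt g) (clampL t) := toBC_volT_apply g t

theorem opB_apply (g : BC) (t : ℝ) : opB g t = volB (wgt g) (clampL t) := toBC_volB_apply g t

theorem clampL_eventuallyEq {t : ℝ} (ht : -1 < t) (f : ℝ → ℂ) :
    (fun s => f (clampL s)) =ᶠ[𝓝 t] f := by
  filter_upwards [Ioi_mem_nhds ht] with s hs
  rw [clampL_of_le (le_of_lt hs)]

theorem hasDerivAt_opB (g : BC) {t : ℝ} (ht : -1 < t) : HasDerivAt (opB g) (opT g t) t := by
  rw [opT_apply, clampL_of_le ht.le]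
  refine (hasDerivAt_volB (continuous_wgt g) t).congr_of_eventuallyEq ?_
  rw [show ⇑(opB g) = fun t => volB (wgt g) (clampL t) from funext (opB_apply g)]
  exact clampL_eventuallyEq ht _

theorem hasDerivAt_opT (g : BC) {t : ℝ} (ht : -1 < t) :
    HasDerivAt (opT g) (-(airyP t * opT g t) - wgt g t) t := by
  rw [opT_apply, clampL_of_le ht.le]
  refine (hasDerivAt_volT (continuous_wgt g) t).congr_of_eventuallyEq ?_
  rw [show ⇑(opT g) = fun t => volT (wgt g) (clampL t) from funext (opT_apply g)]
  exact clampL_eventuallyEq ht _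

/-! ### The perturbation as a smooth family of bounded continuous functions -/

theorem contDiffOn_succ_of_partial {F F1 F2 : ℝ × ℝ → ℂ} {Ω : Set (ℝ × ℝ)} (hΩ : IsOpen Ω)
    {n : ℕ} (h1 : ∀ p ∈ Ω, HasDerivAt (fun v => F (v, p.2)) (F1 p) p.1)
    (h2 : ∀ p ∈ Ω, HasDerivAt (fun t => F (p.1, t)) (F2 p) p.2)
    (c1 : ContDiffOn ℝ n F1 Ω) (c2 : ContDiffOn ℝ n F2 Ω) : ContDiffOn ℝ (n + 1 : ℕ) F Ω := by
  set D : ℝ × ℝ → (ℝ × ℝ →L[ℝ] ℂ) := fun p =>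
    ((ContinuousLinearMap.fst ℝ ℝ ℝ).smulRight (F1 p)) +
      ((ContinuousLinearMap.snd ℝ ℝ ℝ).smulRight (F2 p))
  have hD : ∀ p ∈ Ω, HasFDerivAt F (D p) p := fun p hp => by
    have hn := hΩ.mem_nhds hp
    have key := hasStrictFDerivAt_uncurry_coprod (𝕜 := ℝ) (u := p) (f := fun v t => F (v, t))
      (f₁ := fun v t => ContinuousLinearMap.toSpanSingleton ℝ (F1 (v, t)))
      (f₂ := fun v t => ContinuousLinearMap.toSpanSingleton ℝ (F2 (v, t)))
      (by filter_upwards [hn] with q hq using (h1 q hq).hasFDerivAt)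
      (by filter_upwards [hn] with q hq using (h2 q hq).hasFDerivAt)
      (((ContinuousLinearMap.toSpanSingletonCLE (𝕜 := ℝ) (E := ℂ)).continuous.continuousAt).comp
        (c1.continuousOn.continuousAt hn))
      (((ContinuousLinearMap.toSpanSingletonCLE (𝕜 := ℝ) (E := ℂ)).continuous.continuousAt).comp
        (c2.continuousOn.continuousAt hn))
    refine key.hasFDerivAt.congr_fderiv ?_
    ext <;> simp [D, Function.HasUncurry.uncurry]
  have hc : ContDiffOn ℝ n D Ω := (((ContinuousLinearMap.smulRightL ℝ (ℝ × ℝ) ℂ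
      (ContinuousLinearMap.fst ℝ ℝ ℝ)).contDiff.comp_contDiffOn c1)).add
    ((ContinuousLinearMap.smulRightL ℝ (ℝ × ℝ) ℂ
      (ContinuousLinearMap.snd ℝ ℝ ℝ)).contDiff.comp_contDiffOn c2)
  rw [show ((n + 1 : ℕ) : WithTop ℕ∞) = (n : WithTop ℕ∞) + 1 by norm_cast,
    contDiffOn_succ_iff_fderiv_of_isOpen hΩ]
  refine ⟨fun p hp => (hD p hp).differentiableAt.differentiableWithinAt, ?_, ?_⟩
  · intro h; exact absurd h (by simp)
  · exact hc.congr fun p hp => (hD p hp).fderiv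

theorem norm_taylor_le {f f1 f2 : ℝ → ℂ} {v w b C : ℝ} (hv : v < b) (hw : w < b)
    (h1 : ∀ x < b, HasDerivAt f (f1 x) x) (h2 : ∀ x < b, HasDerivAt f1 (f2 x) x)
    (hC : ∀ x < b, ‖f2 x‖ ≤ C) : ‖f w - f v - (w - v : ℝ) * f1 v‖ ≤ C * |w - v| ^ 2 := by
  have hC0 : 0 ≤ C := (norm_nonneg _).trans (hC v hv)
  have hsub : ∀ x ∈ uIcc v w, x < b := fun x hx =>
    lt_of_le_of_lt hx.2 (max_lt hv hw)
  have hb : ∀ x ∈ uIcc v w, ‖f1 x - f1 v‖ ≤ C * |w - v| := fun x hx => by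
    have h := (convex_Iio b).norm_image_sub_le_of_norm_hasDerivWithin_le (𝕜 := ℝ)
      (fun x hx => (h2 x hx).hasDerivWithinAt) (fun x hx => hC x hx) hv (hsub x hx)
    refine h.trans ?_
    gcongr; rw [norm_eq_abs]
    exact abs_sub_left_of_mem_uIcc hx
  have h := (convex_uIcc v w).norm_image_sub_le_of_norm_hasDerivWithin_le (𝕜 := ℝ)
    (f := fun x => f x - ((x - v : ℝ) : ℂ) * f1 v) (f' := fun x => f1 x - f1 v)
    (fun x hx => by
      have e := (((hasDerivAt_id x).sub_const v).ofReal_comp).mul_const (f1 v)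
      refine ((h1 x (hsub x hx)).sub e).hasDerivWithinAt.congr_deriv ?_
      simp) hb left_mem_uIcc right_mem_uIcc
  rw [norm_eq_abs] at h
  simp only [sub_self, Complex.ofReal_zero, zero_mul, sub_zero] at h
  calc _ = ‖f w - ((w - v : ℝ) : ℂ) * f1 v - f v‖ := by congr 1; ring
    _ ≤ _ := h
    _ = _ := by ring

theorem hasDerivAt_BC {F F1 F2 : ℝ → BC} {b C : ℝ}
    (h1 : ∀ x < b, ∀ s, HasDerivAt (fun x => F x s) (F1 x s) x)
    (h2 : ∀ x < b, ∀ s, HasDerivAt (fun x => F1 x s) (F2 x s) x)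
    (hC : ∀ x < b, ‖F2 x‖ ≤ C) {v : ℝ} (hv : v < b) : HasDerivAt F (F1 v) v := by
  rw [hasDerivAt_iff_isLittleO]
  have hO : (fun w => F w - F v - (w - v) • F1 v) =O[𝓝 v] fun w => |w - v| ^ 2 := by
    refine Asymptotics.IsBigO.of_bound C ?_
    filter_upwards [Iio_mem_nhds hv] with w hw
    have hC0 : 0 ≤ C := (norm_nonneg _).trans (hC v hv)
    refine (BoundedContinuousFunction.norm_le (by positivity)).mpr fun s => ?_
    have h := norm_taylor_le hv hw (fun x hx => h1 x hx s) (fun x hx => h2 x hx s)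
      (fun x hx => ((F2 x).norm_coe_le_norm s).trans (hC x hx))
    rw [Real.norm_of_nonneg (by positivity)]; simpa using h
  refine hO.trans_isLittleO ?_
  have : (fun w : ℝ => |w - v| ^ 2) = fun w => (w - v) ^ 2 := by ext; rw [sq_abs]
  rw [this]
  have h0 : Tendsto (fun w : ℝ => w - v) (𝓝 v) (𝓝 0) := by
    have : Tendsto (fun w : ℝ => w - v) (𝓝 v) (𝓝 (v - v)) := tendsto_id.sub_const v
    rwa [sub_self] at this
  exact (Asymptotics.isLittleO_pow_id (by norm_num : 1 < 2)).comp_tendsto h0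

/-- An upper bound for the logarithmic parameter `v = log σ / 3`. -/
def volV0 : ℝ := min 0 (log (-zetaMin / 2) / 2)

theorem exp_lt_one_of_lt {v : ℝ} (hv : v < volV0) : exp v < 1 :=
  Real.exp_lt_one_iff.mpr (hv.trans_le (min_le_left _ _))

theorem zetaMin_lt_mul {v s : ℝ} (hv : v < volV0) (hs : -1 ≤ s) :
    zetaMin / 2 < exp v ^ 2 * s := by
  have h1 : 2 * v < log (-zetaMin / 2) := by have := hv.trans_le (min_le_right _ _); linarith
  have h2 : exp v ^ 2 < -zetaMin / 2 := by
    have h := zetaMin_neg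
    rw [← Real.exp_log (by linarith : 0 < -zetaMin / 2), ← Real.exp_nat_mul]
    exact Real.exp_lt_exp.mpr (by push_cast; exact h1)
  have := exp_pos v
  nlinarith

/-- The dilate of a symbol. -/
def symFun (k : ℕ) (W : ℝ → ℝ) (v s : ℝ) : ℝ := exp v ^ k * W (exp v ^ 2 * s)

/-- The symbol whose dilates are the derivatives of the dilates of `W` in `v`. -/
def volD (W : ℝ → ℝ) (z : ℝ) : ℝ := 2 * eulerOp 2 W z

theorem IsSymbol.volD {a : ℝ} {W : ℝ → ℝ} (h : IsSymbol a 2 W) : IsSymbol a 2 (volD W) :=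
  (h.eulerOp 2).const_mul 2

theorem IsSymbol.hasDerivAt {a : ℝ} {m : ℕ} {W : ℝ → ℝ} (h : IsSymbol a m W) {z : ℝ}
    (hz : a < z) : HasDerivAt W (_root_.deriv W z) z :=
  hasDerivAt_of_contDiffOn isOpen_Ioi h.1 hz

theorem hasDerivAt_symFun {W : ℝ → ℝ} (hW : IsSymbol (zetaMin / 2) 2 W) {v s : ℝ}
    (hv : v < volV0) (hs : -1 ≤ s) :
    HasDerivAt (fun v => symFun 4 W v s) (symFun 4 (volD W) v s) v := by
  have h1 := hW.hasDerivAt (zetaMin_lt_mul hv hs)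
  have h2 := ((Real.hasDerivAt_exp v).pow 2).mul_const s
  have h3 := ((Real.hasDerivAt_exp v).pow 4).mul (h1.comp v h2)
  refine h3.congr_deriv ?_
  simp only [symFun, volD, eulerOp, Function.comp, Pi.pow_apply]
  push_cast; ring

theorem hasDerivAt_symFun_right {k : ℕ} {W : ℝ → ℝ} {m : ℕ} (hW : IsSymbol (zetaMin / 2) m W)
    {v s : ℝ} (hv : v < volV0) (hs : -1 ≤ s) :
    HasDerivAt (symFun k W v) (symFun (k + 2) (deriv W) v s) s := by
  have h1 := hW.hasDerivAt (zetaMin_lt_mul hv hs)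
  have h3 := (h1.comp s ((hasDerivAt_id s).const_mul (exp v ^ 2))).const_mul (exp v ^ k)
  refine h3.congr_deriv ?_
  simp only [symFun]
  ring

theorem exists_symFun_le {W : ℝ → ℝ} {k : ℕ} (hW : IsSymbol (zetaMin / 2) (2 + k) W) :
    ∃ C, 0 ≤ C ∧ ∀ v < volV0, ∀ s, -1 ≤ s →
      |symFun (4 + 2 * k) W v s| ≤ C * volRho 1 (exp v) s ^ 4 / wt s ^ (2 * k) := by
  obtain ⟨C, hC⟩ := hW.2 0
  refine ⟨|C| * (4 * 4 ^ 2 * 3 ^ k), by positivity, fun v hv s hs => ?_⟩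
  have ha := exp_pos v
  have ha1 := exp_lt_one_of_lt hv
  have hz := zetaMin_lt_mul hv hs
  have hw := wt_pos hs
  have hw2 := wt_sq hs
  have h := hC _ hz
  simp only [iteratedDeriv_zero, add_zero] at h
  set a := exp v
  set Z := 1 + |a ^ 2 * s| with hZ
  have hZ1 : 1 ≤ Z := by rw [hZ]; linarith [abs_nonneg (a ^ 2 * s)]
  have haw : a ^ 2 * wt s ^ 2 ≤ 3 * Z := by
    rw [hw2, hZ]
    have := le_abs_self (a ^ 2 * s)
    nlinarith
  have hR : (1 + a * wt s) ^ 4 ≤ 4 * (4 * Z) ^ 2 := by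
    have h1 : (1 + a * wt s) ^ 2 ≤ 2 * (4 * Z) := by nlinarith [sq_nonneg (1 - a * wt s)]
    calc (1 + a * wt s) ^ 4 = ((1 + a * wt s) ^ 2) ^ 2 := by ring
      _ ≤ (2 * (4 * Z)) ^ 2 := by gcongr
      _ = _ := by ring
  have hk : (a ^ 2 * wt s ^ 2) ^ k ≤ (3 * Z) ^ k := by gcongr
  have e : a ^ (4 + 2 * k) = a ^ 4 * (a ^ 2) ^ k := by rw [pow_add, pow_mul]
  have e' : wt s ^ (2 * k) = (wt s ^ 2) ^ k := by rw [pow_mul]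
  rw [symFun, abs_mul, abs_of_pos (by positivity : 0 < a ^ (4 + 2 * k)), volRho, div_pow,
    le_div_iff₀ (by positivity), ← mul_div_assoc, le_div_iff₀ (by positivity), e, e']
  have hWn := abs_nonneg (W (a ^ 2 * s))
  calc a ^ 4 * (a ^ 2) ^ k * |W (a ^ 2 * s)| * (wt s ^ 2) ^ k * (1 + a * wt s) ^ 4
      = a ^ 4 * |W (a ^ 2 * s)| * ((a ^ 2 * wt s ^ 2) ^ k * (1 + a * wt s) ^ 4) := by
        rw [mul_pow]; ring
    _ ≤ a ^ 4 * |W (a ^ 2 * s)| * ((3 * Z) ^ k * (4 * (4 * Z) ^ 2)) := by gcongr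
    _ = a ^ 4 * (4 * 4 ^ 2 * 3 ^ k) * (|W (a ^ 2 * s)| * Z ^ (2 + k)) := by
        rw [mul_pow, pow_add]; ring
    _ ≤ a ^ 4 * (4 * 4 ^ 2 * 3 ^ k) * |C| := by gcongr; exact h.trans (le_abs_self C)
    _ = _ := by ring

/-- The dilate of a symbol as a bounded continuous function, with a weight. -/
def symBC (W : ℝ → ℝ) (v : ℝ) : BC :=
  toBC fun s => ((wt (clampL s) ^ 4 * symFun 4 W v (clampL s) : ℝ) : ℂ)

theorem exists_symBC_le {W : ℝ → ℝ} (hW : IsSymbol (zetaMin / 2) 2 W) :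
    ∃ C, 0 ≤ C ∧ ∀ v < volV0, ∀ s, |wt (clampL s) ^ 4 * symFun 4 W v (clampL s)| ≤ C := by
  obtain ⟨C, hC0, hC⟩ := exists_symFun_le (k := 0) hW
  refine ⟨C, hC0, fun v hv s => ?_⟩
  have hs := neg_one_le_clampL s
  have h := hC v hv _ hs
  have hw := wt_pos hs
  have hr := volRho_pos zero_le_one (exp_pos v) hs
  have h1 := volRho_mul_wt_le zero_le_one (exp_pos v) hs
  simp only [mul_zero, add_zero, pow_zero, div_one] at h
  rw [abs_mul, abs_of_pos (by positivity)]
  calc _ ≤ wt (clampL s) ^ 4 * (C * volRho 1 (exp v) (clampL s) ^ 4) := by gcongr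
    _ = C * (volRho 1 (exp v) (clampL s) * wt (clampL s)) ^ 4 := by ring
    _ ≤ C * 1 := by gcongr; exact pow_le_one₀ (by positivity) h1
    _ = C := mul_one C

theorem symBC_apply {W : ℝ → ℝ} (hW : IsSymbol (zetaMin / 2) 2 W) {v : ℝ} (hv : v < volV0)
    (s : ℝ) : symBC W v s = ((wt (clampL s) ^ 4 * symFun 4 W v (clampL s) : ℝ) : ℂ) := by
  obtain ⟨C, hC0, hC⟩ := exists_symBC_le hW
  refine toBC_apply (C := C) (continuous_ofReal.comp ?_) (fun s => ?_) s
  · refine ((continuous_wt.comp continuous_clampL).pow 4).mul (continuous_const.mul ?_)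
    refine hW.1.continuousOn.comp_continuous (continuous_const.mul continuous_clampL) fun s => ?_
    exact zetaMin_lt_mul hv (neg_one_le_clampL s)
  · exact (norm_real _).trans_le (hC v hv s)

theorem hasDerivAt_symBC {W : ℝ → ℝ} (hW : IsSymbol (zetaMin / 2) 2 W) {v : ℝ} (hv : v < volV0) :
    HasDerivAt (symBC W) (symBC (volD W) v) v := by
  have hd : ∀ {W : ℝ → ℝ}, IsSymbol (zetaMin / 2) 2 W → ∀ x < volV0, ∀ s,
      HasDerivAt (fun x => symBC W x s) (symBC (volD W) x s) x := fun {W} hW x hx s => by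
    have h := ((hasDerivAt_symFun hW hx (neg_one_le_clampL s)).const_mul
      (wt (clampL s) ^ 4)).ofReal_comp
    rw [symBC_apply hW.volD hx]
    refine h.congr_of_eventuallyEq ?_
    filter_upwards [Iio_mem_nhds hx] with y hy using symBC_apply hW hy s
  obtain ⟨C, hC0, hC⟩ := exists_symBC_le hW.volD.volD
  refine hasDerivAt_BC (hd hW) (hd hW.volD) (C := C) (fun x hx => ?_) hv
  refine (BoundedContinuousFunction.norm_le hC0).mpr fun s => ?_
  rw [symBC_apply hW.volD.volD hx, norm_real]; exact hC x hx s

theorem contDiffOn_symBC {W : ℝ → ℝ} (hW : IsSymbol (zetaMin / 2) 2 W) :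
    ContDiffOn ℝ ∞ (symBC W) (Iio volV0) := by
  rw [contDiffOn_infty]
  intro n
  induction n generalizing W with
  | zero =>
    exact contDiffOn_zero.mpr fun v hv => (hasDerivAt_symBC hW hv).continuousAt.continuousWithinAt
  | succ n ih =>
    rw [show ((n + 1 : ℕ) : WithTop ℕ∞) = (n : WithTop ℕ∞) + 1 by norm_cast,
      contDiffOn_succ_iff_deriv_of_isOpen isOpen_Iio]
    refine ⟨fun v hv => (hasDerivAt_symBC hW hv).differentiableAt.differentiableWithinAt,
      fun h => absurd h (by simp), ?_⟩
    exact (ih hW.volD).congr fun v hv => (hasDerivAt_symBC hW hv).deriv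

theorem iteratedDeriv_symBC {W : ℝ → ℝ} (hW : IsSymbol (zetaMin / 2) 2 W) (j : ℕ) :
    IsSymbol (zetaMin / 2) 2 (volD^[j] W) ∧
      ∀ v < volV0, iteratedDeriv j (symBC W) v = symBC (volD^[j] W) v := by
  induction j with
  | zero => exact ⟨hW, fun v _ => by simp⟩
  | succ j ih =>
    rw [Function.iterate_succ_apply']
    refine ⟨ih.1.volD, fun v hv => ?_⟩
    rw [iteratedDeriv_succ]
    refine ((hasDerivAt_symBC ih.1 hv).congr_of_eventuallyEq ?_).deriv
    filter_upwards [Iio_mem_nhds hv] with y hy using ih.2 y hy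

/-! ### The Volterra equation -/

theorem wgt_symBC_mul {W : ℝ → ℝ} (hW : IsSymbol (zetaMin / 2) 2 W) {v : ℝ} (hv : v < volV0)
    (g : BC) {s : ℝ} (hs : -1 ≤ s) : wgt (symBC W v * g) s = (symFun 4 W v s : ℝ) * g s := by
  have := wt_pos hs
  have h : ((wt s : ℝ) : ℂ) ≠ 0 := by exact_mod_cast this.ne'
  rw [wgt, BoundedContinuousFunction.mul_apply, symBC_apply hW hv, clampL_of_le hs]; push_cast
  field_simp

theorem exists_opB_symBC_le {W : ℝ → ℝ} (hW : IsSymbol (zetaMin / 2) 2 W) :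
    ∃ C, 0 ≤ C ∧ ∀ v < volV0, ∀ g : BC,
      ‖opB (symBC W v * g)‖ ≤ C * exp v ^ 3 * ‖g‖ := by
  obtain ⟨C, hC0, hC⟩ := exists_symFun_le (k := 0) hW
  have hκ := airyC_pos
  refine ⟨‖airyW‖⁻¹ * 2 * airyC * C, by positivity, fun v hv g => ?_⟩
  have ha := exp_pos v
  refine (BoundedContinuousFunction.norm_le (by positivity)).mpr fun t => ?_
  have ht := neg_one_le_clampL t
  rw [opB_apply]
  have h := norm_volB_le (continuous_wgt (symBC W v * g)) zero_le_one ha (A := C * ‖g‖)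
    (fun s hs => ?_) ht
  · have hr := volRho_pos zero_le_one ha ht
    have hra : volRho 1 (exp v) (clampL t) ≤ exp v := by
      have := wt_pos ht
      exact div_le_self ha.le (by nlinarith)
    calc _ ≤ _ := h
      _ ≤ ‖airyW‖⁻¹ * 2 * airyC * (C * ‖g‖) * exp v ^ 3 := by gcongr
      _ = _ := by ring
  · rw [wgt_symBC_mul hW hv g hs, norm_mul, norm_real]
    have h := hC v hv s hs
    simp only [mul_zero, add_zero, pow_zero, div_one] at h
    calc _ ≤ (C * volRho 1 (exp v) s ^ 4) * ‖g‖ := by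
          gcongr
          · exact h
          · exact g.norm_coe_le_norm s
      _ = _ := by ring

theorem exists_volV1 : ∃ v1 ≤ volV0, ∀ v < v1, ∀ g : BC, ‖opB (symBC V v * g)‖ ≤ 1 / 2 * ‖g‖ := by
  obtain ⟨C, hC0, hC⟩ := exists_opB_symBC_le isSymbol_V
  have ht : Tendsto (fun v => C * exp v ^ 3) atBot (𝓝 0) := by
    simpa using (Real.tendsto_exp_atBot.pow 3).const_mul C
  obtain ⟨w, hw⟩ := (ht.eventually (ge_mem_nhds (by norm_num : (0 : ℝ) < 1 / 2))).exists_forall_of_atBot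
  refine ⟨min volV0 w, min_le_left _ _, fun v hv g => ?_⟩
  refine (hC v (hv.trans_le (min_le_left _ _)) g).trans ?_
  gcongr; exact hw v (hv.trans_le (min_le_right _ _)).le

/-- The range of the logarithmic parameter on which the Volterra equation is contracting. -/
def volV1 : ℝ := exists_volV1.choose

theorem volV1_le : volV1 ≤ volV0 := exists_volV1.choose_spec.1

theorem norm_opB_symBC_le {v : ℝ} (hv : v < volV1) (g : BC) :
    ‖opB (symBC V v * g)‖ ≤ 1 / 2 * ‖g‖ := exists_volV1.choose_spec.2 v hv g

/-- The operator of the Volterra equation. -/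
def volA (v : ℝ) : BC →L[ℝ] BC := opB.comp (ContinuousLinearMap.mul ℝ BC (symBC V v))

theorem volA_apply (v : ℝ) (g : BC) : volA v g = opB (symBC V v * g) := rfl

theorem isUnit_one_sub_volA {v : ℝ} (hv : v < volV1) : IsUnit (1 - volA v) := by
  refine isUnit_one_sub_of_norm_lt_one (R := BC →L[ℝ] BC) (lt_of_le_of_lt (b := 1 / 2) ?_ (by norm_num))
  exact ContinuousLinearMap.opNorm_le_bound _ (by norm_num) fun g => norm_opB_symBC_le hv g

/-- The solution `γ` of `γ = 1 + B[U γ]`. -/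
def volGamma (v : ℝ) : BC := Ring.inverse (1 - volA v) 1

theorem contDiffOn_volGamma : ContDiffOn ℝ ∞ volGamma (Iio volV1) := by
  have h1 : ContDiffOn ℝ ∞ volA (Iio volV1) := by
    have hc : ContDiff ℝ ∞ fun g : BC => opB.comp (ContinuousLinearMap.mul ℝ BC g) :=
      (((ContinuousLinearMap.compL ℝ BC BC BC opB).comp (ContinuousLinearMap.mul ℝ BC))).contDiff
    exact hc.comp_contDiffOn ((contDiffOn_symBC isSymbol_V).mono (Iio_subset_Iio volV1_le))
  intro v hv
  obtain ⟨u, hu⟩ := isUnit_one_sub_volA hv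
  have h2 : ContDiffAt ℝ ∞ (fun v => 1 - volA v) v :=
    contDiffAt_const.sub (h1.contDiffAt (Iio_mem_nhds hv))
  have h3 : ContDiffAt ℝ ∞ (fun v => Ring.inverse (1 - volA v)) v := by
    have h4 := contDiffAt_ringInverse ℝ (R := BC →L[ℝ] BC) (n := ∞) u
    rw [hu] at h4
    exact h4.comp v h2
  exact (h3.clm_apply contDiffAt_const).contDiffWithinAt

theorem volGamma_eq {v : ℝ} (hv : v < volV1) :
    volGamma v = 1 + opB (symBC V v * volGamma v) := by
  have h := Ring.mul_inverse_cancel _ (isUnit_one_sub_volA hv)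
  have h1 := congrArg (fun A : BC →L[ℝ] BC => A 1) h
  have h2 : volGamma v - volA v (volGamma v) = 1 := h1
  rw [volA_apply] at h2
  rw [← h2]; abel

theorem contDiffAt_of_Iio {f : ℝ → BC} {b v : ℝ} {n : WithTop ℕ∞} (hf : ContDiffOn ℝ n f (Iio b))
    (hv : v < b) : ContDiffAt ℝ n f v := hf.contDiffAt (Iio_mem_nhds hv)

theorem contDiffOn_iteratedDeriv_BC {f : ℝ → BC} {b : ℝ} (hf : ContDiffOn ℝ ∞ f (Iio b)) (j : ℕ) :
    ContDiffOn ℝ ∞ (iteratedDeriv j f) (Iio b) := by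
  induction j with
  | zero => simpa using hf
  | succ j ih =>
    rw [iteratedDeriv_succ]; exact ((contDiffOn_infty_iff_deriv_of_isOpen isOpen_Iio).mp ih).2

theorem hasDerivAt_iteratedDeriv_BC {f : ℝ → BC} {b : ℝ} (hf : ContDiffOn ℝ ∞ f (Iio b)) (j : ℕ)
    {v : ℝ} (hv : v < b) : HasDerivAt (iteratedDeriv j f) (iteratedDeriv (j + 1) f v) v := by
  rw [iteratedDeriv_succ]
  exact ((contDiffAt_of_Iio (contDiffOn_iteratedDeriv_BC hf j) hv).differentiableAt
    (by simp)).hasDerivAt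

theorem hasDerivAt_eval_BC {f : ℝ → BC} {f' : BC} {v : ℝ} (h : HasDerivAt f f' v) (t : ℝ) :
    HasDerivAt (fun v => f v t) (f' t) v :=
  (BoundedContinuousFunction.evalCLM ℝ t : BC →L[ℝ] ℂ).hasFDerivAt.comp_hasDerivAt v h

theorem iteratedDeriv_clm_comp {f : ℝ → BC} {b : ℝ} (hf : ContDiffOn ℝ ∞ f (Iio b))
    (A : BC →L[ℝ] BC) (j : ℕ) :
    ∀ v < b, iteratedDeriv j (fun v => A (f v)) v = A (iteratedDeriv j f v) := by
  induction j with
  | zero => intro v _; simp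
  | succ j ih =>
    intro v hv; rw [iteratedDeriv_succ]
    refine ((A.hasFDerivAt.comp_hasDerivAt v
      (hasDerivAt_iteratedDeriv_BC hf j hv)).congr_of_eventuallyEq ?_).deriv
    filter_upwards [Iio_mem_nhds hv] with w hw using ih w hw

/-- All derivatives in the parameter are jointly of class `C^n`. -/
def JointSmooth (n : ℕ) (f : ℝ → BC) : Prop :=
  ∀ j, ContDiffOn ℝ n (fun p : ℝ × ℝ => iteratedDeriv j f p.1 p.2) (Iio volV1 ×ˢ Ioi (-1))

theorem isOpen_volDom : IsOpen (Iio volV1 ×ˢ Ioi (-1 : ℝ)) := isOpen_Iio.prod isOpen_Ioi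

theorem JointSmooth.mul {n : ℕ} {f g : ℝ → BC} (hf : ContDiffOn ℝ ∞ f (Iio volV1))
    (hg : ContDiffOn ℝ ∞ g (Iio volV1)) (jf : JointSmooth n f) (jg : JointSmooth n g) :
    JointSmooth n (fun v => f v * g v) := by
  intro j
  have h : ContDiffOn ℝ n (fun p : ℝ × ℝ => ∑ i ∈ Finset.range (j + 1), (j.choose i : ℂ) *
      iteratedDeriv i f p.1 p.2 * iteratedDeriv (j - i) g p.1 p.2) (Iio volV1 ×ˢ Ioi (-1)) :=
    ContDiffOn.sum fun i _ => (contDiffOn_const.mul (jf i)).mul (jg (j - i))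
  refine h.congr fun p hp => ?_
  have hv : p.1 < volV1 := hp.1
  have e := iteratedDeriv_fun_mul (n := j)
    ((contDiffAt_of_Iio hf hv).of_le (by exact_mod_cast le_top))
    ((contDiffAt_of_Iio hg hv).of_le (by exact_mod_cast le_top))
  simp only [e]
  have : ∀ (s : Finset ℕ) (F : ℕ → BC) (t : ℝ), (∑ i ∈ s, F i) t = ∑ i ∈ s, F i t := by
    intro s F t; exact map_sum (BoundedContinuousFunction.evalCLM ℝ t) F s
  rw [this]
  refine Finset.sum_congr rfl fun i _ => ?_
  simp only [BoundedContinuousFunction.mul_apply]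
  congr 2

theorem jointSmooth_symBC (n : ℕ) : JointSmooth n (symBC V) := by
  intro j
  obtain ⟨hW, h⟩ := iteratedDeriv_symBC isSymbol_V j
  have key : ContDiffOn ℝ ∞ (fun p : ℝ × ℝ => (((p.2 + 2) ^ 2 * (exp p.1 ^ 4 *
      (volD^[j] V) (exp p.1 ^ 2 * p.2)) : ℝ) : ℂ)) (Iio volV1 ×ˢ Ioi (-1)) := by
    refine ofRealCLM.contDiff.comp_contDiffOn (ContDiffOn.mul (by fun_prop)
      (ContDiffOn.mul (by fun_prop) ?_))
    refine hW.1.comp (by fun_prop) fun p hp => ?_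
    exact zetaMin_lt_mul (lt_of_lt_of_le hp.1 volV1_le) (le_of_lt hp.2)
  refine (key.of_le (by exact_mod_cast le_top)).congr fun p hp => ?_
  have hv : p.1 < volV0 := lt_of_lt_of_le hp.1 volV1_le
  have ht : -1 ≤ p.2 := le_of_lt hp.2
  rw [h _ hv, symBC_apply hW hv, clampL_of_le ht, show wt p.2 ^ 4 = (wt p.2 ^ 2) ^ 2 by ring,
    wt_sq ht, symFun]

/-- The right hand side of the Volterra equation. -/
def volG (v : ℝ) : BC := symBC V v * volGamma v

/-- The relative error of the oscillatory basis, as a function of `log σ / 3`. -/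
def volBeta (v : ℝ) : BC := opB (volG v)

/-- The derivative of the relative error. -/
def volH (v : ℝ) : BC := opT (volG v)

theorem contDiffOn_volG : ContDiffOn ℝ ∞ volG (Iio volV1) := by
  have h := ((ContinuousLinearMap.mul ℝ BC).isBoundedBilinearMap.contDiff (n := ∞)).comp_contDiffOn
    (((contDiffOn_symBC isSymbol_V).mono (Iio_subset_Iio volV1_le)).prodMk contDiffOn_volGamma)
  exact h

theorem contDiffOn_volBeta : ContDiffOn ℝ ∞ volBeta (Iio volV1) :=
  opB.contDiff.comp_contDiffOn contDiffOn_volG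

theorem contDiffOn_volH : ContDiffOn ℝ ∞ volH (Iio volV1) :=
  opT.contDiff.comp_contDiffOn contDiffOn_volG

theorem volGamma_eq_add {v : ℝ} (hv : v < volV1) : volGamma v = 1 + volBeta v := volGamma_eq hv

theorem iteratedDeriv_volBeta (j : ℕ) {v : ℝ} (hv : v < volV1) :
    iteratedDeriv j volBeta v = opB (iteratedDeriv j volG v) :=
  iteratedDeriv_clm_comp contDiffOn_volG opB j v hv

theorem iteratedDeriv_volH (j : ℕ) {v : ℝ} (hv : v < volV1) :
    iteratedDeriv j volH v = opT (iteratedDeriv j volG v) :=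
  iteratedDeriv_clm_comp contDiffOn_volG opT j v hv

theorem hasDerivAt_volBeta_right (j : ℕ) {v t : ℝ} (hv : v < volV1) (ht : -1 < t) :
    HasDerivAt (fun t => iteratedDeriv j volBeta v t) (iteratedDeriv j volH v t) t := by
  rw [iteratedDeriv_volBeta j hv, iteratedDeriv_volH j hv]; exact hasDerivAt_opB _ ht

theorem hasDerivAt_volH_right (j : ℕ) {v t : ℝ} (hv : v < volV1) (ht : -1 < t) :
    HasDerivAt (fun t => iteratedDeriv j volH v t)
      (-(airyP t * iteratedDeriv j volH v t) - wgt (iteratedDeriv j volG v) t) t := by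
  rw [iteratedDeriv_volH j hv]; exact hasDerivAt_opT _ ht

theorem JointSmooth.of_zero {f : ℝ → BC} (hf : ContDiffOn ℝ ∞ f (Iio volV1)) : JointSmooth 0 f := by
  intro j; rw [Nat.cast_zero, contDiffOn_zero]
  have h := (contDiffOn_iteratedDeriv_BC hf j).continuousOn
  have h1 : ContinuousOn (fun p : ℝ × ℝ => iteratedDeriv j f p.1) (Iio volV1 ×ˢ Ioi (-1)) :=
    h.comp continuousOn_fst fun p hp => hp.1
  exact continuous_eval.comp_continuousOn (h1.prodMk continuousOn_snd)

theorem JointSmooth.volGamma {n : ℕ} (h : JointSmooth n volBeta) : JointSmooth n volGamma := by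
  intro j
  have h0 : ContDiffOn ℝ n (fun p : ℝ × ℝ => iteratedDeriv j (fun _ : ℝ => (1 : BC)) p.1 p.2 +
      iteratedDeriv j volBeta p.1 p.2) (Iio volV1 ×ˢ Ioi (-1)) := by
    refine ContDiffOn.add ?_ (h j)
    have : ∀ v : ℝ, iteratedDeriv j (fun _ : ℝ => (1 : BC)) v = if j = 0 then 1 else 0 :=
      fun v => by rw [iteratedDeriv_const]
    simp only [this]
    by_cases hj : j = 0
    · simp only [hj, if_true]
      exact contDiffOn_const (c := (1 : ℂ))
    · simp only [hj, if_false]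
      exact contDiffOn_const (c := (0 : ℂ))
  refine h0.congr fun p hp => ?_
  have hv : p.1 < volV1 := hp.1
  have e : CoulombLG.volGamma =ᶠ[𝓝 p.1] fun v => (1 : BC) + volBeta v := by
    filter_upwards [Iio_mem_nhds hv] with v hv using volGamma_eq_add hv
  rw [e.iteratedDeriv_eq, iteratedDeriv_fun_add contDiffAt_const
    ((contDiffAt_of_Iio contDiffOn_volBeta hv).of_le (by exact_mod_cast le_top))]
  rfl

theorem JointSmooth.volG {n : ℕ} (h : JointSmooth n volBeta) : JointSmooth n volG :=
  JointSmooth.mul ((contDiffOn_symBC isSymbol_V).mono (Iio_subset_Iio volV1_le))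
    contDiffOn_volGamma (jointSmooth_symBC n) h.volGamma

theorem JointSmooth.wgt_volG {n : ℕ} (h : JointSmooth n volBeta) (j : ℕ) :
    ContDiffOn ℝ n (fun p : ℝ × ℝ => wgt (iteratedDeriv j CoulombLG.volG p.1) p.2)
      (Iio volV1 ×ˢ Ioi (-1)) := by
  have h1 : ContDiffOn ℝ n (fun p : ℝ × ℝ => ((((p.2 + 2) ^ 2)⁻¹ : ℝ) : ℂ))
      (Iio volV1 ×ˢ Ioi (-1)) := by
    refine ofRealCLM.contDiff.comp_contDiffOn (ContDiffOn.inv (by fun_prop) ?_)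
    intro p hp
    have : -1 < p.2 := hp.2
    have : 0 < p.2 + 2 := by linarith
    positivity
  refine (h1.mul (h.volG j)).congr fun p hp => ?_
  have ht : -1 ≤ p.2 := le_of_lt hp.2
  rw [wgt, clampL_of_le ht, show wt p.2 ^ 4 = (wt p.2 ^ 2) ^ 2 by ring, wt_sq ht]

theorem jointSmooth_vol (n : ℕ) : JointSmooth n volBeta ∧ JointSmooth n volH := by
  induction n with
  | zero => exact ⟨.of_zero contDiffOn_volBeta, .of_zero contDiffOn_volH⟩
  | succ n ih =>
    refine ⟨fun j => ?_, fun j => ?_⟩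
    · exact contDiffOn_succ_of_partial isOpen_volDom
        (fun p hp => hasDerivAt_eval_BC (hasDerivAt_iteratedDeriv_BC contDiffOn_volBeta j hp.1) p.2)
        (fun p hp => hasDerivAt_volBeta_right j hp.1 hp.2) (ih.1 (j + 1)) (ih.2 j)
    · refine contDiffOn_succ_of_partial isOpen_volDom
        (fun p hp => hasDerivAt_eval_BC (hasDerivAt_iteratedDeriv_BC contDiffOn_volH j hp.1) p.2)
        (fun p hp => hasDerivAt_volH_right j hp.1 hp.2) (ih.2 (j + 1)) ?_
      refine ContDiffOn.sub ((ContDiffOn.mul ?_ (ih.2 j)).neg) ?_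
      · exact ((contDiff_airyP.of_le (by exact_mod_cast le_top)).comp contDiff_snd).contDiffOn
      · exact ih.1.wgt_volG j

theorem contDiffOn_volBeta_uncurry :
    ContDiffOn ℝ ∞ (fun p : ℝ × ℝ => volBeta p.1 p.2) (Iio volV1 ×ˢ Ioi (-1)) :=
  contDiffOn_infty.mpr fun n => by simpa using (jointSmooth_vol n).1 0

/-! ### Estimates -/

theorem norm_volGamma_le {v : ℝ} (hv : v < volV1) : ‖volGamma v‖ ≤ 2 := by
  have h := norm_opB_symBC_le hv (volGamma v)
  have h1 : ‖volGamma v‖ ≤ ‖(1 : BC)‖ + ‖opB (symBC V v * volGamma v)‖ := by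
    conv_lhs => rw [volGamma_eq hv]
    exact norm_add_le _ _
  rw [norm_one] at h1
  linarith

theorem hasDerivAt_volGamma {v : ℝ} (hv : v < volV1) :
    HasDerivAt volGamma (iteratedDeriv 1 volBeta v) v := by
  have h := (hasDerivAt_iteratedDeriv_BC contDiffOn_volBeta 0 hv).const_add (1 : BC)
  rw [iteratedDeriv_zero] at h
  refine h.congr_of_eventuallyEq ?_
  filter_upwards [Iio_mem_nhds hv] with w hw using volGamma_eq_add hw

theorem iteratedDeriv_one_volG {v : ℝ} (hv : v < volV1) : iteratedDeriv 1 volG v =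
    symBC (volD V) v * volGamma v + symBC V v * iteratedDeriv 1 volBeta v := by
  rw [iteratedDeriv_one]
  exact ((hasDerivAt_symBC isSymbol_V (hv.trans_le volV1_le)).mul (hasDerivAt_volGamma hv)).deriv

theorem iteratedDeriv_two_volG {v : ℝ} (hv : v < volV1) : iteratedDeriv 2 volG v =
    symBC (volD (volD V)) v * volGamma v + (2 : ℝ) • (symBC (volD V) v * iteratedDeriv 1 volBeta v) +
      symBC V v * iteratedDeriv 2 volBeta v := by
  rw [iteratedDeriv_succ]
  have hv0 := hv.trans_le volV1_le
  have hB := hasDerivAt_iteratedDeriv_BC contDiffOn_volBeta 1 hv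
  have h1 := ((hasDerivAt_symBC isSymbol_V.volD hv0).mul (hasDerivAt_volGamma hv)).add
    ((hasDerivAt_symBC isSymbol_V hv0).mul hB)
  have h2 : deriv (iteratedDeriv 1 volG) v = _ := (h1.congr_of_eventuallyEq (by
    filter_upwards [Iio_mem_nhds hv] with w hw using iteratedDeriv_one_volG hw)).deriv
  rw [h2, two_smul]
  abel

theorem exists_iteratedDeriv_volBeta_le :
    ∃ C, 0 ≤ C ∧ ∀ v < volV1, ‖iteratedDeriv 1 volBeta v‖ ≤ C ∧ ‖iteratedDeriv 2 volBeta v‖ ≤ C := by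
  obtain ⟨C1, h10, h1⟩ := exists_opB_symBC_le isSymbol_V.volD
  obtain ⟨C2, h20, h2⟩ := exists_opB_symBC_le isSymbol_V.volD.volD
  refine ⟨4 * C1 + 4 * C2 + 16 * C1 ^ 2, by positivity, fun v hv => ?_⟩
  have hv0 := hv.trans_le volV1_le
  have ha := exp_pos v
  have ha1 : exp v ^ 3 ≤ 1 := pow_le_one₀ ha.le (exp_lt_one_of_lt hv0).le
  have hγ := norm_volGamma_le hv
  have b1 : ‖iteratedDeriv 1 volBeta v‖ ≤ 4 * C1 := by
    have e : iteratedDeriv 1 volBeta v = opB (symBC (volD V) v * volGamma v) +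
        opB (symBC V v * iteratedDeriv 1 volBeta v) := by
      conv_lhs => rw [iteratedDeriv_volBeta 1 hv, iteratedDeriv_one_volG hv, map_add]
    have t1 : ‖opB (symBC (volD V) v * volGamma v)‖ ≤ C1 * 1 * 2 := (h1 v hv0 _).trans (by gcongr)
    have t2 := norm_opB_symBC_le hv (iteratedDeriv 1 volBeta v)
    have t3 := norm_add_le (opB (symBC (volD V) v * volGamma v))
      (opB (symBC V v * iteratedDeriv 1 volBeta v))
    rw [← e] at t3
    linarith
  refine ⟨b1.trans (by nlinarith), ?_⟩
  have e : iteratedDeriv 2 volBeta v = opB (symBC (volD (volD V)) v * volGamma v) +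
      (2 : ℝ) • opB (symBC (volD V) v * iteratedDeriv 1 volBeta v) +
        opB (symBC V v * iteratedDeriv 2 volBeta v) := by
    conv_lhs => rw [iteratedDeriv_volBeta 2 hv, iteratedDeriv_two_volG hv, map_add, map_add, map_smul]
  have t0 : ‖opB (symBC (volD (volD V)) v * volGamma v)‖ ≤ C2 * 1 * 2 :=
    (h2 v hv0 _).trans (by gcongr)
  have t1 : ‖(2 : ℝ) • opB (symBC (volD V) v * iteratedDeriv 1 volBeta v)‖ ≤
      2 * (C1 * 1 * (4 * C1)) := by
    rw [norm_smul, Real.norm_of_nonneg (by norm_num : (0 : ℝ) ≤ 2)]; gcongr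
    exact (h1 v hv0 _).trans (by gcongr)
  have t2 := norm_opB_symBC_le hv (iteratedDeriv 2 volBeta v)
  have t3 := norm_add₃_le (a := opB (symBC (volD (volD V)) v * volGamma v))
    (b := (2 : ℝ) • opB (symBC (volD V) v * iteratedDeriv 1 volBeta v))
    (c := opB (symBC V v * iteratedDeriv 2 volBeta v))
  rw [← e] at t3
  nlinarith

/-- The values of the derivatives in the parameter. -/
def betaJ (j : ℕ) (v t : ℝ) : ℂ := iteratedDeriv j volBeta v t

def hJ (j : ℕ) (v t : ℝ) : ℂ := iteratedDeriv j volH v t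

def gJ (j : ℕ) (v t : ℝ) : ℂ := wgt (iteratedDeriv j volG v) t

section

variable {v t : ℝ}

theorem hasDerivAt_betaJ_left (j : ℕ) (hv : v < volV1) (t : ℝ) :
    HasDerivAt (fun v => betaJ j v t) (betaJ (j + 1) v t) v :=
  hasDerivAt_eval_BC (hasDerivAt_iteratedDeriv_BC contDiffOn_volBeta j hv) t

theorem hasDerivAt_hJ_left (j : ℕ) (hv : v < volV1) (t : ℝ) :
    HasDerivAt (fun v => hJ j v t) (hJ (j + 1) v t) v :=
  hasDerivAt_eval_BC (hasDerivAt_iteratedDeriv_BC contDiffOn_volH j hv) t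

theorem hasDerivAt_betaJ (j : ℕ) (hv : v < volV1) (ht : -1 < t) :
    HasDerivAt (betaJ j v) (hJ j v t) t := hasDerivAt_volBeta_right j hv ht

theorem hasDerivAt_hJ (j : ℕ) (hv : v < volV1) (ht : -1 < t) :
    HasDerivAt (hJ j v) (-(airyP t * hJ j v t) - gJ j v t) t := hasDerivAt_volH_right j hv ht

theorem volGamma_apply (hv : v < volV1) (t : ℝ) : volGamma v t = 1 + betaJ 0 v t := by
  rw [volGamma_eq_add hv, betaJ, iteratedDeriv_zero]; rfl

theorem gJ_zero (hv : v < volV1) (ht : -1 ≤ t) :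
    gJ 0 v t = (symFun 4 V v t : ℝ) * (1 + betaJ 0 v t) := by
  rw [gJ, iteratedDeriv_zero, volG, wgt_symBC_mul isSymbol_V (hv.trans_le volV1_le) _ ht,
    volGamma_apply hv]

theorem gJ_one (hv : v < volV1) (ht : -1 ≤ t) :
    gJ 1 v t = (symFun 4 (volD V) v t : ℝ) * (1 + betaJ 0 v t) +
      (symFun 4 V v t : ℝ) * betaJ 1 v t := by
  have hv0 := hv.trans_le volV1_le
  rw [gJ, iteratedDeriv_one_volG hv, wgt_add, wgt_symBC_mul isSymbol_V hv0 _ ht,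
    wgt_symBC_mul isSymbol_V.volD hv0 _ ht, volGamma_apply hv]
  rfl

theorem gJ_two (hv : v < volV1) (ht : -1 ≤ t) :
    gJ 2 v t = (symFun 4 (volD (volD V)) v t : ℝ) * (1 + betaJ 0 v t) +
      2 * ((symFun 4 (volD V) v t : ℝ) * betaJ 1 v t) + (symFun 4 V v t : ℝ) * betaJ 2 v t := by
  have hv0 := hv.trans_le volV1_le
  have e : ∀ g : BC, wgt ((2 : ℝ) • g) t = 2 * wgt g t := fun g => by
    have : (2 : ℝ) • g = (2 : ℂ) • g := by ext; simp
    rw [this, wgt_smul]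
  rw [gJ, iteratedDeriv_two_volG hv, wgt_add, wgt_add, e, wgt_symBC_mul isSymbol_V hv0 _ ht,
    wgt_symBC_mul isSymbol_V.volD hv0 _ ht, wgt_symBC_mul isSymbol_V.volD.volD hv0 _ ht,
    volGamma_apply hv]
  rfl

theorem volRho_exp_pos (v : ℝ) (ht : -1 ≤ t) : 0 < volRho 1 (exp v) t :=
  volRho_pos zero_le_one (exp_pos v) ht

end

theorem exists_symFun_four_le {W : ℝ → ℝ} (hW : IsSymbol (zetaMin / 2) 2 W) :
    ∃ C, 0 ≤ C ∧ ∀ v < volV1, ∀ s, -1 ≤ s →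
      ‖((symFun 4 W v s : ℝ) : ℂ)‖ ≤ C * volRho 1 (exp v) s ^ 4 := by
  obtain ⟨C, hC0, hC⟩ := exists_symFun_le (k := 0) hW
  refine ⟨C, hC0, fun v hv s hs => ?_⟩
  rw [norm_real]; simpa using hC v (hv.trans_le volV1_le) s hs

theorem exists_betaJ_le_const : ∃ C, 1 ≤ C ∧ ∀ v < volV1, ∀ t,
    ‖1 + betaJ 0 v t‖ ≤ C ∧ ‖betaJ 1 v t‖ ≤ C ∧ ‖betaJ 2 v t‖ ≤ C := by
  obtain ⟨C, hC0, hC⟩ := exists_iteratedDeriv_volBeta_le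
  refine ⟨2 + C, by linarith, fun v hv t => ⟨?_, ?_, ?_⟩⟩
  · rw [← volGamma_apply hv]
    refine ((volGamma v).norm_coe_le_norm t).trans ((norm_volGamma_le hv).trans (by linarith))
  · exact (BoundedContinuousFunction.norm_coe_le_norm _ t).trans ((hC v hv).1.trans (by linarith))
  · exact (BoundedContinuousFunction.norm_coe_le_norm _ t).trans ((hC v hv).2.trans (by linarith))

/-- A bound for the relative error, its derivatives in the parameter, and the right hand sides. -/
theorem exists_crude_bounds : ∃ C, 1 ≤ C ∧ ∀ v < volV1, ∀ t, -1 ≤ t → ∀ j ≤ 2,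
    ‖gJ j v t‖ ≤ C * volRho 1 (exp v) t ^ 4 ∧
    ‖betaJ j v t‖ ≤ C * volRho 1 (exp v) t ^ 3 ∧
    ‖hJ j v t‖ ≤ C * volRho 1 (exp v) t ^ 2 := by
  obtain ⟨A0, hA0, h0⟩ := exists_symFun_four_le isSymbol_V
  obtain ⟨A1, hA1, h1⟩ := exists_symFun_four_le isSymbol_V.volD
  obtain ⟨A2, hA2, h2⟩ := exists_symFun_four_le isSymbol_V.volD.volD
  obtain ⟨D, hD1, hD⟩ := exists_betaJ_le_const
  set M := (A0 + 2 * A1 + A2) * D with hM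
  have hM0 : 0 ≤ M := by positivity
  have hκ := airyC_pos
  have hg : ∀ v < volV1, ∀ t, -1 ≤ t → ∀ j ≤ 2,
      ‖gJ j v t‖ ≤ M * volRho 1 (exp v) t ^ 4 := fun v hv t ht j hj => by
    have hr := volRho_exp_pos v ht
    obtain ⟨d0, d1, d2⟩ := hD v hv t
    set ρ := volRho 1 (exp v) t ^ 4 with hρ
    have hρ0 : 0 < ρ := by positivity
    have m : ∀ {a b : ℂ} {A : ℝ}, 0 ≤ A → ‖a‖ ≤ A * ρ → ‖b‖ ≤ D → ‖a * b‖ ≤ A * D * ρ :=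
      fun {a b A} hA ha hb => by
        rw [norm_mul]
        calc _ ≤ (A * ρ) * D := by gcongr
          _ = _ := by ring
    have p1 : 0 ≤ A0 * D * ρ := by positivity
    have p2 : 0 ≤ A1 * D * ρ := by positivity
    have p3 : 0 ≤ A2 * D * ρ := by positivity
    have eM : M * ρ = A0 * D * ρ + 2 * (A1 * D * ρ) + A2 * D * ρ := by rw [hM]; ring
    rw [eM]
    interval_cases j
    · rw [gJ_zero hv ht]
      have := m hA0 (h0 v hv t ht) d0
      linarith
    · rw [gJ_one hv ht]
      have e1 := m hA1 (h1 v hv t ht) d0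
      have e2 := m hA0 (h0 v hv t ht) d1
      refine (norm_add_le _ _).trans ?_
      linarith
    · rw [gJ_two hv ht]
      have e1 := m hA2 (h2 v hv t ht) d0
      have e2 := m hA1 (h1 v hv t ht) d1
      have e3 := m hA0 (h0 v hv t ht) d2
      refine (norm_add₃_le).trans ?_
      rw [norm_mul 2, show ‖(2 : ℂ)‖ = 2 by norm_num]; linarith
  refine ⟨1 + M + ‖airyW‖⁻¹ * 2 * airyC * M + airyC ^ 2 * M, ?_, fun v hv t ht j hj => ?_⟩
  · have : 0 ≤ ‖airyW‖⁻¹ * 2 * airyC * M := by positivity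
    have : 0 ≤ airyC ^ 2 * M := by positivity
    linarith
  have hr := volRho_exp_pos v ht
  have q1 : 0 ≤ ‖airyW‖⁻¹ * 2 * airyC * M := by positivity
  have q2 : 0 ≤ airyC ^ 2 * M := by positivity
  have hc : Continuous (gJ j v) := continuous_wgt _
  refine ⟨(hg v hv t ht j hj).trans (by gcongr; linarith), ?_, ?_⟩
  · rw [betaJ, iteratedDeriv_volBeta j hv, opB_apply, clampL_of_le ht]
    refine (norm_volB_le hc zero_le_one (exp_pos v) (fun s hs => hg v hv s hs j hj) ht).trans ?_
    gcongr; linarith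
  · rw [hJ, iteratedDeriv_volH j hv, opT_apply, clampL_of_le ht]
    refine (norm_volT_le hc zero_le_one (exp_pos v) (fun s hs => hg v hv s hs j hj) ht).trans ?_
    gcongr; linarith

theorem tendsto_hJ {j : ℕ} (hj : j ≤ 2) {v : ℝ} (hv : v < volV1) :
    Tendsto (hJ j v) atTop (𝓝 0) := by
  obtain ⟨C, hC1, hC⟩ := exists_crude_bounds
  refine tendsto_of_le_volRho (exp_pos v) (B := C) (t := -1) fun s hs => ?_
  refine (hC v hv s hs j hj).2.2.trans ?_
  have hr := volRho_exp_pos v hs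
  gcongr; exact pow_le_of_le_one hr.le (volRho_le_one zero_le_one (exp_pos v) hs) (by norm_num)

theorem tendsto_betaJ {j : ℕ} (hj : j ≤ 2) {v : ℝ} (hv : v < volV1) :
    Tendsto (betaJ j v) atTop (𝓝 0) := by
  obtain ⟨C, hC1, hC⟩ := exists_crude_bounds
  refine tendsto_of_le_volRho (exp_pos v) (B := C) (t := -1) fun s hs => ?_
  refine (hC v hv s hs j hj).2.1.trans ?_
  have hr := volRho_exp_pos v hs
  gcongr; exact pow_le_of_le_one hr.le (volRho_le_one zero_le_one (exp_pos v) hs) (by norm_num)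

/-! ### Refined estimates -/

/-- The first two `t`-derivatives of `gJ 0 v` and the first one of `gJ 1 v`. -/
def gT (v t : ℝ) : ℂ :=
  (symFun 6 (deriv V) v t : ℝ) * (1 + betaJ 0 v t) + (symFun 4 V v t : ℝ) * hJ 0 v t

def gTT (v t : ℝ) : ℂ := (symFun 8 (deriv (deriv V)) v t : ℝ) * (1 + betaJ 0 v t) +
    2 * ((symFun 6 (deriv V) v t : ℝ) * hJ 0 v t) +
    (symFun 4 V v t : ℝ) * (-(airyP t * hJ 0 v t) - gJ 0 v t)

def gT1 (v t : ℝ) : ℂ := (symFun 6 (deriv (volD V)) v t : ℝ) * (1 + betaJ 0 v t) +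
    (symFun 4 (volD V) v t : ℝ) * hJ 0 v t + (symFun 6 (deriv V) v t : ℝ) * betaJ 1 v t +
    (symFun 4 V v t : ℝ) * hJ 1 v t

section

variable {v t : ℝ}

theorem hasDerivAt_gJ_zero (hv : v < volV1) (ht : -1 < t) : HasDerivAt (gJ 0 v) (gT v t) t := by
  have h1 := (hasDerivAt_symFun_right (k := 4) isSymbol_V (hv.trans_le volV1_le) ht.le).ofReal_comp
  have h2 := (hasDerivAt_betaJ 0 hv ht).const_add 1
  refine (h1.mul h2).congr_of_eventuallyEq ?_
  filter_upwards [Ioi_mem_nhds ht] with s hs using gJ_zero hv (le_of_lt hs)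

theorem hasDerivAt_gJ_one (hv : v < volV1) (ht : -1 < t) : HasDerivAt (gJ 1 v) (gT1 v t) t := by
  have hv0 := hv.trans_le volV1_le
  have h1 := (hasDerivAt_symFun_right (k := 4) isSymbol_V hv0 ht.le).ofReal_comp
  have h1' := (hasDerivAt_symFun_right (k := 4) isSymbol_V.volD hv0 ht.le).ofReal_comp
  have h2 := (hasDerivAt_betaJ 0 hv ht).const_add 1
  have h3 := ((h1'.mul h2).add (h1.mul (hasDerivAt_betaJ 1 hv ht))).congr_of_eventuallyEq
    (f₁ := gJ 1 v) (by
      filter_upwards [Ioi_mem_nhds ht] with s hs using gJ_one hv (le_of_lt hs))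
  refine h3.congr_deriv ?_
  rw [gT1]; ring

theorem hasDerivAt_gT (hv : v < volV1) (ht : -1 < t) : HasDerivAt (gT v) (gTT v t) t := by
  have hv0 := hv.trans_le volV1_le
  have h1 := (hasDerivAt_symFun_right (k := 4) isSymbol_V hv0 ht.le).ofReal_comp
  have h1' := (hasDerivAt_symFun_right (k := 6) isSymbol_V.deriv hv0 ht.le).ofReal_comp
  have h2 := (hasDerivAt_betaJ 0 hv ht).const_add 1
  refine ((h1'.mul h2).add (h1.mul (hasDerivAt_hJ 0 hv ht))).congr_deriv ?_
  rw [gTT]; ring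

end

theorem exists_symFun_six_le {W : ℝ → ℝ} (hW : IsSymbol (zetaMin / 2) 3 W) :
    ∃ C, 0 ≤ C ∧ ∀ v < volV1, ∀ s, -1 ≤ s →
      ‖((symFun 6 W v s : ℝ) : ℂ)‖ ≤ C * (volRho 1 (exp v) s ^ 4 / wt s ^ 2) := by
  obtain ⟨C, hC0, hC⟩ := exists_symFun_le (k := 1) hW
  refine ⟨C, hC0, fun v hv s hs => ?_⟩
  rw [norm_real, ← mul_div_assoc]; simpa using hC v (hv.trans_le volV1_le) s hs

theorem exists_symFun_eight_le {W : ℝ → ℝ} (hW : IsSymbol (zetaMin / 2) 4 W) :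
    ∃ C, 0 ≤ C ∧ ∀ v < volV1, ∀ s, -1 ≤ s →
      ‖((symFun 8 W v s : ℝ) : ℂ)‖ ≤ C * (volRho 1 (exp v) s ^ 4 / wt s ^ 4) := by
  obtain ⟨C, hC0, hC⟩ := exists_symFun_le (k := 2) hW
  refine ⟨C, hC0, fun v hv s hs => ?_⟩
  rw [norm_real, ← mul_div_assoc]; simpa using hC v (hv.trans_le volV1_le) s hs

theorem norm_mul_le_of {a b : ℂ} {A B X Y : ℝ} (ha : ‖a‖ ≤ A * X) (hb : ‖b‖ ≤ B * Y) :
    ‖a * b‖ ≤ (A * B) * (X * Y) := by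
  rw [norm_mul]
  calc _ ≤ (A * X) * (B * Y) := mul_le_mul ha hb (norm_nonneg _) ((norm_nonneg _).trans ha)
    _ = _ := by ring

/-- The refined bounds for the relative error for `t ≥ 0`. -/
theorem exists_refined_bounds : ∃ C, 1 ≤ C ∧ ∀ v < volV1, ∀ t, 0 ≤ t →
    ‖gT v t‖ ≤ C * (volRho 1 (exp v) t ^ 4 / wt t ^ 2) ∧
    ‖hJ 0 v t‖ ≤ C * (volRho 1 (exp v) t ^ 4 / wt t) ∧
    ‖hJ 1 v t‖ ≤ C * (volRho 1 (exp v) t ^ 4 / wt t) ∧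
    ‖-(airyP t * hJ 0 v t) - gJ 0 v t‖ ≤ C * (volRho 1 (exp v) t ^ 4 / wt t ^ 3) := by
  obtain ⟨A0, hA0, h0⟩ := exists_symFun_four_le isSymbol_V
  obtain ⟨A1, hA1, h1⟩ := exists_symFun_four_le isSymbol_V.volD
  obtain ⟨B0, hB0, b0⟩ := exists_symFun_six_le isSymbol_V.deriv
  obtain ⟨B1, hB1, b1⟩ := exists_symFun_six_le isSymbol_V.volD.deriv
  obtain ⟨E0, hE0, e0⟩ := exists_symFun_eight_le isSymbol_V.deriv.deriv
  obtain ⟨D, hD1, hD⟩ := exists_betaJ_le_const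
  obtain ⟨C, hC1, hC⟩ := exists_crude_bounds
  have hκ := airyC_pos
  have hC0 : 0 ≤ C := by linarith
  have hD0 : 0 ≤ D := by linarith
  -- the size of `ρ²` relative to the weights
  have ρsq : ∀ v t : ℝ, -1 ≤ t → volRho 1 (exp v) t ^ 2 ≤ 1 / wt t ^ 2 := fun v t ht => by
    have hr := volRho_exp_pos v ht
    have := volRho_le_inv zero_le_one (exp_pos v) ht
    calc _ ≤ (1 / wt t) ^ 2 := by gcongr
      _ = _ := by rw [div_pow, one_pow]
  have hH : ∀ v < volV1, ∀ t, -1 ≤ t → ∀ j ≤ 2, ‖hJ j v t‖ ≤ C * (1 / wt t ^ 2) :=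
    fun v hv t ht j hj => (hC v hv t ht j hj).2.2.trans (by gcongr; exact ρsq v t ht)
  set M1 := B0 * D + A0 * C + C with hM1
  have hgT : ∀ v < volV1, ∀ t, -1 ≤ t →
      ‖gT v t‖ ≤ M1 * (volRho 1 (exp v) t ^ 4 / wt t ^ 2) := fun v hv t ht => by
    have hr := volRho_exp_pos v ht
    have hw := wt_pos ht
    have t1 := norm_mul_le_of (b0 v hv t ht) ((hD v hv t).1.trans_eq (mul_one D).symm)
    have t2 := norm_mul_le_of (h0 v hv t ht) (hH v hv t ht 0 (by norm_num))
    refine (norm_add_le _ _).trans ((add_le_add t1 t2).trans ?_)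
    rw [mul_one, ← div_eq_mul_one_div, ← add_mul]; gcongr
    rw [hM1]; linarith
  set M2 := B1 * D + A1 * C + B0 * D + A0 * C + C with hM2
  have hgT1 : ∀ v < volV1, ∀ t, -1 ≤ t →
      ‖gT1 v t‖ ≤ M2 * (volRho 1 (exp v) t ^ 4 / wt t ^ 2) := fun v hv t ht => by
    have hr := volRho_exp_pos v ht
    have hw := wt_pos ht
    have t1 := norm_mul_le_of (b1 v hv t ht) ((hD v hv t).1.trans_eq (mul_one D).symm)
    have t2 := norm_mul_le_of (h1 v hv t ht) (hH v hv t ht 0 (by norm_num))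
    have t3 := norm_mul_le_of (b0 v hv t ht) ((hD v hv t).2.1.trans_eq (mul_one D).symm)
    have t4 := norm_mul_le_of (h0 v hv t ht) (hH v hv t ht 1 (by norm_num))
    refine (norm_add_le _ _).trans ((add_le_add ((norm_add_le _ _).trans
      (add_le_add (norm_add_le _ _) le_rfl)) le_rfl).trans
      ((add_le_add (add_le_add (add_le_add t1 t2) t3) t4).trans ?_))
    rw [mul_one, ← div_eq_mul_one_div, ← add_mul, ← add_mul, ← add_mul]; gcongr
    rw [hM2]; linarith
  have bH0 : ∀ v < volV1, ∀ t, 0 ≤ t →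
      ‖hJ 0 v t‖ ≤ 5 * airyC ^ 5 * M1 * (volRho 1 (exp v) t ^ 4 / wt t) :=
    fun v hv t ht => by
      rw [← mul_div_assoc]
      refine norm_le_of_byParts (exp_pos v) (by linarith) (by positivity)
        (fun s hs => hasDerivAt_hJ 0 hv (by linarith))
        (fun s hs => hasDerivAt_gJ_zero hv (by linarith)) (fun s hs => ?_) (fun s hs => ?_)
        (tendsto_hJ (by norm_num) hv)
      · have hs1 : -1 ≤ s := by linarith
        have hr := volRho_exp_pos v hs1
        refine (hC v hv s hs1 0 (by norm_num)).1.trans ?_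
        gcongr; rw [hM1]; nlinarith
      · rw [mul_div_assoc]; exact hgT v hv s (by linarith)
  have bH1 : ∀ v < volV1, ∀ t, 0 ≤ t →
      ‖hJ 1 v t‖ ≤ 5 * airyC ^ 5 * M2 * (volRho 1 (exp v) t ^ 4 / wt t) :=
    fun v hv t ht => by
      rw [← mul_div_assoc]
      refine norm_le_of_byParts (exp_pos v) (by linarith) (by positivity)
        (fun s hs => hasDerivAt_hJ 1 hv (by linarith))
        (fun s hs => hasDerivAt_gJ_one hv (by linarith)) (fun s hs => ?_) (fun s hs => ?_)
        (tendsto_hJ (by norm_num) hv)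
      · have hs1 : -1 ≤ s := by linarith
        have hr := volRho_exp_pos v hs1
        refine (hC v hv s hs1 1 (by norm_num)).1.trans ?_
        gcongr
        have : 0 ≤ B1 * D + A1 * C + B0 * D + A0 * C := by positivity
        rw [hM2]; linarith
      · rw [mul_div_assoc]; exact hgT1 v hv s (by linarith)
  set M3 := airyC * (5 * airyC ^ 5 * M1) + C with hM3
  have hM10 : 0 ≤ M1 := by positivity
  have hM20 : 0 ≤ M2 := by positivity
  have hM30 : 0 ≤ M3 := by positivity
  have bK : ∀ v < volV1, ∀ t, 0 ≤ t →
      ‖-(airyP t * hJ 0 v t) - gJ 0 v t‖ ≤ M3 * volRho 1 (exp v) t ^ 4 := fun v hv t ht => by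
    have ht1 : -1 ≤ t := by linarith
    have hr := volRho_exp_pos v ht1
    have hw := wt_pos ht1
    have t1 := norm_mul_le_of (norm_airyP_le ht1) (bH0 v hv t ht)
    have t2 := (hC v hv t ht1 0 (by norm_num)).1
    refine (norm_sub_le _ _).trans ?_
    rw [norm_neg]
    refine (add_le_add t1 t2).trans (le_of_eq ?_)
    rw [hM3]; field_simp
  set M4 := E0 * D + 2 * (B0 * C) + A0 * M3 + M1 with hM4
  have hgTT : ∀ v < volV1, ∀ t, 0 ≤ t →
      ‖gTT v t‖ ≤ M4 * (volRho 1 (exp v) t ^ 4 / wt t ^ 4) := fun v hv t ht => by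
    have ht1 : -1 ≤ t := by linarith
    have hr := volRho_exp_pos v ht1
    have hw := wt_pos ht1
    have t1 := norm_mul_le_of (e0 v hv t ht1) ((hD v hv t).1.trans_eq (mul_one D).symm)
    have t2 := norm_mul_le_of (b0 v hv t ht1) (hH v hv t ht1 0 (by norm_num))
    have hb := bK v hv t ht
    have hρ4 : volRho 1 (exp v) t ^ 4 ≤ 1 / wt t ^ 4 := by
      have := volRho_le_inv zero_le_one (exp_pos v) ht1
      calc _ ≤ (1 / wt t) ^ 4 := by gcongr
        _ = _ := by rw [div_pow, one_pow]
    have t3 := norm_mul_le_of (h0 v hv t ht1) (hb.trans (by gcongr : _ ≤ M3 * (1 / wt t ^ 4)))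
    refine (norm_add₃_le).trans ?_
    rw [norm_mul 2, show ‖(2 : ℂ)‖ = 2 by norm_num]
    calc _ ≤ E0 * D * (volRho 1 (exp v) t ^ 4 / wt t ^ 4 * 1) +
          2 * (B0 * C * (volRho 1 (exp v) t ^ 4 / wt t ^ 2 * (1 / wt t ^ 2))) +
          A0 * M3 * (volRho 1 (exp v) t ^ 4 * (1 / wt t ^ 4)) :=
          add_le_add (add_le_add t1 (mul_le_mul_of_nonneg_left t2 (by norm_num))) t3
      _ = (E0 * D + 2 * (B0 * C) + A0 * M3) * (volRho 1 (exp v) t ^ 4 / wt t ^ 4) := by field_simp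
      _ ≤ _ := by
          gcongr; rw [hM4]; linarith
  have bK2 : ∀ v < volV1, ∀ t, 0 ≤ t → ‖-(airyP t * hJ 0 v t) - gJ 0 v t‖ ≤
      20 * airyC ^ 9 * M4 * (volRho 1 (exp v) t ^ 4 / wt t ^ 3) := fun v hv t ht => by
    have hA0M3 : 0 ≤ A0 * M3 := by positivity
    have hlast : M1 ≤ M4 := by
      have : 0 ≤ E0 * D + 2 * (B0 * C) + A0 * M3 := by positivity
      rw [hM4]; linarith
    have hCM1 : C ≤ M1 := by
      have : 0 ≤ B0 * D + A0 * C := by positivity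
      rw [hM1]; linarith
    rw [← mul_div_assoc]
    refine norm_deriv_le_of_byParts (exp_pos v) (by linarith) (by positivity)
      (fun s hs => hasDerivAt_hJ 0 hv (by linarith))
      (fun s hs => hasDerivAt_gJ_zero hv (by linarith))
      (fun s hs => hasDerivAt_gT hv (by linarith)) (fun s hs => ?_) (fun s hs => ?_)
      (fun s hs => ?_) (tendsto_hJ (by norm_num) hv)
    · have hs1 : -1 ≤ s := by linarith
      have hr := volRho_exp_pos v hs1
      refine (hC v hv s hs1 0 (by norm_num)).1.trans ?_
      gcongr; linarith
    · have hs1 : -1 ≤ s := by linarith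
      have hr := volRho_exp_pos v hs1
      have hw := wt_pos hs1
      rw [mul_div_assoc]
      refine (hgT v hv s hs1).trans ?_
      gcongr
    · rw [mul_div_assoc]; exact hgTT v hv s (ht.trans hs)
  have hM40 : 0 ≤ M4 := by positivity
  have s1 : 0 ≤ 5 * airyC ^ 5 * M1 := by positivity
  have s2 : 0 ≤ 5 * airyC ^ 5 * M2 := by positivity
  have s3 : 0 ≤ 20 * airyC ^ 9 * M4 := by positivity
  refine ⟨1 + M1 + 5 * airyC ^ 5 * M1 + 5 * airyC ^ 5 * M2 + 20 * airyC ^ 9 * M4, by linarith,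
    fun v hv t ht => ?_⟩
  have ht1 : -1 ≤ t := by linarith
  have hr := volRho_exp_pos v ht1
  have hw := wt_pos ht1
  refine ⟨(hgT v hv t ht1).trans ?_, (bH0 v hv t ht).trans ?_, (bH1 v hv t ht).trans ?_,
    (bK2 v hv t ht).trans ?_⟩ <;>
  · gcongr; linarith

/-! ### Derivatives at fixed `ζ` -/

theorem hasDerivAt_curve {F : ℝ × ℝ → ℂ} {A B : ℂ} {γ δ : ℝ → ℝ} {γ' δ' s : ℝ}
    (hF : DifferentiableAt ℝ F (γ s, δ s)) (h1 : HasDerivAt (fun v => F (v, δ s)) A (γ s))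
    (h2 : HasDerivAt (fun t => F (γ s, t)) B (δ s)) (hγ : HasDerivAt γ γ' s)
    (hδ : HasDerivAt δ δ' s) : HasDerivAt (fun s => F (γ s, δ s)) (γ' * A + δ' * B) s := by
  set L := fderiv ℝ F (γ s, δ s)
  have hL : HasFDerivAt F L (γ s, δ s) := hF.hasFDerivAt
  have e1 : L (1, 0) = A := by
    have h := hL.comp_hasDerivAt (γ s) ((hasDerivAt_id (γ s)).prodMk (hasDerivAt_const _ (δ s)))
    exact h.unique h1
  have e2 : L (0, 1) = B := by
    have h := hL.comp_hasDerivAt (δ s) ((hasDerivAt_const (δ s) (γ s)).prodMk (hasDerivAt_id _))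
    exact h.unique h2
  have h := hL.comp_hasDerivAt s (hγ.prodMk hδ)
  refine h.congr_deriv ?_
  have : ((γ', δ') : ℝ × ℝ) = γ' • ((1, 0) : ℝ × ℝ) + δ' • ((0, 1) : ℝ × ℝ) := by ext <;> simp
  rw [this, map_add, map_smul, map_smul, e1, e2, real_smul, real_smul]

/-- The variable `t` as a function of `v` and `ζ`. -/
def tOf (v z : ℝ) : ℝ := exp (-2 * v) * z

theorem tOf_nonneg (v : ℝ) {z : ℝ} (hz : 0 ≤ z) : 0 ≤ tOf v z := by unfold tOf; positivity

theorem hasDerivAt_tOf (v z : ℝ) : HasDerivAt (fun v => tOf v z) (-2 * tOf v z) v := by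
  refine ((((hasDerivAt_id v).const_mul (-2)).exp).mul_const z).congr_deriv ?_
  rw [tOf, id]; ring

theorem hasDerivAt_tOf_right (v z : ℝ) : HasDerivAt (tOf v) (exp (-2 * v)) z :=
  ((hasDerivAt_id z).const_mul _).congr_deriv (mul_one _)

section

variable {v z : ℝ}

theorem mem_volDom (hv : v < volV1) (hz : 0 ≤ z) : (v, tOf v z) ∈ Iio volV1 ×ˢ Ioi (-1 : ℝ) :=
  ⟨hv, lt_of_lt_of_le (by norm_num) (tOf_nonneg v hz)⟩

theorem neg_one_lt_tOf (v : ℝ) (hz : 0 ≤ z) : -1 < tOf v z :=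
  lt_of_lt_of_le (by norm_num) (tOf_nonneg v hz)

theorem differentiableAt_of_volDom {F : ℝ × ℝ → ℂ} (hF : ContDiffOn ℝ 1 F (Iio volV1 ×ˢ Ioi (-1)))
    (hv : v < volV1) (hz : 0 ≤ z) : DifferentiableAt ℝ F (v, tOf v z) :=
  (hF.contDiffAt (isOpen_volDom.mem_nhds (mem_volDom hv hz))).differentiableAt (by simp)

theorem hasDerivAt_betaJ_curve (j : ℕ) (hv : v < volV1) (hz : 0 ≤ z) :
    HasDerivAt (fun v => betaJ j v (tOf v z))
      (betaJ (j + 1) v (tOf v z) - 2 * tOf v z * hJ j v (tOf v z)) v := by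
  have h := hasDerivAt_curve (γ := id) (δ := fun v => tOf v z) (s := v)
    (differentiableAt_of_volDom ((jointSmooth_vol 1).1 j) hv hz)
    (hasDerivAt_betaJ_left j hv (tOf v z)) (hasDerivAt_betaJ j hv (neg_one_lt_tOf v hz))
    (hasDerivAt_id v) (hasDerivAt_tOf v z)
  refine h.congr_deriv ?_
  push_cast; ring

/-- The `t`-derivative of `hJ j v`. -/
def kJ (j : ℕ) (v t : ℝ) : ℂ := -(airyP t * hJ j v t) - gJ j v t

theorem hasDerivAt_hJ_curve (j : ℕ) (hv : v < volV1) (hz : 0 ≤ z) :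
    HasDerivAt (fun v => hJ j v (tOf v z))
      (hJ (j + 1) v (tOf v z) - 2 * tOf v z * kJ j v (tOf v z)) v := by
  have h := hasDerivAt_curve (γ := id) (δ := fun v => tOf v z) (s := v)
    (differentiableAt_of_volDom ((jointSmooth_vol 1).2 j) hv hz)
    (hasDerivAt_hJ_left j hv (tOf v z)) (hasDerivAt_hJ j hv (neg_one_lt_tOf v hz))
    (hasDerivAt_id v) (hasDerivAt_tOf v z)
  refine h.congr_deriv ?_
  rw [kJ]; push_cast; ring

theorem hasDerivAt_gJ_left (j : ℕ) (hv : v < volV1) (t : ℝ) :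
    HasDerivAt (fun v => gJ j v t) (gJ (j + 1) v t) v :=
  (hasDerivAt_eval_BC (hasDerivAt_iteratedDeriv_BC contDiffOn_volG j hv) t).const_mul _

theorem hasDerivAt_gJ_curve (hv : v < volV1) (hz : 0 ≤ z) : HasDerivAt (fun v => gJ 0 v (tOf v z))
      (gJ 1 v (tOf v z) - 2 * tOf v z * gT v (tOf v z)) v := by
  have h := hasDerivAt_curve (γ := id) (δ := fun v => tOf v z) (s := v)
    (differentiableAt_of_volDom ((jointSmooth_vol 1).1.wgt_volG 0) hv hz)
    (hasDerivAt_gJ_left 0 hv (tOf v z)) (hasDerivAt_gJ_zero hv (neg_one_lt_tOf v hz))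
    (hasDerivAt_id v) (hasDerivAt_tOf v z)
  refine h.congr_deriv ?_
  push_cast; ring

/-- The `t`-derivative of `kJ 0 v`. -/
def lT (v t : ℝ) : ℂ := -(airyP1 t * hJ 0 v t) - airyP t * kJ 0 v t - gT v t

theorem hasDerivAt_kJ_curve (hv : v < volV1) (hz : 0 ≤ z) : HasDerivAt (fun v => kJ 0 v (tOf v z))
      (kJ 1 v (tOf v z) - 2 * tOf v z * lT v (tOf v z)) v := by
  have h1 : HasDerivAt (fun v => airyP (tOf v z)) ((-2 * tOf v z : ℝ) • airyP1 (tOf v z)) v :=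
    (hasDerivAt_airyP _).scomp v (hasDerivAt_tOf v z)
  refine (((h1.mul (hasDerivAt_hJ_curve 0 hv hz)).neg).sub
    (hasDerivAt_gJ_curve hv hz)).congr_deriv ?_
  rw [lT, kJ, kJ, real_smul]; push_cast
  ring

/-- The derivatives of `β` and `h` in `v`, at fixed `ζ`. -/
def dBeta (v t : ℝ) : ℂ := betaJ 1 v t - 2 * t * hJ 0 v t

def ddBeta (v t : ℝ) : ℂ := betaJ 2 v t - 4 * t * hJ 1 v t + 4 * t * hJ 0 v t + 4 * t ^ 2 * kJ 0 v t

def dH (v t : ℝ) : ℂ := hJ 1 v t - 2 * t * kJ 0 v t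

def ddH (v t : ℝ) : ℂ := hJ 2 v t - 4 * t * kJ 1 v t + 4 * t * kJ 0 v t + 4 * t ^ 2 * lT v t

theorem hasDerivAt_dBeta (hv : v < volV1) (hz : 0 ≤ z) :
    HasDerivAt (fun v => dBeta v (tOf v z)) (ddBeta v (tOf v z)) v := by
  have ht := (hasDerivAt_tOf v z).ofReal_comp
  refine ((hasDerivAt_betaJ_curve 1 hv hz).sub ((ht.const_mul 2).mul
    (hasDerivAt_hJ_curve 0 hv hz))).congr_deriv ?_
  rw [ddBeta]; push_cast; ring

theorem hasDerivAt_dH (hv : v < volV1) (hz : 0 ≤ z) :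
    HasDerivAt (fun v => dH v (tOf v z)) (ddH v (tOf v z)) v := by
  have ht := (hasDerivAt_tOf v z).ofReal_comp
  refine ((hasDerivAt_hJ_curve 1 hv hz).sub ((ht.const_mul 2).mul
    (hasDerivAt_kJ_curve hv hz))).congr_deriv ?_
  rw [ddH]; push_cast; ring

/-- `exp (m v)` as a complex number. -/
def cexpR (m v : ℝ) : ℂ := (exp (m * v) : ℝ)

theorem cexpR_mul (m n v : ℝ) : cexpR m v * cexpR n v = cexpR (m + n) v := by
  rw [cexpR, cexpR, cexpR, ← ofReal_mul, ← Real.exp_add, add_mul]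

theorem hasDerivAt_cexpR (m v : ℝ) : HasDerivAt (cexpR m) (m * cexpR m v) v := by
  have h := (((hasDerivAt_id v).const_mul m).exp).ofReal_comp
  refine h.congr_deriv ?_
  rw [cexpR, id]; push_cast; ring

/-- The logarithmic parameter. -/
def vOf (σ : ℝ) : ℝ := log σ / 3

theorem exp_vOf_mul {σ : ℝ} (hσ : 0 < σ) (m : ℝ) : exp (m * vOf σ) = σ ^ (m / 3) := by
  rw [Real.rpow_def_of_pos hσ, vOf]; congr 1; ring

theorem tOf_vOf {σ : ℝ} (hσ : 0 < σ) (z : ℝ) : tOf (vOf σ) z = σ ^ (-2 / 3 : ℝ) * z := by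
  rw [tOf, exp_vOf_mul hσ]

theorem hasDerivAt_comp_vOf {f : ℝ → ℂ} {f' : ℂ} {m σ : ℝ} (hσ : 0 < σ)
    (hf : HasDerivAt f f' (vOf σ)) :
    HasDerivAt (fun s => cexpR (-m) (vOf s) * f (vOf s))
      (cexpR (-(m + 3)) (vOf σ) * ((f' - m * f (vOf σ)) / 3)) σ := by
  have hv : HasDerivAt vOf (σ⁻¹ / 3) σ := (Real.hasDerivAt_log hσ.ne').div_const 3
  have h := ((hasDerivAt_cexpR (-m) (vOf σ)).mul hf).scomp σ hv
  refine h.congr_deriv ?_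
  have e : ((σ⁻¹ : ℝ) : ℂ) = cexpR (-3) (vOf σ) := by
    rw [cexpR, exp_vOf_mul hσ, show (-3 / 3 : ℝ) = -1 by norm_num, rpow_neg_one]
  rw [neg_add, ← cexpR_mul, ← e, real_smul]; push_cast
  ring

end

/-- The upper bound for `σ` corresponding to `volV1`. -/
def sigma0 : ℝ := exp (3 * volV1)

theorem sigma0_pos : 0 < sigma0 := exp_pos _

theorem vOf_lt {σ : ℝ} (hσ : σ ∈ Ioo 0 sigma0) : vOf σ < volV1 := by
  have h := Real.log_lt_log hσ.1 hσ.2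
  rw [sigma0, Real.log_exp] at h
  rw [vOf]; linarith

/-- The relative error of the oscillatory basis. -/
def oscB (σ z : ℝ) : ℂ := cexpR (-3) (vOf σ) * betaJ 0 (vOf σ) (tOf (vOf σ) z)

def oscBz (σ z : ℝ) : ℂ := cexpR (-5) (vOf σ) * hJ 0 (vOf σ) (tOf (vOf σ) z)

def oscBzz (σ z : ℝ) : ℂ := cexpR (-7) (vOf σ) * kJ 0 (vOf σ) (tOf (vOf σ) z)

def oscBs (σ z : ℝ) : ℂ := cexpR (-6) (vOf σ) *
  ((dBeta (vOf σ) (tOf (vOf σ) z) - 3 * betaJ 0 (vOf σ) (tOf (vOf σ) z)) / 3)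

def oscBss (σ z : ℝ) : ℂ := cexpR (-9) (vOf σ) *
  ((ddBeta (vOf σ) (tOf (vOf σ) z) - 9 * dBeta (vOf σ) (tOf (vOf σ) z) +
    18 * betaJ 0 (vOf σ) (tOf (vOf σ) z)) / 9)

def oscBzs (σ z : ℝ) : ℂ := cexpR (-8) (vOf σ) *
  ((dH (vOf σ) (tOf (vOf σ) z) - 5 * hJ 0 (vOf σ) (tOf (vOf σ) z)) / 3)

def oscBzss (σ z : ℝ) : ℂ := cexpR (-11) (vOf σ) *
  ((ddH (vOf σ) (tOf (vOf σ) z) - 13 * dH (vOf σ) (tOf (vOf σ) z) +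
    40 * hJ 0 (vOf σ) (tOf (vOf σ) z)) / 9)

section

variable {σ z : ℝ}

theorem hasDerivAt_oscB (hσ : σ ∈ Ioo 0 sigma0) (hz : 0 ≤ z) :
    HasDerivAt (oscB σ) (oscBz σ z) z := by
  have h := ((hasDerivAt_betaJ 0 (vOf_lt hσ) (neg_one_lt_tOf (vOf σ) hz)).scomp z
    (hasDerivAt_tOf_right (vOf σ) z)).const_mul (cexpR (-3) (vOf σ))
  refine h.congr_deriv ?_
  rw [oscBz, show (-5 : ℝ) = -3 + -2 by norm_num, ← cexpR_mul, real_smul]; simp only [cexpR]; ring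

theorem hasDerivAt_oscBz (hσ : σ ∈ Ioo 0 sigma0) (hz : 0 ≤ z) :
    HasDerivAt (oscBz σ) (oscBzz σ z) z := by
  have h := ((hasDerivAt_hJ 0 (vOf_lt hσ) (neg_one_lt_tOf (vOf σ) hz)).scomp z
    (hasDerivAt_tOf_right (vOf σ) z)).const_mul (cexpR (-5) (vOf σ))
  refine h.congr_deriv ?_
  rw [oscBzz, show (-7 : ℝ) = -5 + -2 by norm_num, ← cexpR_mul, real_smul, kJ]
  simp only [cexpR]; ring

theorem hasDerivAt_oscB_left (hσ : σ ∈ Ioo 0 sigma0) (hz : 0 ≤ z) :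
    HasDerivAt (fun s => oscB s z) (oscBs σ z) σ := by
  refine (hasDerivAt_comp_vOf hσ.1 (hasDerivAt_betaJ_curve 0 (vOf_lt hσ) hz)).congr_deriv ?_
  rw [oscBs, dBeta]; norm_num

theorem hasDerivAt_oscBs (hσ : σ ∈ Ioo 0 sigma0) (hz : 0 ≤ z) :
    HasDerivAt (fun s => oscBs s z) (oscBss σ z) σ := by
  refine (hasDerivAt_comp_vOf (m := 6) hσ.1 (((hasDerivAt_dBeta (vOf_lt hσ) hz).sub
    ((hasDerivAt_betaJ_curve 0 (vOf_lt hσ) hz).const_mul 3)).div_const 3)).congr_deriv ?_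
  rw [oscBss, ← dBeta, show (-(6 + 3) : ℝ) = -9 by norm_num]
  push_cast; simp only [Pi.sub_apply]; ring

theorem hasDerivAt_oscBz_left (hσ : σ ∈ Ioo 0 sigma0) (hz : 0 ≤ z) :
    HasDerivAt (fun s => oscBz s z) (oscBzs σ z) σ := by
  refine (hasDerivAt_comp_vOf hσ.1 (hasDerivAt_hJ_curve 0 (vOf_lt hσ) hz)).congr_deriv ?_
  rw [oscBzs, dH]; norm_num

theorem hasDerivAt_oscBzs (hσ : σ ∈ Ioo 0 sigma0) (hz : 0 ≤ z) :
    HasDerivAt (fun s => oscBzs s z) (oscBzss σ z) σ := by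
  refine (hasDerivAt_comp_vOf (m := 8) hσ.1 (((hasDerivAt_dH (vOf_lt hσ) hz).sub
    ((hasDerivAt_hJ_curve 0 (vOf_lt hσ) hz).const_mul 5)).div_const 3)).congr_deriv ?_
  rw [oscBzss, ← dH, show (-(8 + 3) : ℝ) = -11 by norm_num]
  push_cast; simp only [Pi.sub_apply]; ring

end

theorem contDiffOn_oscB : ContDiffOn ℝ ∞ (Function.uncurry oscB) (Ioo 0 sigma0 ×ˢ Ici 0) := by
  have hlog : ContDiffOn ℝ ∞ (fun p : ℝ × ℝ => vOf p.1) (Ioo 0 sigma0 ×ˢ Ici 0) :=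
    (ContDiffOn.log contDiffOn_fst fun p hp => hp.1.1.ne').div_const 3
  have ht : ContDiffOn ℝ ∞ (fun p : ℝ × ℝ => tOf (vOf p.1) p.2) (Ioo 0 sigma0 ×ˢ Ici 0) :=
    ((contDiffOn_const.mul hlog).exp).mul contDiffOn_snd
  have h1 : ContDiffOn ℝ ∞ (fun p : ℝ × ℝ => cexpR (-3) (vOf p.1)) (Ioo 0 sigma0 ×ˢ Ici 0) :=
    ofRealCLM.contDiff.comp_contDiffOn (contDiffOn_const.mul hlog).exp
  have h2 := contDiffOn_volBeta_uncurry.comp (hlog.prodMk ht) fun p hp =>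
    mem_volDom (vOf_lt hp.1) hp.2
  refine (h1.mul h2).congr fun p hp => ?_
  simp only [Function.uncurry, oscB, betaJ, iteratedDeriv_zero, Function.comp]

/-! ### The bounds of the relative errors -/

theorem OscBounds.of_hasDerivAt {c K : ℝ} {b bz bzz bs bss bzs bzss : ℝ → ℝ → ℂ}
    (smooth : ContDiffOn ℝ ∞ (Function.uncurry b) (Ioo 0 c ×ˢ Ici 0))
    (hz : ∀ σ ∈ Ioo 0 c, ∀ z, 0 ≤ z → HasDerivAt (b σ) (bz σ z) z)
    (hzz : ∀ σ ∈ Ioo 0 c, ∀ z, 0 ≤ z → HasDerivAt (bz σ) (bzz σ z) z)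
    (hs : ∀ σ ∈ Ioo 0 c, ∀ z, 0 ≤ z → HasDerivAt (fun s => b s z) (bs σ z) σ)
    (hss : ∀ σ ∈ Ioo 0 c, ∀ z, 0 ≤ z → HasDerivAt (fun s => bs s z) (bss σ z) σ)
    (hzs : ∀ σ ∈ Ioo 0 c, ∀ z, 0 ≤ z → HasDerivAt (fun s => bz s z) (bzs σ z) σ)
    (hzss : ∀ σ ∈ Ioo 0 c, ∀ z, 0 ≤ z → HasDerivAt (fun s => bzs s z) (bzss σ z) σ)
    (b0 : ∀ σ ∈ Ioo 0 c, ∀ z, 0 ≤ z → ‖b σ z‖ ≤ K * bracket z ^ (-3 / 2 : ℝ))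
    (b1 : ∀ σ ∈ Ioo 0 c, ∀ z, 0 ≤ z → ‖bz σ z‖ ≤ K * (σ ^ (-1 / 3 : ℝ) *
      bracket (σ ^ (-2 / 3 : ℝ) * z) ^ (-1 / 2 : ℝ) * bracket z ^ (-2 : ℝ)))
    (b2 : ∀ σ ∈ Ioo 0 c, ∀ z, 0 ≤ z → ‖bzz σ z‖ ≤ K * (σ ^ (-1 : ℝ) * bracket z ^ (-2 : ℝ)))
    (b3 : ∀ σ ∈ Ioo 0 c, ∀ z, 0 ≤ z → ‖bs σ z‖ ≤ K * (σ ^ (-1 : ℝ) * bracket z ^ (-3 / 2 : ℝ)))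
    (b4 : ∀ σ ∈ Ioo 0 c, ∀ z, 0 ≤ z → ‖bss σ z‖ ≤ K * σ ^ (-3 : ℝ))
    (b5 : ∀ σ ∈ Ioo 0 c, ∀ z, 0 ≤ z → ‖bzs σ z‖ ≤ K * (σ ^ (-2 : ℝ) * bracket z ^ (-1 : ℝ)))
    (b6 : ∀ σ ∈ Ioo 0 c, ∀ z, 0 ≤ z → ‖bzss σ z‖ ≤ K * σ ^ (-3 : ℝ)) : OscBounds c K b := by
  have e1 : ∀ σ ∈ Ioo 0 c, ∀ z, 0 ≤ z → derivWithin (b σ) (Ici 0) z = bz σ z :=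
    fun σ hσ z hz0 => (hz σ hσ z hz0).hasDerivWithinAt.derivWithin (uniqueDiffOn_Ici 0 z hz0)
  have e2 : ∀ σ ∈ Ioo 0 c, ∀ z, 0 ≤ z → iteratedDerivWithin 2 (b σ) (Ici 0) z = bzz σ z :=
    fun σ hσ z hz0 => by
      rw [iteratedDerivWithin_succ, derivWithin_congr (f := bz σ)]
      · exact (hzz σ hσ z hz0).hasDerivWithinAt.derivWithin (uniqueDiffOn_Ici 0 z hz0)
      · intro w hw; rw [iteratedDerivWithin_one]
        exact e1 σ hσ w hw
      · rw [iteratedDerivWithin_one]; exact e1 σ hσ z hz0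
  have e3 : ∀ σ ∈ Ioo 0 c, ∀ z, 0 ≤ z → deriv (fun s => b s z) σ = bs σ z :=
    fun σ hσ z hz0 => (hs σ hσ z hz0).deriv
  have e4 : ∀ σ ∈ Ioo 0 c, ∀ z, 0 ≤ z → iteratedDeriv 2 (fun s => b s z) σ = bss σ z :=
    fun σ hσ z hz0 => by
      rw [iteratedDeriv_succ, iteratedDeriv_one]
      refine ((hss σ hσ z hz0).congr_of_eventuallyEq ?_).deriv
      filter_upwards [Ioo_mem_nhds hσ.1 hσ.2] with s h using e3 s h z hz0
  have e5 : ∀ σ ∈ Ioo 0 c, ∀ z, 0 ≤ z →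
      deriv (fun s => derivWithin (b s) (Ici 0) z) σ = bzs σ z := fun σ hσ z hz0 => by
    refine ((hzs σ hσ z hz0).congr_of_eventuallyEq ?_).deriv
    filter_upwards [Ioo_mem_nhds hσ.1 hσ.2] with s h using e1 s h z hz0
  have e6 : ∀ σ ∈ Ioo 0 c, ∀ z, 0 ≤ z →
      iteratedDeriv 2 (fun s => derivWithin (b s) (Ici 0) z) σ = bzss σ z := fun σ hσ z hz0 => by
    rw [iteratedDeriv_succ, iteratedDeriv_one]
    refine ((hzss σ hσ z hz0).congr_of_eventuallyEq ?_).deriv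
    filter_upwards [Ioo_mem_nhds hσ.1 hσ.2] with s h using e5 s h z hz0
  exact
    { smooth := smooth
      zero := b0
      dz := fun σ hσ z hz0 => (congrArg norm (e1 σ hσ z hz0)).trans_le (b1 σ hσ z hz0)
      dzz := fun σ hσ z hz0 => (congrArg norm (e2 σ hσ z hz0)).trans_le (b2 σ hσ z hz0)
      ds := fun σ hσ z hz0 => (congrArg norm (e3 σ hσ z hz0)).trans_le (b3 σ hσ z hz0)
      dss := fun σ hσ z hz0 => (congrArg norm (e4 σ hσ z hz0)).trans_le (b4 σ hσ z hz0)
      dsdz := fun σ hσ z hz0 => (congrArg norm (e5 σ hσ z hz0)).trans_le (b5 σ hσ z hz0)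
      dssdz := fun σ hσ z hz0 => (congrArg norm (e6 σ hσ z hz0)).trans_le (b6 σ hσ z hz0) }

/-- The square root of the Japanese bracket. -/
def sbr (z : ℝ) : ℝ := sqrt (bracket z)

theorem one_le_bracket (z : ℝ) : 1 ≤ bracket z := by
  rw [bracket, Real.one_le_sqrt]; nlinarith [sq_nonneg z]

theorem one_le_sbr (z : ℝ) : 1 ≤ sbr z := by rw [sbr, Real.one_le_sqrt]; exact one_le_bracket z

theorem sbr_sq (z : ℝ) : sbr z ^ 2 = bracket z := sq_sqrt (zero_le_one.trans (one_le_bracket z))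

theorem bracket_rpow (z : ℝ) (k : ℕ) : bracket z ^ (-(k / 2) : ℝ) = (sbr z ^ k)⁻¹ := by
  have h := one_le_sbr z
  rw [← sbr_sq, Real.rpow_neg (by positivity), ← rpow_natCast, ← rpow_mul (by positivity),
    show ((2 : ℕ) : ℝ) * (k / 2) = k by push_cast; ring, rpow_natCast]

theorem bracket_le {z : ℝ} (hz : 0 ≤ z) : bracket z ≤ 1 + z := by
  rw [bracket]; exact Real.sqrt_le_iff.mpr ⟨by linarith, by nlinarith⟩

theorem sbr_le_wt {t : ℝ} (ht : 0 ≤ t) : sbr t ≤ wt t :=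
  Real.sqrt_le_sqrt ((bracket_le ht).trans (by linarith))

theorem volRho_le_div_sbr {v z : ℝ} (hz : 0 ≤ z) :
    volRho 1 (exp v) (tOf v z) ≤ exp v / sbr z := by
  have ha := exp_pos v
  have ht := tOf_nonneg v hz
  have hw := wt_pos (by linarith : -1 ≤ tOf v z)
  have hs := one_le_sbr z
  rw [volRho]
  refine div_le_div_of_nonneg_left ha.le (by linarith) ?_
  rw [sbr]
  apply Real.sqrt_le_iff.mpr
  refine ⟨by positivity, (bracket_le hz).trans ?_⟩
  have e : exp v ^ 2 * tOf v z = z := by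
    rw [tOf, ← mul_assoc, ← Real.exp_nat_mul, ← Real.exp_add]; norm_num
  have h2 := wt_sq (by linarith : -1 ≤ tOf v z)
  have : (1 + exp v * wt (tOf v z)) ^ 2 =
      1 + 2 * (exp v * wt (tOf v z)) + exp v ^ 2 * wt (tOf v z) ^ 2 := by ring
  rw [this, h2, mul_add, e]; nlinarith [mul_pos ha hw]

theorem norm_cexpR (m v : ℝ) : ‖cexpR m v‖ = exp (m * v) := by
  rw [cexpR, norm_real, Real.norm_of_nonneg (exp_pos _).le]

theorem exp_neg_nat_mul (k : ℕ) (v : ℝ) : exp (-k * v) = (exp v ^ k)⁻¹ := by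
  rw [← Real.exp_nat_mul, ← Real.exp_neg]; ring_nf

theorem sigma_rpow {σ : ℝ} (hσ : 0 < σ) (k : ℕ) :
    σ ^ (-(k / 3) : ℝ) = (exp (vOf σ) ^ k)⁻¹ := by rw [← exp_neg_nat_mul, exp_vOf_mul hσ, neg_div]

set_option maxHeartbeats 1000000 in
/-- All bounds of the Volterra quantities, in terms of one power of `ρ`. -/
theorem exists_vol_bounds : ∃ M, 1 ≤ M ∧ ∀ v < volV1, ∀ t, 0 ≤ t → ∃ ρ w : ℝ, 0 < ρ ∧ 1 ≤ w ∧
    ρ = volRho 1 (exp v) t ∧ w = wt t ∧ ρ * w ≤ 1 ∧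
    ‖betaJ 0 v t‖ ≤ M * ρ ^ 3 ∧ ‖dBeta v t‖ ≤ M * ρ ^ 3 ∧ ‖ddBeta v t‖ ≤ M * ρ ^ 3 ∧
    ‖hJ 0 v t‖ ≤ M * (ρ ^ 4 / w) ∧ ‖kJ 0 v t‖ ≤ M * ρ ^ 4 ∧
    ‖hJ 0 v t‖ ≤ M * ρ ^ 2 ∧ ‖dH v t‖ ≤ M * ρ ^ 2 ∧ ‖ddH v t‖ ≤ M * ρ ^ 2 := by
  obtain ⟨C, hC1, hC⟩ := exists_crude_bounds
  obtain ⟨D, hD1, hD⟩ := exists_refined_bounds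
  have hκ := one_le_airyC
  set N := C + D with hN
  have hN1 : 1 ≤ N := by rw [hN]; linarith
  refine ⟨40 * airyC * N, by nlinarith, fun v hv t ht => ?_⟩
  have ht1 : -1 ≤ t := by linarith
  have hρ := volRho_exp_pos v ht1
  have hw := one_le_wt ht1
  have hρw := volRho_mul_wt_le zero_le_one (exp_pos v) ht1
  have hρ1 := volRho_le_one zero_le_one (exp_pos v) ht1
  refine ⟨_, _, hρ, hw, rfl, rfl, hρw, ?_⟩
  obtain ⟨gb, hb, hb1, kb⟩ := hD v hv t ht
  have c0 := hC v hv t ht1 0 (by norm_num)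
  have c1 := hC v hv t ht1 1 (by norm_num)
  have c2 := hC v hv t ht1 2 (by norm_num)
  have p0 := norm_airyP_le ht1
  have p1 := norm_airyP1_le ht1
  have htw : ‖(t : ℂ)‖ ≤ wt t ^ 2 := by rw [norm_real, Real.norm_of_nonneg ht, wt_sq ht1]; linarith
  generalize hρe : volRho 1 (exp v) t = ρ at *
  generalize hwe : wt t = w at *
  have hw0 : 0 < w := by linarith
  have hCN : C ≤ N := by rw [hN]; linarith
  have hDN : D ≤ N := by rw [hN]; linarith
  have hκ0 : 0 < airyC := by linarith
  have hN0 : 0 < N := by linarith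
  -- the basic quantities
  have B0 : ‖betaJ 0 v t‖ ≤ N * ρ ^ 3 := c0.2.1.trans (by gcongr)
  have B1 : ‖betaJ 1 v t‖ ≤ N * ρ ^ 3 := c1.2.1.trans (by gcongr)
  have B2 : ‖betaJ 2 v t‖ ≤ N * ρ ^ 3 := c2.2.1.trans (by gcongr)
  have H0 : ‖hJ 0 v t‖ ≤ N * (ρ ^ 4 / w) := hb.trans (by gcongr)
  have H1 : ‖hJ 1 v t‖ ≤ N * (ρ ^ 4 / w) := hb1.trans (by gcongr)
  have H0' : ‖hJ 0 v t‖ ≤ N * ρ ^ 2 := c0.2.2.trans (by gcongr)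
  have H1' : ‖hJ 1 v t‖ ≤ N * ρ ^ 2 := c1.2.2.trans (by gcongr)
  have H2' : ‖hJ 2 v t‖ ≤ N * ρ ^ 2 := c2.2.2.trans (by gcongr)
  have K0 : ‖kJ 0 v t‖ ≤ N * (ρ ^ 4 / w ^ 3) := kb.trans (by gcongr)
  have G1 : ‖gJ 1 v t‖ ≤ N * ρ ^ 4 := c1.1.trans (by gcongr)
  have GT : ‖gT v t‖ ≤ N * (ρ ^ 4 / w ^ 2) := gb.trans (by gcongr)
  have K1 : ‖kJ 1 v t‖ ≤ 2 * airyC * N * ρ ^ 4 := by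
    have := norm_mul_le_of p0 H1
    refine (norm_sub_le _ _).trans ?_
    rw [norm_neg]
    refine (add_le_add this G1).trans ?_
    have e : airyC * N * (w * (ρ ^ 4 / w)) = airyC * N * ρ ^ 4 := by field_simp
    rw [e]
    have : N * ρ ^ 4 ≤ airyC * N * ρ ^ 4 := by
      rw [mul_assoc]; exact le_mul_of_one_le_left (by positivity) hκ
    linarith only [this]
  have LT : ‖lT v t‖ ≤ 3 * airyC * N * (ρ ^ 4 / w ^ 2) := by
    have t1 := norm_mul_le_of (p1.trans_eq (div_eq_mul_inv _ _)) H0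
    have t2 := norm_mul_le_of p0 K0
    refine (norm_sub_le _ _).trans ((add_le_add ((norm_sub_le _ _).trans (add_le_add
      ((norm_neg _).trans_le t1) t2)) GT).trans ?_)
    have e1 : airyC * N * (w⁻¹ * (ρ ^ 4 / w)) = airyC * (N * (ρ ^ 4 / w ^ 2)) := by field_simp
    have e2 : airyC * N * (w * (ρ ^ 4 / w ^ 3)) = airyC * (N * (ρ ^ 4 / w ^ 2)) := by field_simp
    rw [e1, e2]
    have : N * (ρ ^ 4 / w ^ 2) ≤ airyC * (N * (ρ ^ 4 / w ^ 2)) :=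
      le_mul_of_one_le_left (by positivity) hκ
    linarith only [this]
  -- products with powers of `t`
  have ρw3 : w ^ 2 * (ρ ^ 4 / w) ≤ ρ ^ 3 := by
    have : w ^ 2 * (ρ ^ 4 / w) = ρ ^ 3 * (ρ * w) := by field_simp
    rw [this]; exact mul_le_of_le_one_right (by positivity) hρw
  have tH : ∀ {X : ℂ}, ‖X‖ ≤ N * (ρ ^ 4 / w) → ‖t * X‖ ≤ N * ρ ^ 3 := fun {X} hX => by
    rw [norm_mul]
    calc _ ≤ w ^ 2 * (N * (ρ ^ 4 / w)) := by gcongr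
      _ = N * (w ^ 2 * (ρ ^ 4 / w)) := by ring
      _ ≤ _ := by gcongr
  have ttK : ‖(t : ℂ) ^ 2 * kJ 0 v t‖ ≤ N * ρ ^ 3 := by
    rw [norm_mul, norm_pow]
    calc _ ≤ (w ^ 2) ^ 2 * (N * (ρ ^ 4 / w ^ 3)) := by gcongr
      _ = N * (w ^ 2 * (ρ ^ 4 / w)) := by field_simp
      _ ≤ _ := by gcongr
  have ρw2 : w ^ 2 * ρ ^ 4 ≤ ρ ^ 2 := by
    have : w ^ 2 * ρ ^ 4 = ρ ^ 2 * (ρ * w) ^ 2 := by ring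
    rw [this]; exact mul_le_of_le_one_right (by positivity) (pow_le_one₀ (by positivity) hρw)
  have tK0 : ‖t * kJ 0 v t‖ ≤ N * ρ ^ 2 := by
    rw [norm_mul]
    calc _ ≤ w ^ 2 * (N * (ρ ^ 4 / w ^ 3)) := by gcongr
      _ ≤ w ^ 2 * (N * ρ ^ 4) := by
          gcongr; exact div_le_self (by positivity) (one_le_pow₀ hw)
      _ = N * (w ^ 2 * ρ ^ 4) := by ring
      _ ≤ _ := by gcongr
  have tK1 : ‖t * kJ 1 v t‖ ≤ 2 * airyC * N * ρ ^ 2 := by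
    rw [norm_mul]
    calc _ ≤ w ^ 2 * (2 * airyC * N * ρ ^ 4) := by gcongr
      _ = 2 * airyC * N * (w ^ 2 * ρ ^ 4) := by ring
      _ ≤ _ := by gcongr
  have ttL : ‖(t : ℂ) ^ 2 * lT v t‖ ≤ 3 * airyC * N * ρ ^ 2 := by
    rw [norm_mul, norm_pow]
    calc _ ≤ (w ^ 2) ^ 2 * (3 * airyC * N * (ρ ^ 4 / w ^ 2)) := by gcongr
      _ = 3 * airyC * N * (w ^ 2 * ρ ^ 4) := by field_simp
      _ ≤ _ := by gcongr
  have n2 : ‖(2 : ℂ)‖ = 2 := by norm_num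
  have n4 : ‖(4 : ℂ)‖ = 4 := by norm_num
  have N3 : 0 ≤ N * ρ ^ 3 := by positivity
  have N2 : 0 ≤ N * ρ ^ 2 := by positivity
  have aN3 : N * ρ ^ 3 ≤ airyC * (N * ρ ^ 3) := le_mul_of_one_le_left N3 hκ
  have aN2 : N * ρ ^ 2 ≤ airyC * (N * ρ ^ 2) := le_mul_of_one_le_left N2 hκ
  have hN40 : N ≤ 40 * airyC * N := le_mul_of_one_le_left hN0.le (by linarith only [hκ])
  refine ⟨B0.trans (by gcongr), ?_, ?_, H0.trans (by gcongr), ?_, H0'.trans (by gcongr), ?_, ?_⟩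
  · have h := tH H0
    rw [dBeta, mul_assoc]
    refine (norm_sub_le _ _).trans ?_
    rw [norm_mul 2, n2]; linarith
  · have h0 := tH H0
    have h1 := tH H1
    rw [ddBeta, mul_assoc 4, mul_assoc 4, mul_assoc 4]
    refine (norm_add_le _ _).trans ((add_le_add_left ((norm_add_le _ _).trans
      (add_le_add_left (norm_sub_le _ _) _)) _).trans ?_)
    rw [norm_mul 4, norm_mul 4, norm_mul 4, n4]; linarith
  · refine K0.trans ?_
    have : ρ ^ 4 / w ^ 3 ≤ ρ ^ 4 := div_le_self (by positivity) (one_le_pow₀ hw)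
    gcongr
  · rw [dH, mul_assoc]
    refine (norm_sub_le _ _).trans ?_
    rw [norm_mul 2, n2]; linarith
  · rw [ddH, mul_assoc 4, mul_assoc 4, mul_assoc 4]
    refine (norm_add_le _ _).trans ((add_le_add_left ((norm_add_le _ _).trans
      (add_le_add_left (norm_sub_le _ _) _)) _).trans ?_)
    rw [norm_mul 4, norm_mul 4, norm_mul 4, n4]; linarith

set_option maxHeartbeats 1000000 in
theorem exists_oscB_bounds : ∃ K, 0 < K ∧ ∀ σ ∈ Ioo 0 sigma0, ∀ z, 0 ≤ z →
    ‖oscB σ z‖ ≤ K * bracket z ^ (-3 / 2 : ℝ) ∧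
    ‖oscBz σ z‖ ≤ K * (σ ^ (-1 / 3 : ℝ) *
      bracket (σ ^ (-2 / 3 : ℝ) * z) ^ (-1 / 2 : ℝ) * bracket z ^ (-2 : ℝ)) ∧
    ‖oscBzz σ z‖ ≤ K * (σ ^ (-1 : ℝ) * bracket z ^ (-2 : ℝ)) ∧
    ‖oscBs σ z‖ ≤ K * (σ ^ (-1 : ℝ) * bracket z ^ (-3 / 2 : ℝ)) ∧
    ‖oscBss σ z‖ ≤ K * σ ^ (-3 : ℝ) ∧
    ‖oscBzs σ z‖ ≤ K * (σ ^ (-2 : ℝ) * bracket z ^ (-1 : ℝ)) ∧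
    ‖oscBzss σ z‖ ≤ K * σ ^ (-3 : ℝ) := by
  obtain ⟨M, hM1, hM⟩ := exists_vol_bounds
  refine ⟨6 * M, by linarith, fun σ hσ z hz => ?_⟩
  have hM0 : 0 < M := by linarith
  obtain ⟨ρ, w, hρ0, hw1, hρ, hw, hρw, B0, B1, B2, H, Kb, H0, H1, H2⟩ :=
    hM (vOf σ) (vOf_lt hσ) (tOf (vOf σ) z) (tOf_nonneg _ hz)
  have hρs : ρ ≤ exp (vOf σ) / sbr z := by rw [hρ]; exact volRho_le_div_sbr hz
  have hs := one_le_sbr z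
  have ha := exp_pos (vOf σ)
  have ha1 : exp (vOf σ) < 1 := exp_lt_one_of_lt ((vOf_lt hσ).trans_le volV1_le)
  have hsw := sbr_le_wt (tOf_nonneg (vOf σ) hz)
  have hst := one_le_sbr (tOf (vOf σ) z)
  rw [← hw] at hsw
  have x1 := bracket_rpow z 3
  have x2 := bracket_rpow z 4
  have x3 := bracket_rpow z 2
  have x4 := bracket_rpow (tOf (vOf σ) z) 1
  have y1 := sigma_rpow hσ.1 1
  have y3 := sigma_rpow hσ.1 3
  have y6 := sigma_rpow hσ.1 6
  have y9 := sigma_rpow hσ.1 9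
  have z3 : exp (-3 * vOf σ) = (exp (vOf σ) ^ 3)⁻¹ := by rw [← exp_neg_nat_mul]; norm_num
  have z5 : exp (-5 * vOf σ) = (exp (vOf σ) ^ 5)⁻¹ := by rw [← exp_neg_nat_mul]; norm_num
  have z6 : exp (-6 * vOf σ) = (exp (vOf σ) ^ 6)⁻¹ := by rw [← exp_neg_nat_mul]; norm_num
  have z7 : exp (-7 * vOf σ) = (exp (vOf σ) ^ 7)⁻¹ := by rw [← exp_neg_nat_mul]; norm_num
  have z8 : exp (-8 * vOf σ) = (exp (vOf σ) ^ 8)⁻¹ := by rw [← exp_neg_nat_mul]; norm_num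
  have z9 : exp (-9 * vOf σ) = (exp (vOf σ) ^ 9)⁻¹ := by rw [← exp_neg_nat_mul]; norm_num
  have z11 : exp (-11 * vOf σ) = (exp (vOf σ) ^ 11)⁻¹ := by rw [← exp_neg_nat_mul]; norm_num
  norm_num at x1 x2 x3 x4 y1 y3 y6 y9
  rw [← tOf_vOf hσ.1]; norm_num
  rw [x1, x2, x3, x4, y1, y3, y6, y9]
  simp only [oscB, oscBz, oscBzz, oscBs, oscBss, oscBzs, oscBzss, norm_mul, norm_cexpR, norm_div,
    z3, z5, z6, z7, z8, z9, z11]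
  generalize exp (vOf σ) = a at *
  generalize sbr z = s at *
  generalize sbr (tOf (vOf σ) z) = s' at *
  generalize betaJ 0 (vOf σ) (tOf (vOf σ) z) = X0 at *
  generalize dBeta (vOf σ) (tOf (vOf σ) z) = X1 at *
  generalize ddBeta (vOf σ) (tOf (vOf σ) z) = X2 at *
  generalize hJ 0 (vOf σ) (tOf (vOf σ) z) = Y0 at *
  generalize dH (vOf σ) (tOf (vOf σ) z) = Y1 at *
  generalize ddH (vOf σ) (tOf (vOf σ) z) = Y2 at *
  have hs0 : 0 < s := by linarith
  have hs'0 : 0 < s' := by linarith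
  have n3 : ‖(3 : ℂ)‖ = 3 := by norm_num
  have n9 : ‖(9 : ℂ)‖ = 9 := by norm_num
  have r1 : ρ ≤ a := hρs.trans (div_le_self ha.le hs)
  have r2 : ρ ^ 2 ≤ a ^ 2 / s ^ 2 := by rw [← div_pow]; gcongr
  have r3 : ρ ^ 3 ≤ a ^ 3 / s ^ 3 := by rw [← div_pow]; gcongr
  have r4 : ρ ^ 4 ≤ a ^ 4 / s ^ 4 := by rw [← div_pow]; gcongr
  have M3 : 0 ≤ M * ρ ^ 3 := by positivity
  have M2 : 0 ≤ M * ρ ^ 2 := by positivity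
  have t1 : ‖X1 - 3 * X0‖ ≤ 4 * (M * ρ ^ 3) := by
    refine (norm_sub_le _ _).trans ?_
    rw [norm_mul, n3]; linarith
  have t2 : ‖X2 - 9 * X1 + 18 * X0‖ ≤ 28 * (M * ρ ^ 3) := by
    refine (norm_add_le _ _).trans ((add_le_add_left (norm_sub_le _ _) _).trans ?_)
    rw [norm_mul, norm_mul, n9, show ‖(18 : ℂ)‖ = 18 by norm_num]; linarith
  have t3 : ‖Y1 - 5 * Y0‖ ≤ 6 * (M * ρ ^ 2) := by
    refine (norm_sub_le _ _).trans ?_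
    rw [norm_mul, show ‖(5 : ℂ)‖ = 5 by norm_num]; linarith
  have t4 : ‖Y2 - 13 * Y1 + 40 * Y0‖ ≤ 54 * (M * ρ ^ 2) := by
    refine (norm_add_le _ _).trans ((add_le_add_left (norm_sub_le _ _) _).trans ?_)
    rw [norm_mul, norm_mul, show ‖(13 : ℂ)‖ = 13 by norm_num, show ‖(40 : ℂ)‖ = 40 by norm_num]
    linarith
  rw [n3, n9]
  refine ⟨?_, ?_, ?_, ?_, ?_, ?_, ?_⟩
  · calc _ ≤ (a ^ 3)⁻¹ * (M * (a ^ 3 / s ^ 3)) := by gcongr; exact B0.trans (by gcongr)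
      _ = M * (s ^ 3)⁻¹ := by field_simp
      _ ≤ _ := by gcongr; linarith
  · calc _ ≤ (a ^ 5)⁻¹ * (M * (a ^ 4 / s ^ 4 / s')) := by gcongr; exact H.trans (by gcongr)
      _ = M * (a⁻¹ * s'⁻¹ * (s ^ 4)⁻¹) := by field_simp
      _ ≤ _ := by gcongr; linarith
  · calc _ ≤ (a ^ 7)⁻¹ * (M * (a ^ 4 / s ^ 4)) := by gcongr; exact Kb.trans (by gcongr)
      _ = M * ((a ^ 3)⁻¹ * (s ^ 4)⁻¹) := by field_simp
      _ ≤ _ := by gcongr; linarith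
  · calc _ ≤ (a ^ 6)⁻¹ * (4 * (M * (a ^ 3 / s ^ 3)) / 3) := by gcongr; exact t1.trans (by gcongr)
      _ = 4 / 3 * M * ((a ^ 3)⁻¹ * (s ^ 3)⁻¹) := by field_simp
      _ ≤ _ := by gcongr; linarith
  · have : ρ ^ 3 ≤ 1 := pow_le_one₀ hρ0.le (r1.trans ha1.le)
    calc _ ≤ (a ^ 9)⁻¹ * (28 * (M * 1) / 9) := by gcongr; exact t2.trans (by gcongr)
      _ = 28 / 9 * M * (a ^ 9)⁻¹ := by ring
      _ ≤ _ := by gcongr; linarith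
  · calc _ ≤ (a ^ 8)⁻¹ * (6 * (M * (a ^ 2 / s ^ 2)) / 3) := by gcongr; exact t3.trans (by gcongr)
      _ = 2 * M * ((a ^ 6)⁻¹ * (s ^ 2)⁻¹) := by field_simp; ring
      _ ≤ _ := by gcongr; linarith
  · have : ρ ^ 2 ≤ a ^ 2 := by gcongr
    calc _ ≤ (a ^ 11)⁻¹ * (54 * (M * a ^ 2) / 9) := by gcongr; exact t4.trans (by gcongr)
      _ = 6 * M * (a ^ 9)⁻¹ := by field_simp; ring
      _ ≤ _ := le_rfl

theorem exists_oscBounds : ∃ K, 0 < K ∧ OscBounds sigma0 K oscB ∧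
    OscBounds sigma0 K fun σ z => conj (oscB σ z) := by
  obtain ⟨K, hK, h⟩ := exists_oscB_bounds
  refine ⟨K, hK, ?_, ?_⟩
  · exact OscBounds.of_hasDerivAt contDiffOn_oscB (fun σ hσ z hz => hasDerivAt_oscB hσ hz)
      (fun σ hσ z hz => hasDerivAt_oscBz hσ hz) (fun σ hσ z hz => hasDerivAt_oscB_left hσ hz)
      (fun σ hσ z hz => hasDerivAt_oscBs hσ hz) (fun σ hσ z hz => hasDerivAt_oscBz_left hσ hz)
      (fun σ hσ z hz => hasDerivAt_oscBzs hσ hz)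
      (fun σ hσ z hz => (h σ hσ z hz).1) (fun σ hσ z hz => (h σ hσ z hz).2.1)
      (fun σ hσ z hz => (h σ hσ z hz).2.2.1) (fun σ hσ z hz => (h σ hσ z hz).2.2.2.1)
      (fun σ hσ z hz => (h σ hσ z hz).2.2.2.2.1) (fun σ hσ z hz => (h σ hσ z hz).2.2.2.2.2.1)
      (fun σ hσ z hz => (h σ hσ z hz).2.2.2.2.2.2)
  · have nc : ∀ w : ℂ, ‖conj w‖ = ‖w‖ := RCLike.norm_conj
    exact OscBounds.of_hasDerivAt (b := fun σ z => conj (oscB σ z))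
      (bz := fun σ z => conj (oscBz σ z))
      (bzz := fun σ z => conj (oscBzz σ z))
      (bs := fun σ z => conj (oscBs σ z))
      (bss := fun σ z => conj (oscBss σ z))
      (bzs := fun σ z => conj (oscBzs σ z))
      (bzss := fun σ z => conj (oscBzss σ z))
      (Complex.conjCLE.contDiff.comp_contDiffOn contDiffOn_oscB)
      (fun σ hσ z hz => hasDerivAt_conj (hasDerivAt_oscB hσ hz))
      (fun σ hσ z hz => hasDerivAt_conj (hasDerivAt_oscBz hσ hz))
      (fun σ hσ z hz => hasDerivAt_conj (hasDerivAt_oscB_left hσ hz))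
      (fun σ hσ z hz => hasDerivAt_conj (hasDerivAt_oscBs hσ hz))
      (fun σ hσ z hz => hasDerivAt_conj (hasDerivAt_oscBz_left hσ hz))
      (fun σ hσ z hz => hasDerivAt_conj (hasDerivAt_oscBzs hσ hz))
      (fun σ hσ z hz => (nc _).trans_le (h σ hσ z hz).1)
      (fun σ hσ z hz => (nc _).trans_le (h σ hσ z hz).2.1)
      (fun σ hσ z hz => (nc _).trans_le (h σ hσ z hz).2.2.1)
      (fun σ hσ z hz => (nc _).trans_le (h σ hσ z hz).2.2.2.1)
      (fun σ hσ z hz => (nc _).trans_le (h σ hσ z hz).2.2.2.2.1)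
      (fun σ hσ z hz => (nc _).trans_le (h σ hσ z hz).2.2.2.2.2.1)
      (fun σ hσ z hz => (nc _).trans_le (h σ hσ z hz).2.2.2.2.2.2)

/-! ### The oscillatory basis -/

theorem IsSolution.of_hasDerivAt {σ : ℝ} (hσ : σ ≠ 0) {w w1 : ℝ → ℂ}
    (h1 : ∀ z, 0 ≤ z → HasDerivAt w (w1 z) z)
    (h2 : ∀ z, 0 ≤ z → HasDerivAt w1 (-(((z + σ ^ 2 * V z : ℝ) : ℂ) * w z) / (σ : ℂ) ^ 2) z) :
    IsSolution σ w := by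
  have hu := uniqueDiffOn_Ici (0 : ℝ)
  have e1 : ∀ z ∈ Ici (0 : ℝ), derivWithin w (Ici 0) z = w1 z := fun z hz =>
    (h1 z hz).hasDerivWithinAt.derivWithin (hu z hz)
  have e2 : ∀ z ∈ Ici (0 : ℝ), derivWithin w1 (Ici 0) z =
      -(((z + σ ^ 2 * V z : ℝ) : ℂ) * w z) / (σ : ℂ) ^ 2 := fun z hz =>
    (h2 z hz).hasDerivWithinAt.derivWithin (hu z hz)
  have hw : ContinuousOn w (Ici 0) := fun z hz => (h1 z hz).continuousAt.continuousWithinAt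
  have hV : ContinuousOn V (Ici 0) := contDiffOn_V.continuousOn.mono fun z hz =>
    zetaMin_neg.trans_le hz
  have hc2 : ContinuousOn (derivWithin w1 (Ici 0)) (Ici 0) := by
    refine ContinuousOn.congr ?_ e2
    refine ((ContinuousOn.mul ?_ hw).neg).div_const _
    exact continuous_ofReal.comp_continuousOn
      (continuousOn_id.add (continuousOn_const.mul hV))
  have hc1 : ContDiffOn ℝ 1 w1 (Ici 0) := by
    rw [show (1 : WithTop ℕ∞) = 0 + 1 by norm_num, contDiffOn_succ_iff_derivWithin hu]
    exact ⟨fun z hz => (h2 z hz).differentiableAt.differentiableWithinAt,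
      fun h => absurd h (by simp), contDiffOn_zero.mpr hc2⟩
  refine ⟨?_, fun z hz => ?_⟩
  · rw [show (2 : WithTop ℕ∞) = 1 + 1 by norm_num, contDiffOn_succ_iff_derivWithin hu]
    exact ⟨fun z hz => (h1 z hz).differentiableAt.differentiableWithinAt,
      fun h => absurd h (by simp), hc1.congr e1⟩
  · rw [iteratedDerivWithin_succ, iteratedDerivWithin_one, derivWithin_congr e1 (e1 z hz), e2 z hz]
    have : (σ : ℂ) ≠ 0 := by exact_mod_cast hσ
    field_simp

theorem IsSolution.hasDerivWithinAt {σ : ℝ} {w : ℝ → ℂ} (h : IsSolution σ w) {z : ℝ}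
    (hz : 0 ≤ z) : HasDerivWithinAt w (derivWithin w (Ici 0) z) (Ici 0) z :=
  (h.1.differentiableOn (by norm_num) z hz).hasDerivWithinAt

theorem IsSolution.hasDerivWithinAt_deriv {σ : ℝ} (hσ : σ ≠ 0) {w : ℝ → ℂ} (h : IsSolution σ w)
    {z : ℝ} (hz : 0 ≤ z) : HasDerivWithinAt (derivWithin w (Ici 0))
      (-(((z + σ ^ 2 * V z : ℝ) : ℂ) * w z) / (σ : ℂ) ^ 2) (Ici 0) z := by
  have hu := uniqueDiffOn_Ici (0 : ℝ)
  have h1 := h.1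
  rw [show (2 : WithTop ℕ∞) = 1 + 1 by norm_num, contDiffOn_succ_iff_derivWithin hu] at h1
  have h2 := (h1.2.2.differentiableOn (by norm_num) z hz).hasDerivWithinAt
  have e := h.2 z hz
  rw [iteratedDerivWithin_succ, iteratedDerivWithin_one] at e
  have hs : (σ : ℂ) ≠ 0 := by exact_mod_cast hσ
  have e' : derivWithin (derivWithin w (Ici 0)) (Ici 0) z =
      -(((z + σ ^ 2 * V z : ℝ) : ℂ) * w z) / (σ : ℂ) ^ 2 := by rw [← e]; field_simp
  rwa [← e']

/-- The Wronskian. -/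
def wrons (w u : ℝ → ℂ) (z : ℝ) : ℂ := w z * derivWithin u (Ici 0) z - derivWithin w (Ici 0) z * u z

theorem wrons_eq {σ : ℝ} (hσ : σ ≠ 0) {w u : ℝ → ℂ} (hw : IsSolution σ w) (hu : IsSolution σ u)
    {z : ℝ} (hz : 0 ≤ z) : wrons w u z = wrons w u 0 := by
  have hd : ∀ z, 0 ≤ z → HasDerivWithinAt (wrons w u) 0 (Ici 0) z := fun z hz => by
    refine (((hw.hasDerivWithinAt hz).mul (hu.hasDerivWithinAt_deriv hσ hz)).sub
      ((hw.hasDerivWithinAt_deriv hσ hz).mul (hu.hasDerivWithinAt hz))).congr_deriv ?_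
    ring
  have h := (convex_Ici (0 : ℝ)).norm_image_sub_le_of_norm_hasDerivWithin_le (𝕜 := ℝ) (C := 0)
    (fun z hz => hd z hz) (fun z _ => by simp) (self_mem_Ici) hz
  rw [zero_mul, norm_le_zero_iff, sub_eq_zero] at h
  exact h

theorem isSolutionBasis_of_wrons {σ : ℝ} (hσ : σ ≠ 0) {w u : ℝ → ℂ} (hw : IsSolution σ w)
    (hu : IsSolution σ u) (h0 : wrons w u 0 ≠ 0) : IsSolutionBasis σ w u := by
  refine ⟨hw, hu, fun f hf => ?_⟩
  refine ⟨(wrons f u 0 / wrons w u 0, wrons w f 0 / wrons w u 0), fun z hz => ?_, ?_⟩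
  · rw [← wrons_eq hσ hw hu hz] at h0
    rw [← wrons_eq hσ hw hu hz, ← wrons_eq hσ hf hu hz, ← wrons_eq hσ hw hf hz]; field_simp
    simp only [wrons]
    ring
  · rintro ⟨p1, p2⟩ hp
    have hd : derivWithin f (Ici 0) 0 =
        p1 * derivWithin w (Ici 0) 0 + p2 * derivWithin u (Ici 0) 0 := by
      have h := ((hw.hasDerivWithinAt le_rfl).const_mul p1).add
        ((hu.hasDerivWithinAt le_rfl).const_mul p2)
      exact (h.congr (fun z hz => hp z hz) (hp 0 self_mem_Ici)).derivWithin
        (uniqueDiffOn_Ici 0 0 self_mem_Ici)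
    have hv := hp 0 self_mem_Ici
    simp only at hv
    refine Prod.ext ?_ ?_
    · simp only; rw [eq_div_iff h0]; simp only [wrons, hd, hv]; ring
    · simp only; rw [eq_div_iff h0]; simp only [wrons, hd, hv]; ring

section

variable {σ z : ℝ}

theorem tau_eq (hσ : 0 < σ) (z : ℝ) : tau σ z = -tOf (vOf σ) z := by rw [tau, tOf_vOf hσ]; ring

theorem sigma_mul_oscB (hσ : 0 < σ) (z : ℝ) :
    (σ : ℂ) * oscB σ z = betaJ 0 (vOf σ) (tOf (vOf σ) z) := by
  have e : cexpR (-3) (vOf σ) = ((σ⁻¹ : ℝ) : ℂ) := by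
    rw [cexpR, exp_vOf_mul hσ, show (-3 / 3 : ℝ) = -1 by norm_num, rpow_neg_one]
  have : (σ : ℂ) ≠ 0 := by exact_mod_cast hσ.ne'
  rw [oscB, e]; push_cast; field_simp

theorem psiMinus_eq (hσ : 0 < σ) (z : ℝ) : psiMinus oscB σ z =
    outAiry (tOf (vOf σ) z) * (1 + betaJ 0 (vOf σ) (tOf (vOf σ) z)) := by
  rw [psiMinus, sigma_mul_oscB hσ, tau_eq hσ, outAiry]

theorem psiPlus_eq (σ z : ℝ) :
    psiPlus (fun σ z => conj (oscB σ z)) σ z = conj (psiMinus oscB σ z) := by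
  rw [psiPlus, psiMinus]; simp

/-- The `ζ`-derivative of `psiMinus oscB`. -/
def psiMinus' (σ z : ℝ) : ℂ := cexpR (-2) (vOf σ) *
  (outAiry' (tOf (vOf σ) z) * (1 + betaJ 0 (vOf σ) (tOf (vOf σ) z)) +
    outAiry (tOf (vOf σ) z) * hJ 0 (vOf σ) (tOf (vOf σ) z))

theorem hasDerivAt_psiMinus (hσ : σ ∈ Ioo 0 sigma0) (hz : 0 ≤ z) :
    HasDerivAt (psiMinus oscB σ) (psiMinus' σ z) z := by
  have ht := hasDerivAt_tOf_right (vOf σ) z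
  have h1 := (hasDerivAt_outAiry (tOf (vOf σ) z)).scomp z ht
  have h2 := ((hasDerivAt_betaJ 0 (vOf_lt hσ) (neg_one_lt_tOf (vOf σ) hz)).scomp z ht).const_add 1
  refine ((h1.mul h2).congr_of_eventuallyEq (Eventually.of_forall fun z =>
    psiMinus_eq hσ.1 z)).congr_deriv ?_
  simp only [psiMinus', cexpR, real_smul, Function.comp]
  ring

theorem hasDerivAt_psiMinus' (hσ : σ ∈ Ioo 0 sigma0) (hz : 0 ≤ z) : HasDerivAt (psiMinus' σ)
      (-(((z + σ ^ 2 * V z : ℝ) : ℂ) * psiMinus oscB σ z) / (σ : ℂ) ^ 2) z := by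
  have hv := vOf_lt hσ
  have htp := neg_one_lt_tOf (vOf σ) hz
  have ht := hasDerivAt_tOf_right (vOf σ) z
  have h1 := (hasDerivAt_outAiry (tOf (vOf σ) z)).scomp z ht
  have h1' := (hasDerivAt_outAiry' (tOf (vOf σ) z)).scomp z ht
  have h2 := ((hasDerivAt_betaJ 0 hv htp).scomp z ht).const_add 1
  have h3 := (hasDerivAt_hJ 0 hv htp).scomp z ht
  refine (((h1'.mul h2).add (h1.mul h3)).const_mul (cexpR (-2) (vOf σ))).congr_deriv ?_
  have hp := outAiry_mul_airyP (tOf (vOf σ) z)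
  rw [psiMinus_eq hσ.1, gJ_zero hv htp.le]
  have hσ0 : (σ : ℂ) ≠ 0 := by exact_mod_cast hσ.1.ne'
  have ea : exp (vOf σ) ^ 3 = σ := by
    rw [← Real.exp_nat_mul, vOf, show ((3 : ℕ) : ℝ) * (log σ / 3) = log σ by push_cast; ring,
      Real.exp_log hσ.1]
  have hz' : exp (vOf σ) ^ 2 * tOf (vOf σ) z = z := by
    rw [tOf, ← mul_assoc, ← Real.exp_nat_mul, ← Real.exp_add]; norm_num
  have em : exp (-2 * vOf σ) = (exp (vOf σ) ^ 2)⁻¹ := by rw [← exp_neg_nat_mul]; norm_num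
  simp only [cexpR, real_smul, Function.comp, symFun]
  rw [hz', em]
  generalize outAiry (tOf (vOf σ) z) = ψ at *
  generalize outAiry' (tOf (vOf σ) z) = ψ' at *
  generalize airyP (tOf (vOf σ) z) = p at *
  generalize betaJ 0 (vOf σ) (tOf (vOf σ) z) = β at *
  generalize hJ 0 (vOf σ) (tOf (vOf σ) z) = h at *
  generalize tOf (vOf σ) z = t at *
  have ha := exp_pos (vOf σ)
  generalize exp (vOf σ) = a at *
  have ha0 : (a : ℂ) ≠ 0 := by exact_mod_cast ha.ne'
  generalize V z = U at *
  subst hz' ea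
  push_cast; field_simp
  linear_combination (-h) * hp

theorem isSolution_psiMinus (hσ : σ ∈ Ioo 0 sigma0) : IsSolution σ (psiMinus oscB σ) :=
  IsSolution.of_hasDerivAt hσ.1.ne' (fun _ hz => hasDerivAt_psiMinus hσ hz)
    fun _ hz => hasDerivAt_psiMinus' hσ hz

/-- The relative error of the conjugate solution. -/
def oscBconj (σ z : ℝ) : ℂ := conj (oscB σ z)

theorem psiPlus_eq_conj (σ : ℝ) :
    psiPlus oscBconj σ = fun z => conj (psiMinus oscB σ z) := funext (psiPlus_eq σ)

theorem isSolution_psiPlus (hσ : σ ∈ Ioo 0 sigma0) : IsSolution σ (psiPlus oscBconj σ) := by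
  rw [psiPlus_eq_conj]
  refine IsSolution.of_hasDerivAt hσ.1.ne' (w1 := fun z => conj (psiMinus' σ z))
    (fun _ hz => hasDerivAt_conj (hasDerivAt_psiMinus hσ hz)) fun z hz => ?_
  refine (hasDerivAt_conj (hasDerivAt_psiMinus' hσ hz)).congr_deriv ?_
  simp

theorem derivWithin_psiMinus (hσ : σ ∈ Ioo 0 sigma0) (hz : 0 ≤ z) :
    derivWithin (psiMinus oscB σ) (Ici 0) z = psiMinus' σ z :=
  (hasDerivAt_psiMinus hσ hz).hasDerivWithinAt.derivWithin (uniqueDiffOn_Ici 0 z hz)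

theorem derivWithin_psiPlus (hσ : σ ∈ Ioo 0 sigma0) (hz : 0 ≤ z) :
    derivWithin (psiPlus oscBconj σ) (Ici 0) z = conj (psiMinus' σ z) := by
  rw [psiPlus_eq_conj]
  exact (hasDerivAt_conj (hasDerivAt_psiMinus hσ hz)).hasDerivWithinAt.derivWithin
    (uniqueDiffOn_Ici 0 z hz)

theorem tendsto_tOf (v : ℝ) : Tendsto (tOf v) atTop atTop := tendsto_id.const_mul_atTop (exp_pos _)

theorem wrons_psi (hσ : σ ∈ Ioo 0 sigma0) :
    wrons (psiPlus oscBconj σ) (psiMinus oscB σ) 0 = -(cexpR (-2) (vOf σ) * airyW) := by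
  have hv := vOf_lt hσ
  have hconst : ∀ z, 0 ≤ z → wrons (psiPlus oscBconj σ) (psiMinus oscB σ) z =
      wrons (psiPlus oscBconj σ) (psiMinus oscB σ) 0 := fun z hz =>
    wrons_eq hσ.1.ne' (isSolution_psiPlus hσ) (isSolution_psiMinus hσ) hz
  set F : ℝ → ℂ := fun t => cexpR (-2) (vOf σ) * (-(airyW * (conj (1 + betaJ 0 (vOf σ) t) *
    (1 + betaJ 0 (vOf σ) t))) + outAiry t * conj (outAiry t) *
      (conj (1 + betaJ 0 (vOf σ) t) * hJ 0 (vOf σ) t -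
        conj (hJ 0 (vOf σ) t) * (1 + betaJ 0 (vOf σ) t))) with hF
  have hcc : ∀ w : ℂ, conj (conj w) = w := Complex.conj_conj
  have heq : ∀ z, 0 ≤ z → wrons (psiPlus oscBconj σ) (psiMinus oscB σ) z = F (tOf (vOf σ) z) :=
    fun z hz => by
      rw [wrons, derivWithin_psiMinus hσ hz, derivWithin_psiPlus hσ hz, psiPlus_eq_conj]
      simp only [psiMinus_eq hσ.1, psiMinus', map_mul, map_add]
      have hc : conj (cexpR (-2) (vOf σ)) = cexpR (-2) (vOf σ) := conj_ofReal _
      rw [hc, hF, ← outAiry_wronskian (tOf (vOf σ) z)]; simp only [map_add, map_one]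
      ring
  have c : ∀ {f : ℝ → ℂ} {l : ℂ}, Tendsto f atTop (𝓝 l) →
      Tendsto (fun t => conj (f t)) atTop (𝓝 (conj l)) := fun h =>
    (Complex.continuous_conj.tendsto _).comp h
  have hβ : Tendsto (fun t => 1 + betaJ 0 (vOf σ) t) atTop (𝓝 (1 + 0)) :=
    (tendsto_betaJ (by norm_num) hv).const_add 1
  have hh := tendsto_hJ (j := 0) (by norm_num) hv
  have hN : Tendsto (fun t => outAiry t * conj (outAiry t) *
      (conj (1 + betaJ 0 (vOf σ) t) * hJ 0 (vOf σ) t -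
        conj (hJ 0 (vOf σ) t) * (1 + betaJ 0 (vOf σ) t))) atTop (𝓝 0) := by
    have h1 := (((c hβ).mul hh).sub ((c hh).mul hβ)).norm.const_mul airyC
    simp only [map_zero, mul_zero, zero_mul, sub_zero, norm_zero] at h1
    rw [tendsto_zero_iff_norm_tendsto_zero]
    refine squeeze_zero' (Eventually.of_forall fun t => norm_nonneg _) ?_ h1
    filter_upwards [eventually_ge_atTop (-1)] with t ht
    rw [norm_mul, norm_mul, RCLike.norm_conj, ← sq]; gcongr
    exact (norm_outAiry_sq_le ht).trans (div_le_self airyC_pos.le (one_le_wt ht))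
  have hlim : Tendsto F atTop (𝓝 (cexpR (-2) (vOf σ) * (-(airyW * (conj (1 + 0) *
      (1 + 0))) + 0))) :=
    (((((c hβ).mul hβ).const_mul airyW).neg).add hN).const_mul _
  have h2 := hlim.comp (tendsto_tOf (vOf σ))
  have h3 : Tendsto (F ∘ tOf (vOf σ)) atTop
      (𝓝 (wrons (psiPlus oscBconj σ) (psiMinus oscB σ) 0)) := by
    refine tendsto_const_nhds.congr' ?_
    filter_upwards [eventually_ge_atTop 0] with z hz
    rw [← hconst z hz, heq z hz]; rfl
  rw [tendsto_nhds_unique h3 h2]; simp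

theorem isSolutionBasis_psi (hσ : σ ∈ Ioo 0 sigma0) :
    IsSolutionBasis σ (psiPlus oscBconj σ) (psiMinus oscB σ) := by
  refine isSolutionBasis_of_wrons hσ.1.ne' (isSolution_psiPlus hσ) (isSolution_psiMinus hσ) ?_
  rw [wrons_psi hσ]
  refine neg_ne_zero.mpr (mul_ne_zero ?_ airyW_ne_zero)
  rw [cexpR]; exact_mod_cast (exp_pos _).ne'

end

/-! ### The phase of the Gamma function on a vertical line -/

/-- The kernel of the Euler-Maclaurin formula to second order. -/
def sawP (t : ℝ) : ℝ := Int.fract t * (1 - Int.fract t) / 2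

theorem abs_sawP_le (t : ℝ) : |sawP t| ≤ 1 := by
  have h0 := Int.fract_nonneg t
  have h1 := (Int.fract_lt_one t).le
  rw [sawP, abs_of_nonneg (by have := sub_nonneg.mpr h1; positivity)]; nlinarith

theorem measurable_sawP : Measurable sawP := by
  unfold sawP
  fun_prop

theorem sawP_eq {k : ℕ} {t : ℝ} (h0 : (k : ℝ) ≤ t) (h1 : t ≤ k + 1) :
    sawP t = (t - k) * (k + 1 - t) / 2 := by
  rcases h1.eq_or_lt with rfl | h1
  · have : Int.fract ((k : ℝ) + 1) = 0 := by
      rw [Int.fract_add_one, Int.fract_natCast]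
    simp [sawP, this]
  · have : Int.fract t = t - k := by
      rw [Int.fract_eq_iff]; exact ⟨by linarith, by linarith, k, by push_cast; ring⟩
    rw [sawP, this]; ring

/-- The majorant of the remainder kernels. -/
def gammaMaj (η t : ℝ) : ℝ := 2 * t / (t ^ 2 + η ^ 2) ^ 2

theorem hasDerivAt_gammaMaj_primitive {η : ℝ} (hη : 0 < η) (t : ℝ) :
    HasDerivAt (fun t : ℝ => -(t ^ 2 + η ^ 2)⁻¹) (gammaMaj η t) t := by
  have hD : t ^ 2 + η ^ 2 ≠ 0 := by positivity
  refine ((((hasDerivAt_pow 2 t).add_const (η ^ 2)).inv hD).neg).congr_deriv ?_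
  rw [gammaMaj]; push_cast; ring

theorem tendsto_gammaMaj_primitive (η : ℝ) :
    Tendsto (fun t : ℝ => -(t ^ 2 + η ^ 2)⁻¹) atTop (𝓝 (-0)) :=
  (tendsto_inv_atTop_zero.comp (tendsto_atTop_add_const_right _ _
    (tendsto_pow_atTop two_ne_zero))).neg

theorem gammaMaj_nonneg {η t : ℝ} (ht : 0 ≤ t) : 0 ≤ gammaMaj η t := by unfold gammaMaj; positivity

theorem integrableOn_gammaMaj {η : ℝ} (hη : 0 < η) : IntegrableOn (gammaMaj η) (Ioi 0) :=
  integrableOn_Ioi_deriv_of_nonneg' (fun t _ => hasDerivAt_gammaMaj_primitive hη t)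
    (fun _ ht => gammaMaj_nonneg (le_of_lt ht)) (tendsto_gammaMaj_primitive η)

theorem integral_gammaMaj {η : ℝ} (hη : 0 < η) : ∫ t in Ioi 0, gammaMaj η t = (η ^ 2)⁻¹ := by
  rw [integral_Ioi_of_hasDerivAt_of_nonneg' (fun t _ => hasDerivAt_gammaMaj_primitive hη t)
    (fun _ ht => gammaMaj_nonneg (le_of_lt ht)) (tendsto_gammaMaj_primitive η)]
  simp

theorem gammaMaj_anti {η η' t : ℝ} (h0 : 0 < η') (h : η' ≤ η) (ht : 0 ≤ t) :
    gammaMaj η t ≤ gammaMaj η' t := by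
  unfold gammaMaj
  gcongr

/-- The remainder kernel and its first two derivatives in the parameter. -/
def gammaKer (j : ℕ) (η t : ℝ) : ℝ := if j = 0 then η * (2 * t / (t ^ 2 + η ^ 2) ^ 2)
  else if j = 1 then 2 * t / (t ^ 2 + η ^ 2) ^ 2 - 8 * η ^ 2 * t / (t ^ 2 + η ^ 2) ^ 3
  else -(24 * η * t) / (t ^ 2 + η ^ 2) ^ 3 + 48 * η ^ 3 * t / (t ^ 2 + η ^ 2) ^ 4

theorem hasDerivAt_gammaKer {j : ℕ} (hj : j ≤ 1) {η : ℝ} (hη : 0 < η) (t : ℝ) :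
    HasDerivAt (fun η => gammaKer j η t) (gammaKer (j + 1) η t) η := by
  have hD : t ^ 2 + η ^ 2 ≠ 0 := by positivity
  have h1 : HasDerivAt (fun η : ℝ => t ^ 2 + η ^ 2) (2 * η) η :=
    ((hasDerivAt_pow 2 η).const_add (t ^ 2)).congr_deriv (by push_cast; ring)
  have h2 := (hasDerivAt_const η (2 * t)).div (h1.pow 2) (pow_ne_zero 2 hD)
  interval_cases j
  · refine ((hasDerivAt_id η).mul h2).congr_deriv ?_
    simp only [gammaKer, id, one_ne_zero, if_false, if_true, zero_add, Pi.pow_apply, Pi.div_apply]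
    generalize t ^ 2 + η ^ 2 = D at hD
    push_cast; field_simp
    ring
  · have h3 := (((hasDerivAt_pow 2 η).const_mul 8).mul_const t).div (h1.pow 3) (pow_ne_zero 3 hD)
    refine (h2.sub h3).congr_deriv ?_
    simp only [gammaKer, Pi.pow_apply]
    norm_num
    generalize t ^ 2 + η ^ 2 = D at hD
    field_simp; ring

theorem abs_gammaKer_le (j : ℕ) {η t : ℝ} (hη : 0 < η) (ht : 0 ≤ t) :
    |gammaKer j η t| ≤ (if j = 0 then η else if j = 1 then 5 else 36 / η) * gammaMaj η t := by
  have hD : 0 < t ^ 2 + η ^ 2 := by positivity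
  have hs : η ^ 2 / (t ^ 2 + η ^ 2) ≤ 1 := by rw [div_le_one hD]; nlinarith
  have hs0 : 0 ≤ η ^ 2 / (t ^ 2 + η ^ 2) := by positivity
  have hB := gammaMaj_nonneg (η := η) ht
  unfold gammaKer
  split_ifs
  · rw [abs_of_nonneg (by positivity)]; rfl
  · have e : 2 * t / (t ^ 2 + η ^ 2) ^ 2 - 8 * η ^ 2 * t / (t ^ 2 + η ^ 2) ^ 3 =
        (1 - 4 * (η ^ 2 / (t ^ 2 + η ^ 2))) * gammaMaj η t := by
      unfold gammaMaj; generalize t ^ 2 + η ^ 2 = D at hD; field_simp; ring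
    rw [e, abs_mul, abs_of_nonneg hB]; gcongr
    rw [abs_le]; constructor <;> linarith
  · have e : -(24 * η * t) / (t ^ 2 + η ^ 2) ^ 3 + 48 * η ^ 3 * t / (t ^ 2 + η ^ 2) ^ 4 =
        (η ^ 2 / (t ^ 2 + η ^ 2) * (-12 + 24 * (η ^ 2 / (t ^ 2 + η ^ 2)))) / η * gammaMaj η t := by
      unfold gammaMaj; generalize t ^ 2 + η ^ 2 = D at hD; field_simp; ring
    rw [e, abs_mul, abs_of_nonneg hB, abs_div, abs_of_pos hη]; gcongr
    rw [abs_mul, abs_of_nonneg hs0]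
    have : |-12 + 24 * (η ^ 2 / (t ^ 2 + η ^ 2))| ≤ 36 := by rw [abs_le]; constructor <;> linarith
    nlinarith [abs_nonneg (-12 + 24 * (η ^ 2 / (t ^ 2 + η ^ 2)))]

theorem aestronglyMeasurable_gammaKer (j : ℕ) (η : ℝ) :
    AEStronglyMeasurable (fun t => sawP t * gammaKer j η t) (volume.restrict (Ioi 0)) := by
  refine (measurable_sawP.mul ?_).aestronglyMeasurable
  unfold gammaKer
  split_ifs <;> fun_prop

theorem abs_saw_mul_le (t x : ℝ) : ‖sawP t * x‖ ≤ |x| := by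
  rw [norm_mul]; exact mul_le_of_le_one_left (abs_nonneg _) (abs_sawP_le t)

theorem integrableOn_gammaKer (j : ℕ) {η : ℝ} (hη : 0 < η) :
    IntegrableOn (fun t => sawP t * gammaKer j η t) (Ioi 0) := by
  refine Integrable.mono' ((integrableOn_gammaMaj hη).const_mul
    (if j = 0 then η else if j = 1 then 5 else 36 / η)) (aestronglyMeasurable_gammaKer j η) ?_
  filter_upwards [ae_restrict_mem measurableSet_Ioi] with t ht
  exact (abs_saw_mul_le _ _).trans (abs_gammaKer_le j hη (le_of_lt ht))

/-- The remainder in Stirling's formula for the phase and its derivatives. -/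
def gammaRem (j : ℕ) (η : ℝ) : ℝ := ∫ t in Ioi 0, sawP t * gammaKer j η t

theorem abs_gammaRem_le (j : ℕ) {η : ℝ} (hη : 0 < η) :
    |gammaRem j η| ≤ (if j = 0 then η else if j = 1 then 5 else 36 / η) * (η ^ 2)⁻¹ := by
  rw [← integral_gammaMaj hη, ← integral_const_mul, gammaRem, ← norm_eq_abs]
  refine norm_integral_le_of_norm_le ((integrableOn_gammaMaj hη).const_mul _) ?_
  filter_upwards [ae_restrict_mem measurableSet_Ioi] with t ht
  exact (abs_saw_mul_le _ _).trans (abs_gammaKer_le j hη (le_of_lt ht))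

theorem hasDerivAt_gammaRem {j : ℕ} (hj : j ≤ 1) {η : ℝ} (hη : 0 < η) :
    HasDerivAt (gammaRem j) (gammaRem (j + 1) η) η := by
  have hs : Ioi (η / 2) ∈ 𝓝 η := Ioi_mem_nhds (by linarith)
  refine (hasDerivAt_integral_of_dominated_loc_of_deriv_le (μ := volume.restrict (Ioi (0 : ℝ)))
    (F := fun η t => sawP t * gammaKer j η t) (x₀ := η)
    (F' := fun η t => sawP t * gammaKer (j + 1) η t)
    (bound := fun t => (5 + 72 / η) * gammaMaj (η / 2) t) hs
    (Eventually.of_forall fun η => aestronglyMeasurable_gammaKer j η)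
    (integrableOn_gammaKer j hη) (aestronglyMeasurable_gammaKer (j + 1) η) ?_
    ((integrableOn_gammaMaj (half_pos hη)).const_mul _) ?_).2
  · filter_upwards [ae_restrict_mem measurableSet_Ioi] with t ht x hx
    have hx : η / 2 < x := hx
    have hx0 : 0 < x := (half_pos hη).trans hx
    have ht : 0 ≤ t := le_of_lt ht
    refine (abs_saw_mul_le _ _).trans ((abs_gammaKer_le (j + 1) hx0 ht).trans ?_)
    refine mul_le_mul ?_ (gammaMaj_anti (half_pos hη) hx.le ht) (gammaMaj_nonneg ht)
      (by positivity)
    interval_cases j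
    · simp only [zero_add, one_ne_zero, if_false, if_true]
      have : 0 ≤ 72 / η := by positivity
      linarith
    · norm_num
      have : 36 / x ≤ 72 / η := by rw [div_le_div_iff₀ hx0 hη]; linarith
      linarith
  · refine Eventually.of_forall fun t x hx => ?_
    exact (hasDerivAt_gammaKer hj ((half_pos hη).trans hx) t).const_mul _

/-- The argument of `t + iη`. -/
def phaseF (η t : ℝ) : ℝ := π / 2 - Real.arctan (t / η)

theorem hasDerivAt_phaseF {η : ℝ} (hη : 0 < η) (t : ℝ) :
    HasDerivAt (phaseF η) (-(η / (t ^ 2 + η ^ 2))) t := by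
  have hD : t ^ 2 + η ^ 2 ≠ 0 := by positivity
  refine ((((hasDerivAt_id t).div_const η).arctan).const_sub (π / 2)).congr_deriv ?_
  have h2 : 1 + (t / η) ^ 2 ≠ 0 := by positivity
  simp only [id]
  field_simp; ring

/-- A primitive of `phaseF`. -/
def phaseG (η t : ℝ) : ℝ := t * phaseF η t + η / 2 * log (t ^ 2 + η ^ 2)

theorem hasDerivAt_phaseG {η : ℝ} (hη : 0 < η) (t : ℝ) :
    HasDerivAt (phaseG η) (phaseF η t) t := by
  have hD : t ^ 2 + η ^ 2 ≠ 0 := by positivity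
  refine (((hasDerivAt_id t).mul (hasDerivAt_phaseF hη t)).add
    ((((hasDerivAt_pow 2 t).add_const (η ^ 2)).log hD).const_mul (η / 2))).congr_deriv ?_
  simp only [id]
  push_cast; field_simp
  ring

theorem integral_saw_gammaKer_step {η : ℝ} (hη : 0 < η) (k : ℕ) :
    ∫ t in (k : ℝ)..(k + 1 : ℝ), sawP t * gammaKer 0 η t =
      (phaseF η k + phaseF η (k + 1)) / 2 - phaseG η (k + 1) + phaseG η k := by
  have hc : Continuous fun t : ℝ => (t - k) * (k + 1 - t) / 2 * gammaKer 0 η t := by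
    simp only [gammaKer, if_true]
    refine Continuous.mul (by fun_prop) (continuous_const.mul (Continuous.div (by fun_prop)
      (by fun_prop) fun t => by positivity))
  have h : ∀ t : ℝ, HasDerivAt (fun t => (t - k) * (k + 1 - t) / 2 * -(η / (t ^ 2 + η ^ 2))
      - (k + 1 / 2 - t) * phaseF η t - phaseG η t)
      ((t - k) * (k + 1 - t) / 2 * gammaKer 0 η t) t := by
    intro t
    have hD : t ^ 2 + η ^ 2 ≠ 0 := by positivity
    have h1 : HasDerivAt (fun t : ℝ => (t - k) * (k + 1 - t) / 2) (k + 1 / 2 - t) t := by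
      refine ((((hasDerivAt_id t).sub_const (k : ℝ)).mul
        ((hasDerivAt_id t).const_sub ((k : ℝ) + 1))).div_const 2).congr_deriv ?_
      simp only [id]; ring
    have h2 : HasDerivAt (fun t : ℝ => -(η / (t ^ 2 + η ^ 2))) (gammaKer 0 η t) t := by
      refine ((hasDerivAt_const t η).div ((hasDerivAt_pow 2 t).add_const (η ^ 2)) hD).neg.congr_deriv
        ?_
      simp only [gammaKer, if_true]; push_cast; field_simp; ring
    refine (((h1.mul h2).sub (((hasDerivAt_id t).const_sub ((k : ℝ) + 1 / 2)).mul
      (hasDerivAt_phaseF hη t))).sub (hasDerivAt_phaseG hη t)).congr_deriv ?_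
    simp only [id]; ring
  have key := intervalIntegral.integral_eq_sub_of_hasDerivAt (a := (k : ℝ)) (b := k + 1)
    (fun t _ => h t) (hc.intervalIntegrable _ _)
  rw [intervalIntegral.integral_congr
    (g := fun t : ℝ => (t - k) * (k + 1 - t) / 2 * gammaKer 0 η t), key]
  · ring
  · intro t ht; rw [uIcc_of_le (by linarith)] at ht
    simp only [sawP_eq ht.1 ht.2]

theorem sum_phaseF {η : ℝ} (hη : 0 < η) (N : ℕ) : ∑ j ∈ Finset.range N, phaseF η (j + 1) =
      (∫ t in (0 : ℝ)..N, sawP t * gammaKer 0 η t) - π / 4 + phaseF η N / 2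
        + phaseG η N - η * log η := by
  have hI : ∀ a b : ℕ, IntervalIntegrable (fun t => sawP t * gammaKer 0 η t) volume a b := by
    intro a b; rw [intervalIntegrable_iff]
    refine (integrableOn_gammaKer 0 hη).mono_set fun t ht => ?_
    exact lt_of_le_of_lt (le_min (Nat.cast_nonneg a) (Nat.cast_nonneg b)) ht.1
  induction N with
  | zero =>
    simp only [Finset.range_zero, Finset.sum_empty, Nat.cast_zero, intervalIntegral.integral_same,
      phaseF, phaseG, zero_div, Real.arctan_zero]
    have : (0 : ℝ) ^ 2 + η ^ 2 = η ^ 2 := by ring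
    rw [this, Real.log_pow]; push_cast; ring
  | succ N ih =>
    have h0 := hI 0 N
    have h1 := hI N (N + 1)
    push_cast at h0 h1
    rw [Finset.sum_range_succ, ih]; push_cast
    rw [← intervalIntegral.integral_add_adjacent_intervals h0 h1, integral_saw_gammaKer_step hη]
    ring

theorem tendsto_mul_phaseF {η : ℝ} (hη : 0 < η) :
    Tendsto (fun n : ℕ => ((n : ℝ) + 1) * phaseF η (n + 1)) atTop (𝓝 η) := by
  have h1 : HasDerivAt (fun x : ℝ => Real.arctan (η * x)) η 0 := by
    refine (((hasDerivAt_id (0 : ℝ)).const_mul η).arctan).congr_deriv ?_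
    simp
  have h2 := h1.tendsto_slope
  have h3 : Tendsto (fun n : ℕ => (1 : ℝ) / (n + 1)) atTop (𝓝[≠] 0) := by
    refine tendsto_nhdsWithin_iff.mpr ⟨tendsto_one_div_add_atTop_nhds_zero_nat, ?_⟩
    exact Eventually.of_forall fun n => by simp only [mem_compl_iff, mem_singleton_iff]; positivity
  refine (h2.comp h3).congr fun n => ?_
  have hn : (0 : ℝ) < n + 1 := by positivity
  have : Real.arctan (η * (1 / (n + 1))) = phaseF η (n + 1) := by
    rw [phaseF, ← Real.arctan_inv_of_pos (by positivity)]
    congr 1; field_simp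
  simp only [Function.comp, slope, vsub_eq_sub, sub_zero, smul_eq_mul, mul_zero,
    Real.arctan_zero, this]
  field_simp

theorem tendsto_phaseF {η : ℝ} (hη : 0 < η) :
    Tendsto (fun n : ℕ => phaseF η (n + 1)) atTop (𝓝 0) := by
  have := (tendsto_one_div_add_atTop_nhds_zero_nat (𝕜 := ℝ)).mul (tendsto_mul_phaseF hη)
  rw [zero_mul] at this
  refine this.congr fun n => ?_
  have hn : (n + 1 : ℝ) ≠ 0 := by positivity
  field_simp

theorem tendsto_log_sub (η : ℝ) :
    Tendsto (fun n : ℕ => η / 2 * log (((n : ℝ) + 1) ^ 2 + η ^ 2) - η * log n) atTop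
      (𝓝 0) := by
  have h0 : Tendsto (fun n : ℕ => ((n : ℝ))⁻¹) atTop (𝓝 0) := tendsto_inv_atTop_nhds_zero_nat
  have h1 : Tendsto (fun n : ℕ => (1 + (n : ℝ)⁻¹) ^ 2 + (η * (n : ℝ)⁻¹) ^ 2) atTop
      (𝓝 ((1 + 0) ^ 2 + (η * 0) ^ 2)) :=
    ((h0.const_add 1).pow 2).add ((h0.const_mul η).pow 2)
  have h2 := ((Real.continuousAt_log (by norm_num)).tendsto.comp h1).const_mul (η / 2)
  have e : η / 2 * log ((1 + 0) ^ 2 + (η * 0) ^ 2) = 0 := by simp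
  rw [e] at h2
  refine h2.congr' ?_
  filter_upwards [eventually_gt_atTop 0] with n hn
  have hn : (0 : ℝ) < n := by exact_mod_cast hn
  have e2 : (1 + (n : ℝ)⁻¹) ^ 2 + (η * (n : ℝ)⁻¹) ^ 2 = (((n : ℝ) + 1) ^ 2 + η ^ 2) / n ^ 2 := by
    field_simp
  simp only [Function.comp]
  rw [e2, Real.log_div (by positivity) (by positivity), Real.log_pow]; push_cast; ring

theorem tendsto_gamma_phase {η : ℝ} (hη : 0 < η) :
    Tendsto (fun n : ℕ => -(η * log n) + ∑ j ∈ Finset.range (n + 1), phaseF η (j + 1)) atTop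
      (𝓝 (η - η * log η - π / 4 + gammaRem 0 η)) := by
  have h1 := intervalIntegral_tendsto_integral_Ioi (μ := volume) 0 (integrableOn_gammaKer 0 hη)
    (tendsto_atTop_add_const_right _ (1 : ℝ) tendsto_natCast_atTop_atTop)
  have h2 := ((((h1.sub_const (π / 4)).add ((tendsto_phaseF hη).div_const 2)).add
    (tendsto_mul_phaseF hη)).add (tendsto_log_sub η)).sub_const (η * log η)
  refine (h2.congr fun n => ?_).trans (le_of_eq ?_)
  · rw [sum_phaseF hη (n + 1), phaseG]; push_cast
    ring
  · congr 1; rw [gammaRem]; ring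

theorem sub_I_mul_eq {η : ℝ} (hη : 0 < η) {t : ℝ} (ht : 0 < t) :
    (t : ℂ) - I * η = ‖(t : ℂ) - I * η‖ * cexp (-(I * phaseF η t)) := by
  have e : ((t : ℂ) - I * η).arg = -phaseF η t := by
    have h1 : Real.tan (((t : ℂ) - I * η).arg) = -(η / t) := by rw [Complex.tan_arg]; simp; ring
    have h2 : |((t : ℂ) - I * η).arg| < π / 2 := by
      rw [Complex.abs_arg_lt_pi_div_two_iff]; left; simpa using ht
    rw [abs_lt] at h2
    have h3 := Real.arctan_tan h2.1 h2.2
    rw [h1, Real.arctan_neg, ← inv_div, Real.arctan_inv_of_pos (by positivity)] at h3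
    rw [← h3]; rfl
  conv_lhs => rw [← Complex.norm_mul_exp_arg_mul_I ((t : ℂ) - I * η), e]
  push_cast
  congr 2; ring

theorem Gamma_phase {η : ℝ} (hη : 0 < η) : Gamma (1 - I * η) = ‖Gamma (1 - I * η)‖ * cexp (I *
        ((η - η * log η - π / 4 + gammaRem 0 η : ℝ) : ℂ)) := by
  have h1 := Complex.GammaSeq_tendsto_Gamma (1 - I * η)
  have h2 := (continuous_ofReal.continuousAt.tendsto.comp h1.norm).mul
    ((Complex.continuous_exp.continuousAt.tendsto).comp
    ((continuous_ofReal.continuousAt.tendsto.comp (tendsto_gamma_phase hη)).const_mul I))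
  refine tendsto_nhds_unique (h1.congr' ?_) h2
  filter_upwards [eventually_gt_atTop 0] with n hn
  have hn : (0 : ℝ) < n := by exact_mod_cast hn
  have hprod : ∏ j ∈ Finset.range (n + 1), (1 - I * (η : ℂ) + j) =
      (∏ j ∈ Finset.range (n + 1), ‖1 - I * (η : ℂ) + j‖ : ℝ) *
        cexp (-(I * ∑ j ∈ Finset.range (n + 1), (phaseF η (j + 1) : ℂ))) := by
    rw [Finset.mul_sum, ← Finset.sum_neg_distrib, Complex.exp_sum, Complex.ofReal_prod,
      ← Finset.prod_mul_distrib]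
    refine Finset.prod_congr rfl fun j _ => ?_
    have := sub_I_mul_eq hη (t := (j : ℝ) + 1) (by positivity)
    push_cast at this
    rw [show 1 - I * (η : ℂ) + j = (j : ℂ) + 1 - I * η by ring]; exact this
  have hpow : (n : ℂ) ^ (1 - I * (η : ℂ)) =
      ‖(n : ℂ) ^ (1 - I * (η : ℂ))‖ *
        cexp (-(I * (η * log n : ℝ))) := by
    have hn' : (n : ℂ) ≠ 0 := by exact_mod_cast hn.ne'
    have e1 : ‖(n : ℂ) ^ (1 - I * (η : ℂ))‖ = n := by
      rw [show (n : ℂ) = ((n : ℝ) : ℂ) by simp, norm_cpow_eq_rpow_re_of_pos hn]; simp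
    rw [e1, sub_eq_add_neg, Complex.cpow_add _ _ hn', Complex.cpow_one,
      Complex.cpow_def_of_ne_zero hn', ← Complex.natCast_log]
    push_cast
    congr 2; ring
  set R : ℝ := ∏ j ∈ Finset.range (n + 1), ‖1 - I * (η : ℂ) + j‖
  set T : ℂ := ∑ j ∈ Finset.range (n + 1), (phaseF η (j + 1) : ℂ)
  have hR : R = ‖∏ j ∈ Finset.range (n + 1), (1 - I * (η : ℂ) + j)‖ := by rw [norm_prod]
  have hnorm : ‖Complex.GammaSeq (1 - I * η) n‖ =
      ‖(n : ℂ) ^ (1 - I * (η : ℂ))‖ * n.factorial / R := by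
    rw [Complex.GammaSeq, norm_div, norm_mul, ← hR]; simp
  simp only [Function.comp]
  rw [hnorm, Complex.GammaSeq, hprod]
  conv_lhs => rw [hpow]
  push_cast; rw [mul_add, Complex.exp_add, mul_neg, Complex.exp_neg (I * T)]
  rw [← div_div, div_inv_eq_mul]; ring

theorem norm_Gamma_sq {η : ℝ} (hη : 0 < η) :
    ‖Gamma (1 - I * η)‖ ^ 2 = π * η / sinh (π * η) := by
  have h := Complex.Gamma_mul_Gamma_one_sub (I * η)
  have hne : I * (η : ℂ) ≠ 0 := by simp [hη.ne']
  have h1 := Complex.Gamma_add_one (I * η) hne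
  have h2 : Gamma (I * η + 1) =
      conj (Gamma (1 - I * η)) := by
    rw [← Complex.Gamma_conj]
    congr 1; simp [add_comm]
  have h3 : Complex.sin (π * (I * η)) = I * sinh (π * η) := by
    rw [show (π : ℂ) * (I * η) = (π * η : ℝ) * I by push_cast; ring,
      Complex.sin_mul_I]
    push_cast; ring
  have hs : (sinh (π * η) : ℂ) ≠ 0 := by exact_mod_cast (Real.sinh_pos_iff.mpr (by positivity)).ne'
  have key : (Gamma (1 - I * η)) * conj (Gamma (1 - I * η))
      = ((π * η / sinh (π * η) : ℝ) : ℂ) := by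
    rw [← h2, h1, mul_comm, mul_assoc, h, h3]; push_cast at hs ⊢
    have := Complex.I_ne_zero
    field_simp
  rw [Complex.mul_conj, Complex.normSq_eq_norm_sq] at key
  exact_mod_cast key

/-! ### The regular Coulomb function and its Laplace transform -/

/-- The coefficients of `₁F₁(1 - iη; 2; z)`. -/
def coulCoeff (η : ℝ) (n : ℕ) : ℂ :=
  (ascPochhammer ℂ n).eval (1 - I * η) / ((n + 1).factorial * n.factorial)

theorem coulCoeff_succ (η : ℝ) (n : ℕ) : ((n : ℂ) + 1) * (1 * n + 2) * coulCoeff η (n + 1) =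
      (1 * n + (1 - I * η)) * coulCoeff η n := by
  simp only [coulCoeff, ascPochhammer_succ_eval, Nat.factorial_succ]
  have h1 : (n.factorial : ℂ) ≠ 0 := by exact_mod_cast n.factorial_ne_zero
  have h2 : (n : ℂ) + 1 ≠ 0 := by exact_mod_cast n.succ_ne_zero
  have h3 : (n : ℂ) + 1 + 1 ≠ 0 := by exact_mod_cast (n + 1).succ_ne_zero
  push_cast; field_simp
  ring

theorem norm_one_sub_I_mul_add_le (η : ℝ) (n : ℕ) :
    ‖1 - I * (η : ℂ) + n‖ ≤ (1 + |η|) * (n + 1) := by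
  have h1 : ‖I * (η : ℂ)‖ = |η| := by simp
  have h2 : ‖1 + (n : ℂ)‖ = 1 + n := by
    rw [show (1 : ℂ) + n = ((1 + n : ℕ) : ℂ) by push_cast; rfl, Complex.norm_natCast]
    push_cast; rfl
  calc ‖1 - I * (η : ℂ) + n‖ = ‖(1 + (n : ℂ)) - I * η‖ := by congr 1; ring
    _ ≤ 1 + n + |η| := by rw [← h1, ← h2]; exact norm_sub_le _ _
    _ ≤ _ := by nlinarith [abs_nonneg η, (Nat.cast_nonneg n : (0 : ℝ) ≤ n)]

theorem norm_ascPochhammer_le (η : ℝ) (n : ℕ) :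
    ‖(ascPochhammer ℂ n).eval (1 - I * η)‖ ≤ (1 + |η|) ^ n * n.factorial := by
  induction n with
  | zero => simp
  | succ n ih =>
    rw [ascPochhammer_succ_eval, norm_mul, Nat.factorial_succ]; push_cast
    calc _ ≤ (1 + |η|) ^ n * n.factorial * ((1 + |η|) * (n + 1)) :=
          mul_le_mul ih (norm_one_sub_I_mul_add_le η n) (norm_nonneg _) (by positivity)
      _ = _ := by ring

theorem norm_coulCoeff_le (η : ℝ) (n : ℕ) :
    ‖coulCoeff η n‖ ≤ (1 + |η|) ^ n / (n + 1).factorial := by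
  have hn : (0 : ℝ) < n.factorial := by positivity
  rw [coulCoeff, norm_div, norm_mul, Complex.norm_natCast, Complex.norm_natCast,
    div_le_div_iff₀ (by positivity) (by positivity)]
  calc _ ≤ (1 + |η|) ^ n * n.factorial * (n + 1).factorial := by
        gcongr; exact norm_ascPochhammer_le η n
    _ = _ := by ring

theorem entireCoeff_coul (η : ℝ) : EntireCoeff (coulCoeff η) := by
  refine ⟨1, 1 + |η|, fun n => (norm_coulCoeff_le η n).trans ?_⟩
  rw [one_mul]; gcongr
  omega

/-- The regular solution of `y'' = (2ησ / r - σ²) y` with unit slope at the origin. -/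
def coulReg (η σ r : ℝ) : ℂ := r * (cexp (-(I * σ * r)) * powSum (coulCoeff η) (2 * I * σ * r))

theorem continuous_powSum {d : ℕ → ℂ} (h : EntireCoeff d) : Continuous (powSum d) :=
  continuous_iff_continuousAt.mpr fun z => (h.hasDerivAt z).continuousAt

theorem continuous_coulReg (η σ : ℝ) : Continuous (coulReg η σ) := by
  have := continuous_powSum (entireCoeff_coul η)
  unfold coulReg
  fun_prop

theorem hasSum_one_sub_cpow (a : ℂ) {u : ℂ} (hu : ‖u‖ < 1) :
    HasSum (fun n : ℕ => (ascPochhammer ℂ n).eval a / n.factorial * u ^ n) ((1 - u) ^ (-a)) := by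
  have h := (Complex.one_div_one_sub_cpow_hasFPowerSeriesOnBall_zero a).hasSum (y := u) (by
    rw [← ENNReal.ofReal_one, Metric.eball_ofReal]; simpa using hu)
  simp only [zero_add] at h
  rw [Complex.cpow_neg, ← one_div]
  convert! h using 2 with n
  rw [FormalMultilinearSeries.ofScalars_apply_eq, smul_eq_mul]
  congr 1
  have h1 := Ring.factorial_nsmul_multichoose_eq_ascPochhammer a n
  rw [Polynomial.ascPochhammer_smeval_eq_eval, nsmul_eq_mul] at h1
  have h2 : (n.factorial : ℂ) ≠ 0 := by exact_mod_cast n.factorial_ne_zero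
  rw [Ring.choose, show a + n - 1 - n + 1 = a by ring, ← h1]; field_simp

theorem log_div_of_re_pos {z w : ℂ} (hz : 0 < z.re) (hw : 0 < w.re) :
    Complex.log (z / w) = Complex.log z - Complex.log w := by
  have hz0 : z ≠ 0 := by rintro rfl; simp at hz
  have hw0 : w ≠ 0 := by rintro rfl; simp at hw
  have h1 := Complex.abs_arg_lt_pi_div_two_iff.mpr (Or.inl hz)
  have h2 := Complex.abs_arg_lt_pi_div_two_iff.mpr (Or.inl hw)
  rw [abs_lt] at h1 h2
  have hw1 : w.arg ≠ π := by have := pi_pos; intro h; linarith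
  have h3 : (w⁻¹).arg = -w.arg := by rw [Complex.arg_inv, if_neg hw1]
  rw [div_eq_mul_inv, (Complex.log_mul_eq_add_log_iff hz0 (inv_ne_zero hw0)).mpr, Complex.log_inv _ hw1]
  · ring
  · rw [h3]; constructor <;> linarith

/-- The Laplace transform of the regular Coulomb function. -/
def coulLap (η σ : ℝ) (z : ℂ) : ℂ := (z + I * σ) ^ (-1 - I * η) * (z - I * σ) ^ (-1 + I * η)

theorem integral_coulReg_of_large {η σ l : ℝ} (hσ : 0 < σ) (hl : 2 * σ * (1 + |η|) < l) :
    ∫ r : ℝ in Ioi 0, cexp (-(l : ℂ) * r) * coulReg η σ r = coulLap η σ l := by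
  have hη := abs_nonneg η
  have hl0 : 0 < l := lt_of_le_of_lt (by positivity) hl
  set w : ℂ := l + I * σ
  have hw : w.re = l := by simp [w]
  have hw0 : 0 < w.re := by rw [hw]; exact hl0
  have hwn : w ≠ 0 := by rintro h; rw [h] at hw0; simp at hw0
  set F : ℕ → ℝ → ℂ := fun n r => coulCoeff η n * (2 * I * σ) ^ n *
    ((r : ℂ) ^ ((n + 2 : ℂ) - 1) * cexp (-w * r))
  have hre : ∀ n : ℕ, 0 < (n + 2 : ℂ).re := fun n => by simp; positivity
  have hint : ∀ n, Integrable (F n) (volume.restrict (Ioi 0)) := fun n =>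
    (integrableOn_cpow_mul_exp (hre n) hw0).const_mul _
  have hnorm : ∀ n, ∫ r in Ioi 0, ‖F n r‖ =
      ‖coulCoeff η n‖ * (2 * σ) ^ n * ((n + 1).factorial / l ^ (n + 2)) := by
    intro n
    have e : ∀ r ∈ Ioi (0 : ℝ), ‖F n r‖ =
        ‖coulCoeff η n‖ * (2 * σ) ^ n * (r ^ ((n + 2 : ℝ) - 1) * exp (-(l * r))) := by
      intro r hr
      rw [norm_mul, norm_ofReal_cpow_mul_exp hr, hw, norm_mul, norm_pow, norm_mul, norm_mul]
      simp [abs_of_pos hσ]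
    rw [setIntegral_congr_fun measurableSet_Ioi e, integral_const_mul,
      Real.integral_rpow_mul_exp_neg_mul_Ioi (by positivity) hl0]
    congr 1
    rw [show (n : ℝ) + 2 = ((n + 1 : ℕ) : ℝ) + 1 by push_cast; ring, Real.Gamma_nat_eq_factorial,
      show ((n + 1 : ℕ) : ℝ) + 1 = ((n + 2 : ℕ) : ℝ) by push_cast; ring, rpow_natCast]
    rw [one_div, inv_pow]; ring
  have hsum : Summable fun n => ∫ r in Ioi 0, ‖F n r‖ := by
    have hq : 2 * σ * (1 + |η|) / l < 1 := by rwa [div_lt_one hl0]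
    refine Summable.of_nonneg_of_le (fun n => integral_nonneg fun _ => norm_nonneg _) (fun n => ?_)
      ((summable_geometric_of_lt_one (by positivity) hq).mul_right (l ^ 2)⁻¹)
    rw [hnorm]
    calc _ ≤ (1 + |η|) ^ n / (n + 1).factorial * (2 * σ) ^ n * ((n + 1).factorial / l ^ (n + 2)) := by
          gcongr; exact norm_coulCoeff_le η n
      _ = _ := by
          have : ((n + 1).factorial : ℝ) ≠ 0 := by positivity
          rw [div_pow, pow_add, mul_pow _ (1 + |η|)]; field_simp
  have key := hasSum_integral_of_summable_integral_norm hint hsum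
  have e1 : ∀ n, ∫ r in Ioi 0, F n r = (1 / w) ^ 2 *
      ((ascPochhammer ℂ n).eval (1 - I * η) / n.factorial *
        (2 * I * σ / w) ^ n) := by
    intro n
    have : ((n + 1).factorial : ℂ) ≠ 0 := by exact_mod_cast (n + 1).factorial_ne_zero
    simp only [F]
    rw [integral_const_mul, integral_cpow_mul_exp_neg (hre n) hw0,
      show (n : ℂ) + 2 = ((n + 1 : ℕ) : ℂ) + 1 by push_cast; ring, Complex.Gamma_nat_eq_factorial,
      show ((n + 1 : ℕ) : ℂ) + 1 = ((n + 2 : ℕ) : ℂ) by push_cast; ring, Complex.cpow_natCast,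
      coulCoeff]
    simp only [div_pow, pow_add, one_pow]
    field_simp
  have e2 : ∀ r ∈ Ioi (0 : ℝ), ∑' n, F n r = cexp (-(l : ℂ) * r) * coulReg η σ r := by
    intro r hr
    have hr' : (r : ℂ) ≠ 0 := by exact_mod_cast (ne_of_gt hr)
    have : ∀ n, F n r = r * cexp (-w * r) *
        (coulCoeff η n * (2 * I * σ * r) ^ n) := by
      intro n; simp only [F]
      rw [show (n : ℂ) + 2 - 1 = ((n + 1 : ℕ) : ℂ) by push_cast; ring, Complex.cpow_natCast, mul_pow]
      ring
    rw [tsum_congr this, tsum_mul_left, coulReg, powSum,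
      show -w * (r : ℂ) = -(l : ℂ) * r + -(I * σ * r) by simp only [w]; ring, Complex.exp_add]
    ring
  rw [setIntegral_congr_fun measurableSet_Ioi e2] at key
  simp only [e1] at key
  have hu : ‖2 * I * σ / w‖ < 1 := by
    have h1 : l ≤ ‖w‖ := by rw [← hw]; exact (Complex.re_le_norm w)
    rw [norm_div, div_lt_one (norm_pos_iff.mpr hwn)]
    simp only [norm_mul, Complex.norm_ofNat, Complex.norm_I, norm_real, norm_eq_abs, abs_of_pos hσ]
    nlinarith
  rw [key.unique ((hasSum_one_sub_cpow (1 - I * η) hu).mul_left ((1 / w) ^ 2))]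
  set z : ℂ := l - I * σ
  have hz : 0 < z.re := by simp [z, hl0]
  have hzn : z ≠ 0 := by rintro h; rw [h] at hz; simp at hz
  have e3 : 1 - 2 * I * σ / w = z / w := by field_simp; simp only [w, z]; ring
  rw [e3, coulLap, Complex.cpow_def_of_ne_zero (div_ne_zero hzn hwn), log_div_of_re_pos hz hw0,
    Complex.cpow_def_of_ne_zero hwn, Complex.cpow_def_of_ne_zero hzn]
  have e4 : (1 / w) ^ 2 = cexp (-(2 * Complex.log w)) := by
    rw [Complex.exp_neg, two_mul, Complex.exp_add, Complex.exp_log hwn]; field_simp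
  rw [e4, ← Complex.exp_add, ← Complex.exp_add]
  congr 1; ring

theorem integral_coulReg {η σ M : ℝ} (hσ : 0 < σ) (hb : ∀ r > 0, ‖coulReg η σ r‖ ≤ M) {z : ℂ}
    (hz : 0 < z.re) :
    ∫ r : ℝ in Ioi 0, cexp (-z * r) * coulReg η σ r = coulLap η σ z := by
  have hM : 0 ≤ M := (norm_nonneg _).trans (hb 1 one_pos)
  have hc : ∀ z : ℂ, Continuous fun r : ℝ => cexp (-z * r) * coulReg η σ r := fun z =>
    (by fun_prop : Continuous fun r : ℝ => cexp (-z * r)).mul (continuous_coulReg η σ)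
  have hle : ∀ (z : ℂ) (r : ℝ), 0 < r → ‖cexp (-z * r) * coulReg η σ r‖ ≤
      M * exp (-z.re * r) := by
    intro z r hr; rw [norm_mul, Complex.norm_exp, mul_comm M]
    have : (-z * (r : ℂ)).re = -z.re * r := by simp
    rw [this]; gcongr
    exact hb r hr
  have hf : DifferentiableOn ℂ
      (fun z : ℂ => ∫ r : ℝ in Ioi 0, cexp (-z * r) * coulReg η σ r) {z | 0 < z.re} := by
    intro z hz
    have hz : 0 < z.re := hz
    have hs : {w : ℂ | z.re / 2 < w.re} ∈ 𝓝 z :=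
      (isOpen_lt continuous_const Complex.continuous_re).mem_nhds (by simp; linarith)
    have := hasDerivAt_integral_of_dominated_loc_of_deriv_le (μ := volume.restrict (Ioi (0 : ℝ)))
      (F := fun (z : ℂ) (r : ℝ) => cexp (-z * r) * coulReg η σ r) (x₀ := z)
      (F' := fun (z : ℂ) (r : ℝ) => -r * (cexp (-z * r) * coulReg η σ r))
      (bound := fun r => M * (r ^ ((2 : ℝ) - 1) * exp (-(z.re / 2) * r))) hs
      (Eventually.of_forall fun z => (hc z).aestronglyMeasurable)
      ?_ ((continuous_ofReal.neg.mul (hc z)).aestronglyMeasurable) ?_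
      ((integrableOn_rpow_mul_exp (by norm_num) (by linarith)).const_mul M) ?_
    · exact this.2.differentiableAt.differentiableWithinAt
    · refine Integrable.mono' (((exp_neg_integrableOn_Ioi 0 hz)).const_mul M)
        (hc z).aestronglyMeasurable ?_
      filter_upwards [ae_restrict_mem measurableSet_Ioi] with r hr
      exact hle z r hr
    · filter_upwards [ae_restrict_mem measurableSet_Ioi] with r hr w hw
      have hr : 0 < r := hr
      have hw : z.re / 2 < w.re := hw
      rw [norm_mul, norm_neg, norm_real, norm_eq_abs, abs_of_pos hr]; norm_num
      calc r * _ ≤ r * (M * exp (-w.re * r)) := by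
            refine mul_le_mul_of_nonneg_left ?_ hr.le
            have := hle w r hr
            rwa [norm_mul, neg_mul] at this
        _ ≤ r * (M * exp (-(z.re / 2) * r)) := by gcongr
        _ = _ := by rw [neg_mul]; ring
    · refine Eventually.of_forall fun r w _ => ?_
      have h1 : HasDerivAt (fun w : ℂ => -w * (r : ℂ)) (-r) w := by
        simpa using ((hasDerivAt_id w).neg.mul_const (r : ℂ))
      exact (h1.cexp.mul_const _).congr_deriv (by ring)
  have hg : DifferentiableOn ℂ (coulLap η σ) {z | 0 < z.re} := by
    intro z hz
    have hz : 0 < z.re := hz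
    refine DifferentiableAt.differentiableWithinAt (DifferentiableAt.mul ?_ ?_)
    · refine DifferentiableAt.cpow_const (differentiableAt_id.add_const _) (Or.inl ?_)
      simpa using hz
    · refine DifferentiableAt.cpow_const (differentiableAt_id.sub_const _) (Or.inl ?_)
      simpa using hz
  exact eq_of_differentiableOn_re_pos hf hg (by positivity : 0 < 2 * σ * (1 + |η|) + 1)
    (fun x hx => integral_coulReg_of_large hσ (by linarith)) hz

/-! ### An Abelian theorem -/

theorem tendsto_laplace_of_tendsto_zero {g : ℝ → ℂ} {M : ℝ} (hM : 0 ≤ M)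
    (hb : ∀ r > 0, ‖g r‖ ≤ M) (h0 : Tendsto g atTop (𝓝 0)) (κ : ℝ) :
    Tendsto (fun δ : ℝ => (δ : ℂ) * ∫ r : ℝ in Ioi 0, cexp (-(δ + I * κ) * r) * g r)
      (𝓝[>] 0) (𝓝 0) := by
  rw [Metric.tendsto_nhds]
  intro ε hε
  obtain ⟨R, hR⟩ := (eventually_atTop.mp ((Metric.tendsto_nhds.mp h0) (ε / 2) (half_pos hε)))
  have hpt : ∀ r > 0, ‖g r‖ ≤ ε / 2 + M * exp (R - r) := by
    intro r hr
    by_cases h : R ≤ r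
    · have := hR r h
      rw [dist_zero_right] at this
      have : 0 ≤ M * exp (R - r) := by positivity
      linarith
    · have h1 : 1 ≤ exp (R - r) := Real.one_le_exp (by linarith)
      have := hb r hr
      nlinarith
  have hlim : Tendsto (fun δ : ℝ => ε / 2 + δ * (M * exp R)) (𝓝[>] 0) (𝓝 (ε / 2 + 0 * _)) :=
    ((tendsto_id.mono_left nhdsWithin_le_nhds).mul_const _).const_add _
  rw [zero_mul, add_zero] at hlim
  filter_upwards [hlim.eventually (gt_mem_nhds (half_lt_self hε)), self_mem_nhdsWithin] with δ hδ hδ0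
  have hδ0 : 0 < δ := hδ0
  have hi1 : IntegrableOn (fun r : ℝ => exp (-δ * r)) (Ioi 0) := exp_neg_integrableOn_Ioi 0 hδ0
  have hi2 : IntegrableOn (fun r : ℝ => exp (-(δ + 1) * r)) (Ioi 0) :=
    exp_neg_integrableOn_Ioi 0 (by linarith)
  have hv : ∀ a : ℝ, 0 < a → ∫ r : ℝ in Ioi 0, exp (-a * r) = a⁻¹ := by
    intro a ha
    have := integral_exp_mul_Ioi (a := -a) (by linarith) 0
    rw [this]; simp
  have hle : ‖∫ r : ℝ in Ioi 0, cexp (-(δ + I * κ) * r) * g r‖ ≤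
      ∫ r : ℝ in Ioi 0, (ε / 2 * exp (-δ * r) +
        M * exp R * exp (-(δ + 1) * r)) := by
    refine norm_integral_le_of_norm_le ((hi1.const_mul _).add (hi2.const_mul _)) ?_
    filter_upwards [ae_restrict_mem measurableSet_Ioi] with r hr
    rw [norm_mul, Complex.norm_exp]
    have e : (-((δ : ℂ) + I * κ) * r).re = -δ * r := by simp
    rw [e]
    calc _ ≤ exp (-δ * r) * (ε / 2 + M * exp (R - r)) := by gcongr; exact hpt r hr
      _ = _ := by
        rw [show -(δ + 1) * r = -δ * r + -r by ring, sub_eq_add_neg, Real.exp_add, Real.exp_add]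
        ring
  rw [integral_add (hi1.const_mul _) (hi2.const_mul _), integral_const_mul, integral_const_mul,
    hv δ hδ0, hv (δ + 1) (by linarith)] at hle
  rw [dist_zero_right, norm_mul, norm_real, norm_eq_abs, abs_of_pos hδ0]
  refine lt_of_le_of_lt ?_ hδ
  calc _ ≤ δ * (ε / 2 * δ⁻¹ + M * exp R * (δ + 1)⁻¹) := by gcongr
    _ = ε / 2 + δ * (M * exp R) * (δ + 1)⁻¹ := by field_simp
    _ ≤ _ := by
      have : (δ + 1)⁻¹ ≤ 1 := inv_le_one_of_one_le₀ (by linarith)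
      have h2 : 0 ≤ δ * (M * exp R) := by positivity
      nlinarith

theorem coulomb_coefficient {η σ M : ℝ} (hσ : σ ≠ 0) {φ : ℝ → ℂ} {α α' : ℂ} (hc : Continuous φ)
    (hb : ∀ r > 0, ‖φ r‖ ≤ M)
    (has : Tendsto (fun r : ℝ => φ r - (α * ((r : ℂ) ^ (-(I * η)) *
      cexp (I * σ * r)) + α' * ((r : ℂ) ^ (I * η) *
      cexp (-(I * σ * r))))) atTop (𝓝 0))
    (hY : ∀ δ : ℝ, 0 < δ → ∫ r : ℝ in Ioi 0, cexp (-(δ + I * σ) * r) * φ r =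
      (δ + 2 * I * σ) ^ (-1 - I * η) * (δ : ℂ) ^ (-1 + I * η)) :
    α * Gamma (1 - I * η) = (2 * I * σ) ^ (-1 - I * η) := by
  set g : ℝ → ℂ := fun r => φ r - (α * ((r : ℂ) ^ (-(I * η)) *
      cexp (I * σ * r)) + α' * ((r : ℂ) ^ (I * η) *
      cexp (-(I * σ * r))))
  have hM : 0 ≤ M := (norm_nonneg _).trans (hb 1 one_pos)
  have hn1 : ∀ r : ℝ, 0 < r → ‖(r : ℂ) ^ (-(I * η)) * cexp (I * σ * r)‖ = 1 := by
    intro r hr; rw [norm_mul, norm_cpow_eq_rpow_re_of_pos hr, Complex.norm_exp]; simp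
  have hn2 : ∀ r : ℝ, 0 < r →
      ‖(r : ℂ) ^ (I * η) * cexp (-(I * σ * r))‖ = 1 := by
    intro r hr; rw [norm_mul, norm_cpow_eq_rpow_re_of_pos hr, Complex.norm_exp]; simp
  have hgb : ∀ r > 0, ‖g r‖ ≤ M + (‖α‖ + ‖α'‖) := by
    intro r hr
    refine (norm_sub_le _ _).trans (add_le_add (hb r hr) ((norm_add_le _ _).trans ?_))
    rw [norm_mul, norm_mul _ (_ * _), hn1 r hr, hn2 r hr, mul_one, mul_one]
  have hlap := tendsto_laplace_of_tendsto_zero (by positivity) hgb has σ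
  have ha1 : 0 < (1 - I * (η : ℂ)).re := by simp
  have ha2 : 0 < (1 + I * (η : ℂ)).re := by simp
  have hint : ∀ δ : ℝ, 0 < δ → (δ : ℂ) ^ (1 - I * (η : ℂ)) *
      ((δ + 2 * I * σ) ^ (-1 - I * η) * (δ : ℂ) ^ (-1 + I * η)) =
      α * Gamma (1 - I * η) +
      (δ : ℂ) ^ (1 - I * (η : ℂ)) * (α' * ((1 / (δ + 2 * I * σ)) ^ (1 + I * η)
        * Gamma (1 + I * η))) +
      (δ : ℂ) ^ (-(I * (η : ℂ))) * ((δ : ℂ) *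
        ∫ r : ℝ in Ioi 0, cexp (-(δ + I * σ) * r) * g r) := by
    intro δ hδ
    have hδc : (δ : ℂ) ≠ 0 := by exact_mod_cast hδ.ne'
    have hr1 : 0 < (δ : ℂ).re := by simpa using hδ
    have hr2 : 0 < ((δ : ℂ) + 2 * I * σ).re := by simpa using hδ
    have i1 := integrableOn_cpow_mul_exp ha1 hr1
    have i2 := integrableOn_cpow_mul_exp ha2 hr2
    have hgm : IntegrableOn (fun r : ℝ => cexp (-(δ + I * σ) * r) * g r) (Ioi 0) := by
      refine Integrable.mono' ((exp_neg_integrableOn_Ioi 0 hδ).const_mul (M + (‖α‖ + ‖α'‖))) ?_ ?_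
      · refine ContinuousOn.aestronglyMeasurable (fun r hr => ?_) measurableSet_Ioi
        have hr : 0 < r := hr
        have hp : ∀ s : ℂ, ContinuousAt (fun r : ℝ => (r : ℂ) ^ s) r := fun s =>
          (Complex.continuousAt_ofReal_cpow_const r s (Or.inr hr.ne'))
        refine ContinuousAt.continuousWithinAt (ContinuousAt.mul (by fun_prop)
          (hc.continuousAt.sub ?_))
        exact ((continuousAt_const.mul ((hp _).mul (by fun_prop))).add
          (continuousAt_const.mul ((hp _).mul (by fun_prop))))
      · filter_upwards [ae_restrict_mem measurableSet_Ioi] with r hr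
        rw [norm_mul, Complex.norm_exp, mul_comm]
        have e : (-((δ : ℂ) + I * σ) * r).re = -δ * r := by simp
        rw [e]; gcongr
        exact hgb r hr
    have e : ∀ r : ℝ, cexp (-(δ + I * σ) * r) * φ r =
        α * ((r : ℂ) ^ ((1 - I * (η : ℂ)) - 1) * cexp (-δ * r)) +
        α' * ((r : ℂ) ^ ((1 + I * (η : ℂ)) - 1) * cexp (-(δ + 2 * I * σ) * r)) +
        cexp (-(δ + I * σ) * r) * g r := by
      intro r
      have e1 : cexp (-(δ : ℂ) * r) = cexp (-(δ + I * σ) * r) *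
          cexp (I * σ * r) := by rw [← Complex.exp_add]; congr 1; ring
      have e2 : cexp (-(δ + 2 * I * σ) * r) = cexp (-(δ + I * σ) * r) *
          cexp (-(I * σ * r)) := by rw [← Complex.exp_add]; congr 1; ring
      rw [e1, e2, show (1 - I * (η : ℂ)) - 1 = -(I * η) by ring,
        show (1 + I * (η : ℂ)) - 1 = I * η by ring]
      simp only [g]; ring
    have h12 : ∫ r : ℝ in Ioi 0, cexp (-(δ + I * σ) * r) * φ r =
        α * ((1 / (δ : ℂ)) ^ (1 - I * (η : ℂ)) * Gamma (1 - I * η)) +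
        α' * ((1 / (δ + 2 * I * σ)) ^ (1 + I * η) * Gamma (1 + I * η))
        + ∫ r : ℝ in Ioi 0, cexp (-(δ + I * σ) * r) * g r := by
      rw [← integral_cpow_mul_exp_neg ha1 hr1, ← integral_cpow_mul_exp_neg ha2 hr2,
        ← integral_const_mul, ← integral_const_mul, ← integral_add (i1.const_mul α) (i2.const_mul α')]
      have i3 := integral_add ((i1.const_mul α).add (i2.const_mul α')) hgm
      simp only [Pi.add_apply] at i3
      rw [← i3]; exact integral_congr_ae (Eventually.of_forall e)
    rw [← hY δ hδ, h12]
    have e3 : (δ : ℂ) ^ (1 - I * (η : ℂ)) * (1 / (δ : ℂ)) ^ (1 - I * (η : ℂ)) = 1 := by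
      rw [one_div, Complex.inv_cpow _ _ (by
        rw [Complex.arg_ofReal_of_nonneg hδ.le]; exact pi_pos.ne)]
      exact mul_inv_cancel₀ (by rw [Complex.cpow_ne_zero_iff]; exact Or.inl hδc)
    have e4 : (δ : ℂ) ^ (1 - I * (η : ℂ)) = (δ : ℂ) ^ (-(I * (η : ℂ))) * δ := by
      rw [sub_eq_add_neg, Complex.cpow_add _ _ hδc, Complex.cpow_one, mul_comm]
    linear_combination α * Gamma (1 - I * η) * e3 +
      (∫ r : ℝ in Ioi 0, cexp (-(δ + I * σ) * r) * g r) * e4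
  have h2σ : (2 * I * σ : ℂ) ∈ Complex.slitPlane := by
    rw [Complex.mem_slitPlane_iff]; right; simpa using hσ
  have hδlim : Tendsto (fun δ : ℝ => (δ : ℂ) + 2 * I * σ) (𝓝[>] 0) (𝓝 (2 * I * σ)) := by
    have : ContinuousAt (fun δ : ℝ => (δ : ℂ) + 2 * I * σ) 0 := by fun_prop
    have := this.tendsto.mono_left (nhdsWithin_le_nhds (s := Ioi 0))
    simpa using this
  have hL : Tendsto (fun δ : ℝ => (δ + 2 * I * (σ : ℂ)) ^ (-1 - I * (η : ℂ))) (𝓝[>] 0)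
      (𝓝 ((2 * I * σ) ^ (-1 - I * η))) :=
    hδlim.cpow tendsto_const_nhds h2σ
  have hz : Tendsto (fun δ : ℝ => (δ : ℂ) ^ (1 - I * (η : ℂ))) (𝓝[>] 0) (𝓝 0) := by
    rw [tendsto_zero_iff_norm_tendsto_zero]
    have : Tendsto (fun δ : ℝ => δ) (𝓝[>] 0) (𝓝 0) := nhdsWithin_le_nhds
    refine this.congr' ?_
    filter_upwards [self_mem_nhdsWithin] with δ hδ
    rw [norm_cpow_eq_rpow_re_of_pos hδ]; simp
  have hA : Tendsto (fun δ : ℝ => (1 / (δ + 2 * I * (σ : ℂ))) ^ (1 + I * (η : ℂ)))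
      (𝓝[>] 0) (𝓝 ((1 / (2 * I * σ)) ^ (1 + I * (η : ℂ)))) := by
    refine Tendsto.cpow ?_ tendsto_const_nhds ?_
    · exact tendsto_const_nhds.div hδlim (Complex.slitPlane_ne_zero h2σ)
    · rw [one_div]; rw [Complex.mem_slitPlane_iff]; right
      simp [hσ]
  have hG : Tendsto (fun δ : ℝ => (δ : ℂ) ^ (-(I * (η : ℂ))) * ((δ : ℂ) *
        ∫ r : ℝ in Ioi 0, cexp (-(δ + I * σ) * r) * g r)) (𝓝[>] 0) (𝓝 0) := by
    rw [tendsto_zero_iff_norm_tendsto_zero] at hlap ⊢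
    refine hlap.congr' ?_
    filter_upwards [self_mem_nhdsWithin] with δ hδ
    rw [norm_mul _ ((δ : ℂ) * _), norm_cpow_eq_rpow_re_of_pos hδ]; simp
  have hR := ((hz.mul ((hA.mul_const (Gamma (1 + I * η))).const_mul α')).const_add
    (α * Gamma (1 - I * η))).add hG
  rw [zero_mul, add_zero, add_zero] at hR
  refine tendsto_nhds_unique hR (hL.congr' ?_)
  filter_upwards [self_mem_nhdsWithin] with δ hδ
  have hδ : 0 < δ := hδ
  have hδc : (δ : ℂ) ≠ 0 := by exact_mod_cast hδ.ne'
  rw [← hint δ hδ, mul_left_comm, ← Complex.cpow_add _ _ hδc]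
  rw [show 1 - I * (η : ℂ) + (-1 + I * η) = 0 by ring, Complex.cpow_zero, mul_one]

/-! ### The distorted Fourier basis as a solution -/

/-- The parameter `η = 1 / (2σ)`. -/
def etaOf (σ : ℝ) : ℝ := 1 / (2 * σ)

/-- The slope of `eFun` at the origin. -/
def eSlope (σ : ℝ) : ℝ := 2 * σ * (σ ^ (-1 / 2 : ℝ) * (exp (π / σ) - 1) ^ (-1 / 2 : ℝ))

theorem ascPochhammer_two (n : ℕ) : (ascPochhammer ℂ n).eval 2 = (n + 1).factorial := by
  induction n with
  | zero => simp
  | succ n ih =>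
    rw [ascPochhammer_succ_eval, ih, Nat.factorial_succ (n + 1)]; push_cast; ring

theorem kummerM_two (η : ℝ) (z : ℂ) : kummerM (1 - I * η) 2 z = powSum (coulCoeff η) z := by
  rw [kummerM, powSum]
  congr 1; ext n
  rw [ascPochhammer_two, coulCoeff]; field_simp

theorem eFun_eq {σ : ℝ} (hσ : 0 < σ) (r : ℝ) :
    eFun σ r = eSlope σ * coulReg (etaOf σ) σ r := by
  have hs : (σ : ℂ) ≠ 0 := by exact_mod_cast hσ.ne'
  have e : (1 / 2 + 1 / 2 - I / (2 * (σ : ℂ)) : ℂ) = 1 - I * (etaOf σ : ℂ) := by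
    rw [etaOf]; push_cast; field_simp; ring
  have e2 : (1 : ℂ) + 2 * (1 / 2) = 2 := by norm_num
  have e3 : (1 / 2 + 1 / 2 : ℂ) = 1 := by norm_num
  have e4 : cexp (-(2 * I * (σ : ℂ) * r) / 2) =
      cexp (-(I * σ * r)) := by congr 1; ring
  rw [eFun, whittakerM, e, e2, kummerM_two, e3, Complex.cpow_one, e4, coulReg, eSlope]; push_cast
  linear_combination (-(2 * (σ : ℂ) * r) * ((σ ^ (-1 / 2 : ℝ) : ℝ) : ℂ) *
    (((exp (π / σ) - 1) ^ (-1 / 2 : ℝ) : ℝ) : ℂ) * cexp (-(I * σ * r)) *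
    powSum (coulCoeff (etaOf σ)) (2 * I * σ * r)) * I_sq

/-- The derivative of `coulReg`. -/
def coulReg' (η σ r : ℝ) : ℂ := cexp (-(I * σ * r)) * ((1 - I * σ * r) *
    powSum (coulCoeff η) (2 * I * σ * r) +
    2 * I * σ * r * powSum (derivCoeff (coulCoeff η)) (2 * I * σ * r))

theorem hasDerivAt_powSum_line {d : ℕ → ℂ} (h : EntireCoeff d) (a : ℂ) (r : ℝ) :
    HasDerivAt (fun r : ℝ => powSum d (a * r)) (a * powSum (derivCoeff d) (a * r)) r := by
  have h1 : HasDerivAt (fun r : ℝ => a * (r : ℂ)) a r := by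
    simpa using (ofRealCLM.hasDerivAt (x := r)).const_mul a
  exact ((h.hasDerivAt (a * r)).comp r h1).congr_deriv (mul_comm _ _)

theorem hasDerivAt_exp_line (a : ℂ) (r : ℝ) :
    HasDerivAt (fun r : ℝ => cexp (a * r)) (a * cexp (a * r)) r := by
  have h1 : HasDerivAt (fun r : ℝ => a * (r : ℂ)) a r := by
    simpa using (ofRealCLM.hasDerivAt (x := r)).const_mul a
  exact h1.cexp.congr_deriv (mul_comm _ _)

theorem hasDerivAt_coulReg (η σ r : ℝ) : HasDerivAt (coulReg η σ) (coulReg' η σ r) r := by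
  have h0 : HasDerivAt (fun r : ℝ => (r : ℂ)) 1 r := ofRealCLM.hasDerivAt (x := r)
  have h1 := hasDerivAt_exp_line (-(I * σ)) r
  have h2 := hasDerivAt_powSum_line (entireCoeff_coul η) (2 * I * σ) r
  simp only [neg_mul] at h1
  refine (h0.mul (h1.mul h2)).congr_deriv ?_
  simp only [coulReg', Pi.mul_apply]
  ring

theorem hasDerivAt_coulReg' (η σ : ℝ) {r : ℝ} (hr : r ≠ 0) :
    HasDerivAt (coulReg' η σ) (((2 * η * σ / r - σ ^ 2 : ℝ) : ℂ) * coulReg η σ r) r := by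
  have hr' : (r : ℂ) ≠ 0 := by exact_mod_cast hr
  have h0 : HasDerivAt (fun r : ℝ => (r : ℂ)) 1 r := ofRealCLM.hasDerivAt (x := r)
  have h1 := hasDerivAt_exp_line (-(I * σ)) r
  have h2 := hasDerivAt_powSum_line (entireCoeff_coul η) (2 * I * σ) r
  have h3 := hasDerivAt_powSum_line (entireCoeff_coul η).deriv_coeff (2 * I * σ) r
  simp only [neg_mul] at h1
  refine (h1.mul ((((h0.const_mul (I * σ)).const_sub 1).mul h2).add
    ((h0.const_mul (2 * I * σ)).mul h3))).congr_deriv ?_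
  have hode := (entireCoeff_coul η).hyp_ode (coulCoeff_succ η) (2 * I * σ * r)
  simp only [Pi.add_apply, Pi.mul_apply, coulReg]
  have hI := I_sq
  push_cast
  generalize cexp (-(I * σ * r)) = E at *
  generalize powSum (coulCoeff η) (2 * I * σ * r) = k0 at *
  generalize powSum (derivCoeff (coulCoeff η)) (2 * I * σ * r) = k1 at *
  generalize powSum (derivCoeff (derivCoeff (coulCoeff η))) (2 * I * σ * r) = k2 at *
  field_simp
  linear_combination (2 * I * σ * E) * hode + (E * σ * (σ * r * k0 + -2 * η * k0)) * hI

/-- The Liouville-Green transform of `coulReg`. -/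
def coulLG (σ z : ℝ) : ℂ := (lgWeight z : ℂ) * coulReg (etaOf σ) σ (xOf z / σ ^ 2)

/-- The derivative of `coulLG`. -/
def coulLG' (σ z : ℝ) : ℂ := ((deriv lgWeight z : ℝ) : ℂ) * coulReg (etaOf σ) σ (xOf z / σ ^ 2) +
    ((lgWeight z)⁻¹ / σ ^ 2 : ℝ) * coulReg' (etaOf σ) σ (xOf z / σ ^ 2)

theorem hasDerivAt_comp_xOf {f : ℝ → ℂ} {f' : ℂ} {z : ℝ} (hz : zetaMin < z) (σ : ℝ)
    (hf : HasDerivAt f f' (xOf z / σ ^ 2)) :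
    HasDerivAt (fun z => f (xOf z / σ ^ 2)) ((((lgWeight z ^ 2)⁻¹ / σ ^ 2 : ℝ) : ℂ) * f') z := by
  have e : sqrt (q (xOf z)) = lgWeight z ^ 2 := by
    rw [lgWeight, ← rpow_natCast, ← rpow_mul (q_pos (xOf_pos hz)).le, sqrt_eq_rpow]; norm_num
  have h1 := (hasDerivAt_xOf hz).div_const (σ ^ 2)
  rw [e] at h1
  exact (hf.scomp z h1).congr_deriv (by rw [real_smul])

theorem isSolution_coulLG {σ : ℝ} (hσ : 0 < σ) : IsSolution σ (coulLG σ) := by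
  have hs : (σ : ℂ) ≠ 0 := by exact_mod_cast hσ.ne'
  have hg : ∀ z, zetaMin < z → HasDerivAt lgWeight (deriv lgWeight z) z := fun z hz =>
    hasDerivAt_of_contDiffOn isOpen_Ioi contDiffOn_lgWeight hz
  have hg' : ∀ z, zetaMin < z → HasDerivAt (deriv lgWeight) (deriv (deriv lgWeight) z) z :=
    fun z hz => hasDerivAt_of_contDiffOn isOpen_Ioi
      (contDiffOn_deriv isOpen_Ioi contDiffOn_lgWeight) hz
  refine IsSolution.of_hasDerivAt hσ.ne' (w1 := coulLG' σ) (fun z hz => ?_) (fun z hz => ?_)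
  all_goals
    have hz' : zetaMin < z := zetaMin_neg.trans_le hz
    have hgp := lgWeight_pos hz'
    have hgc : (lgWeight z : ℂ) ≠ 0 := by exact_mod_cast hgp.ne'
    have hx := xOf_pos hz'
    have hxr : xOf z / σ ^ 2 ≠ 0 := by positivity
    have h0 := hasDerivAt_comp_xOf hz' σ (hasDerivAt_coulReg (etaOf σ) σ (xOf z / σ ^ 2))
  · refine ((hg z hz').ofReal_comp.mul h0).congr_deriv ?_
    simp only [coulLG']
    push_cast; field_simp
  · have h1 := hasDerivAt_comp_xOf hz' σ (hasDerivAt_coulReg' (etaOf σ) σ hxr)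
    have h2 := (((hg z hz').inv hgp.ne').div_const (σ ^ 2)).ofReal_comp
    refine (((hg' z hz').ofReal_comp.mul h0).add (h2.mul h1)).congr_deriv ?_
    have e1 : 2 * etaOf σ * σ / (xOf z / σ ^ 2) - σ ^ 2 = -(σ ^ 2 * (lgWeight z ^ 4 * z)) := by
      have : lgWeight z ^ 4 = q (xOf z) := by
        rw [lgWeight, ← rpow_natCast, ← rpow_mul (q_pos hx).le]; norm_num
      have h := q_mul_zeta hx
      rw [zeta_xOf hz'] at h
      rw [this, h, etaOf]; field_simp
      ring
    rw [e1, V_eq hz']; simp only [coulLG, Pi.inv_apply]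
    push_cast; field_simp
    ring

/-- The coefficients of the Liouville-Green transform of `coulReg` in the oscillatory basis. -/
theorem exists_coulReg_eq {σ : ℝ} (hσ : σ ∈ Ioo 0 sigma0) : ∃ p₁ p₂ : ℂ, ∀ x : ℝ, 1 ≤ x →
    coulReg (etaOf σ) σ (x / σ ^ 2) = ((q x ^ (-1 / 4 : ℝ) : ℝ) : ℂ) *
      (p₁ * psiPlus oscBconj σ (zeta x) + p₂ * psiMinus oscB σ (zeta x)) := by
  obtain ⟨⟨p₁, p₂⟩, hp, -⟩ := (isSolutionBasis_psi hσ).2.2 _ (isSolution_coulLG hσ.1)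
  refine ⟨p₁, p₂, fun x hx => ?_⟩
  have hx0 : 0 < x := by linarith
  have hz : 0 ≤ zeta x := by
    rcases hx.eq_or_lt with rfl | hx
    · rw [zeta_one]
    · exact (zeta_pos hx).le
  have h := hp (zeta x) hz
  simp only [coulLG, xOf_zeta hx0] at h
  rw [← h, lgWeight, xOf_zeta hx0, ← mul_assoc, ← ofReal_mul, ← rpow_add (q_pos hx0)]
  norm_num

/-! ### The connection coefficients -/

theorem two_thirds_zeta_rpow {x : ℝ} (hx : 1 ≤ x) : 2 / 3 * zeta x ^ (3 / 2 : ℝ) =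
    sqrt (x ^ 2 - x) - log (sqrt x + sqrt (x - 1)) := by
  rw [zeta_rpow hx, ← integral_sqrt_Q_right hx]
  have hc : ContinuousOn (fun x : ℝ => sqrt (x ^ 2 - x) -
      log (sqrt x + sqrt (x - 1))) (Icc 1 x) := by
    refine ContinuousOn.sub (by fun_prop) (ContinuousOn.log (by fun_prop) fun y hy => ?_)
    have : 0 < sqrt y := Real.sqrt_pos.mpr (by linarith [hy.1])
    positivity
  rw [intervalIntegral.integral_eq_sub_of_hasDerivAt_of_le hx hc (fun y hy => ?_)
    ((continuousOn_sqrt_Q one_pos).intervalIntegrable_of_Icc hx)]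
  · norm_num
  · have hy0 : 0 < y := by linarith [hy.1]
    have hy1 : 0 < y - 1 := by linarith [hy.1]
    have hyy : 0 < y ^ 2 - y := by nlinarith
    have ha : 0 < sqrt y := Real.sqrt_pos.mpr hy0
    have hb : 0 < sqrt (y - 1) := Real.sqrt_pos.mpr hy1
    have e1 : sqrt (y ^ 2 - y) = sqrt y * sqrt (y - 1) := by
      rw [← Real.sqrt_mul hy0.le]; congr 1; ring
    have e2 : sqrt |Q y| = sqrt (y - 1) / sqrt y := by
      rw [← Real.sqrt_div hy1.le, Q, abs_of_neg]
      · congr 1; field_simp; ring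
      · have : y⁻¹ < 1 := inv_lt_one_of_one_lt₀ hy.1
        linarith
    have h1 := ((hasDerivAt_pow 2 y).sub (hasDerivAt_id y)).sqrt hyy.ne'
    have h2 := (Real.hasDerivAt_sqrt hy0.ne').add (((hasDerivAt_id y).sub_const 1).sqrt hy1.ne')
    refine (h1.sub (h2.log (by simp only [Pi.add_apply, id]; positivity))).congr_deriv ?_
    rw [e2]; simp only [Pi.add_apply, Pi.sub_apply, id]
    rw [e1]
    have hs1 : sqrt y ^ 2 = y := sq_sqrt hy0.le
    have hs2 : sqrt (y - 1) ^ 2 = y - 1 := sq_sqrt hy1.le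
    generalize sqrt y = a at *
    generalize sqrt (y - 1) = b at *
    have hab : a + b ≠ 0 := by positivity
    push_cast; field_simp
    linear_combination (-2 * (a + b)) * hs2

theorem tendsto_action_asymptotics :
    Tendsto (fun x => 2 / 3 * zeta x ^ (3 / 2 : ℝ) - x + log (4 * x) / 2) atTop
      (𝓝 (-1 / 2)) := by
  have h1 : Tendsto (fun x : ℝ => sqrt (1 - x⁻¹)) atTop (𝓝 1) := by
    have := (tendsto_inv_atTop_zero (𝕜 := ℝ)).const_sub 1
    have h2 := (Real.continuous_sqrt.tendsto _).comp this
    simpa [Function.comp_def] using h2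
  have h2 : Tendsto (fun s : ℝ => -(1 + s)⁻¹ - log ((1 + s) / 2)) (𝓝 1) (𝓝 (-1 / 2)) := by
    have : ContinuousAt (fun s : ℝ => -(1 + s)⁻¹ - log ((1 + s) / 2)) 1 := by
      refine ContinuousAt.sub (ContinuousAt.neg (ContinuousAt.inv₀ (by fun_prop) (by norm_num)))
        (ContinuousAt.log (by fun_prop) (by norm_num))
    have h := this.tendsto
    norm_num at h ⊢
    exact h
  refine (h2.comp h1).congr' ?_
  filter_upwards [eventually_gt_atTop 1] with x hx
  have hx0 : 0 < x := by linarith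
  have hi : 0 < 1 - x⁻¹ := by
    have : x⁻¹ < 1 := inv_lt_one_of_one_lt₀ hx
    linarith
  set s := sqrt (1 - x⁻¹)
  have hs : 0 < s := Real.sqrt_pos.mpr hi
  have hs2 : s ^ 2 = 1 - x⁻¹ := sq_sqrt hi.le
  have e1 : sqrt (x ^ 2 - x) = x * s := by
    rw [show x ^ 2 - x = x ^ 2 * (1 - x⁻¹) by field_simp, Real.sqrt_mul (by positivity),
      Real.sqrt_sq hx0.le]
  have e2 : sqrt (x - 1) = sqrt x * s := by rw [← Real.sqrt_mul hx0.le]; congr 1; field_simp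
  have hsx : 0 < sqrt x := Real.sqrt_pos.mpr hx0
  simp only [Function.comp]
  rw [two_thirds_zeta_rpow hx.le, e1, e2, show sqrt x + sqrt x * s = sqrt x * (1 + s)
    by ring, Real.log_mul hsx.ne' (by positivity), Real.log_sqrt hx0.le,
    Real.log_mul (by norm_num) hx0.ne', Real.log_div (by positivity) (by norm_num),
    show (4 : ℝ) = 2 ^ 2 by norm_num, Real.log_pow]
  have : (1 + s) ≠ 0 := by positivity
  push_cast
  have h3 : x * s ^ 2 = x - 1 := by rw [hs2]; field_simp
  have h4 : -(1 + s)⁻¹ = x * s - x := by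
    field_simp
    linear_combination (-1 : ℝ) * h3
  rw [h4]; ring

/-- The argument of the Airy functions as a function of `σ` and `x`. -/
def tOfX (σ x : ℝ) : ℝ := σ ^ (-2 / 3 : ℝ) * zeta x

theorem tOfX_eq {σ : ℝ} (hσ : 0 < σ) (x : ℝ) : tOfX σ x = tOf (vOf σ) (zeta x) :=
  (tOf_vOf hσ _).symm

/-- The amplitude of `psiMinus` as a function of `σ` and `x`. -/
def ampX (σ x : ℝ) : ℂ := -I / π * (((1 - x⁻¹) ^ (-1 / 4 : ℝ) : ℝ) *
    (airyAmp 0 (tOfX σ x ^ (-3 / 4 : ℝ)) * (1 + betaJ 0 (vOf σ) (tOfX σ x))))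

theorem q_mul_psiMinus {σ x : ℝ} (hσ : 0 < σ) (hx : 1 < x) :
    ((q x ^ (-1 / 4 : ℝ) : ℝ) : ℂ) * psiMinus oscB σ (zeta x) =
      ((σ ^ (1 / 6 : ℝ) : ℝ) : ℂ) *
        (cexp (I * (σ⁻¹ * (2 / 3) * zeta x ^ (3 / 2 : ℝ) : ℝ)) * ampX σ x) := by
  have hx0 : 0 < x := by linarith
  have hz := zeta_pos hx
  have ht : 0 < tOfX σ x := by unfold tOfX; positivity
  rw [psiMinus_eq hσ, ← tOfX_eq hσ, outAiry_eq_amp ht, ampX]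
  have e1 : tOfX σ x ^ (3 / 2 : ℝ) = σ⁻¹ * zeta x ^ (3 / 2 : ℝ) := by
    rw [tOfX, Real.mul_rpow (by positivity) hz.le, ← rpow_mul hσ.le]; norm_num
    rw [rpow_neg_one]; exact Or.inl rfl
  have e2 : q x ^ (-1 / 4 : ℝ) * tOfX σ x ^ (-1 / 4 : ℝ) =
      σ ^ (1 / 6 : ℝ) * (1 - x⁻¹) ^ (-1 / 4 : ℝ) := by
    rw [← q_mul_zeta hx0, tOfX, Real.mul_rpow (by positivity) hz.le,
      Real.mul_rpow (q_pos hx0).le hz.le, ← rpow_mul hσ.le]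
    norm_num; ring
  have e2' : ((q x ^ (-1 / 4 : ℝ) : ℝ) : ℂ) * ((tOfX σ x ^ (-1 / 4 : ℝ) : ℝ) : ℂ) =
      ((σ ^ (1 / 6 : ℝ) : ℝ) : ℂ) * (((1 - x⁻¹) ^ (-1 / 4 : ℝ) : ℝ) : ℂ) := by
    rw [← ofReal_mul, e2, ofReal_mul]
  rw [e1, show 2 / 3 * (σ⁻¹ * zeta x ^ (3 / 2 : ℝ)) = σ⁻¹ * (2 / 3) * zeta x ^ (3 / 2 : ℝ) by ring]
  linear_combination (-I / π * (cexp (I * (σ⁻¹ * (2 / 3) * zeta x ^ (3 / 2 : ℝ) : ℝ)) *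
      airyAmp 0 (tOfX σ x ^ (-3 / 4 : ℝ)) * (1 + betaJ 0 (vOf σ) (tOfX σ x)))) * e2'

/-- The limit of the amplitude. -/
def ampInf : ℂ := -I / π * airyAmp 0 0

theorem ampInf_eq : ampInf = ((sqrt π)⁻¹ : ℝ) *
    cexp (-(I * (π / 4 : ℝ))) := by
  have hp : sqrt π ≠ 0 := (Real.sqrt_pos.mpr pi_pos).ne'
  have hp2 : ((sqrt π : ℝ) : ℂ) ^ 2 = π := by rw [← ofReal_pow, sq_sqrt pi_pos.le]
  have hp' : ((sqrt π : ℝ) : ℂ) ≠ 0 := by exact_mod_cast hp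
  have e : cexp (-(I * (π / 4 : ℝ))) =
      (sqrt 2 / 2 : ℝ) * (1 - I) := by
    rw [show -(I * ((π / 4 : ℝ) : ℂ)) = ((-(π / 4) : ℝ) : ℂ) * I by
      push_cast; ring, Complex.exp_mul_I, ← Complex.ofReal_cos, ← Complex.ofReal_sin, Real.cos_neg,
      Real.sin_neg, Real.cos_pi_div_four, Real.sin_pi_div_four]
    push_cast; ring
  rw [ampInf, airyAmp_zero_zero, e, ← hp2]; push_cast
  field_simp
  linear_combination (-1 : ℂ) * I_sq

theorem tendsto_ampX {σ : ℝ} (hσ : σ ∈ Ioo 0 sigma0) :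
    Tendsto (ampX σ) atTop (𝓝 ampInf) := by
  have hσ0 : 0 < σ := hσ.1
  have ht : Tendsto (tOfX σ) atTop atTop :=
    tendsto_zeta.const_mul_atTop (by positivity : 0 < σ ^ (-2 / 3 : ℝ))
  have h1 : Tendsto (fun x : ℝ => (((1 - x⁻¹) ^ (-1 / 4 : ℝ) : ℝ) : ℂ)) atTop (𝓝 ((1 : ℝ) : ℂ)) := by
    refine (continuous_ofReal.tendsto _).comp ?_
    have h := ((tendsto_inv_atTop_zero (𝕜 := ℝ)).const_sub 1).rpow_const (p := (-1 / 4 : ℝ))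
      (Or.inl (by norm_num))
    simpa using h
  have h2 : Tendsto (fun x => tOfX σ x ^ (-3 / 4 : ℝ)) atTop (𝓝[>] 0) := by
    refine tendsto_nhdsWithin_iff.mpr ⟨?_, ?_⟩
    · have := (tendsto_rpow_neg_atTop (y := 3 / 4) (by norm_num)).comp ht
      refine this.congr fun x => ?_
      simp only [Function.comp]; norm_num
    · filter_upwards [ht.eventually (eventually_gt_atTop 0)] with x hx
      exact rpow_pos_of_pos hx _
  have h3 := (tendsto_betaJ (j := 0) (by norm_num) (vOf_lt hσ)).comp ht
  have h := (h1.mul ((tendsto_airyAmp.comp h2).mul (h3.const_add 1))).const_mul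
    (-I / π)
  rw [Complex.ofReal_one, one_mul, add_zero, mul_one] at h
  exact h

/-- The coefficient of the outgoing wave in `psiMinus`. -/
def outCoeff (σ : ℝ) : ℂ := ((σ ^ (1 / 6 : ℝ) : ℝ) : ℂ) *
    (cexp (I * (-etaOf σ - etaOf σ * log (4 * σ ^ 2) : ℝ)) * ampInf)

theorem norm_cpow_mul_exp (η σ : ℝ) {r : ℝ} (hr : 0 < r) :
    ‖(r : ℂ) ^ (-(I * η)) * cexp (I * σ * r)‖ = 1 := by
  rw [norm_mul, norm_cpow_eq_rpow_re_of_pos hr, Complex.norm_exp]; simp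

theorem tendsto_psiMinus_sub {σ : ℝ} (hσ : σ ∈ Ioo 0 sigma0) :
    Tendsto (fun r : ℝ => ((q (σ ^ 2 * r) ^ (-1 / 4 : ℝ) : ℝ) : ℂ) *
      psiMinus oscB σ (zeta (σ ^ 2 * r)) - outCoeff σ * ((r : ℂ) ^ (-(I * etaOf σ)) *
        cexp (I * σ * r))) atTop (𝓝 0) := by
  have hσ0 : 0 < σ := hσ.1
  have hx : Tendsto (fun r : ℝ => σ ^ 2 * r) atTop atTop :=
    tendsto_id.const_mul_atTop (by positivity)
  have h1 := (((tendsto_action_asymptotics.comp hx).const_mul σ⁻¹).sub_const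
    (etaOf σ * log (4 * σ ^ 2)))
  have h2 := (((Complex.continuous_exp.tendsto _).comp
    (((continuous_ofReal.tendsto _).comp h1).const_mul I)).mul
      ((tendsto_ampX hσ).comp hx)).const_mul ((σ ^ (1 / 6 : ℝ) : ℝ) : ℂ)
  have h3 := h2.sub_const (outCoeff σ)
  have e0 : σ⁻¹ * (-1 / 2) = -etaOf σ := by rw [etaOf]; field_simp
  rw [e0, ← outCoeff, sub_self, tendsto_zero_iff_norm_tendsto_zero] at h3
  rw [tendsto_zero_iff_norm_tendsto_zero]
  refine h3.congr' ?_
  filter_upwards [hx.eventually (eventually_gt_atTop 1), eventually_gt_atTop 0] with r hr hr0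
  have hrc : (r : ℂ) ≠ 0 := by exact_mod_cast hr0.ne'
  simp only [Function.comp]
  set X : ℝ := σ⁻¹ * (2 / 3 * zeta (σ ^ 2 * r) ^ (3 / 2 : ℝ) - σ ^ 2 * r +
    log (4 * (σ ^ 2 * r)) / 2) - etaOf σ * log (4 * σ ^ 2)
  have e1 : cexp (I * (σ⁻¹ * (2 / 3) * zeta (σ ^ 2 * r) ^ (3 / 2 : ℝ) : ℝ)) =
      cexp (I * (X : ℝ)) * ((r : ℂ) ^ (-(I * etaOf σ)) *
        cexp (I * σ * r)) := by
    rw [Complex.cpow_def_of_ne_zero hrc, ← Complex.ofReal_log hr0.le, ← Complex.exp_add,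
      ← Complex.exp_add]
    congr 1
    have : σ⁻¹ * (2 / 3) * zeta (σ ^ 2 * r) ^ (3 / 2 : ℝ) =
        X - etaOf σ * log r + σ * r := by
      simp only [X, etaOf]
      rw [← mul_assoc 4, Real.log_mul (by positivity) hr0.ne']; field_simp
      ring
    rw [this]; push_cast; ring
  rw [q_mul_psiMinus hσ0 hr, e1, show ∀ a b c d : ℂ, a * (b * d * c) - outCoeff σ * d =
    (a * (b * c) - outCoeff σ) * d by intros; ring, norm_mul, norm_cpow_mul_exp _ _ hr0, mul_one]

theorem exists_norm_coulReg_le {σ : ℝ} {α α' : ℂ}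
    (has : Tendsto (fun r : ℝ => coulReg (etaOf σ) σ r - (α * ((r : ℂ) ^ (-(I * etaOf σ)) *
      cexp (I * σ * r)) + α' * ((r : ℂ) ^ (I * etaOf σ) *
      cexp (-(I * σ * r))))) atTop (𝓝 0)) :
    ∃ M, ∀ r > 0, ‖coulReg (etaOf σ) σ r‖ ≤ M := by
  obtain ⟨R, hR⟩ := eventually_atTop.mp ((Metric.tendsto_nhds.mp has) 1 one_pos)
  obtain ⟨M, hM⟩ := isCompact_Icc.exists_bound_of_continuousOn
    (continuous_coulReg (etaOf σ) σ).continuousOn (s := Icc 0 R)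
  refine ⟨max M (1 + (‖α‖ + ‖α'‖)), fun r hr => ?_⟩
  by_cases h : R ≤ r
  · refine le_max_of_le_right ?_
    have h1 := (hR r h).le
    rw [dist_zero_right] at h1
    have h2 := norm_cpow_mul_exp (etaOf σ) σ hr
    have h3 := norm_cpow_mul_exp (-etaOf σ) (-σ) hr
    push_cast at h3
    rw [show -(I * -(etaOf σ : ℂ)) = I * etaOf σ by ring,
      show I * -(σ : ℂ) * r = -(I * σ * r) by ring] at h3
    refine (norm_le_norm_sub_add _ (α * ((r : ℂ) ^ (-(I * etaOf σ)) *
      cexp (I * σ * r)) + α' * ((r : ℂ) ^ (I * etaOf σ) *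
      cexp (-(I * σ * r))))).trans (add_le_add h1 ((norm_add_le _ _).trans ?_))
    rw [norm_mul, norm_mul _ (_ * _), h2, h3, mul_one, mul_one]
  · exact le_max_of_le_left (hM r ⟨hr.le, (not_le.mp h).le⟩)

theorem conj_ofReal_cpow {r : ℝ} (hr : 0 < r) (s : ℂ) :
    conj ((r : ℂ) ^ s) = (r : ℂ) ^ (conj s) := by
  have hrc : (r : ℂ) ≠ 0 := by exact_mod_cast hr.ne'
  rw [Complex.cpow_def_of_ne_zero hrc, Complex.cpow_def_of_ne_zero hrc, ← Complex.exp_conj,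
    ← Complex.ofReal_log hr.le, map_mul, conj_ofReal]

/-- The coefficients of `coulReg` in the oscillatory basis are determined by the Gamma function. -/
theorem coulReg_connection {σ : ℝ} (hσ : σ ∈ Ioo 0 sigma0) : ∃ p₁ p₂ : ℂ,
    (∀ x : ℝ, 1 ≤ x → coulReg (etaOf σ) σ (x / σ ^ 2) = ((q x ^ (-1 / 4 : ℝ) : ℝ) : ℂ) *
      (p₁ * psiPlus oscBconj σ (zeta x) + p₂ * psiMinus oscB σ (zeta x))) ∧
    p₂ * outCoeff σ * Gamma (1 - I * etaOf σ) =
      (2 * I * σ) ^ (-1 - I * etaOf σ) ∧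
    p₁ * conj (outCoeff σ) * Gamma (1 + I * etaOf σ) =
      (-(2 * I * σ)) ^ (-1 + I * etaOf σ) := by
  have hσ0 : 0 < σ := hσ.1
  obtain ⟨p₁, p₂, hp⟩ := exists_coulReg_eq hσ
  refine ⟨p₁, p₂, hp, ?_⟩
  have hx : Tendsto (fun r : ℝ => σ ^ 2 * r) atTop atTop :=
    tendsto_id.const_mul_atTop (by positivity)
  have hminus := tendsto_psiMinus_sub hσ
  have hplus := (Complex.continuous_conj.tendsto _).comp hminus
  rw [map_zero] at hplus
  have has : Tendsto (fun r : ℝ => coulReg (etaOf σ) σ r - (p₂ * outCoeff σ *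
      ((r : ℂ) ^ (-(I * etaOf σ)) * cexp (I * σ * r)) +
      p₁ * conj (outCoeff σ) * ((r : ℂ) ^ (I * etaOf σ) *
      cexp (-(I * σ * r))))) atTop (𝓝 0) := by
    have h := (hplus.const_mul p₁).add (hminus.const_mul p₂)
    rw [mul_zero, mul_zero, add_zero] at h
    refine h.congr' ?_
    filter_upwards [hx.eventually (eventually_ge_atTop 1), eventually_gt_atTop 0] with r hr hr0
    have h1 := hp _ hr
    rw [show σ ^ 2 * r / σ ^ 2 = r by field_simp] at h1
    rw [h1, psiPlus_eq_conj]
    simp only [Function.comp, map_sub, map_mul, conj_ofReal, conj_ofReal_cpow hr0, map_neg,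
      Complex.conj_I, ← Complex.exp_conj, neg_mul, neg_neg]
    ring
  obtain ⟨M, hM⟩ := exists_norm_coulReg_le has
  have hY : ∀ δ s : ℝ, 0 < δ → ∫ r : ℝ in Ioi 0, cexp (-(δ + I * s) * r) *
      coulReg (etaOf σ) σ r = coulLap (etaOf σ) σ (δ + I * s) := fun δ s hδ =>
    integral_coulReg hσ0 hM (by simpa using hδ)
  constructor
  · refine coulomb_coefficient hσ0.ne' (continuous_coulReg _ _) hM has fun δ hδ => ?_
    rw [hY δ σ hδ, coulLap]
    congr 2 <;> ring
  · have has' : Tendsto (fun r : ℝ => coulReg (etaOf σ) σ r -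
        (p₁ * conj (outCoeff σ) * ((r : ℂ) ^ (-(I * ((-etaOf σ : ℝ) : ℂ))) *
        cexp (I * ((-σ : ℝ) : ℂ) * r)) + p₂ * outCoeff σ *
        ((r : ℂ) ^ (I * ((-etaOf σ : ℝ) : ℂ)) *
          cexp (-(I * ((-σ : ℝ) : ℂ) * r))))) atTop (𝓝 0) := by
      refine has.congr fun r => ?_
      push_cast; simp only [mul_neg, neg_mul, neg_neg]
      ring
    have h := coulomb_coefficient (η := -etaOf σ) (σ := -σ) (neg_ne_zero.mpr hσ0.ne')
      (continuous_coulReg _ _) hM has' fun δ hδ => ?_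
    · push_cast at h
      simpa only [mul_neg, sub_neg_eq_add] using h
    · rw [hY δ (-σ) hδ, coulLap, mul_comm]; push_cast
      congr 2 <;> ring

/-- The modulus one connection coefficient. -/
def connE (σ : ℝ) : ℂ := cexp (-(I * gammaRem 0 (etaOf σ)))

theorem eSlope_mul {σ : ℝ} (hσ : 0 < σ) : eSlope σ * (etaOf σ * exp (π * etaOf σ / 2)) =
      (sqrt π)⁻¹ * sqrt (π * etaOf σ / sinh (π * etaOf σ)) := by
  have hη : 0 < etaOf σ := by unfold etaOf; positivity
  have hp := pi_pos
  have hE : 0 < exp (π / σ) - 1 := by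
    have : 0 < π / σ := by positivity
    linarith [Real.add_one_lt_exp this.ne']
  have hsh : 0 < sinh (π * etaOf σ) := Real.sinh_pos_iff.mpr (by positivity)
  have e1 : exp (π / σ) - 1 =
      2 * exp (π * etaOf σ) * sinh (π * etaOf σ) := by
    rw [Real.sinh_eq, show π / σ = π * etaOf σ + π * etaOf σ by
      rw [etaOf]; field_simp; ring, Real.exp_add, Real.exp_neg]
    field_simp
  have hpos : 0 < eSlope σ := by unfold eSlope; positivity
  rw [← Real.sqrt_inv, ← Real.sqrt_mul (by positivity)]
  symm
  have e2 : eSlope σ ^ 2 = 4 * σ * (exp (π / σ) - 1)⁻¹ := by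
    rw [eSlope, mul_pow, mul_pow, mul_pow, ← rpow_natCast (σ ^ _), ← rpow_mul hσ.le,
      ← rpow_natCast (_ ^ (-1 / 2 : ℝ)), ← rpow_mul hE.le]
    norm_num; rw [rpow_neg_one, rpow_neg_one]
    field_simp
  have key : π⁻¹ * (π * etaOf σ / sinh (π * etaOf σ)) =
      (eSlope σ * (etaOf σ * exp (π * etaOf σ / 2))) ^ 2 := by
    rw [mul_pow, mul_pow, e2, e1, ← Real.exp_nat_mul, show ((2 : ℕ) : ℝ) *
      (π * etaOf σ / 2) = π * etaOf σ by push_cast; ring]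
    have : σ = 1 / (2 * etaOf σ) := by rw [etaOf]; field_simp
    generalize etaOf σ = η at *
    rw [this]; field_simp
    ring
  rw [key, Real.sqrt_sq (by positivity)]

theorem Gamma_ne_zero_line (η : ℝ) : Gamma (1 - I * η) ≠ 0 :=
  Complex.Gamma_ne_zero_of_re_pos (by simp)

theorem outCoeff_ne_zero {σ : ℝ} (hσ : 0 < σ) : outCoeff σ ≠ 0 := by
  have h1 : ampInf ≠ 0 := by
    rw [ampInf]
    exact mul_ne_zero (div_ne_zero (neg_ne_zero.mpr Complex.I_ne_zero)
      (by exact_mod_cast Real.pi_ne_zero)) airyAmp_zero_ne_zero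
  have h2 : ((σ ^ (1 / 6 : ℝ) : ℝ) : ℂ) ≠ 0 := by exact_mod_cast (rpow_pos_of_pos hσ _).ne'
  exact mul_ne_zero h2 (mul_ne_zero (Complex.exp_ne_zero _) h1)

theorem eSlope_mul_cpow {σ : ℝ} (hσ : 0 < σ) : eSlope σ * (2 * I * σ) ^ (-1 - I * etaOf σ) =
      ((σ ^ (-1 / 6 : ℝ) : ℝ) : ℂ) * connE σ *
        (outCoeff σ * Gamma (1 - I * etaOf σ)) := by
  have hη : 0 < etaOf σ := by unfold etaOf; positivity
  have hησ : 2 * σ = (etaOf σ)⁻¹ := by rw [etaOf]; field_simp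
  have hp := pi_pos
  have hsh : 0 < sinh (π * etaOf σ) := Real.sinh_pos_iff.mpr (by positivity)
  have hΓ : ‖Gamma (1 - I * etaOf σ)‖ =
      sqrt (π * etaOf σ / sinh (π * etaOf σ)) := by
    rw [← norm_Gamma_sq hη, Real.sqrt_sq (norm_nonneg _)]
  have h2 : (2 * I * σ : ℂ) ^ (-1 - I * (etaOf σ : ℂ)) =
      (etaOf σ * exp (π * etaOf σ / 2) : ℝ) *
        cexp (I * (-(π / 2) + etaOf σ * log (etaOf σ) : ℝ)) := by
    have hne : (2 * I * σ : ℂ) ≠ 0 := by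
      have : (σ : ℂ) ≠ 0 := by exact_mod_cast hσ.ne'
      exact mul_ne_zero (mul_ne_zero two_ne_zero Complex.I_ne_zero) this
    have hl : Complex.log (2 * I * σ) =
        (-log (etaOf σ) : ℝ) + (π / 2 : ℝ) * I := by
      rw [show (2 * I * σ : ℂ) = ((2 * σ : ℝ) : ℂ) * I by push_cast; ring,
        Complex.log_ofReal_mul (by positivity) Complex.I_ne_zero, Complex.log_I, hησ, Real.log_inv]
      push_cast; ring
    rw [Complex.cpow_def_of_ne_zero hne, hl]
    have hexp : ((etaOf σ * exp (π * etaOf σ / 2) : ℝ) : ℂ) =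
        cexp ((log (etaOf σ) + π * etaOf σ / 2 : ℝ) : ℂ) := by
      rw [← Complex.ofReal_exp, Real.exp_add, Real.exp_log hη]
    rw [hexp, ← Complex.exp_add]
    congr 1; push_cast
    linear_combination (-(π / 2) * (etaOf σ : ℂ)) * I_sq
  have hlog : log (4 * σ ^ 2) = -(2 * log (etaOf σ)) := by
    rw [show 4 * σ ^ 2 = (2 * σ) ^ 2 by ring, hησ, Real.log_pow, Real.log_inv]; push_cast; ring
  have hs16 : ((σ ^ (-1 / 6 : ℝ) : ℝ) : ℂ) * ((σ ^ (1 / 6 : ℝ) : ℝ) : ℂ) = 1 := by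
    rw [← ofReal_mul, ← rpow_add hσ]; norm_num
  have hmod := congrArg (Complex.ofReal) (eSlope_mul hσ)
  rw [ofReal_mul, ofReal_mul (sqrt π)⁻¹] at hmod
  have hphase : cexp (I * (-(π / 2) + etaOf σ * log (etaOf σ) : ℝ)) =
      connE σ * (cexp (I * (-etaOf σ - etaOf σ * log (4 * σ ^ 2) : ℝ)) *
        cexp (-(I * (π / 4 : ℝ)))) *
      cexp (I * ((etaOf σ - etaOf σ * log (etaOf σ) - π / 4 +
        gammaRem 0 (etaOf σ) : ℝ) : ℂ)) := by
    rw [connE, ← Complex.exp_add, ← Complex.exp_add, ← Complex.exp_add, hlog]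
    congr 1; push_cast; ring
  rw [h2, Gamma_phase hη, hΓ, outCoeff, ampInf_eq, ← mul_assoc, hmod, hphase]
  set a : ℂ := ((σ ^ (-1 / 6 : ℝ) : ℝ) : ℂ)
  set b : ℂ := ((σ ^ (1 / 6 : ℝ) : ℝ) : ℂ)
  generalize connE σ = e1
  generalize cexp (I * (-etaOf σ - etaOf σ * log (4 * σ ^ 2) : ℝ)) = e2
  generalize cexp (-(I * (π / 4 : ℝ))) = e3
  generalize cexp (I * ((etaOf σ - etaOf σ * log (etaOf σ) - π / 4 +
        gammaRem 0 (etaOf σ) : ℝ) : ℂ)) = e4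
  generalize (((sqrt π)⁻¹ : ℝ) : ℂ) = e5
  generalize ((sqrt (π * etaOf σ / sinh (π * etaOf σ)) : ℝ) : ℂ) = e6
  linear_combination (-(e1 * e2 * e3 * e4 * e5 * e6)) * hs16

theorem eFun_connection {σ : ℝ} (hσ : σ ∈ Ioo 0 sigma0) {x : ℝ} (hx : 1 ≤ x) : eFun σ (x / σ ^ 2) =
      ((σ ^ (-1 / 6 : ℝ) : ℝ) : ℂ) * conj (connE σ) * ((q x ^ (-1 / 4 : ℝ) : ℝ) : ℂ) *
        psiPlus oscBconj σ (zeta x) +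
      ((σ ^ (-1 / 6 : ℝ) : ℝ) : ℂ) * connE σ * ((q x ^ (-1 / 4 : ℝ) : ℝ) : ℂ) *
        psiMinus oscB σ (zeta x) := by
  have hσ0 : 0 < σ := hσ.1
  obtain ⟨p₁, p₂, hp, h2, h1⟩ := coulReg_connection hσ
  have key := eSlope_mul_cpow hσ0
  have hne := mul_ne_zero (outCoeff_ne_zero hσ0) (Gamma_ne_zero_line (etaOf σ))
  have e2 : eSlope σ * p₂ = ((σ ^ (-1 / 6 : ℝ) : ℝ) : ℂ) * connE σ := by
    refine mul_right_cancel₀ hne ?_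
    rw [← key, ← h2]; ring
  have hconj : conj ((2 * I * σ) ^ (-1 - I * etaOf σ)) =
      (-(2 * I * (σ : ℂ))) ^ (-1 + I * etaOf σ) := by
    have harg : (-(2 * I * (σ : ℂ))).arg ≠ π := by
      intro h; rw [Complex.arg_eq_pi_iff] at h
      simp at h
    have h := Complex.cpow_conj (-(2 * I * (σ : ℂ))) (-1 - I * etaOf σ) harg
    have e3 : conj (-(2 * I * (σ : ℂ))) = 2 * I * σ := by
      rw [map_neg, map_mul, map_mul, map_ofNat, Complex.conj_I, conj_ofReal]; ring
    have e4 : conj (-1 - I * (etaOf σ : ℂ)) = -1 + I * etaOf σ := by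
      rw [map_sub, map_neg, map_one, map_mul, Complex.conj_I, conj_ofReal]; ring
    rw [e3, e4] at h
    exact h.symm
  have hΓc : Gamma (1 + I * etaOf σ) =
      conj (Gamma (1 - I * etaOf σ)) := by rw [← Complex.Gamma_conj]; simp [conj_ofReal]
  have e1 : eSlope σ * p₁ = ((σ ^ (-1 / 6 : ℝ) : ℝ) : ℂ) * conj (connE σ) := by
    have keyc := congrArg conj key
    simp only [map_mul, conj_ofReal] at keyc
    have hne' : conj (outCoeff σ) *
        conj (Gamma (1 - I * etaOf σ)) ≠ 0 := by rw [← map_mul]; exact (map_ne_zero _).mpr hne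
    refine mul_right_cancel₀ hne' ?_
    rw [← keyc]; rw [← hΓc, mul_assoc, ← mul_assoc p₁, h1, ← hconj]
  rw [eFun_eq hσ0, hp x hx]
  linear_combination ((q x ^ (-1 / 4 : ℝ) : ℝ) : ℂ) * (psiPlus oscBconj σ (zeta x)) * e1 +
    ((q x ^ (-1 / 4 : ℝ) : ℝ) : ℂ) * (psiMinus oscB σ (zeta x)) * e2

/-! ### Bounds for the connection coefficients -/

theorem etaOf_pos {σ : ℝ} (hσ : 0 < σ) : 0 < etaOf σ := by unfold etaOf; positivity

theorem hasDerivAt_etaOf {σ : ℝ} (hσ : 0 < σ) : HasDerivAt etaOf (-(1 / (2 * σ ^ 2))) σ := by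
  refine ((hasDerivAt_const σ (1 : ℝ)).div ((hasDerivAt_id σ).const_mul 2)
    (by simp [hσ.ne'])).congr_deriv ?_
  simp only [id]
  field_simp; norm_num

/-- The first derivative of the phase of `connE`. -/
def connPhase1 (σ : ℝ) : ℝ := gammaRem 1 (etaOf σ) * -(1 / (2 * σ ^ 2))

/-- The second derivative of the phase of `connE`. -/
def connPhase2 (σ : ℝ) : ℝ := gammaRem 2 (etaOf σ) / (4 * σ ^ 4) + gammaRem 1 (etaOf σ) / σ ^ 3

theorem hasDerivAt_connPhase {σ : ℝ} (hσ : 0 < σ) :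
    HasDerivAt (fun σ => gammaRem 0 (etaOf σ)) (connPhase1 σ) σ :=
  (hasDerivAt_gammaRem (by norm_num) (etaOf_pos hσ)).comp σ (hasDerivAt_etaOf hσ)

theorem hasDerivAt_connPhase1 {σ : ℝ} (hσ : 0 < σ) : HasDerivAt connPhase1 (connPhase2 σ) σ := by
  have h1 := (hasDerivAt_gammaRem (j := 1) le_rfl (etaOf_pos hσ)).comp σ (hasDerivAt_etaOf hσ)
  have h2 : HasDerivAt (fun σ : ℝ => -(1 / (2 * σ ^ 2))) (1 / σ ^ 3) σ := by
    refine ((hasDerivAt_const σ (1 : ℝ)).div ((hasDerivAt_pow 2 σ).const_mul 2)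
      (by positivity)).neg.congr_deriv ?_
    push_cast; field_simp
    ring
  refine (h1.mul h2).congr_deriv ?_
  rw [connPhase2, Function.comp]; field_simp
  ring

theorem abs_connPhase_le {σ : ℝ} (hσ : 0 < σ) : |gammaRem 0 (etaOf σ)| ≤ 2 * σ ∧
    |connPhase1 σ| ≤ 10 ∧ |connPhase2 σ| ≤ 92 / σ := by
  have hη := etaOf_pos hσ
  have h0 := abs_gammaRem_le 0 hη
  have h1 := abs_gammaRem_le 1 hη
  have h2 := abs_gammaRem_le 2 hη
  norm_num at h0 h1 h2
  have e : (etaOf σ ^ 2)⁻¹ = 4 * σ ^ 2 := by rw [etaOf]; field_simp; norm_num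
  have e' : etaOf σ = 1 / (2 * σ) := rfl
  rw [e, e'] at h0 h2
  rw [e] at h1
  refine ⟨?_, ?_, ?_⟩
  · refine h0.trans (le_of_eq ?_); field_simp; norm_num
  · rw [connPhase1, abs_mul, abs_neg, abs_of_pos (by positivity : 0 < 1 / (2 * σ ^ 2))]
    calc _ ≤ 5 * (4 * σ ^ 2) * (1 / (2 * σ ^ 2)) := by gcongr
      _ = 10 := by field_simp; norm_num
  · rw [e'] at h1
    rw [connPhase2, e']
    refine (abs_add_le _ _).trans ?_
    rw [abs_div, abs_div, abs_of_pos (by positivity : 0 < 4 * σ ^ 4),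
      abs_of_pos (by positivity : 0 < σ ^ 3)]
    calc _ ≤ 36 / (1 / (2 * σ)) * (4 * σ ^ 2) / (4 * σ ^ 4) + 5 * (4 * σ ^ 2) / σ ^ 3 := by
          gcongr
      _ = _ := by field_simp; norm_num

theorem norm_connE (σ : ℝ) : ‖connE σ‖ = 1 := by rw [connE, Complex.norm_exp]; simp

/-- The first derivative of `connE`. -/
def connE1 (σ : ℝ) : ℂ := -(I * connPhase1 σ) * connE σ

/-- The second derivative of `connE`. -/
def connE2 (σ : ℝ) : ℂ := (-(I * connPhase2 σ) - (connPhase1 σ : ℂ) ^ 2) * connE σ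

theorem hasDerivAt_connE {σ : ℝ} (hσ : 0 < σ) : HasDerivAt connE (connE1 σ) σ :=
  ((((hasDerivAt_connPhase hσ).ofReal_comp).const_mul I).neg.cexp).congr_deriv
    (by simp only [Pi.neg_apply]; rw [connE1, connE, mul_comm])

theorem hasDerivAt_connE1 {σ : ℝ} (hσ : 0 < σ) : HasDerivAt connE1 (connE2 σ) σ := by
  refine (((((hasDerivAt_connPhase1 hσ).ofReal_comp).const_mul I).neg).mul
    (hasDerivAt_connE hσ)).congr_deriv ?_
  simp only [connE2, connE1, Pi.neg_apply]
  linear_combination ((connPhase1 σ : ℂ) ^ 2 * connE σ) * I_sq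

theorem norm_connE_sub_one_le {σ : ℝ} (hσ : 0 < σ) : ‖connE σ - 1‖ ≤ 2 * σ := by
  rw [connE, show -(I * (gammaRem 0 (etaOf σ) : ℂ)) =
    I * ((-gammaRem 0 (etaOf σ) : ℝ) : ℂ) by push_cast; ring]
  refine (Real.norm_exp_I_mul_ofReal_sub_one_le).trans ?_
  rw [norm_neg]; exact (abs_connPhase_le hσ).1

theorem norm_connE1_le {σ : ℝ} (hσ : 0 < σ) : ‖connE1 σ‖ ≤ 10 := by
  rw [connE1, norm_mul, norm_connE, mul_one, norm_neg, norm_mul, Complex.norm_I, one_mul, norm_real]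
  exact (abs_connPhase_le hσ).2.1

theorem norm_connE2_le {σ : ℝ} (hσ : 0 < σ) : ‖connE2 σ‖ ≤ 92 / σ + 100 := by
  obtain ⟨-, h1, h2⟩ := abs_connPhase_le hσ
  rw [connE2, norm_mul, norm_connE, mul_one]
  refine (norm_sub_le _ _).trans (add_le_add ?_ ?_)
  · rw [norm_neg, norm_mul, Complex.norm_I, one_mul, norm_real]; exact h2
  · rw [norm_pow, norm_real, norm_eq_abs]; nlinarith [abs_nonneg (connPhase1 σ)]

theorem connE_eq {σ : ℝ} (hσ : 0 < σ) : connE σ =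
    cexp (I * (etaOf σ - etaOf σ * log (etaOf σ) - π / 4 : ℝ)) *
      (sqrt (π * etaOf σ / sinh (π * etaOf σ)) : ℝ) *
        (Gamma (1 - I * etaOf σ))⁻¹ := by
  have hη := etaOf_pos hσ
  have hΓ : sqrt (π * etaOf σ / sinh (π * etaOf σ)) =
      ‖Gamma (1 - I * etaOf σ)‖ := by rw [← norm_Gamma_sq hη, Real.sqrt_sq (norm_nonneg _)]
  rw [eq_mul_inv_iff_mul_eq₀ (Gamma_ne_zero_line _), hΓ]
  conv_lhs => rw [Gamma_phase hη]
  rw [connE, mul_left_comm, ← Complex.exp_add, mul_comm]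
  congr 2
  push_cast; ring

theorem contDiffAt_connE {σ : ℝ} (hσ : 0 < σ) : ContDiffAt ℝ ∞ connE σ := by
  have hη := etaOf_pos hσ
  have hp := pi_pos
  have hE : ContDiffAt ℝ ∞ etaOf σ := by
    unfold etaOf
    exact contDiffAt_const.div (by fun_prop) (by positivity)
  have hs : 0 < sinh (π * etaOf σ) := Real.sinh_pos_iff.mpr (by positivity)
  have h1 : ContDiffAt ℝ ∞ (fun σ => cexp (I *
      (etaOf σ - etaOf σ * log (etaOf σ) - π / 4 : ℝ))) σ := by
    refine ContDiffAt.cexp (contDiffAt_const.mul ?_)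
    exact ofRealCLM.contDiff.contDiffAt.comp σ
      ((hE.sub (hE.mul (hE.log hη.ne'))).sub contDiffAt_const)
  have h2 : ContDiffAt ℝ ∞ (fun σ =>
      ((sqrt (π * etaOf σ / sinh (π * etaOf σ)) : ℝ) : ℂ)) σ := by
    refine ofRealCLM.contDiff.contDiffAt.comp σ (ContDiffAt.sqrt ?_ (by positivity))
    exact (contDiffAt_const.mul hE).div
      (Real.contDiff_sinh.contDiffAt.comp σ (contDiffAt_const.mul hE)) hs.ne'
  have h3 : ContDiffAt ℝ ∞ (fun σ => (Gamma (1 - I * etaOf σ))⁻¹) σ := by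
    have hG : ContDiff ℝ ∞ (fun s : ℂ => (Gamma s)⁻¹) :=
      (Complex.differentiable_one_div_Gamma.contDiff (n := ∞)).restrict_scalars ℝ
    exact hG.contDiffAt.comp σ (contDiffAt_const.sub (contDiffAt_const.mul
      (ofRealCLM.contDiff.contDiffAt.comp σ hE)))
  refine ((h1.mul h2).mul h3).congr_of_eventuallyEq ?_
  filter_upwards [lt_mem_nhds hσ] with s hs
  exact connE_eq hs

theorem CoeffBounds.of_hasDerivAt {c K : ℝ} {e e1 e2 : ℝ → ℂ}
    (h : ∀ σ ∈ Ioo 0 c, ContDiffAt ℝ 2 e σ) (h1 : ∀ σ ∈ Ioo 0 c, HasDerivAt e (e1 σ) σ)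
    (h2 : ∀ σ ∈ Ioo 0 c, HasDerivAt e1 (e2 σ) σ)
    (hb : ∀ σ ∈ Ioo 0 c, ‖e σ‖ ≤ K * σ ∧ ‖e1 σ‖ ≤ K * σ ^ (-1 / 3 : ℝ) ∧
      ‖e2 σ‖ ≤ K * σ ^ (-7 / 3 : ℝ)) : CoeffBounds c K e where
  smooth := fun σ hσ => (h σ hσ).contDiffWithinAt
  zero := fun σ hσ => (hb σ hσ).1
  ds := fun σ hσ => by rw [(h1 σ hσ).deriv]; exact (hb σ hσ).2.1
  dss := fun σ hσ => by
    have : deriv e =ᶠ[𝓝 σ] e1 := by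
      filter_upwards [isOpen_Ioo.mem_nhds hσ] with s hs using (h1 s hs).deriv
    rw [iteratedDeriv_succ, iteratedDeriv_one, this.deriv_eq, (h2 σ hσ).deriv]; exact (hb σ hσ).2.2

theorem one_le_rpow_neg {σ : ℝ} (hσ : 0 < σ) (h1 : σ ≤ 1) {a : ℝ} (ha : a ≤ 0) : 1 ≤ σ ^ a :=
  Real.one_le_rpow_of_pos_of_le_one_of_nonpos hσ h1 ha

theorem connE_bounds {σ : ℝ} (hσ : 0 < σ) (h1 : σ ≤ 1) {K : ℝ} (hK : 192 ≤ K) :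
    ‖connE σ - 1‖ ≤ K * σ ∧ ‖connE1 σ‖ ≤ K * σ ^ (-1 / 3 : ℝ) ∧
      ‖connE2 σ‖ ≤ K * σ ^ (-7 / 3 : ℝ) := by
  refine ⟨(norm_connE_sub_one_le hσ).trans (by gcongr; linarith), ?_, ?_⟩
  · have := one_le_rpow_neg hσ h1 (a := -1 / 3) (by norm_num)
    refine (norm_connE1_le hσ).trans ?_
    nlinarith
  · have h2 : σ⁻¹ ≤ σ ^ (-7 / 3 : ℝ) := by
      rw [← rpow_neg_one]; exact Real.rpow_le_rpow_of_exponent_ge hσ h1 (by norm_num)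
    have h3 := one_le_rpow_neg hσ h1 (a := -7 / 3) (by norm_num)
    refine (norm_connE2_le hσ).trans ?_
    rw [div_eq_mul_inv]; nlinarith

theorem coeffBounds_connE {c K : ℝ} (hc : c ≤ 1) (hK : 192 ≤ K) :
    CoeffBounds c K (fun σ => connE σ - 1) :=
  CoeffBounds.of_hasDerivAt
    (fun _ hσ => ((contDiffAt_connE hσ.1).of_le (WithTop.coe_le_coe.mpr le_top : ((2 : ℕ∞) : WithTop ℕ∞) ≤ ∞)).sub contDiffAt_const)
    (fun _ hσ => (hasDerivAt_connE hσ.1).sub_const 1) (fun _ hσ => hasDerivAt_connE1 hσ.1)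
    (fun _ hσ => connE_bounds hσ.1 (hσ.2.le.trans hc) hK)

theorem coeffBounds_conj_connE {c K : ℝ} (hc : c ≤ 1) (hK : 192 ≤ K) :
    CoeffBounds c K (fun σ => conj (connE σ) - 1) := by
  refine CoeffBounds.of_hasDerivAt
    (fun σ hσ => ((Complex.conjCLE.contDiff.contDiffAt.comp σ ((contDiffAt_connE hσ.1).of_le
      (WithTop.coe_le_coe.mpr le_top : ((2 : ℕ∞) : WithTop ℕ∞) ≤ ∞))).sub contDiffAt_const))
    (fun _ hσ => (hasDerivAt_conj (hasDerivAt_connE hσ.1)).sub_const 1)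
    (fun _ hσ => hasDerivAt_conj (hasDerivAt_connE1 hσ.1)) (fun σ hσ => ?_)
  have h := connE_bounds hσ.1 (hσ.2.le.trans hc) hK
  rw [show conj (connE σ) - 1 = conj (connE σ - 1) by simp,
    RCLike.norm_conj, RCLike.norm_conj, RCLike.norm_conj]
  exact h

/-! ### Bounds for the amplitudes -/

/-- The region of `(σ, r)` to the right of the turning point. -/
def AmpDom (σ r : ℝ) : Prop := 0 < σ ∧ σ < 1 ∧ σ < sigma0 ∧ 2 < σ ^ 2 * r

/-- `f` is bounded, together with its first two derivatives with respect to `log σ`. -/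
def EulerBounded (f : ℝ → ℝ → ℂ) : Prop := ∃ (f1 f2 : ℝ → ℝ → ℂ) (C : ℝ), ∀ σ r, AmpDom σ r →
    HasDerivAt (fun s => f s r) (f1 σ r / σ) σ ∧ HasDerivAt (fun s => f1 s r) (f2 σ r / σ) σ ∧
      ‖f σ r‖ ≤ C ∧ ‖f1 σ r‖ ≤ C ∧ ‖f2 σ r‖ ≤ C

theorem eulerBounded_const (a : ℂ) : EulerBounded fun _ _ => a :=
  ⟨fun _ _ => 0, fun _ _ => 0, ‖a‖, fun σ r _ => ⟨by simpa using hasDerivAt_const σ a,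
    by simpa using hasDerivAt_const σ (0 : ℂ), le_rfl, by simp, by simp⟩⟩

theorem EulerBounded.mul {f g : ℝ → ℝ → ℂ} (hf : EulerBounded f) (hg : EulerBounded g) :
    EulerBounded fun σ r => f σ r * g σ r := by
  obtain ⟨f1, f2, A, hf⟩ := hf
  obtain ⟨g1, g2, B, hg⟩ := hg
  refine ⟨fun σ r => f1 σ r * g σ r + f σ r * g1 σ r,
    fun σ r => f2 σ r * g σ r + 2 * (f1 σ r * g1 σ r) + f σ r * g2 σ r, 4 * (A * B), fun σ r h => ?_⟩
  obtain ⟨a1, a2, a3, a4, a5⟩ := hf σ r h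
  obtain ⟨b1, b2, b3, b4, b5⟩ := hg σ r h
  have hA : 0 ≤ A := (norm_nonneg _).trans a3
  have hB : 0 ≤ B := (norm_nonneg _).trans b3
  have key : ∀ {x y : ℂ}, ‖x‖ ≤ A → ‖y‖ ≤ B → ‖x * y‖ ≤ A * B := fun hx hy => by
    rw [norm_mul]; gcongr
  have hAB : 0 ≤ A * B := mul_nonneg hA hB
  refine ⟨(a1.mul b1).congr_deriv (by ring), ((a2.mul b1).add (a1.mul b2)).congr_deriv (by ring),
    (key a3 b3).trans (by linarith), ?_, ?_⟩
  · refine (norm_add_le _ _).trans ?_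
    linarith [key a4 b3, key a3 b4]
  · refine (norm_add₃_le).trans ?_
    rw [norm_mul (2 : ℂ), Complex.norm_ofNat]; linarith [key a5 b3, key a4 b4, key a3 b5]

theorem EulerBounded.conj {f : ℝ → ℝ → ℂ} (hf : EulerBounded f) :
    EulerBounded fun σ r => conj (f σ r) := by
  obtain ⟨f1, f2, A, hf⟩ := hf
  refine ⟨fun σ r => conj (f1 σ r), fun σ r => conj (f2 σ r), A, fun σ r h => ?_⟩
  obtain ⟨a1, a2, a3, a4, a5⟩ := hf σ r h
  simp only [RCLike.norm_conj]
  exact ⟨(hasDerivAt_conj a1).congr_deriv (by simp), (hasDerivAt_conj a2).congr_deriv (by simp),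
    a3, a4, a5⟩

theorem eulerBounded_connE : EulerBounded fun σ _ => connE σ := by
  refine ⟨fun σ _ => σ * connE1 σ, fun σ _ => σ * connE1 σ + σ ^ 2 * connE2 σ, 202, fun σ r h => ?_⟩
  have hσ := h.1
  have h1 := h.2.1
  have hs : (σ : ℂ) ≠ 0 := by exact_mod_cast hσ.ne'
  have hn : ‖(σ : ℂ)‖ = σ := by simp [abs_of_pos hσ]
  have hb1 : ‖(σ : ℂ) * connE1 σ‖ ≤ 10 := by
    rw [norm_mul, hn]
    have := norm_connE1_le hσ
    nlinarith [norm_nonneg (connE1 σ)]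
  refine ⟨(hasDerivAt_connE hσ).congr_deriv (by field_simp), ?_, ?_, hb1.trans (by norm_num), ?_⟩
  · have h0 : HasDerivAt (fun s : ℝ => (s : ℂ)) 1 σ := ofRealCLM.hasDerivAt (x := σ)
    refine (h0.mul (hasDerivAt_connE1 hσ)).congr_deriv ?_
    field_simp
  · rw [norm_connE]; norm_num
  · refine (norm_add_le _ _).trans ?_
    have hb2 : ‖(σ : ℂ) ^ 2 * connE2 σ‖ ≤ 192 := by
      rw [norm_mul, norm_pow, hn]
      calc σ ^ 2 * ‖connE2 σ‖ ≤ σ ^ 2 * (92 / σ + 100) := by gcongr; exact norm_connE2_le hσ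
        _ = 92 * σ + 100 * σ ^ 2 := by field_simp
        _ ≤ 192 := by nlinarith
    linarith

theorem hasDerivAt_scale (r : ℝ) {σ : ℝ} (hσ : 0 < σ) :
    HasDerivAt (fun s : ℝ => s ^ 2 * r) (2 * (σ ^ 2 * r) / σ) σ := by
  refine ((hasDerivAt_pow 2 σ).mul_const r).congr_deriv ?_
  push_cast; field_simp

theorem hasDerivAt_comp_scale {f : ℝ → ℝ} {f' r σ : ℝ} (hσ : 0 < σ)
    (hf : HasDerivAt f f' (σ ^ 2 * r)) :
    HasDerivAt (fun s : ℝ => f (s ^ 2 * r)) (2 * (σ ^ 2 * r) * f' / σ) σ :=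
  (hf.comp σ (hasDerivAt_scale r hσ)).congr_deriv (by ring)

/-- The logarithmic derivative of `ζ`, doubled. -/
def lgL (x : ℝ) : ℝ := 2 * x * sqrt (1 - x⁻¹) / zeta x ^ (3 / 2 : ℝ)

theorem lgL_bounds {x : ℝ} (hx : 2 < x) : 0 ≤ lgL x ∧ lgL x ≤ 8 := by
  have hz := zeta_rpow_ge hx.le
  have hx0 : 0 < x := by linarith
  have hz0 : 0 < zeta x ^ (3 / 2 : ℝ) := lt_of_lt_of_le (by positivity) hz
  refine ⟨by unfold lgL; positivity, ?_⟩
  rw [lgL, div_le_iff₀ hz0]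
  have : sqrt (1 - x⁻¹) ≤ 1 := by
    rw [Real.sqrt_le_iff]
    have : 0 < x⁻¹ := by positivity
    constructor <;> linarith
  nlinarith [Real.sqrt_nonneg (1 - x⁻¹)]

theorem hasDerivAt_zeta_lgL {x : ℝ} (hx : 2 < x) :
    HasDerivAt zeta (zeta x * lgL x / (2 * x)) x := by
  have hx0 : 0 < x := by linarith
  have hz := zeta_pos (by linarith : 1 < x)
  refine (hasDerivAt_zeta hx0).congr_deriv ?_
  have e : zeta x ^ (3 / 2 : ℝ) = zeta x * sqrt (zeta x) := by
    rw [sqrt_eq_rpow, ← Real.rpow_one_add' hz.le (by norm_num)]; norm_num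
  rw [lgL, e, ← q_mul_zeta hx0, Real.sqrt_mul (q_pos hx0).le]
  have : sqrt (zeta x) ≠ 0 := (Real.sqrt_pos.mpr hz).ne'
  field_simp

/-- The Euler derivative of `lgL` along `σ`. -/
def lgL1 (x : ℝ) : ℝ := lgL x * (2 + (x - 1)⁻¹ - 3 / 2 * lgL x)

theorem lgL1_bound {x : ℝ} (hx : 2 < x) : |lgL1 x| ≤ 120 := by
  obtain ⟨h0, h8⟩ := lgL_bounds hx
  have h1 : (x - 1)⁻¹ ≤ 1 := inv_le_one_of_one_le₀ (by linarith)
  have h2 : 0 < (x - 1)⁻¹ := inv_pos.mpr (by linarith)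
  rw [lgL1, abs_mul, abs_of_nonneg h0]
  have : |2 + (x - 1)⁻¹ - 3 / 2 * lgL x| ≤ 15 := by rw [abs_le]; constructor <;> linarith
  nlinarith [abs_nonneg (2 + (x - 1)⁻¹ - 3 / 2 * lgL x)]

theorem hasDerivAt_lgL {x : ℝ} (hx : 2 < x) : HasDerivAt lgL (lgL1 x / (2 * x)) x := by
  have hx0 : 0 < x := by linarith
  have hx1 : 0 < x - 1 := by linarith
  have hz := zeta_pos (by linarith : 1 < x)
  have hi : 0 < 1 - x⁻¹ := by
    have : x⁻¹ < 1 := inv_lt_one_of_one_lt₀ (by linarith)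
    linarith
  have h1 := (((hasDerivAt_inv hx0.ne').const_sub 1).sqrt hi.ne')
  have h2 := (hasDerivAt_zeta_lgL hx).rpow_const (p := (3 / 2 : ℝ)) (Or.inl hz.ne')
  have hz0 : 0 < zeta x ^ (3 / 2 : ℝ) := rpow_pos_of_pos hz _
  refine ((((hasDerivAt_id x).const_mul 2).mul h1).div h2 hz0.ne').congr_deriv ?_
  have e : zeta x ^ (3 / 2 - 1 : ℝ) = zeta x ^ (3 / 2 : ℝ) / zeta x := by
    rw [Real.rpow_sub hz, Real.rpow_one]
  simp only [Pi.mul_apply, id]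
  rw [e]
  have hs : sqrt (1 - x⁻¹) ^ 2 = 1 - x⁻¹ := sq_sqrt hi.le
  have hsp := Real.sqrt_pos.mpr hi
  have hL : lgL x * zeta x ^ (3 / 2 : ℝ) = 2 * x * sqrt (1 - x⁻¹) := by rw [lgL]; field_simp
  have hs' : sqrt (1 - x⁻¹) ^ 2 * x = x - 1 := by rw [hs]; field_simp
  rw [lgL1]
  generalize sqrt (1 - x⁻¹) = s at *
  generalize zeta x ^ (3 / 2 : ℝ) = Z at *
  have hLe : lgL x = 2 * x * s / Z := by field_simp; linarith
  rw [hLe]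
  have e2 : x - 1 = s ^ 2 * x := hs'.symm
  rw [e2]; field_simp

theorem hasDerivAt_tOfX_scale {σ r : ℝ} (h : AmpDom σ r) : HasDerivAt (fun s => tOfX s (s ^ 2 * r))
      (tOfX σ (σ ^ 2 * r) * (lgL (σ ^ 2 * r) - 2 / 3) / σ) σ := by
  have hσ := h.1
  have hx := h.2.2.2
  have h1 := hasDerivAt_comp_scale hσ (hasDerivAt_zeta_lgL hx)
  have h2 := (hasDerivAt_rpow_const (p := (-2 / 3 : ℝ)) (Or.inl hσ.ne'))
  refine (h2.mul h1).congr_deriv ?_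
  rw [tOfX, Real.rpow_sub hσ, Real.rpow_one]
  have hx0 : σ ^ 2 * r ≠ 0 := by linarith
  generalize lgL (σ ^ 2 * r) = L at *
  generalize zeta (σ ^ 2 * r) = Z at *
  generalize σ ^ 2 * r = x at *
  field_simp; ring

theorem hasDerivAt_lgL_scale {σ r : ℝ} (h : AmpDom σ r) :
    HasDerivAt (fun s => lgL (s ^ 2 * r)) (lgL1 (σ ^ 2 * r) / σ) σ := by
  have hx0 : σ ^ 2 * r ≠ 0 := by linarith [h.2.2.2]
  refine (hasDerivAt_comp_scale h.1 (hasDerivAt_lgL h.2.2.2)).congr_deriv ?_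
  generalize σ ^ 2 * r = x at *
  field_simp

theorem tOfX_rpow {σ x : ℝ} (hσ : 0 < σ) (hx : 1 < x) :
    tOfX σ x ^ (3 / 2 : ℝ) = σ⁻¹ * zeta x ^ (3 / 2 : ℝ) := by
  rw [tOfX, Real.mul_rpow (by positivity) (zeta_pos hx).le, ← rpow_mul hσ.le]; norm_num
  rw [rpow_neg_one]; exact Or.inl rfl

theorem tOfX_pos {σ x : ℝ} (hσ : 0 < σ) (hx : 1 < x) : 0 < tOfX σ x := by
  have := zeta_pos hx
  unfold tOfX; positivity

theorem ampVar_le {σ r : ℝ} (h : AmpDom σ r) : tOfX σ (σ ^ 2 * r) ^ (-3 / 4 : ℝ) ≤ 2 := by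
  obtain ⟨hσ, h1, -, hx⟩ := h
  have ht := tOfX_pos hσ (by linarith : 1 < σ ^ 2 * r)
  have h2 : 1 / 2 ≤ tOfX σ (σ ^ 2 * r) ^ (3 / 2 : ℝ) := by
    rw [tOfX_rpow hσ (by linarith)]
    have h3 := zeta_rpow_ge hx.le
    have h4 : 1 ≤ σ⁻¹ := (one_le_inv₀ hσ).mpr h1.le
    nlinarith
  set y := tOfX σ (σ ^ 2 * r) ^ (-3 / 4 : ℝ)
  have hy : 0 < y := rpow_pos_of_pos ht _
  have e : y ^ 2 * tOfX σ (σ ^ 2 * r) ^ (3 / 2 : ℝ) = 1 := by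
    rw [← rpow_natCast, ← rpow_mul ht.le, ← rpow_add ht]; norm_num
  by_contra hc
  push Not at hc
  have : 4 ≤ y ^ 2 := by nlinarith
  nlinarith

theorem eulerBounded_ofReal {f f1 f2 : ℝ → ℝ → ℝ} {C : ℝ}
    (h : ∀ σ r, AmpDom σ r → HasDerivAt (fun s => f s r) (f1 σ r / σ) σ ∧
      HasDerivAt (fun s => f1 s r) (f2 σ r / σ) σ ∧
      |f σ r| ≤ C ∧ |f1 σ r| ≤ C ∧ |f2 σ r| ≤ C) : EulerBounded fun σ r => (f σ r : ℂ) := by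
  refine ⟨fun σ r => (f1 σ r : ℂ), fun σ r => (f2 σ r : ℂ), C, fun σ r hd => ?_⟩
  obtain ⟨h1, h2, h3⟩ := h σ r hd
  simp only [norm_real, norm_eq_abs]
  exact ⟨h1.ofReal_comp.congr_deriv (by push_cast; rfl),
    h2.ofReal_comp.congr_deriv (by push_cast; rfl), h3⟩

theorem eulerBounded_turning :
    EulerBounded fun σ r => (((1 - (σ ^ 2 * r)⁻¹) ^ (-1 / 4 : ℝ) : ℝ) : ℂ) := by
  refine eulerBounded_ofReal (C := 8)
    (f1 := fun σ r => (1 - (σ ^ 2 * r)⁻¹) ^ (-1 / 4 : ℝ) * (-1 / 2 * (σ ^ 2 * r - 1)⁻¹))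
    (f2 := fun σ r => (1 - (σ ^ 2 * r)⁻¹) ^ (-1 / 4 : ℝ) *
      (1 / 4 * (σ ^ 2 * r - 1)⁻¹ ^ 2 + (σ ^ 2 * r) * (σ ^ 2 * r - 1)⁻¹ ^ 2)) fun σ r h => ?_
  obtain ⟨hσ, -, -, hx⟩ := h
  have hd1 : ∀ x : ℝ, 2 < x → HasDerivAt (fun x : ℝ => (1 - x⁻¹) ^ (-1 / 4 : ℝ))
      ((1 - x⁻¹) ^ (-1 / 4 : ℝ) * (-1 / 4 * (x - 1)⁻¹) / x) x := by
    intro x hx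
    have hx0 : 0 < x := by linarith
    have hx1 : x - 1 ≠ 0 := by linarith
    have hi : 0 < 1 - x⁻¹ := by
      have : x⁻¹ < 1 := inv_lt_one_of_one_lt₀ (by linarith)
      linarith
    refine (((hasDerivAt_inv hx0.ne').const_sub 1).rpow_const (Or.inl hi.ne')).congr_deriv ?_
    rw [Real.rpow_sub hi, Real.rpow_one]
    have e : (1 - x⁻¹) = (x - 1) / x := by field_simp
    generalize (1 - x⁻¹) ^ (-1 / 4 : ℝ) = A
    rw [e]; field_simp
  have hd2 : ∀ x : ℝ, 2 < x → HasDerivAt (fun x : ℝ => (x - 1)⁻¹) (-(x - 1)⁻¹ ^ 2) x := by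
    intro x hx
    have hx1 : x - 1 ≠ 0 := by linarith
    refine (((hasDerivAt_id x).sub_const 1).inv hx1).congr_deriv ?_
    simp only [id]; field_simp
  have h1 := hasDerivAt_comp_scale hσ (hd1 _ hx)
  have h2 := hasDerivAt_comp_scale hσ (hd2 _ hx)
  have hx0 : σ ^ 2 * r ≠ 0 := by linarith
  set x := σ ^ 2 * r
  set A := (1 - x⁻¹) ^ (-1 / 4 : ℝ)
  have hA0 : 0 ≤ A := Real.rpow_nonneg (by
    have : x⁻¹ < 1 := inv_lt_one_of_one_lt₀ (by linarith)
    linarith) _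
  have hA : A ≤ 2 := by
    have hi : 1 / 2 ≤ 1 - x⁻¹ := by
      have : x⁻¹ ≤ 2⁻¹ := inv_anti₀ (by norm_num) hx.le
      linarith
    have h3 : A ≤ (1 / 2) ^ (-1 / 4 : ℝ) :=
      Real.rpow_le_rpow_of_nonpos (by norm_num) hi (by norm_num)
    have h4 : (1 / 2 : ℝ) ^ (-1 / 4 : ℝ) ≤ (1 / 2 : ℝ) ^ (-1 : ℝ) :=
      Real.rpow_le_rpow_of_exponent_ge (by norm_num) (by norm_num) (by norm_num)
    rw [rpow_neg_one] at h4
    linarith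
  have hi1 : (x - 1)⁻¹ ≤ 1 := inv_le_one_of_one_le₀ (by linarith)
  have hi0 : 0 < (x - 1)⁻¹ := inv_pos.mpr (by linarith)
  have hxi : x * (x - 1)⁻¹ ≤ 2 := by rw [← div_eq_mul_inv, div_le_iff₀ (by linarith)]; linarith
  refine ⟨h1.congr_deriv (by field_simp; ring), (h1.mul (h2.const_mul (-1 / 2))).congr_deriv ?_,
    ?_, ?_, ?_⟩
  · change _ * (-1 / 2 * (x - 1)⁻¹) + A * _ = _
    field_simp
  · rw [abs_of_nonneg hA0]; linarith
  · rw [abs_mul, abs_of_nonneg hA0, abs_mul, abs_of_pos hi0]; norm_num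
    nlinarith
  · have h5 : (x - 1)⁻¹ ^ 2 ≤ 1 := pow_le_one₀ hi0.le hi1
    have h6 : x * (x - 1)⁻¹ ^ 2 ≤ 2 := by nlinarith
    have h7 : 0 ≤ x * (x - 1)⁻¹ ^ 2 := by
      have : 0 < x := by linarith
      positivity
    rw [abs_of_nonneg (mul_nonneg hA0 (by positivity))]; nlinarith

theorem hasDerivAt_ampVar {σ r : ℝ} (h : AmpDom σ r) :
    HasDerivAt (fun s => tOfX s (s ^ 2 * r) ^ (-3 / 4 : ℝ))
      (tOfX σ (σ ^ 2 * r) ^ (-3 / 4 : ℝ) * (1 / 2 - 3 / 4 * lgL (σ ^ 2 * r)) / σ) σ := by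
  have ht := tOfX_pos h.1 (by linarith [h.2.2.2] : 1 < σ ^ 2 * r)
  refine ((hasDerivAt_tOfX_scale h).rpow_const (Or.inl ht.ne')).congr_deriv ?_
  rw [Real.rpow_sub ht, Real.rpow_one]; field_simp
  ring

theorem eulerBounded_airyAmp :
    EulerBounded fun σ r => airyAmp 0 (tOfX σ (σ ^ 2 * r) ^ (-3 / 4 : ℝ)) := by
  obtain ⟨C0, hC0, h0⟩ := exists_norm_airyAmp_le 0
  obtain ⟨C1, hC1, h1⟩ := exists_norm_airyAmp_le 1
  obtain ⟨C2, hC2, h2⟩ := exists_norm_airyAmp_le 2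
  let y : ℝ → ℝ → ℝ := fun σ r => tOfX σ (σ ^ 2 * r) ^ (-3 / 4 : ℝ)
  let P : ℝ → ℝ → ℝ := fun σ r => 1 / 2 - 3 / 4 * lgL (σ ^ 2 * r)
  refine ⟨fun σ r => (y σ r * P σ r : ℝ) * airyAmp 1 (y σ r),
    fun σ r => (y σ r * (P σ r ^ 2 - 3 / 4 * lgL1 (σ ^ 2 * r)) : ℝ) * airyAmp 1 (y σ r) +
      ((y σ r * P σ r) ^ 2 : ℝ) * airyAmp 2 (y σ r), C0 + 10000 * C1 + 10000 * C2,
    fun σ r h => ?_⟩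
  have hσ := h.1
  have hs : (σ : ℂ) ≠ 0 := by exact_mod_cast hσ.ne'
  have ht := tOfX_pos hσ (by linarith [h.2.2.2] : 1 < σ ^ 2 * r)
  have hy0 : 0 < y σ r := rpow_pos_of_pos ht _
  have hy2 : y σ r ≤ 2 := ampVar_le h
  have hd : HasDerivAt (fun s => y s r) (y σ r * P σ r / σ) σ := hasDerivAt_ampVar h
  have hP : HasDerivAt (fun s => P s r) (-(3 / 4 * lgL1 (σ ^ 2 * r)) / σ) σ :=
    (((hasDerivAt_lgL_scale h).const_mul (3 / 4)).const_sub (1 / 2)).congr_deriv (by ring)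
  have hA : ∀ k, HasDerivAt (fun s => airyAmp k (y s r))
      ((y σ r * P σ r / σ : ℝ) * airyAmp (k + 1) (y σ r)) σ := fun k =>
    (HasDerivAt.scomp (h := fun s => y s r) σ (hasDerivAt_airyAmp k hy0) hd).congr_deriv
      (by rw [real_smul])
  obtain ⟨hL0, hL8⟩ := lgL_bounds h.2.2.2
  have hL1 := abs_le.mp (lgL1_bound h.2.2.2)
  have hPb : |P σ r| ≤ 6 := by rw [abs_le]; constructor <;> simp only [P] <;> linarith
  have hyP : |y σ r * P σ r| ≤ 12 := by
    rw [abs_mul, abs_of_pos hy0]; nlinarith [abs_nonneg (P σ r)]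
  refine ⟨(hA 0).congr_deriv (by push_cast; ring),
    (((hd.mul hP).ofReal_comp).mul (hA 1)).congr_deriv ?_, ?_, ?_, ?_⟩
  · simp only [Pi.mul_apply]
    push_cast; field_simp
    ring
  · exact (h0 _ hy0.le).trans (by linarith)
  · rw [norm_mul, norm_real, norm_eq_abs]
    have := h1 _ hy0.le
    calc _ ≤ 12 * C1 := by gcongr
      _ ≤ _ := by linarith
  · refine (norm_add_le _ _).trans ?_
    rw [norm_mul, norm_mul, norm_real, norm_real, norm_eq_abs, norm_eq_abs]
    have e1 := h1 _ hy0.le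
    have e2 := h2 _ hy0.le
    have b1 : |y σ r * (P σ r ^ 2 - 3 / 4 * lgL1 (σ ^ 2 * r))| ≤ 1000 := by
      rw [abs_mul, abs_of_pos hy0]
      have : |P σ r ^ 2 - 3 / 4 * lgL1 (σ ^ 2 * r)| ≤ 200 := by
        have := abs_le.mp hPb
        rw [abs_le]; constructor <;> nlinarith
      nlinarith [abs_nonneg (P σ r ^ 2 - 3 / 4 * lgL1 (σ ^ 2 * r))]
    have b2 : |(y σ r * P σ r) ^ 2| ≤ 1000 := by
      rw [abs_pow]; nlinarith [abs_nonneg (y σ r * P σ r)]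
    calc _ ≤ 1000 * C1 + 1000 * C2 := by gcongr
      _ ≤ _ := by linarith

theorem hasDerivAt_vOf {σ : ℝ} (hσ : 0 < σ) : HasDerivAt vOf (σ⁻¹ / 3) σ :=
  (Real.hasDerivAt_log hσ.ne').div_const 3

/-- The derivative along `σ` at fixed `r` of a function of `v` and `t`. -/
theorem hasDerivAt_vol_scale {F : ℝ × ℝ → ℂ} {A B : ℂ} {σ r : ℝ} (h : AmpDom σ r)
    (hF : ContDiffOn ℝ 1 F (Iio volV1 ×ˢ Ioi (-1)))
    (h1 : HasDerivAt (fun v => F (v, tOfX σ (σ ^ 2 * r))) A (vOf σ))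
    (h2 : HasDerivAt (fun t => F (vOf σ, t)) B (tOfX σ (σ ^ 2 * r))) :
    HasDerivAt (fun s => F (vOf s, tOfX s (s ^ 2 * r)))
      ((A / 3 + tOfX σ (σ ^ 2 * r) * (lgL (σ ^ 2 * r) - 2 / 3) * B) / σ) σ := by
  have hσ := h.1
  have ht := tOfX_pos hσ (by linarith [h.2.2.2] : 1 < σ ^ 2 * r)
  have hm : (vOf σ, tOfX σ (σ ^ 2 * r)) ∈ Iio volV1 ×ˢ Ioi (-1 : ℝ) :=
    ⟨vOf_lt ⟨hσ, h.2.2.1⟩, lt_trans (by norm_num) ht⟩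
  refine (hasDerivAt_curve (γ := vOf) (δ := fun s => tOfX s (s ^ 2 * r))
    ((hF.contDiffAt (isOpen_volDom.mem_nhds hm)).differentiableAt (by simp)) h1 h2
    (hasDerivAt_vOf hσ) (hasDerivAt_tOfX_scale h)).congr_deriv ?_
  push_cast; ring

theorem exists_weighted_vol_bounds : ∃ C, 0 < C ∧ ∀ v < volV1, ∀ t, 0 ≤ t →
    (∀ j ≤ 2, ‖betaJ j v t‖ ≤ C ∧ ‖t * hJ j v t‖ ≤ C) ∧ ‖(t : ℂ) ^ 2 * kJ 0 v t‖ ≤ C := by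
  obtain ⟨A, hA, h1⟩ := exists_crude_bounds
  obtain ⟨M, hM, h2⟩ := exists_vol_bounds
  refine ⟨A + M, by linarith, fun v hv t ht => ?_⟩
  obtain ⟨ρ, w, hρ, hw, rfl, rfl, hρw, -, -, -, -, hk, -⟩ := h2 v hv t ht
  have h1 := h1 v hv t (by linarith)
  set ρ := volRho 1 (exp v) t
  have hw2 := wt_sq (by linarith : -1 ≤ t)
  have hρ1 : ρ ≤ 1 := by nlinarith
  have hρt : t * ρ ^ 2 ≤ 1 := by
    have : (ρ * wt t) ^ 2 ≤ 1 := pow_le_one₀ (by positivity) hρw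
    rw [mul_pow, hw2] at this
    nlinarith [sq_nonneg ρ]
  have hn : ‖(t : ℂ)‖ = t := by simp [abs_of_nonneg ht]
  refine ⟨fun j hj => ⟨?_, ?_⟩, ?_⟩
  · refine (h1 j hj).2.1.trans ?_
    have : ρ ^ 3 ≤ 1 := pow_le_one₀ hρ.le hρ1
    nlinarith
  · rw [norm_mul, hn]
    calc t * ‖hJ j v t‖ ≤ t * (A * ρ ^ 2) := by gcongr; exact (h1 j hj).2.2
      _ = A * (t * ρ ^ 2) := by ring
      _ ≤ A * 1 := by gcongr
      _ ≤ _ := by linarith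
  · rw [norm_mul, norm_pow, hn]
    calc t ^ 2 * ‖kJ 0 v t‖ ≤ t ^ 2 * (M * ρ ^ 4) := by gcongr
      _ = M * (t * ρ ^ 2) ^ 2 := by ring
      _ ≤ M * 1 := by
        gcongr; exact pow_le_one₀ (by positivity) hρt
      _ ≤ _ := by linarith

theorem eulerBounded_beta :
    EulerBounded fun σ r => 1 + betaJ 0 (vOf σ) (tOfX σ (σ ^ 2 * r)) := by
  obtain ⟨C, hC, hb⟩ := exists_weighted_vol_bounds
  let t : ℝ → ℝ → ℝ := fun σ r => tOfX σ (σ ^ 2 * r)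
  let N : ℝ → ℝ → ℝ := fun σ r => lgL (σ ^ 2 * r) - 2 / 3
  refine ⟨fun σ r => betaJ 1 (vOf σ) (t σ r) / 3 + ((t σ r * N σ r : ℝ) : ℂ) * hJ 0 (vOf σ) (t σ r),
    fun σ r => (betaJ 2 (vOf σ) (t σ r) / 9 + (N σ r : ℂ) / 3 * (t σ r * hJ 1 (vOf σ) (t σ r))) +
      (((N σ r : ℂ) ^ 2 + lgL1 (σ ^ 2 * r)) * (t σ r * hJ 0 (vOf σ) (t σ r)) +
      ((N σ r : ℂ) / 3 * (t σ r * hJ 1 (vOf σ) (t σ r)) +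
        (N σ r : ℂ) ^ 2 * ((t σ r : ℂ) ^ 2 * kJ 0 (vOf σ) (t σ r)))),
    1 + 1000 * C, fun σ r h => ?_⟩
  have hσ := h.1
  have hs : (σ : ℂ) ≠ 0 := by exact_mod_cast hσ.ne'
  have ht : 0 < t σ r := tOfX_pos hσ (by linarith [h.2.2.2] : 1 < σ ^ 2 * r)
  have ht1 : -1 < t σ r := by linarith
  have hv : vOf σ < volV1 := vOf_lt ⟨hσ, h.2.2.1⟩
  have hdt : HasDerivAt (fun s => t s r) (t σ r * N σ r / σ) σ := hasDerivAt_tOfX_scale h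
  have hdN : HasDerivAt (fun s => N s r) (lgL1 (σ ^ 2 * r) / σ) σ :=
    (hasDerivAt_lgL_scale h).sub_const _
  have hB : ∀ j, HasDerivAt (fun s => betaJ j (vOf s) (t s r))
      ((betaJ (j + 1) (vOf σ) (t σ r) / 3 + t σ r * (N σ r : ℂ) * hJ j (vOf σ) (t σ r)) / σ) σ := by
    intro j
    refine (hasDerivAt_vol_scale (F := fun p => betaJ j p.1 p.2) h ((jointSmooth_vol 1).1 j)
      (hasDerivAt_betaJ_left j hv _) (hasDerivAt_betaJ j hv ht1)).congr_deriv ?_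
    simp only [t, N]; push_cast; rfl
  have hH : HasDerivAt (fun s => hJ 0 (vOf s) (t s r))
      ((hJ 1 (vOf σ) (t σ r) / 3 + t σ r * (N σ r : ℂ) * kJ 0 (vOf σ) (t σ r)) / σ) σ := by
    refine (hasDerivAt_vol_scale (F := fun p => hJ 0 p.1 p.2) h ((jointSmooth_vol 1).2 0)
      (hasDerivAt_hJ_left 0 hv _) (hasDerivAt_hJ 0 hv ht1)).congr_deriv ?_
    simp only [t, N, kJ]; push_cast; rfl
  obtain ⟨hb1, hb2⟩ := hb _ hv _ ht.le
  obtain ⟨hL0, hL8⟩ := lgL_bounds h.2.2.2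
  have hN : ‖(N σ r : ℂ)‖ ≤ 8 := by
    rw [norm_real, norm_eq_abs, abs_le]
    constructor <;> simp only [N] <;> linarith
  have hL1 : ‖(lgL1 (σ ^ 2 * r) : ℂ)‖ ≤ 120 := by rw [norm_real]; exact lgL1_bound h.2.2.2
  have hN2 : ‖(N σ r : ℂ) ^ 2‖ ≤ 64 := by rw [norm_pow]; nlinarith [norm_nonneg (N σ r : ℂ)]
  have hN3 : ‖(N σ r : ℂ) / 3‖ ≤ 8 := by
    rw [norm_div, Complex.norm_ofNat]; linarith [norm_nonneg (N σ r : ℂ)]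
  have hN4 : ‖(N σ r : ℂ) ^ 2 + lgL1 (σ ^ 2 * r)‖ ≤ 184 := (norm_add_le _ _).trans (by linarith)
  have hm : ∀ {a b : ℂ} {A : ℝ}, ‖a‖ ≤ A → ‖b‖ ≤ C → ‖a * b‖ ≤ A * C := fun ha hb => by
    rw [norm_mul]; exact mul_le_mul ha hb (norm_nonneg _) ((norm_nonneg _).trans ha)
  refine ⟨((hB 0).const_add 1).congr_deriv (by push_cast; rfl),
    (((hB 1).div_const 3).add (((hdt.mul hdN).ofReal_comp).mul hH)).congr_deriv ?_, ?_, ?_, ?_⟩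
  · simp only [Pi.mul_apply]
    push_cast; field_simp
    ring
  · refine (norm_add_le _ _).trans ?_
    rw [norm_one]; linarith [(hb1 0 (by norm_num)).1]
  · refine (norm_add_le _ _).trans ?_
    have e : ((t σ r * N σ r : ℝ) : ℂ) * hJ 0 (vOf σ) (t σ r) =
        (N σ r : ℂ) * (t σ r * hJ 0 (vOf σ) (t σ r)) := by push_cast; ring
    rw [e, norm_div, Complex.norm_ofNat]
    linarith [(hb1 1 (by norm_num)).1, hm hN (hb1 0 (by norm_num)).2,
      norm_nonneg (betaJ 1 (vOf σ) (t σ r))]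
  · have g1 : ‖betaJ 2 (vOf σ) (t σ r) / 9‖ ≤ C := by
      rw [norm_div, Complex.norm_ofNat]
      linarith [(hb1 2 le_rfl).1, norm_nonneg (betaJ 2 (vOf σ) (t σ r))]
    have g2 := hm hN3 (hb1 1 (by norm_num)).2
    have g3 := hm hN4 (hb1 0 (by norm_num)).2
    have g4 := hm hN2 hb2
    refine (norm_add_le _ _).trans ?_
    refine (add_le_add (norm_add_le _ _) ((norm_add_le _ _).trans
      (add_le_add le_rfl (norm_add_le _ _)))).trans ?_
    linarith

/-- The amplitude of the outgoing part of the distorted Fourier basis. -/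
def ampPlus (σ r : ℝ) : ℂ := connE σ * ampX σ (σ ^ 2 * r)

theorem eulerBounded_ampPlus : EulerBounded ampPlus :=
  eulerBounded_connE.mul ((eulerBounded_const (-I / π)).mul
    (eulerBounded_turning.mul (eulerBounded_airyAmp.mul eulerBounded_beta)))

theorem contDiffAt_ampPlus {σ r : ℝ} (h : AmpDom σ r) :
    ContDiffAt ℝ ∞ (Function.uncurry ampPlus) (σ, r) := by
  have hσ := h.1
  have hx : 2 < σ ^ 2 * r := h.2.2.2
  have hx0 : 0 < σ ^ 2 * r := by linarith
  have ht : 0 < tOfX σ (σ ^ 2 * r) := tOfX_pos hσ (by linarith)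
  have h1 : ContDiffAt ℝ ∞ (fun p : ℝ × ℝ => p.1) (σ, r) := contDiffAt_fst
  have hX : ContDiffAt ℝ ∞ (fun p : ℝ × ℝ => p.1 ^ 2 * p.2) (σ, r) := by fun_prop
  have hT : ContDiffAt ℝ ∞ (fun p : ℝ × ℝ => tOfX p.1 (p.1 ^ 2 * p.2)) (σ, r) := by
    refine ContDiffAt.mul (h1.rpow_const_of_ne hσ.ne') ?_
    exact (contDiffOn_zeta.contDiffAt (Ioi_mem_nhds hx0)).comp (σ, r) hX
  have hE : ContDiffAt ℝ ∞ (fun p : ℝ × ℝ => connE p.1) (σ, r) :=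
    ContDiffAt.comp (g := connE) (f := fun p : ℝ × ℝ => p.1) (σ, r) (contDiffAt_connE hσ) h1
  have hq : ContDiffAt ℝ ∞ (fun p : ℝ × ℝ => (((1 - (p.1 ^ 2 * p.2)⁻¹) ^ (-1 / 4 : ℝ) : ℝ) : ℂ))
      (σ, r) := by
    refine ofRealCLM.contDiff.contDiffAt.comp (σ, r)
      (ContDiffAt.rpow_const_of_ne (contDiffAt_const.sub (hX.inv hx0.ne')) ?_)
    have : (σ ^ 2 * r)⁻¹ < 1 := inv_lt_one_of_one_lt₀ (by linarith)
    exact (by linarith : (0 : ℝ) < 1 - (σ ^ 2 * r)⁻¹).ne'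
  have hA : ContDiffAt ℝ ∞ (fun p : ℝ × ℝ =>
      airyAmp 0 (tOfX p.1 (p.1 ^ 2 * p.2) ^ (-3 / 4 : ℝ))) (σ, r) :=
    ContDiffAt.comp (g := airyAmp 0)
      (f := fun p : ℝ × ℝ => tOfX p.1 (p.1 ^ 2 * p.2) ^ (-3 / 4 : ℝ)) (σ, r)
      ((contDiffOn_airyAmp 0).contDiffAt (Ioi_mem_nhds (rpow_pos_of_pos ht _)))
      (hT.rpow_const_of_ne ht.ne')
  have hβ : ContDiffAt ℝ ∞ (fun p : ℝ × ℝ =>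
      betaJ 0 (vOf p.1) (tOfX p.1 (p.1 ^ 2 * p.2))) (σ, r) := by
    have hm : (vOf σ, tOfX σ (σ ^ 2 * r)) ∈ Iio volV1 ×ˢ Ioi (-1 : ℝ) :=
      ⟨vOf_lt ⟨hσ, h.2.2.1⟩, lt_trans (by norm_num) ht⟩
    have h2 := (contDiffOn_volBeta_uncurry.contDiffAt (isOpen_volDom.mem_nhds hm)).comp (σ, r)
      (f := fun p : ℝ × ℝ => (vOf p.1, tOfX p.1 (p.1 ^ 2 * p.2)))
      (((h1.log hσ.ne').div_const 3).prodMk hT)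
    refine h2.congr_of_eventuallyEq (Eventually.of_forall fun p => ?_)
    simp only [betaJ, iteratedDeriv_zero, Function.comp]
  exact hE.mul (contDiffAt_const.mul (hq.mul (hA.mul (contDiffAt_const.add hβ))))

theorem eFun_eq_amp {σ r : ℝ} (h : AmpDom σ r) : eFun σ r =
    cexp (I * (phase r σ : ℂ)) * ampPlus σ r +
      cexp (-I * (phase r σ : ℂ)) * conj (ampPlus σ r) := by
  have hσ := h.1
  have hx : 2 < σ ^ 2 * r := h.2.2.2
  have key := eFun_connection ⟨hσ, h.2.2.1⟩ (by linarith : 1 ≤ σ ^ 2 * r)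
  rw [show σ ^ 2 * r / σ ^ 2 = r by field_simp] at key
  have hm := q_mul_psiMinus hσ (by linarith : 1 < σ ^ 2 * r)
  have hp := congrArg conj hm
  have hs16 : ((σ ^ (-1 / 6 : ℝ) : ℝ) : ℂ) * ((σ ^ (1 / 6 : ℝ) : ℝ) : ℂ) = 1 := by
    rw [← ofReal_mul, ← rpow_add hσ]; norm_num
  rw [← phase] at hm hp
  simp only [map_mul, conj_ofReal, ← Complex.exp_conj, Complex.conj_I] at hp
  rw [key, psiPlus_eq_conj, ampPlus, map_mul]
  linear_combination (((σ ^ (-1 / 6 : ℝ) : ℝ) : ℂ) * connE σ) * hm +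
    (((σ ^ (-1 / 6 : ℝ) : ℝ) : ℂ) * conj (connE σ)) * hp +
    (cexp (I * (phase r σ : ℂ)) * (connE σ * ampX σ (σ ^ 2 * r)) +
      cexp (-I * (phase r σ : ℂ)) * (conj (connE σ) * conj (ampX σ (σ ^ 2 * r)))) * hs16

theorem isOpen_ampDom (r : ℝ) : IsOpen {σ | AmpDom σ r} := by
  have : {σ | AmpDom σ r} = {σ | 0 < σ} ∩ ({σ | σ < 1} ∩ ({σ | σ < sigma0} ∩ {σ | 2 < σ ^ 2 * r})) :=
    rfl
  rw [this]
  exact (isOpen_lt continuous_const continuous_id).inter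
    ((isOpen_lt continuous_id continuous_const).inter
    ((isOpen_lt continuous_id continuous_const).inter (isOpen_lt continuous_const (by fun_prop))))

theorem ampDom_of_mem {c s r σ : ℝ} (hc1 : c < 1) (hc : c < sigma0) (hs : 0 < s) (hr : s ≤ r)
    (hσ : σ ∈ Icc (2 * s ^ (-1 / 2 : ℝ)) c) : AmpDom σ r ∧ σ⁻¹ ≤ s ^ (1 / 2 : ℝ) := by
  have h0 : 0 < s ^ (-1 / 2 : ℝ) := rpow_pos_of_pos hs _
  have hσ0 : 0 < σ := by linarith [hσ.1]
  have e : s ^ (-1 / 2 : ℝ) * s ^ (1 / 2 : ℝ) = 1 := by rw [← rpow_add hs]; norm_num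
  have e3 : (s ^ (-1 / 2 : ℝ)) ^ 2 * s = 1 := by
    rw [← rpow_natCast, ← rpow_mul hs.le]; norm_num
    rw [rpow_neg_one]; exact inv_mul_cancel₀ hs.ne'
  refine ⟨⟨hσ0, by linarith [hσ.2], by linarith [hσ.2], ?_⟩, ?_⟩
  · have h1 : (2 * s ^ (-1 / 2 : ℝ)) ^ 2 ≤ σ ^ 2 := by
      have := hσ.1; gcongr
    have h2 : (2 * s ^ (-1 / 2 : ℝ)) ^ 2 * s = 4 := by rw [mul_pow, mul_assoc, e3]; norm_num
    calc (2 : ℝ) < (2 * s ^ (-1 / 2 : ℝ)) ^ 2 * s := by rw [h2]; norm_num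
      _ ≤ σ ^ 2 * r := by gcongr
  · rw [inv_le_iff_one_le_mul₀ hσ0]
    have h2 : 0 < s ^ (1 / 2 : ℝ) := rpow_pos_of_pos hs _
    nlinarith [hσ.1]

theorem EulerBounded.exists_amplitudeBounds {a : ℝ → ℝ → ℂ} (h : EulerBounded a)
    (hs : ∀ σ r, AmpDom σ r → ContDiffAt ℝ ∞ (Function.uncurry a) (σ, r)) {c : ℝ} (hc1 : c < 1)
    (hc : c < sigma0) : ∃ K0, ∀ K, K0 ≤ K → AmplitudeBounds c 2 K a := by
  obtain ⟨a1, a2, C, hb⟩ := h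
  refine ⟨max 1 (2 * C), fun K hK => ?_⟩
  have hK1 : 1 ≤ K := (le_max_left _ _).trans hK
  have hK2 : 2 * C ≤ K := (le_max_right _ _).trans hK
  refine ⟨fun s r σ h0 hr hσ => hs σ r (ampDom_of_mem hc1 hc h0 hr hσ).1,
    fun s r σ h0 hr hσ => ?_, fun s r σ h0 hr hσ => ?_, fun s r σ h0 hr hσ => ?_⟩
  all_goals
    obtain ⟨hd, hi⟩ := ampDom_of_mem hc1 hc h0 hr hσ
    obtain ⟨b1, b2, b3, b4, b5⟩ := hb σ r hd
    have hC : 0 ≤ C := (norm_nonneg _).trans b3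
    have hσ0 := hd.1
    have hn : ‖(σ : ℂ)‖ = σ := by simp [abs_of_pos hσ0]
  · linarith
  · rw [b1.deriv, norm_div, hn, rpow_neg_one]
    refine ⟨?_, hi.trans ?_⟩
    · rw [div_eq_mul_inv]; gcongr; linarith
    · have : 0 < s ^ (1 / 2 : ℝ) := rpow_pos_of_pos h0 _
      nlinarith
  · have he : deriv (fun t => a t r) =ᶠ[𝓝 σ] fun t => a1 t r / t := by
      filter_upwards [(isOpen_ampDom r).mem_nhds hd] with t ht using (hb t r ht).1.deriv
    have hs : (σ : ℂ) ≠ 0 := by exact_mod_cast hσ0.ne'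
    have h2 : HasDerivAt (fun t : ℝ => a1 t r / (t : ℂ)) ((a2 σ r - a1 σ r) / (σ : ℂ) ^ 2) σ := by
      refine (b2.div (ofRealCLM.hasDerivAt (x := σ)) hs).congr_deriv ?_
      simp only [Complex.ofRealCLM_apply, Complex.ofReal_one]
      field_simp
    rw [iteratedDeriv_succ, iteratedDeriv_one, he.deriv_eq, h2.deriv, norm_div, norm_pow, hn]
    have h3 : (σ ^ 2)⁻¹ ≤ σ ^ (-7 / 3 : ℝ) := by
      rw [← rpow_natCast, ← Real.rpow_neg hσ0.le]
      exact Real.rpow_le_rpow_of_exponent_ge hσ0 hd.2.1.le (by norm_num)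
    have h4 : ‖a2 σ r - a1 σ r‖ ≤ 2 * C := (norm_sub_le _ _).trans (by linarith)
    rw [div_eq_mul_inv]
    have := norm_nonneg (a2 σ r - a1 σ r)
    calc _ ≤ (2 * C) * σ ^ (-7 / 3 : ℝ) := by gcongr
      _ ≤ _ := by gcongr

theorem OscBounds.mono {c c' K K' : ℝ} {b : ℝ → ℝ → ℂ} (h : OscBounds c K b) (hc : c' ≤ c)
    (hK : K ≤ K') : OscBounds c' K' b := by
  have hm : ∀ σ ∈ Ioo 0 c', σ ∈ Ioo 0 c := fun σ hσ => ⟨hσ.1, hσ.2.trans_le hc⟩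
  have hb : ∀ z, 0 < bracket z := fun z => one_pos.trans_le (one_le_bracket z)
  refine ⟨h.smooth.mono (prod_mono (fun σ hσ => hm σ hσ) subset_rfl), ?_, ?_, ?_, ?_, ?_, ?_, ?_⟩
  all_goals
    intro σ hσ z hz
    have hσ0 := hσ.1
    have hbz := hb z
    have hbz' := hb (σ ^ (-2 / 3 : ℝ) * z)
  · exact (h.zero σ (hm σ hσ) z hz).trans (by gcongr)
  · exact (h.dz σ (hm σ hσ) z hz).trans (by gcongr)
  · exact (h.dzz σ (hm σ hσ) z hz).trans (by gcongr)
  · exact (h.ds σ (hm σ hσ) z hz).trans (by gcongr)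
  · exact (h.dss σ (hm σ hσ) z hz).trans (by gcongr)
  · exact (h.dsdz σ (hm σ hσ) z hz).trans (by gcongr)
  · exact (h.dssdz σ (hm σ hσ) z hz).trans (by gcongr)

end

end CoulombLG

theorem proposition2p9 :
    ∃ c > (0 : ℝ), ∃ K > (0 : ℝ), ∃ C > (1 : ℝ),
    ∃ bPlus bMinus : ℝ → ℝ → ℂ, ∃ e₃ e₄ : ℝ → ℂ, ∃ aPlus aMinus : ℝ → ℝ → ℂ,
      -- the oscillatory basis
      (∀ σ ∈ Ioo 0 c, CoulombLG.IsSolutionBasis σ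
        (CoulombLG.psiPlus bPlus σ) (CoulombLG.psiMinus bMinus σ)) ∧
      CoulombLG.OscBounds c K bPlus ∧ CoulombLG.OscBounds c K bMinus ∧
      -- the distorted Fourier basis in terms of the oscillatory basis, to the right of `x = 1`
      (∀ σ ∈ Ioo 0 c, ∀ x ≥ (1 : ℝ),
        CoulombLG.eFun σ (x / σ ^ 2) =
          ((σ ^ (-1 / 6 : ℝ) : ℝ) : ℂ) * (1 + e₃ σ) * ((CoulombLG.q x ^ (-1 / 4 : ℝ) : ℝ) : ℂ)
              * CoulombLG.psiPlus bPlus σ (CoulombLG.zeta x)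
            + ((σ ^ (-1 / 6 : ℝ) : ℝ) : ℂ) * (1 + e₄ σ) * ((CoulombLG.q x ^ (-1 / 4 : ℝ) : ℝ) : ℂ)
              * CoulombLG.psiMinus bMinus σ (CoulombLG.zeta x)) ∧
      CoulombLG.CoeffBounds c K e₃ ∧ CoulombLG.CoeffBounds c K e₄ ∧
      -- the oscillatory representation of the distorted Fourier basis
      (∀ s r σ : ℝ, 0 < s → s ≤ r → σ ∈ Icc (C * s ^ (-1 / 2 : ℝ)) c →
        CoulombLG.eFun σ r =
          Complex.exp (Complex.I * (CoulombLG.phase r σ : ℂ)) * aPlus σ r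
            + Complex.exp (-Complex.I * (CoulombLG.phase r σ : ℂ)) * aMinus σ r) ∧
      CoulombLG.AmplitudeBounds c C K aPlus ∧ CoulombLG.AmplitudeBounds c C K aMinus := by
  open CoulombLG in
  obtain ⟨K₁, hK₁, hb, hb'⟩ := exists_oscBounds
  have hσ0 := sigma0_pos
  set c : ℝ := min sigma0 1 / 2
  have hc : 0 < c := by positivity
  have hc1 : c < 1 := by have := min_le_right sigma0 1; simp only [c]; linarith
  have hcs : c < sigma0 := by have := min_le_left sigma0 1; simp only [c]; linarith
  have hm : ∀ σ ∈ Ioo 0 c, σ ∈ Ioo 0 sigma0 := fun σ hσ => ⟨hσ.1, hσ.2.trans hcs⟩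
  obtain ⟨K₂, hK₂⟩ := eulerBounded_ampPlus.exists_amplitudeBounds
    (fun _ _ => contDiffAt_ampPlus) hc1 hcs
  obtain ⟨K₃, hK₃⟩ := eulerBounded_ampPlus.conj.exists_amplitudeBounds
    (fun σ r h => Complex.conjCLE.contDiff.contDiffAt.comp (σ, r) (contDiffAt_ampPlus h)) hc1 hcs
  set K : ℝ := max (max K₁ 192) (max K₂ K₃)
  have h1 : K₁ ≤ K := (le_max_left _ _).trans (le_max_left _ _)
  have h192 : 192 ≤ K := (le_max_right _ _).trans (le_max_left _ _)
  have h2 : K₂ ≤ K := (le_max_left _ _).trans (le_max_right _ _)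
  have h3 : K₃ ≤ K := (le_max_right _ _).trans (le_max_right _ _)
  refine ⟨c, hc, K, by linarith, 2, one_lt_two, oscBconj, oscB,
    fun σ => (starRingEnd ℂ) (connE σ) - 1, fun σ => connE σ - 1, ampPlus,
    fun σ r => (starRingEnd ℂ) (ampPlus σ r), fun σ hσ => isSolutionBasis_psi (hm σ hσ),
    hb'.mono hcs.le h1, hb.mono hcs.le h1, fun σ hσ x hx => ?_,
    coeffBounds_conj_connE hc1.le h192, coeffBounds_connE hc1.le h192,
    fun s r σ h0 hr hσ => eFun_eq_amp (ampDom_of_mem hc1 hcs h0 hr hσ).1, hK₂ K h2, hK₃ K h3⟩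
  rw [eFun_connection (hm σ hσ) hx]
  simp only [add_sub_cancel]
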